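/- Let $d,n\ge 1$ be integers, $\alpha\in(-1,\infty)$, $p\in(1,2]$, $\kappa\in(0,1]$, $\lambda\ge 0$ and $r>0$. Write points of $\mathbb R\times\mathbb R^d$ as $z=(t,x)=(t,x',x_d)$ with $x'\in\mathbb R^{d-1}$, let $B'_\rho=\{x'\in\mathbb R^{d-1}:|x'|<\rho\}$ and $$Q_\rho^+=(-\rho^2,0)\times B'_\rho\times(0,\rho),\qquad d\mu=x_d^{\alpha}\,dx\,dt .$$ Let $a_0,A^{ij},C_0:(0,\infty)\to\mathbb R^{n\times n}$ ($1\le i,j\le d$) be measurable functions of $x_d$ such that, for all $x_d>0$ and all $\xi,\xi_1,\dots,\xi_d\in\mathbb R^n$, $$\kappa\sum_{i=1}^d|\xi_i|^2\le\sum_{i,j=1}^d A^{ij}\xi_j\cdot\xi_i,\quad |A^{ij}|\le\kappa^{-1},\quad \kappa|\xi|^2\le a_0\xi\cdot\xi,\quad |a_0|\le\kappa^{-1},\quad a_0=a_0^T,\quad \kappa|\xi|^2\le C_0\xi\cdot\xi,\quad |C_0|\le\kappa^{-1},$$ where $|\cdot|$ is the square root of the sum of the squares of all entries. Put $Q^{\mathrm{test}}_r=(-r^2,0)\times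 B'_r\times(-\infty,r)$. Let $u\in\mathcal H^1_p(Q_r^+,\mu)$; that is, $u:Q_r^+\to\mathbb R^n$ has weak spatial derivatives $Du=(D_1u,\dots,D_du)$ in $Q_r^+$ with $u,Du\in L_p(Q_r^+,\mu)$, and there are $F^1,\dots,F^d,f\in L_p(Q_r^+,\mu)$ with values in $\mathbb R^n$ such that $-\int_{Q_r^+}a_0u\cdot\varphi_t\,d\mu=\int_{Q_r^+}(F^i\cdot D_i\varphi+f\cdot\varphi)\,d\mu$ for all $\varphi\in C_0^\infty(Q^{\mathrm{test}}_r)^n$ (repeated indices are summed). Suppose that $u$ is a weak solution of $$x_d^{\alpha}a_0(x_d)u_t-D_i\big(x_d^{\alpha}A^{ij}(x_d)D_ju\big)+\lambda x_d^{\alpha}C_0(x_d)u=0\ \text{ in } Q_r^+,\qquad \lim_{x_d\to0^+}x_d^{\alpha}A^{dj}(x_d)D_ju=0,$$ that is, $$\int_{Q_r^+}\big(-a_0u\cdot\varphi_t+A^{ij}D_ju\cdot D_i\varphi+\lambda C_0u\cdot\varphi\big)\,d\mu=0\qquad\text{for all }\varphi\in C_0^\infty(Q^{\mathrm{test}}_r)^n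 .$$ Then, with $\mathcal U=A^{dj}D_ju$ and with a constant $N>0$ that depends only on $d,n,\alpha,p,\kappa$, $$\|u\|_{L_\infty(Q_{r/2}^+)}\le N\Big(\frac1{\mu(Q_r^+)}\int_{Q_r^+}|u|^p\,d\mu\Big)^{1/p},$$ $$\|Du\|_{L_\infty(Q_{r/2}^+)}+\sqrt\lambda\,\|u\|_{L_\infty(Q_{r/2}^+)}\le N\Big(\frac1{\mu(Q_r^+)}\int_{Q_r^+}\big(|Du|^p+\lambda^{p/2}|u|^p\big)\,d\mu\Big)^{1/p},$$ $$\|\mathcal U/x_d\|_{L_\infty(Q_{r/2}^+)}\le Nr^{-1}\Big(\frac1{\mu(Q_r^+)}\int_{Q_r^+}\big(|Du|^p+\lambda^{p/2}|u|^p\big)\,d\mu\Big)^{1/p}.$$ -/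

import Mathlib

open MeasureTheory Set
open scoped ContDiff

noncomputable section

namespace WeightedParabolic

/-- Space-time points `z = (t, x', x_d)` of `ℝ × ℝ^{d-1} × ℝ`, where `d = m + 1`. -/
abbrev Pt (m : ℕ) : Type := ℝ × EuclideanSpace ℝ (Fin m) × ℝ

/-- The values `ℝ^n` of the unknown. -/
abbrev Val (n : ℕ) : Type := EuclideanSpace ℝ (Fin n)

/-- The values of spatial gradients `(D_1 u, …, D_d u)`, `d = m + 1`, with the norm
`|Du|² = ∑_i |D_i u|²`. -/
abbrev Grad (m n : ℕ) : Type := PiLp 2 (fun _ : Fin (m + 1) => Val n)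

/-- The coordinate `x_d`. -/
def xd {m : ℕ} (z : Pt m) : ℝ := z.2.2

/-- The unit vector in the time direction. -/
def timeDir (m : ℕ) : Pt m := (1, 0, 0)

/-- The unit vector in the `i`-th spatial direction; the last index is the `x_d` direction. -/
def spaceDir {m : ℕ} (i : Fin (m + 1)) : Pt m :=
  Fin.lastCases (motive := fun _ => Pt m) (0, 0, 1)
    (fun k => (0, EuclideanSpace.single k 1, 0)) i

/-- `Q_r^+ = (-r², 0) × B'_r × (0, r)`. -/
def Qplus (m : ℕ) (r : ℝ) : Set (Pt m) :=
  Ioo (-r ^ 2) 0 ×ˢ (Metric.ball 0 r ×ˢ Ioo 0 r)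

/-- `(-r², 0) × B'_r × (-∞, r)`: test functions supported here need not vanish at `x_d = 0`. -/
def Qtest (m : ℕ) (r : ℝ) : Set (Pt m) :=
  Ioo (-r ^ 2) 0 ×ˢ (Metric.ball 0 r ×ˢ Iio r)

/-- The measure `dμ = x_d^α dx dt` on `{x_d > 0}`. -/
def mu (m : ℕ) (α : ℝ) : Measure (Pt m) :=
  (volume.restrict {z : Pt m | 0 < xd z}).withDensity fun z => ENNReal.ofReal (xd z ^ α)

/-- The space `C_0^∞(O; E)`. -/
structure IsTestFunction {m : ℕ} {E : Type*} [NormedAddCommGroup E] [NormedSpace ℝ E]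
    (O : Set (Pt m)) (φ : Pt m → E) : Prop where
  smooth : ContDiff ℝ ∞ φ
  hasCompactSupport : HasCompactSupport φ
  tsupport_subset : tsupport φ ⊆ O

/-- `φ_t` for a smooth `φ`. -/
def dt {m : ℕ} {E : Type*} [NormedAddCommGroup E] [NormedSpace ℝ E]
    (φ : Pt m → E) (z : Pt m) : E := fderiv ℝ φ z (timeDir m)

/-- `D_i φ` for a smooth `φ`. -/
def dx {m : ℕ} {E : Type*} [NormedAddCommGroup E] [NormedSpace ℝ E]
    (i : Fin (m + 1)) (φ : Pt m → E) (z : Pt m) : E := fderiv ℝ φ z (spaceDir i)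

/-- `v` is the weak derivative `D_i u` in the open set `O`. -/
structure HasWeakDx {m n : ℕ} (O : Set (Pt m)) (i : Fin (m + 1)) (u v : Pt m → Val n) :
    Prop where
  locallyIntegrableOn : LocallyIntegrableOn u O
  locallyIntegrableOn_deriv : LocallyIntegrableOn v O
  integral_eq : ∀ φ : Pt m → ℝ, IsTestFunction O φ →
    ∫ z in O, dx i φ z • u z = -∫ z in O, φ z • v z

/-- The action of an `n × n` matrix on `ℝ^n`. -/
def act {n : ℕ} (M : Matrix (Fin n) (Fin n) ℝ) (v : Val n) : Val n :=
  WithLp.toLp 2 (M.mulVec v.ofLp)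

/-- `|M|`, the square root of the sum of the squares of all entries. -/
def entryNorm {n : ℕ} (M : Matrix (Fin n) (Fin n) ℝ) : ℝ :=
  √(∑ k, ∑ l, M k l ^ 2)

/-- A measurable matrix-valued function on `(0, ∞)`. -/
def MeasurableCoeff {n : ℕ} (M : ℝ → Matrix (Fin n) (Fin n) ℝ) : Prop :=
  ∀ k l, AEMeasurable (fun s => M s k l) (volume.restrict (Ioi 0))

/-- Coefficients `a₀`, `A^{ij}`, `C₀` that depend on `x_d ∈ (0, ∞)` only. Their values for
`x_d ≤ 0` play no role. -/
structure Coeffs (m n : ℕ) where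
  a0 : ℝ → Matrix (Fin n) (Fin n) ℝ
  A : Fin (m + 1) → Fin (m + 1) → ℝ → Matrix (Fin n) (Fin n) ℝ
  C0 : ℝ → Matrix (Fin n) (Fin n) ℝ

/-- Measurability, boundedness, strong ellipticity of `A^{ij}`, and positivity of `a₀`, `C₀`,
with constant `κ`. -/
structure Coeffs.Admissible {m n : ℕ} (c : Coeffs m n) (κ : ℝ) : Prop where
  measurable_a0 : MeasurableCoeff c.a0
  measurable_A : ∀ i j, MeasurableCoeff (c.A i j)
  measurable_C0 : MeasurableCoeff c.C0
  A_elliptic : ∀ s > 0, ∀ ξ : Fin (m + 1) → Val n,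
    κ * ∑ i, ‖ξ i‖ ^ 2 ≤ ∑ i, ∑ j, inner ℝ (act (c.A i j s) (ξ j)) (ξ i)
  A_bounded : ∀ s > 0, ∀ i j, entryNorm (c.A i j s) ≤ κ⁻¹
  a0_pos : ∀ s > 0, ∀ ξ : Val n, κ * ‖ξ‖ ^ 2 ≤ inner ℝ (act (c.a0 s) ξ) ξ
  a0_bounded : ∀ s > 0, entryNorm (c.a0 s) ≤ κ⁻¹
  a0_symm : ∀ s > 0, c.a0 s = (c.a0 s).transpose
  C0_pos : ∀ s > 0, ∀ ξ : Val n, κ * ‖ξ‖ ^ 2 ≤ inner ℝ (act (c.C0 s) ξ) ξ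
  C0_bounded : ∀ s > 0, entryNorm (c.C0 s) ≤ κ⁻¹

/-- `u ∈ 𝓗¹_p(Q_r^+, μ)` with weak spatial gradient `Du`: `u, Du ∈ L_p(Q_r^+, μ)` and
`x_d^α a₀(x_d) u_t ∈ ℍ⁻¹_p(Q_r^+, μ)`. -/
structure MemH1 {m n : ℕ} (α p r : ℝ) (a0 : ℝ → Matrix (Fin n) (Fin n) ℝ)
    (u : Pt m → Val n) (Du : Pt m → Grad m n) : Prop where
  memLp : MemLp u (ENNReal.ofReal p) ((mu m α).restrict (Qplus m r))
  memLp_grad : MemLp Du (ENNReal.ofReal p) ((mu m α).restrict (Qplus m r))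
  hasWeakDx : ∀ i, HasWeakDx (Qplus m r) i u (fun z => Du z i)
  time_deriv : ∃ (F : Pt m → Grad m n) (f : Pt m → Val n),
    MemLp F (ENNReal.ofReal p) ((mu m α).restrict (Qplus m r)) ∧
    MemLp f (ENNReal.ofReal p) ((mu m α).restrict (Qplus m r)) ∧
    ∀ φ : Pt m → Val n, IsTestFunction (Qtest m r) φ →
      -∫ z in Qplus m r, inner ℝ (act (a0 (xd z)) (u z)) (dt φ z) ∂(mu m α) =
        ∫ z in Qplus m r, (∑ i, inner ℝ (F z i) (dx i φ z) + inner ℝ (f z) (φ z)) ∂(mu m α)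

/-- `u`, with weak spatial gradient `Du`, is a weak solution of
`x_d^α a₀ u_t - D_i(x_d^α A^{ij} D_j u) + λ x_d^α C₀ u = 0` in `Q_r^+` with the conormal
boundary condition `lim_{x_d → 0+} x_d^α A^{dj} D_j u = 0`; the boundary condition is encoded by
test functions that need not vanish at `x_d = 0`. -/
def IsWeakSolution {m n : ℕ} (α lam r : ℝ) (c : Coeffs m n)
    (u : Pt m → Val n) (Du : Pt m → Grad m n) : Prop :=
  ∀ φ : Pt m → Val n, IsTestFunction (Qtest m r) φ →
    ∫ z in Qplus m r,
      (-inner ℝ (act (c.a0 (xd z)) (u z)) (dt φ z)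
        + ∑ i, ∑ j, inner ℝ (act (c.A i j (xd z)) (Du z j)) (dx i φ z)
        + lam * inner ℝ (act (c.C0 (xd z)) (u z)) (φ z)) ∂(mu m α) = 0

/-- `𝒰 = A^{dj} D_j u`. -/
def conormalFlux {m n : ℕ} (c : Coeffs m n) (Du : Pt m → Grad m n) (z : Pt m) : Val n :=
  ∑ j, act (c.A (Fin.last m) j (xd z)) (Du z j)

/-- The norm of `L_∞(Q_r^+)`. -/
def supNorm {m : ℕ} {E : Type*} [NormedAddCommGroup E] (r : ℝ) (f : Pt m → E) : ENNReal :=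
  eLpNorm f ⊤ (volume.restrict (Qplus m r))

/-- `(⨍_{Q_r^+} |u|^p dμ)^{1/p}`. -/
def avgU {m n : ℕ} (α p r : ℝ) (u : Pt m → Val n) : ENNReal :=
  (⨍⁻ z in Qplus m r, ‖u z‖ₑ ^ p ∂(mu m α)) ^ (1 / p)

/-- `(⨍_{Q_r^+} (|Du|^p + λ^{p/2} |u|^p) dμ)^{1/p}`. -/
def avgDU {m n : ℕ} (α p lam r : ℝ) (u : Pt m → Val n) (Du : Pt m → Grad m n) : ENNReal :=
  (⨍⁻ z in Qplus m r,
    (‖Du z‖ₑ ^ p + ENNReal.ofReal (lam ^ (p / 2)) * ‖u z‖ₑ ^ p) ∂(mu m α)) ^ (1 / p)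

end WeightedParabolic

end

open MeasureTheory Set
open scoped ContDiff

noncomputable section

namespace WeightedParabolic
open Filter Topology

section

/-! ### One-dimensional calculus -/

/-! A parabolic dilation reduces everything to `r = 1`, with `λ` replaced by `λ r²`. Call `(t, x')`
the tangential variables and `s = x_d` the normal one.

The coefficients depend on `s` only, so mollification in `(t, x')` commutes with the equation. Let
`w` be the mollification of `u` with a kernel supported in positive times, so that only past values
of `u` enter. Tangential derivatives of `w` and multiples of `w` by `λ` or `√λ` are mollifications
of `u` with other kernels. An estimate that is uniform in the kernel therefore applies to all of
them. `Dom F G` records such an estimate between a cylinder and a larger one, and it composes.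

Normal direction. With `U = A^{dj} D_j w` the equation reads `(s^α U)' = s^α (a₀ w_t + λ C₀ w - ∑
D_i (A^{ij} D_j w))`, the sum being over tangential `i`, and the conormal condition says that `s^α
U` vanishes at `s = 0`. Hence `U` is better than the right-hand side by one power of `s`, and `D_d
w` is recovered from `U` because `A^{dd}` is invertible. Starting from mere integrability, finitely
many such steps (`supT_step`) remove all weights and show that `w` and `Dw` are bounded
(`supT_zero_lt_top`). This justifies the `L_2` energy computations although `u` is only in `L_p`
with `p ≤ 2`. Each step costs tangential derivatives and factors `λ`. Once those are controlled, the
same iteration is quantitative (`Dom.supT_zero`).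

Energy. Let `Φ = (|Dw|² + λ|w|²)^{1/2}`. Caccioppoli's inequality (`caccioppoli_real`) bounds `Φ` in
`L_2` by `w`. Testing with `w_t` (`time_real`), together with Caccioppoli's inequality for `w_t` and
an absorption argument, bounds `w_t` by `Φ`. Splitting `λ w = √λ (√λ w)` bounds `λ w` by `Φ`. So the
`L_2` norm of `w` controls all tangential derivatives, uniformly in `λ`. A Sobolev inequality in
`(t, x')`, applied one coordinate at a time (`Dom.marg_insert`), then feeds the normal iteration and
gives `dom_supT_enU`. Since `w_t`, `D_i w` and `λ w` are controlled by `Φ` alone, the bounds of `U /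
s` and of `Φ` itself involve only `Φ` (`dom_supFlux_enPhi`, `dom_supPhi_enPhi`).

From `L_2` to `L_1`. The square of an `L_2` norm is at most the supremum times the `L_1` norm, and
`Dom.absorb` cancels one factor of the supremum (`Dom.of_interpolation`). The constants do not see
the kernel, and mollification does not increase `L_1` norms. So the scale can tend to zero, with
convergence almost everywhere by Lebesgue differentiation (`exists_bound`). Hölder's inequality
finally turns `L_1` norms into `L_p` averages. -/

lemma contDiff_primitive {χ : ℝ → ℝ} (hχ : ContDiff ℝ ∞ χ) (a : ℝ) :
    ContDiff ℝ ∞ (fun s => ∫ σ in a..s, χ σ) ∧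
      ∀ s, HasDerivAt (fun s => ∫ σ in a..s, χ σ) (χ s) s := by
  have hd : ∀ s, HasDerivAt (fun s => ∫ σ in a..s, χ σ) (χ s) s := fun s =>
    intervalIntegral.integral_hasDerivAt_right (hχ.continuous.intervalIntegrable _ _)
      (hχ.continuous.stronglyMeasurableAtFilter _ _) hχ.continuous.continuousAt
  refine ⟨?_, hd⟩
  rw [contDiff_infty_iff_deriv]
  refine ⟨fun s => (hd s).differentiableAt, ?_⟩
  have : deriv (fun s => ∫ σ in a..s, χ σ) = χ := funext fun s => (hd s).deriv
  rwa [this]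

/-- A compactly supported function on an open interval vanishes outside a compact one. -/
lemma exists_Icc_of_tsupport_subset_Ioo {χ : ℝ → ℝ} {a b : ℝ} (hc : HasCompactSupport χ)
    (hs : tsupport χ ⊆ Ioo a b) (hab : a < b) :
    ∃ a' b', a < a' ∧ b' < b ∧ ∀ s, s ∉ Icc a' b' → χ s = 0 := by
  by_cases hne : (tsupport χ).Nonempty
  · obtain ⟨x, hx, hmax⟩ := hc.isCompact.exists_isMaxOn hne continuousOn_id
    obtain ⟨x', hx', hmin⟩ := hc.isCompact.exists_isMinOn hne continuousOn_id
    refine ⟨x', x, (hs hx').1, (hs hx).2, fun s hs' => ?_⟩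
    by_contra hne'
    exact hs' ⟨hmin (subset_tsupport _ hne'), hmax (subset_tsupport _ hne')⟩
  · refine ⟨(a + b) / 2, (a + b) / 2, by linarith, by linarith, fun s _ => ?_⟩
    by_contra hne'
    exact hne ⟨s, subset_tsupport _ hne'⟩

/-- Integration by parts of a primitive against a smooth function. -/
lemma integral_deriv_mul_primitive {f ψ : ℝ → ℝ} {a b c : ℝ} (hf : IntervalIntegrable f volume a b)
    (hc : c ∈ uIcc a b) (hψ : ContDiff ℝ ∞ ψ) (ha : ψ a = 0 ∨ c = a) (hb : ψ b = 0) :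
    ∫ s in a..b, deriv ψ s * (∫ σ in c..s, f σ) = -∫ s in a..b, ψ s * f s := by
  have hF := hf.absolutelyContinuousOnInterval_intervalIntegral hc
  have hψ' : AbsolutelyContinuousOnInterval ψ a b :=
    ContDiffOn.absolutelyContinuousOnInterval
      ((hψ.of_le (by exact_mod_cast le_top : (1 : WithTop ℕ∞) ≤ ∞)).contDiffOn)
  have h := AbsolutelyContinuousOnInterval.integral_mul_deriv_eq_deriv_mul hψ' hF
  -- The boundary term at `a` disappears either through the test function or because the primitive
  -- starts there.
  have h0 : ψ a * (∫ σ in c..a, f σ) = 0 := by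
    rcases ha with h | h <;> simp [h]
  rw [h0, hb] at h
  have h1 : ∫ s in a..b, ψ s * deriv (fun s => ∫ σ in c..s, f σ) s = ∫ s in a..b, ψ s * f s := by
    apply intervalIntegral.integral_congr_ae
    filter_upwards [hf.ae_hasDerivAt_integral] with x hx hx'
    rw [(hx (uIoc_subset_uIcc hx') c hc).deriv]
  rw [h1] at h
  linarith

/-- A function whose distributional derivative on `(0, 1)`, with the natural boundary condition at
`0`, is `f`, is the primitive of `f` vanishing at `0`. -/
lemma ae_eq_primitive_of_weak_natural {F f : ℝ → ℝ} (hF : IntegrableOn F (Ioo 0 1))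
    (hf : IntegrableOn f (Ioo 0 1))
    (h : ∀ ψ : ℝ → ℝ, ContDiff ℝ ∞ ψ → HasCompactSupport ψ → tsupport ψ ⊆ Iio 1 →
      ∫ s in Ioo 0 1, (deriv ψ s * F s + ψ s * f s) = 0) :
    ∀ᵐ s ∂(volume.restrict (Ioo (0 : ℝ) 1)), F s = ∫ σ in (0 : ℝ)..s, f σ := by
  have hfi : IntervalIntegrable f volume 0 1 :=
    (intervalIntegrable_iff_integrableOn_Ioo_of_le zero_le_one).2 hf
  have hGc : ContinuousOn (fun s => ∫ σ in (0 : ℝ)..s, f σ) (uIcc 0 1) :=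
    (hfi.absolutelyContinuousOnInterval_intervalIntegral (c := 0) (by simp)).continuousOn
  have hGi : IntegrableOn (fun s => ∫ σ in (0 : ℝ)..s, f σ) (Ioo 0 1) := by
    have := hGc.integrableOn_compact (μ := volume) isCompact_uIcc
    rw [uIcc_of_le zero_le_one] at this
    exact this.mono_set Ioo_subset_Icc_self
  rw [ae_restrict_iff' measurableSet_Ioo]
  have key : ∀ᵐ s, s ∈ Ioo (0 : ℝ) 1 → F s - ∫ σ in (0 : ℝ)..s, f σ = 0 := by
    apply isOpen_Ioo.ae_eq_zero_of_integral_contDiff_smul_eq_zero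
    · exact (hF.sub hGi).locallyIntegrableOn
    intro χ hχ hχc hχs
    -- The test function is the primitive of `χ` that vanishes near `1`. It need not vanish at `0`,
    -- and this is where the natural boundary condition enters. The cutoff `ζ` acts only below `-1`,
    -- outside the domain of integration, and makes the support compact.
    obtain ⟨hψ0, hψd⟩ := contDiff_primitive hχ 1
    set ψ0 : ℝ → ℝ := fun s => ∫ σ in (1 : ℝ)..s, χ σ with hψ0def
    set ζ : ℝ → ℝ := fun s => Real.smoothTransition (s + 2) with hζ
    have hζs : ContDiff ℝ ∞ ζ := Real.smoothTransition.contDiff.comp (contDiff_id.add contDiff_const)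
    have hζ1 : ∀ s, -1 ≤ s → ζ s = 1 := fun s hs =>
      Real.smoothTransition.one_of_one_le (by linarith)
    have hζ0 : ∀ s, s ≤ -2 → ζ s = 0 := fun s hs =>
      Real.smoothTransition.zero_of_nonpos (by linarith)
    obtain ⟨_, b, _, hb1, hb'⟩ := exists_Icc_of_tsupport_subset_Ioo hχc hχs zero_lt_one
    have hb : ∀ s, b < s → χ s = 0 := fun s hs => hb' s (fun h => absurd h.2 (not_le.2 hs))
    have hψ00 : ∀ s, b < s → ψ0 s = 0 := by
      intro s hs
      have : ∀ σ ∈ uIcc 1 s, χ σ = (0 : ℝ) := by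
        intro σ hσ
        apply hb
        rcases le_total 1 s with h1 | h1
        · rw [uIcc_of_le h1] at hσ; linarith [hσ.1]
        · rw [uIcc_of_ge h1] at hσ; linarith [hσ.1]
      simp only [hψ0def]
      rw [intervalIntegral.integral_congr (g := fun _ => (0 : ℝ)) this]; simp
    set ψ : ℝ → ℝ := fun s => ζ s * ψ0 s with hψdef
    have hsup : tsupport ψ ⊆ Icc (-2) b := by
      apply closure_minimal _ isClosed_Icc
      intro s hs
      by_contra hcon
      apply hs
      rw [mem_Icc, not_and_or, not_le, not_le] at hcon
      rcases hcon with h1 | h1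
      · simp [hψdef, hζ0 s h1.le]
      · simp [hψdef, hψ00 s h1]
    have hψc : HasCompactSupport ψ := HasCompactSupport.intro isCompact_Icc
      fun s hs => by
        by_contra hne
        exact hs (hsup (subset_tsupport _ hne))
    have hψeq := h ψ (hζs.mul hψ0) hψc (hsup.trans fun s hs => lt_of_le_of_lt hs.2 hb1)
    have hd : ∀ s ∈ Ioo (0 : ℝ) 1, deriv ψ s = χ s ∧ ψ s = ψ0 s := by
      intro s hs
      have he : ψ =ᶠ[𝓝 s] ψ0 := by
        filter_upwards [Ioi_mem_nhds (show (-1 : ℝ) < s by linarith [hs.1])] with x hx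
        simp [hψdef, hζ1 x (le_of_lt hx)]
      exact ⟨by rw [he.deriv_eq, (hψd s).deriv], he.eq_of_nhds⟩
    have h1 : ∫ s in Ioo (0 : ℝ) 1, (χ s * F s + ψ0 s * f s) = 0 := by
      refine Eq.trans (setIntegral_congr_fun measurableSet_Ioo fun s hs => ?_) hψeq
      simp only [(hd s hs).1, (hd s hs).2]
    have hχb : ∃ C, ∀ s, ‖χ s‖ ≤ C := hχ.continuous.bounded_above_of_compact_support hχc
    obtain ⟨C, hC⟩ := hχb
    have hχF : IntegrableOn (fun s => χ s * F s) (Ioo 0 1) :=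
      Integrable.bdd_mul hF hχ.continuous.aestronglyMeasurable (ae_of_all _ hC)
    have hψf : IntegrableOn (fun s => ψ0 s * f s) (Ioo 0 1) := by
      have := (hfi.continuousOn_mul (hψ0.continuous.continuousOn))
      exact (intervalIntegrable_iff_integrableOn_Ioo_of_le zero_le_one).1 this
    have hχG : IntegrableOn (fun s => χ s * ∫ σ in (0 : ℝ)..s, f σ) (Ioo 0 1) :=
      Integrable.bdd_mul hGi hχ.continuous.aestronglyMeasurable (ae_of_all _ hC)
    have h2 := integral_deriv_mul_primitive hfi (c := 0) (by simp) hψ0 (Or.inr rfl)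
      (hψ00 1 hb1)
    have hde : deriv ψ0 = χ := funext fun s => (hψd s).deriv
    rw [hde, intervalIntegral.integral_of_le zero_le_one, intervalIntegral.integral_of_le zero_le_one,
      integral_Ioc_eq_integral_Ioo, integral_Ioc_eq_integral_Ioo] at h2
    rw [integral_add hχF hψf] at h1
    have h3 : ∫ x, χ x • (F x - ∫ σ in (0 : ℝ)..x, f σ) =
        ∫ x in Ioo 0 1, χ x * (F x - ∫ σ in (0 : ℝ)..x, f σ) := by
      rw [setIntegral_eq_integral_of_forall_compl_eq_zero]
      · rfl
      · intro x hx
        have : χ x = 0 := by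
          by_contra hne'
          exact hx (hχs (subset_tsupport _ hne'))
        simp [this]
    rw [h3]
    simp_rw [mul_sub]
    rw [integral_sub hχF hχG]
    linarith
  filter_upwards [key] with s hs hs'
  linarith [hs hs']

/-- A function on `(0, 1)` with a weak derivative is a primitive of it. -/
lemma exists_ae_eq_const_add_primitive_of_weak {v g : ℝ → ℝ}
    (hv : LocallyIntegrableOn v (Ioo 0 1)) (hg : LocallyIntegrableOn g (Ioo 0 1))
    (h : ∀ ψ : ℝ → ℝ, ContDiff ℝ ∞ ψ → HasCompactSupport ψ → tsupport ψ ⊆ Ioo 0 1 →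
      ∫ s in Ioo 0 1, deriv ψ s * v s = -∫ s in Ioo 0 1, ψ s * g s) :
    ∃ c, ∀ᵐ s ∂(volume.restrict (Ioo (0 : ℝ) 1)), v s = c + ∫ σ in (1 / 2 : ℝ)..s, g σ := by
  have hgi : ∀ a b, 0 < a → b < 1 → IntegrableOn g (Icc a b) := fun a b ha hb =>
    hg.integrableOn_compact_subset (fun s hs => ⟨by linarith [hs.1], by linarith [hs.2]⟩)
      isCompact_Icc
  have hgii : ∀ a b, 0 < a → a ≤ b → b < 1 → IntervalIntegrable g volume a b :=
    fun a b ha hab hb => (intervalIntegrable_iff_integrableOn_Icc_of_le hab).2 (hgi a b ha hb)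
  set G : ℝ → ℝ := fun s => ∫ σ in (1 / 2 : ℝ)..s, g σ with hG
  have hGc : ∀ a b, 0 < a → a ≤ 1 / 2 → 1 / 2 ≤ b → b < 1 → ContinuousOn G (Icc a b) := by
    intro a b ha ha' hb' hb
    have := ((hgii a b ha (ha'.trans hb') hb).absolutelyContinuousOnInterval_intervalIntegral
      (c := 1 / 2) (by rw [uIcc_of_le (ha'.trans hb')]; exact ⟨ha', hb'⟩)).continuousOn
    rwa [uIcc_of_le (ha'.trans hb')] at this
  have hGco : ContinuousOn G (Ioo 0 1) := by
    intro s hs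
    have h1 := hGc (min (s / 2) (1 / 2)) (max ((1 + s) / 2) (1 / 2))
      (lt_min (by linarith [hs.1]) (by norm_num)) (min_le_right _ _) (le_max_right _ _)
      (max_lt (by linarith [hs.2]) (by norm_num))
    refine (h1.continuousAt (Icc_mem_nhds ?_ ?_)).continuousWithinAt
    · exact (min_le_left _ _).trans_lt (by linarith [hs.1])
    · exact lt_of_lt_of_le (by linarith [hs.2]) (le_max_left _ _)
  have hGl : LocallyIntegrableOn G (Ioo 0 1) := hGco.locallyIntegrableOn measurableSet_Ioo
  have hvG : LocallyIntegrableOn (fun s => v s - G s) (Ioo 0 1) := hv.sub hGl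
  have hmul : ∀ {w : ℝ → ℝ} {χ : ℝ → ℝ}, LocallyIntegrableOn w (Ioo 0 1) → Continuous χ →
      HasCompactSupport χ → tsupport χ ⊆ Ioo 0 1 → IntegrableOn (fun s => χ s * w s) (Ioo 0 1) := by
    intro w χ hw hχ hχc hχs
    obtain ⟨C, hC⟩ := hχ.bounded_above_of_compact_support hχc
    have h1 : IntegrableOn (fun s => χ s * w s) (tsupport χ) :=
      Integrable.bdd_mul (hw.integrableOn_compact_subset hχs hχc.isCompact)
        hχ.aestronglyMeasurable (ae_of_all _ hC)
    refine (h1.integrable_of_forall_notMem_eq_zero fun x hx => ?_).integrableOn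
    simp [image_eq_zero_of_notMem_tsupport hx]
  have hfull : ∀ {w χ : ℝ → ℝ}, tsupport χ ⊆ Ioo 0 1 →
      ∫ s in Ioo 0 1, χ s * w s = ∫ s, χ s * w s := by
    intro w χ hχs
    rw [setIntegral_eq_integral_of_forall_compl_eq_zero]
    intro x hx
    rw [image_eq_zero_of_notMem_tsupport (fun hx' => hx (hχs hx')), zero_mul]
  -- test with functions of zero mean
  have hzero : ∀ χ : ℝ → ℝ, ContDiff ℝ ∞ χ → HasCompactSupport χ → tsupport χ ⊆ Ioo 0 1 →
      ∫ s, χ s = 0 → ∫ s in Ioo 0 1, χ s * (v s - G s) = 0 := by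
    intro χ hχ hχc hχs hχ0
    obtain ⟨a0, b0, ha0, hb0, hz0⟩ := exists_Icc_of_tsupport_subset_Ioo hχc hχs zero_lt_one
    -- The interval is enlarged to contain the base point `1 / 2` of the primitive `G`.
    set a := min a0 (1 / 2) with hadef
    set b := max b0 (1 / 2) with hbdef
    have ha : 0 < a := lt_min ha0 (by norm_num)
    have hb : b < 1 := max_lt hb0 (by norm_num)
    have ha2 : a ≤ 1 / 2 := min_le_right _ _
    have hb2 : 1 / 2 ≤ b := le_max_right _ _
    have hz : ∀ s, s ∉ Icc a b → χ s = 0 := fun s hs => hz0 s fun h =>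
      hs ⟨(min_le_left _ _).trans h.1, h.2.trans (le_max_left _ _)⟩
    obtain ⟨hψ, hψd⟩ := contDiff_primitive hχ a
    set ψ : ℝ → ℝ := fun s => ∫ σ in a..s, χ σ with hψdef
    have hψa : ∀ s, s ≤ a → ψ s = 0 := by
      intro s hs
      simp only [hψdef]
      rw [intervalIntegral.integral_symm, intervalIntegral.integral_of_le hs,
        integral_Ioc_eq_integral_Ioo,
        setIntegral_eq_zero_of_forall_eq_zero (fun σ hσ => hz σ fun h => by
          linarith [h.1, hσ.2])]
      simp
    have hψb : ∀ s, b ≤ s → ψ s = 0 := by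
      intro s hs
      simp only [hψdef]
      rw [intervalIntegral.integral_of_le (by linarith), ← hχ0]
      rw [setIntegral_eq_integral_of_ae_compl_eq_zero]
      filter_upwards [compl_mem_ae_iff.2 (measure_singleton a)] with σ hσ hσ'
      apply hz
      rintro ⟨h1, h2⟩
      exact hσ' ⟨lt_of_le_of_ne h1 (Ne.symm hσ), h2.trans hs⟩
    have hsup : tsupport ψ ⊆ Icc a b := by
      apply closure_minimal _ isClosed_Icc
      intro s hs
      by_contra hcon
      apply hs
      rw [mem_Icc, not_and_or, not_le, not_le] at hcon
      exact hcon.elim (fun h => hψa s h.le) (fun h => hψb s h.le)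
    have hsub : Icc a b ⊆ Ioo 0 1 := fun s hs => ⟨by linarith [hs.1], by linarith [hs.2]⟩
    have hψc : HasCompactSupport ψ := HasCompactSupport.intro isCompact_Icc fun s hs => by
        by_contra hne
        exact hs (hsup (subset_tsupport _ hne))
    have h1 := h ψ hψ hψc (hsup.trans hsub)
    have hde : deriv ψ = χ := funext fun s => (hψd s).deriv
    have h2 := integral_deriv_mul_primitive (hgii a b ha (by linarith) hb) (c := 1 / 2)
      (by rw [uIcc_of_le (ha2.trans hb2)]; exact ⟨ha2, hb2⟩) hψ (Or.inl (hψa a le_rfl))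
      (hψb b le_rfl)
    rw [hde] at h1 h2
    have h3 : ∀ w φ : ℝ → ℝ, (∀ s, s ∉ Icc a b → φ s = 0) →
        ∫ s in Ioo 0 1, φ s * w s = ∫ s in a..b, φ s * w s := by
      intro w φ hφ
      rw [intervalIntegral.integral_of_le (by linarith), ← integral_Icc_eq_integral_Ioc]
      rw [← setIntegral_eq_of_subset_of_forall_sdiff_eq_zero measurableSet_Ioo hsub]
      intro s hs
      rw [hφ s hs.2, zero_mul]
    simp_rw [mul_sub]
    rw [integral_sub (hmul hv hχ.continuous hχc hχs) (hmul hGl hχ.continuous hχc hχs), h1,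
      h3 G χ hz, h2, h3 g ψ fun s hs => by
        by_contra hne
        exact hs (hsup (subset_tsupport _ hne))]
    ring
  -- a fixed bump of mean one
  obtain ⟨χ0, hχ0, hχ0c, hχ0s, hχ0i⟩ : ∃ χ : ℝ → ℝ, ContDiff ℝ ∞ χ ∧ HasCompactSupport χ ∧
      tsupport χ ⊆ Ioo 0 1 ∧ ∫ s, χ s = 1 := by
    let B : ContDiffBump (1 / 2 : ℝ) := ⟨1 / 8, 1 / 4, by norm_num, by norm_num⟩
    refine ⟨B.normed volume, B.contDiff_normed, B.hasCompactSupport_normed, ?_, B.integral_normed⟩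
    rw [B.tsupport_normed_eq, Real.closedBall_eq_Icc]
    intro s hs
    have h1 : (1 / 2 : ℝ) - 1 / 4 ≤ s := hs.1
    have h2 : s ≤ 1 / 2 + 1 / 4 := hs.2
    constructor <;> linarith
  refine ⟨∫ s in Ioo 0 1, χ0 s * (v s - G s), ?_⟩
  set c := ∫ s in Ioo 0 1, χ0 s * (v s - G s) with hc
  rw [ae_restrict_iff' measurableSet_Ioo]
  have key : ∀ᵐ s, s ∈ Ioo (0 : ℝ) 1 → v s - G s - c = 0 := by
    apply isOpen_Ioo.ae_eq_zero_of_integral_contDiff_smul_eq_zero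
    · exact hvG.sub (continuousOn_const.locallyIntegrableOn measurableSet_Ioo)
    intro χ hχ hχc hχs
    -- Subtracting `(∫ χ) χ0` from `χ` leaves a function of zero mean, whose pairing with `v - G`
    -- vanishes. The pairing of `v - G` with `χ` is therefore `c ∫ χ`.
    have hsubs : tsupport (fun s => χ s - (∫ x, χ x) * χ0 s) ⊆ tsupport χ ∪ tsupport χ0 := by
      apply closure_minimal _ ((isClosed_tsupport _).union (isClosed_tsupport _))
      intro s hs
      by_contra hcon
      rw [mem_union, not_or] at hcon
      apply hs
      simp [image_eq_zero_of_notMem_tsupport hcon.1, image_eq_zero_of_notMem_tsupport hcon.2]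
    have hχi : Integrable χ := hχ.continuous.integrable_of_hasCompactSupport hχc
    have hχ0i' : Integrable χ0 := hχ0.continuous.integrable_of_hasCompactSupport hχ0c
    have h1 := hzero (fun s => χ s - (∫ x, χ x) * χ0 s) (hχ.sub (contDiff_const.mul hχ0))
      (HasCompactSupport.intro (hχc.isCompact.union hχ0c.isCompact) fun s hs => by
        by_contra hne
        exact hs (hsubs (subset_tsupport _ hne)))
      (hsubs.trans (union_subset hχs hχ0s))
      (by rw [integral_sub hχi (hχ0i'.const_mul _), integral_const_mul, hχ0i]; ring)
    have e1 : ∫ s in Ioo 0 1, (χ s - (∫ x, χ x) * χ0 s) * (v s - G s) =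
        (∫ s in Ioo 0 1, χ s * (v s - G s)) - (∫ x, χ x) * c := by
      rw [hc, ← integral_const_mul, ← integral_sub (hmul hvG hχ.continuous hχc hχs)
        ((hmul hvG hχ0.continuous hχ0c hχ0s).const_mul _)]
      congr 1; ext s; ring
    have e2 : ∫ s in Ioo 0 1, χ s * (v s - G s) = ∫ s, χ s * (v s - G s) := hfull hχs
    have e3 : ∫ s, χ s • (v s - G s - c) = (∫ s, χ s * (v s - G s)) - (∫ s, χ s) * c := by
      have hi : Integrable (fun s => χ s * (v s - G s)) := by
        have := hmul hvG hχ.continuous hχc hχs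
        refine this.integrable_of_forall_notMem_eq_zero fun x hx => ?_
        rw [image_eq_zero_of_notMem_tsupport (fun hx' => hx (hχs hx')), zero_mul]
      rw [← integral_mul_const, ← integral_sub hi (hχi.mul_const _)]
      congr 1; ext s; simp only [smul_eq_mul]; ring
    rw [e3, ← e2, ← e1, h1]
  filter_upwards [key] with s hs hs'
  linarith [hs hs']

/-- Integration by parts on `(0, R)` of two primitives, with the factor `(R - s)²`. -/
lemma integral_primitive_mul_cutoff {v g F f : ℝ → ℝ} {R c : ℝ} (hR : 1 / 2 ≤ R)
    (hg : IntegrableOn g (Ioo 0 R)) (hf : IntegrableOn f (Ioo 0 R))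
    (hv : ∀ᵐ s ∂(volume.restrict (Ioo (0 : ℝ) R)), v s = c + ∫ σ in (1 / 2 : ℝ)..s, g σ)
    (hF : ∀ᵐ s ∂(volume.restrict (Ioo (0 : ℝ) R)), F s = ∫ σ in (0 : ℝ)..s, f σ) :
    ∫ s in Ioo 0 R, (f s * ((R - s) ^ 2 * v s) +
      F s * ((R - s) ^ 2 * g s - 2 * (R - s) * v s)) = 0 := by
  have hR0 : (0 : ℝ) ≤ R := by linarith
  have hgi : IntervalIntegrable g volume 0 R :=
    (intervalIntegrable_iff_integrableOn_Ioo_of_le hR0).2 hg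
  have hfi : IntervalIntegrable f volume 0 R :=
    (intervalIntegrable_iff_integrableOn_Ioo_of_le hR0).2 hf
  have hm : (1 / 2 : ℝ) ∈ uIcc 0 R := by rw [uIcc_of_le hR0]; exact ⟨by norm_num, hR⟩
  have hG := hgi.absolutelyContinuousOnInterval_intervalIntegral hm
  have hFa := hfi.absolutelyContinuousOnInterval_intervalIntegral (c := 0) (by simp)
  have hc1 : AbsolutelyContinuousOnInterval (fun s : ℝ => (R - s) ^ 2) 0 R :=
    ContDiffOn.absolutelyContinuousOnInterval (by fun_prop)
  have hcc : AbsolutelyContinuousOnInterval (fun _ : ℝ => c) 0 R :=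
    ContDiffOn.absolutelyContinuousOnInterval (by fun_prop)
  have hq : AbsolutelyContinuousOnInterval
      (fun s => (R - s) ^ 2 * (c + ∫ σ in (1 / 2 : ℝ)..s, g σ)) 0 R := hc1.fun_mul (hcc.add hG)
  -- There are no boundary terms: the primitive of `f` vanishes at `0` and the factor `(R - s)²`
  -- vanishes at `R`.
  have h := hFa.integral_deriv_mul_eq_sub hq
  simp only [sub_self, ne_eq, OfNat.ofNat_ne_zero, not_false_eq_true, zero_pow, zero_mul, mul_zero,
    intervalIntegral.integral_same] at h
  rw [intervalIntegral.integral_of_le hR0, integral_Ioc_eq_integral_Ioo] at h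
  refine Eq.trans (setIntegral_congr_ae measurableSet_Ioo ?_) h
  rw [ae_restrict_iff' measurableSet_Ioo] at hv hF
  filter_upwards [hfi.ae_hasDerivAt_integral, hgi.ae_hasDerivAt_integral, hv, hF]
    with s h1 h2 h3 h4 hs
  have hs' : s ∈ uIcc 0 R := by rw [uIcc_of_le hR0]; exact Ioo_subset_Icc_self hs
  have d1 := h1 hs' 0 (by simp)
  have d2 := h2 hs' (1 / 2) hm
  have d3 : HasDerivAt (fun s : ℝ => (R - s) ^ 2) (2 * (R - s) * (-1)) s := by
    have := ((hasDerivAt_id' s).const_sub R).fun_pow 2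
    simpa using this
  have d4 := d3.mul (d2.const_add c)
  have d5 : deriv (fun x => (R - x) ^ 2 * (c + ∫ σ in (1 / 2 : ℝ)..x, g σ)) s
      = 2 * (R - s) * (-1) * (c + ∫ σ in (1 / 2 : ℝ)..s, g σ) + (R - s) ^ 2 * g s := d4.deriv
  rw [d1.deriv, d5, h3 hs, h4 hs]
  ring

end

/-! ### Weighted pointwise bounds in one variable -/

section

lemma lintegral_Ioo_rpow {β s : ℝ} (hβ : -1 < β) (hs : 0 ≤ s) :
    ∫⁻ σ in Ioo 0 s, ENNReal.ofReal (σ ^ β) = ENNReal.ofReal (s ^ (β + 1) / (β + 1)) := by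
  have hi : IntegrableOn (fun σ : ℝ => σ ^ β) (Ioo 0 s) :=
    (intervalIntegrable_iff_integrableOn_Ioo_of_le hs).1 (intervalIntegral.intervalIntegrable_rpow' hβ)
  rw [← ofReal_integral_eq_lintegral_ofReal hi, ← integral_Ioc_eq_integral_Ioo,
    ← intervalIntegral.integral_of_le hs, integral_rpow (Or.inl hβ), Real.zero_rpow (by linarith),
    sub_zero]
  filter_upwards [ae_restrict_mem measurableSet_Ioo] with σ hσ
  exact Real.rpow_nonneg hσ.1.le _

section Bounds
variable {E : Type*} [NormedAddCommGroup E] [NormedSpace ℝ E]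

/-- Every `σ` between `s'` and `s` satisfies `s ≤ 4 σ`, because `s' > 1 / 4` and `s < 1`. For `γ ≥
0` the weight can therefore be moved inside the integral at the cost of `4 ^ γ`. -/
lemma rpow_mul_enorm_integral_le {g : ℝ → E} {ρ γ s s' : ℝ} (hγ : 0 ≤ γ) (hρ1 : ρ ≤ 1)
    (hρ : 1 / 2 ≤ ρ) (hs : s ∈ Ioo 0 ρ) (hs' : s' ∈ Ioo (1 / 4 : ℝ) (1 / 2)) :
    ENNReal.ofReal (s ^ γ) * ‖∫ σ in s'..s, g σ‖ₑ ≤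
      ENNReal.ofReal (4 ^ γ) * ∫⁻ σ in Ioo 0 ρ, ENNReal.ofReal (σ ^ γ) * ‖g σ‖ₑ := by
  have hsub : uIoc s' s ⊆ Ioo 0 ρ := by
    intro σ hσ
    rcases le_total s' s with h | h
    · rw [uIoc_of_le h] at hσ; exact ⟨by linarith [hσ.1, hs'.1], by linarith [hσ.2, hs.2]⟩
    · rw [uIoc_of_ge h] at hσ; exact ⟨by linarith [hσ.1, hs.1], by linarith [hσ.2, hs'.2]⟩
  have hle : ∀ σ ∈ uIoc s' s, s ≤ 4 * σ := by
    intro σ hσ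
    rcases le_total s' s with h | h
    · rw [uIoc_of_le h] at hσ; linarith [hσ.1, hs'.1, hs.2]
    · rw [uIoc_of_ge h] at hσ; linarith [hσ.1, hs.1]
  have h1 : ‖∫ σ in s'..s, g σ‖ₑ ≤ ∫⁻ σ in uIoc s' s, ‖g σ‖ₑ := by
    rw [← enorm_norm, intervalIntegral.norm_intervalIntegral_eq, enorm_norm]
    exact enorm_integral_le_lintegral_enorm _
  calc ENNReal.ofReal (s ^ γ) * ‖∫ σ in s'..s, g σ‖ₑ
      ≤ ENNReal.ofReal (s ^ γ) * ∫⁻ σ in uIoc s' s, ‖g σ‖ₑ := by gcongr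
    _ = ∫⁻ σ in uIoc s' s, ENNReal.ofReal (s ^ γ) * ‖g σ‖ₑ :=
        (lintegral_const_mul' _ _ ENNReal.ofReal_ne_top).symm
    _ ≤ ∫⁻ σ in uIoc s' s, ENNReal.ofReal (4 ^ γ) * (ENNReal.ofReal (σ ^ γ) * ‖g σ‖ₑ) := by
        apply setLIntegral_mono_ae' measurableSet_uIoc
        refine ae_of_all _ fun σ hσ => ?_
        rw [← mul_assoc, ← ENNReal.ofReal_mul (by positivity)]
        gcongr
        rw [← Real.mul_rpow (by norm_num) (hsub hσ).1.le]
        exact Real.rpow_le_rpow hs.1.le (hle σ hσ) hγ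
    _ ≤ ∫⁻ σ in Ioo 0 ρ, ENNReal.ofReal (4 ^ γ) * (ENNReal.ofReal (σ ^ γ) * ‖g σ‖ₑ) :=
        lintegral_mono_set hsub
    _ = _ := lintegral_const_mul' _ _ ENNReal.ofReal_ne_top

/-- A weighted integral bound for a function and its derivative gives a weighted pointwise bound. -/
lemma ae_rpow_mul_enorm_le_of_primitive {v g : ℝ → E} {ρ γ : ℝ} {c : E} {M : ENNReal}
    (hγ : 0 ≤ γ) (hρ1 : ρ ≤ 1) (hρ : 1 / 2 ≤ ρ) (hg : LocallyIntegrableOn g (Ioo 0 1))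
    (hv : ∀ᵐ s ∂(volume.restrict (Ioo (0 : ℝ) 1)), v s = c + ∫ σ in (1 / 2 : ℝ)..s, g σ)
    (hMv : ∫⁻ s in Ioo 0 ρ, ENNReal.ofReal (s ^ γ) * ‖v s‖ₑ ≤ M)
    (hMg : ∫⁻ s in Ioo 0 ρ, ENNReal.ofReal (s ^ γ) * ‖g s‖ₑ ≤ M) :
    ∀ᵐ s ∂(volume.restrict (Ioo 0 ρ)),
      ENNReal.ofReal (s ^ γ) * ‖v s‖ₑ ≤ ENNReal.ofReal (8 * 4 ^ γ) * M := by
  have hgi : ∀ a b, a ∈ Ioo (0 : ℝ) 1 → b ∈ Ioo (0 : ℝ) 1 → IntervalIntegrable g volume a b := by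
    intro a b ha hb
    rw [intervalIntegrable_iff']
    exact hg.integrableOn_compact_subset (ordConnected_Ioo.uIcc_subset ha hb) isCompact_uIcc
  have hm : (1 / 2 : ℝ) ∈ Ioo (0 : ℝ) 1 := by norm_num
  have hvρ : ∀ᵐ s ∂(volume.restrict (Ioo (0 : ℝ) ρ)), v s = c + ∫ σ in (1 / 2 : ℝ)..s, g σ :=
    ae_restrict_of_ae_restrict_of_subset (Ioo_subset_Ioo_right hρ1) hv
  have hv' : ∀ᵐ s ∂(volume.restrict (Ioo (1 / 4 : ℝ) (1 / 2))),
      v s = c + ∫ σ in (1 / 2 : ℝ)..s, g σ :=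
    ae_restrict_of_ae_restrict_of_subset (Ioo_subset_Ioo (by norm_num) (by norm_num)) hv
  filter_upwards [hvρ, ae_restrict_mem measurableSet_Ioo] with s hs hsm
  have hs1 : s ∈ Ioo (0 : ℝ) 1 := ⟨hsm.1, hsm.2.trans_le hρ1⟩
  -- Compare `v s` with `v s'` for all `s'` at a fixed distance from the boundary, then average over
  -- `s'`.
  have key : ∀ᵐ s' ∂(volume.restrict (Ioo (1 / 4 : ℝ) (1 / 2))),
      ENNReal.ofReal (s ^ γ) * ‖v s‖ₑ ≤
        ENNReal.ofReal (4 ^ γ) * (ENNReal.ofReal (s' ^ γ) * ‖v s'‖ₑ) +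
          ENNReal.ofReal (4 ^ γ) * M := by
    filter_upwards [hv', ae_restrict_mem measurableSet_Ioo] with s' hs' hsm'
    have hs1' : s' ∈ Ioo (0 : ℝ) 1 := ⟨by linarith [hsm'.1], by linarith [hsm'.2]⟩
    have e : v s = v s' + ∫ σ in s'..s, g σ := by
      rw [hs, hs', add_assoc, intervalIntegral.integral_add_adjacent_intervals
        (hgi _ _ hm hs1') (hgi _ _ hs1' hs1)]
    calc ENNReal.ofReal (s ^ γ) * ‖v s‖ₑ
        ≤ ENNReal.ofReal (s ^ γ) * (‖v s'‖ₑ + ‖∫ σ in s'..s, g σ‖ₑ) := by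
          rw [e]; gcongr; exact enorm_add_le _ _
      _ = ENNReal.ofReal (s ^ γ) * ‖v s'‖ₑ + ENNReal.ofReal (s ^ γ) * ‖∫ σ in s'..s, g σ‖ₑ :=
          mul_add _ _ _
      _ ≤ _ := by
          apply add_le_add
          · rw [← mul_assoc, ← ENNReal.ofReal_mul (by positivity)]
            gcongr
            rw [← Real.mul_rpow (by norm_num) hs1'.1.le]
            exact Real.rpow_le_rpow hs1.1.le (by linarith [hs1.2, hsm'.1]) hγ
          · exact (rpow_mul_enorm_integral_le hγ hρ1 hρ hsm hsm').trans (by gcongr)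
  have h2 := lintegral_mono_ae key
  rw [lintegral_const, lintegral_add_right _ measurable_const, lintegral_const,
    lintegral_const_mul' _ _ ENNReal.ofReal_ne_top, Measure.restrict_apply_univ, Real.volume_Ioo]
    at h2
  have h3 : ∫⁻ s' in Ioo (1 / 4 : ℝ) (1 / 2), ENNReal.ofReal (s' ^ γ) * ‖v s'‖ₑ ≤ M :=
    (lintegral_mono_set (Ioo_subset_Ioo (by norm_num) hρ)).trans hMv
  have h4 : ENNReal.ofReal (1 / 2 - 1 / 4) = 4⁻¹ := by
    rw [show (1 / 2 - 1 / 4 : ℝ) = 4⁻¹ by norm_num, ENNReal.ofReal_inv_of_pos (by norm_num)]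
    simp
  rw [h4] at h2
  -- The interval for `s'` has length `1 / 4` and there are two terms on the right, whence the
  -- constant `8 * 4 ^ γ`.
  have h5 : ENNReal.ofReal (s ^ γ) * ‖v s‖ₑ * 4⁻¹ ≤ 2 * (ENNReal.ofReal (4 ^ γ) * M) := by
    refine h2.trans ?_
    rw [two_mul]
    apply add_le_add
    · gcongr
    · exact mul_le_of_le_one_right' (ENNReal.inv_le_one.2 (by norm_num))
  calc ENNReal.ofReal (s ^ γ) * ‖v s‖ₑ = ENNReal.ofReal (s ^ γ) * ‖v s‖ₑ * 4⁻¹ * 4 := by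
        rw [mul_assoc, ENNReal.inv_mul_cancel (by norm_num) (by norm_num), mul_one]
    _ ≤ 2 * (ENNReal.ofReal (4 ^ γ) * M) * 4 := by gcongr
    _ = ENNReal.ofReal (8 * 4 ^ γ) * M := by
        rw [ENNReal.ofReal_mul (by norm_num), show ENNReal.ofReal 8 = 2 * 4 by norm_num]
        ring

/-- The flux inherits weighted pointwise bounds from its divergence, with a gain of one power. -/
lemma ae_rpow_mul_enorm_flux_le {U h : ℝ → E} {α γ ρ : ℝ} {M : ENNReal} (hγ : γ < α + 1)
    (hρ1 : ρ ≤ 1)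
    (hU : ∀ᵐ s ∂(volume.restrict (Ioo (0 : ℝ) 1)), s ^ α • U s = ∫ σ in (0 : ℝ)..s, σ ^ α • h σ)
    (hM : ∀ᵐ s ∂(volume.restrict (Ioo 0 ρ)), ENNReal.ofReal (s ^ γ) * ‖h s‖ₑ ≤ M) :
    ∀ᵐ s ∂(volume.restrict (Ioo 0 ρ)),
      ENNReal.ofReal (s ^ (γ - 1)) * ‖U s‖ₑ ≤ ENNReal.ofReal (1 / (α + 1 - γ)) * M := by
  have hUρ := ae_restrict_of_ae_restrict_of_subset (Ioo_subset_Ioo_right hρ1) hU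
  filter_upwards [hUρ, ae_restrict_mem measurableSet_Ioo] with s hs hsm
  have hMs := ae_restrict_of_ae_restrict_of_subset (Ioo_subset_Ioo_right hsm.2.le) hM
  have e : U s = s ^ (-α) • ∫ σ in (0 : ℝ)..s, σ ^ α • h σ := by
    rw [← hs, smul_smul, ← Real.rpow_add hsm.1]; simp
  -- Since `γ < α + 1`, the function `σ ^ (α - γ)` is integrable at `0`. Its integral is a multiple
  -- of `s ^ (α - γ + 1)`, and division by `s ^ α` leaves `s ^ (1 - γ)`.
  have h1 : ‖∫ σ in (0 : ℝ)..s, σ ^ α • h σ‖ₑ ≤ ∫⁻ σ in Ioo 0 s, ENNReal.ofReal (σ ^ (α - γ)) * M := by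
    rw [intervalIntegral.integral_of_le hsm.1.le, integral_Ioc_eq_integral_Ioo]
    refine (enorm_integral_le_lintegral_enorm _).trans (lintegral_mono_ae ?_)
    filter_upwards [hMs, ae_restrict_mem measurableSet_Ioo] with σ hσ hσm
    rw [enorm_smul, Real.enorm_of_nonneg (Real.rpow_nonneg hσm.1.le _)]
    calc ENNReal.ofReal (σ ^ α) * ‖h σ‖ₑ
        = ENNReal.ofReal (σ ^ (α - γ)) * (ENNReal.ofReal (σ ^ γ) * ‖h σ‖ₑ) := by
          rw [← mul_assoc, ← ENNReal.ofReal_mul (Real.rpow_nonneg hσm.1.le _),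
            ← Real.rpow_add hσm.1]; simp
      _ ≤ _ := by gcongr
  rw [lintegral_mul_const _ (by fun_prop), lintegral_Ioo_rpow (by linarith) hsm.1.le] at h1
  rw [e, enorm_smul, Real.enorm_of_nonneg (Real.rpow_nonneg hsm.1.le _)]
  calc ENNReal.ofReal (s ^ (γ - 1)) * (ENNReal.ofReal (s ^ (-α)) *
        ‖∫ σ in (0 : ℝ)..s, σ ^ α • h σ‖ₑ)
      ≤ ENNReal.ofReal (s ^ (γ - 1)) * (ENNReal.ofReal (s ^ (-α)) *
        (ENNReal.ofReal (s ^ (α - γ + 1) / (α - γ + 1)) * M)) := by gcongr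
    _ = ENNReal.ofReal (s ^ (γ - 1) * s ^ (-α) * (s ^ (α - γ + 1) / (α - γ + 1))) * M := by
        rw [ENNReal.ofReal_mul (by have := hsm.1.le; positivity),
          ENNReal.ofReal_mul (by have := hsm.1.le; positivity)]
        ring
    _ = ENNReal.ofReal (1 / (α + 1 - γ)) * M := by
        rw [mul_div_assoc', ← Real.rpow_add hsm.1, ← Real.rpow_add hsm.1]
        rw [show γ - 1 + -α + (α - γ + 1) = 0 by ring, Real.rpow_zero,
          show α - γ + 1 = α + 1 - γ by ring]

/-- The flux bound that starts from an integral bound of its divergence. -/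
lemma ae_rpow_mul_enorm_flux_le_lintegral {U h : ℝ → E} {α γ ρ : ℝ} (hγ : α ≤ γ) (hρ1 : ρ ≤ 1)
    (hU : ∀ᵐ s ∂(volume.restrict (Ioo (0 : ℝ) 1)), s ^ α • U s = ∫ σ in (0 : ℝ)..s, σ ^ α • h σ) :
    ∀ᵐ s ∂(volume.restrict (Ioo 0 ρ)), ENNReal.ofReal (s ^ γ) * ‖U s‖ₑ ≤
      ∫⁻ σ in Ioo 0 ρ, ENNReal.ofReal (σ ^ α) * ‖h σ‖ₑ := by
  have hUρ := ae_restrict_of_ae_restrict_of_subset (Ioo_subset_Ioo_right hρ1) hU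
  filter_upwards [hUρ, ae_restrict_mem measurableSet_Ioo] with s hs hsm
  have h1 : ENNReal.ofReal (s ^ γ) * ‖U s‖ₑ ≤ ‖s ^ α • U s‖ₑ := by
    rw [enorm_smul, Real.enorm_of_nonneg (Real.rpow_nonneg hsm.1.le _)]
    exact mul_le_mul_left (ENNReal.ofReal_le_ofReal
      (Real.rpow_le_rpow_of_exponent_ge hsm.1 (hsm.2.le.trans hρ1) hγ)) _
  refine h1.trans ?_
  rw [hs, intervalIntegral.integral_of_le hsm.1.le, integral_Ioc_eq_integral_Ioo]
  refine (enorm_integral_le_lintegral_enorm _).trans ?_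
  refine (lintegral_mono_set (Ioo_subset_Ioo_right hsm.2.le)).trans ?_
  refine setLIntegral_mono_ae' measurableSet_Ioo (ae_of_all _ fun σ hσ => ?_)
  rw [enorm_smul, Real.enorm_of_nonneg (Real.rpow_nonneg hσ.1.le _)]

end Bounds

end

section

/-! ### The action of matrices -/

section Act
variable {n : ℕ}

lemma act_add (M : Matrix (Fin n) (Fin n) ℝ) (v w : Val n) : act M (v + w) = act M v + act M w := by
  simp [act, Matrix.mulVec_add]

lemma act_smul (M : Matrix (Fin n) (Fin n) ℝ) (a : ℝ) (v : Val n) : act M (a • v) = a • act M v := by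
  simp [act, Matrix.mulVec_smul]

/-- The action of a matrix as a linear map. -/
def actL (M : Matrix (Fin n) (Fin n) ℝ) : Val n →L[ℝ] Val n :=
  LinearMap.toContinuousLinearMap ⟨⟨act M, act_add M⟩, act_smul M⟩

lemma act_zero (M : Matrix (Fin n) (Fin n) ℝ) : act M 0 = 0 := (actL M).map_zero

lemma act_neg (M : Matrix (Fin n) (Fin n) ℝ) (v : Val n) : act M (-v) = -act M v :=
  (actL M).map_neg v

lemma norm_act_le (M : Matrix (Fin n) (Fin n) ℝ) (v : Val n) : ‖act M v‖ ≤ entryNorm M * ‖v‖ := by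
  rw [EuclideanSpace.norm_eq, EuclideanSpace.norm_eq, entryNorm, ← Real.sqrt_mul (by positivity)]
  apply Real.sqrt_le_sqrt
  rw [Finset.sum_mul]
  apply Finset.sum_le_sum
  intro k _
  simp only [Real.norm_eq_abs, sq_abs]
  exact Finset.sum_mul_sq_le_sq_mul_sq Finset.univ (fun l => M k l) (fun l => v l)

lemma inner_act_comm {M : Matrix (Fin n) (Fin n) ℝ} (hM : M = M.transpose) (v w : Val n) :
    inner ℝ (act M v) w = inner ℝ (act M w) v := by
  have h : ∀ a b : Val n, inner ℝ (act M a) b = ∑ k, ∑ l, M k l * a l * b k := by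
    intro a b
    simp only [PiLp.inner_apply, act, Matrix.mulVec, dotProduct, RCLike.inner_apply, conj_trivial]
    refine Finset.sum_congr rfl fun k _ => ?_
    rw [mul_comm, Finset.sum_mul]
  rw [h, h, Finset.sum_comm]
  refine Finset.sum_congr rfl fun k _ => Finset.sum_congr rfl fun l _ => ?_
  have : M l k = M k l := by
    conv_lhs => rw [hM]
    rfl
  rw [this]; ring

lemma norm_le_of_coercive {M : Matrix (Fin n) (Fin n) ℝ} {κ : ℝ} {v : Val n}
    (h : κ * ‖v‖ ^ 2 ≤ inner ℝ (act M v) v) : κ * ‖v‖ ≤ ‖act M v‖ := by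
  rcases (norm_nonneg v).eq_or_lt with h0 | h0
  · rw [← h0]; simp
  · have h1 := h.trans (real_inner_le_norm _ _)
    nlinarith

lemma aestronglyMeasurable_act {X : Type*} [MeasurableSpace X] {ν : Measure X}
    {M : X → Matrix (Fin n) (Fin n) ℝ} {f : X → Val n} (hM : ∀ k l, AEMeasurable (fun x => M x k l) ν)
    (hf : AEStronglyMeasurable f ν) : AEStronglyMeasurable (fun x => act (M x) (f x)) ν := by
  have hk : ∀ l, AEMeasurable (fun x => f x l) ν := fun l =>
    (((EuclideanSpace.proj l : Val n →L[ℝ] ℝ).continuous).comp_aestronglyMeasurable hf).aemeasurable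
  have : AEMeasurable (fun x => (fun k => ∑ l, M x k l * f x l : Fin n → ℝ)) ν :=
    aemeasurable_pi_lambda _ fun k => Finset.aemeasurable_fun_sum _ fun l _ => (hM k l).mul (hk l)
  exact ((PiLp.continuous_toLp 2 (fun _ : Fin n => ℝ)).comp_aestronglyMeasurable
    this.aestronglyMeasurable)

end Act

/-! ### Tangential variables and partial mollification -/

/-- The tangential variables `(t, x')`. -/
abbrev Tan (m : ℕ) : Type := ℝ × EuclideanSpace ℝ (Fin m)

variable {m n : ℕ}

instance instIsAddHaarMeasureTan : (volume : Measure (Tan m)).IsAddHaarMeasure :=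
  Measure.prod.instIsAddHaarMeasure _ _

/-- The time direction. -/
def tdir (m : ℕ) : Tan m := (1, 0)

/-- The tangential space directions. -/
def xdir (i : Fin m) : Tan m := (0, EuclideanSpace.single i 1)

/-- Directional derivative. -/
def pd (e : Tan m) (η : Tan m → ℝ) (y : Tan m) : ℝ := fderiv ℝ η y e

/-- `(-ρ, 0) × B'_ρ`. -/
def tanBox (m : ℕ) (ρ : ℝ) : Set (Tan m) := Ioo (-ρ) 0 ×ˢ Metric.ball 0 ρ

/-- The measure `s^α ds` on `(0, ρ)`. -/
def wt (α ρ : ℝ) : Measure ℝ :=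
  (volume.restrict (Ioo 0 ρ)).withDensity fun s => ENNReal.ofReal (s ^ α)

/-- The product measure on `(-ρ, 0) × B'_ρ × (0, ρ)`. -/
def nuQ (m : ℕ) (α ρ : ℝ) : Measure (Tan m × ℝ) := (volume.restrict (tanBox m ρ)).prod (wt α ρ)

lemma measurable_weight (α : ℝ) : Measurable fun s : ℝ => ENNReal.ofReal (s ^ α) := by fun_prop

lemma lintegral_wt (α ρ : ℝ) (f : ℝ → ENNReal) :
    ∫⁻ s, f s ∂(wt α ρ) = ∫⁻ s in Ioo 0 ρ, ENNReal.ofReal (s ^ α) * f s := by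
  rw [wt, lintegral_withDensity_eq_lintegral_mul_non_measurable _ (measurable_weight α)
    (ae_of_all _ fun _ => ENNReal.ofReal_lt_top)]
  rfl

lemma ae_wt_iff {α ρ : ℝ} {p : ℝ → Prop} :
    (∀ᵐ s ∂(wt α ρ), p s) ↔ ∀ᵐ s ∂(volume.restrict (Ioo 0 ρ)), p s := by
  rw [wt, ae_withDensity_iff (measurable_weight α)]
  refine eventually_congr ?_
  filter_upwards [ae_restrict_mem measurableSet_Ioo] with s hs
  simp [Real.rpow_pos_of_pos hs.1]

lemma wt_mono (α : ℝ) {ρ R : ℝ} (h : ρ ≤ R) : wt α ρ ≤ wt α R := by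
  rw [wt, wt, ← restrict_withDensity measurableSet_Ioo, ← restrict_withDensity measurableSet_Ioo]
  exact Measure.restrict_mono_set _ (Ioo_subset_Ioo_right h)

instance instSFiniteWt (α ρ : ℝ) : SFinite (wt α ρ) := by unfold wt; infer_instance

lemma isFiniteMeasure_wt {α : ℝ} (hα : -1 < α) {ρ : ℝ} (hρ : 0 ≤ ρ) : IsFiniteMeasure (wt α ρ) := by
  constructor
  rw [wt, withDensity_apply _ MeasurableSet.univ, Measure.restrict_univ, lintegral_Ioo_rpow hα hρ]
  exact ENNReal.ofReal_lt_top

lemma tanBox_mono {ρ R : ℝ} (h : ρ ≤ R) : tanBox m ρ ⊆ tanBox m R :=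
  Set.prod_mono (Ioo_subset_Ioo_left (by linarith)) (Metric.ball_subset_ball h)

lemma measurableSet_tanBox (ρ : ℝ) : MeasurableSet (tanBox m ρ) :=
  measurableSet_Ioo.prod measurableSet_ball

lemma volume_tanBox_lt_top (ρ : ℝ) : volume (tanBox m ρ) < ⊤ := by
  rw [tanBox, Measure.volume_eq_prod, Measure.prod_prod]
  exact ENNReal.mul_lt_top (by simp) measure_ball_lt_top

lemma nuQ_mono (α : ℝ) {ρ R : ℝ} (h : ρ ≤ R) : nuQ m α ρ ≤ nuQ m α R :=
  Measure.prod_mono (Measure.restrict_mono_set _ (tanBox_mono h)) (wt_mono α h)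

lemma isFiniteMeasure_nuQ {α : ℝ} (hα : -1 < α) {ρ : ℝ} (hρ : 0 ≤ ρ) :
    IsFiniteMeasure (nuQ m α ρ) := by
  have := isFiniteMeasure_wt hα hρ
  have : IsFiniteMeasure ((volume : Measure (Tan m)).restrict (tanBox m ρ)) :=
    ⟨by rw [Measure.restrict_apply_univ]; exact volume_tanBox_lt_top ρ⟩
  unfold nuQ
  infer_instance

/-- A kernel: smooth, compactly supported in `(0, δ) × B'_δ`. -/
structure Ker (δ : ℝ) (η : Tan m → ℝ) : Prop where
  smooth : ContDiff ℝ ∞ η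
  hasCompactSupport : HasCompactSupport η
  supp : tsupport η ⊆ Ioo 0 δ ×ˢ Metric.ball 0 δ

/-- Test functions in the tangential variables. -/
structure TanTest (η : Tan m → ℝ) : Prop where
  smooth : ContDiff ℝ ∞ η
  hasCompactSupport : HasCompactSupport η
  supp : tsupport η ⊆ tanBox m 1

lemma contDiff_pd {η : Tan m → ℝ} (h : ContDiff ℝ ∞ η) (e : Tan m) : ContDiff ℝ ∞ (pd e η) :=
  (h.fderiv_right (m := ∞) (by simp)).clm_apply contDiff_const

lemma Ker.pd {δ : ℝ} {η : Tan m → ℝ} (h : Ker δ η) (e : Tan m) : Ker δ (pd e η) :=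
  ⟨contDiff_pd h.smooth e, h.hasCompactSupport.fderiv_apply ℝ e,
    (tsupport_fderiv_apply_subset ℝ e).trans h.supp⟩

lemma Ker.smul {δ : ℝ} {η : Tan m → ℝ} (h : Ker δ η) (a : ℝ) : Ker δ (fun y => a * η y) :=
  ⟨contDiff_const.mul h.smooth, h.hasCompactSupport.mul_left,
    (tsupport_mul_subset_right).trans h.supp⟩

/-- Needed because derivatives of mollified functions are expressed through derivatives of the
kernel, where differentiation happens in the reverse order. -/
lemma pd_comm {η : Tan m → ℝ} (h : ContDiff ℝ ∞ η) (e e₁ : Tan m) :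
    pd e (pd e₁ η) = pd e₁ (pd e η) := by
  have hd : Differentiable ℝ (fderiv ℝ η) :=
    (h.fderiv_right (m := ∞) (by simp)).differentiable (by simp)
  have key : ∀ a b y, pd a (pd b η) y = fderiv ℝ (fderiv ℝ η) y a b := by
    intro a b y
    have := ((hd y).hasFDerivAt.clm_apply (hasFDerivAt_const b y)).fderiv
    unfold pd
    rw [this]; simp
  ext y
  rw [key, key]
  exact (h.contDiffAt.isSymmSndFDerivAt (by
    simp only [minSmoothness_of_isRCLikeNormedField]
    exact WithTop.coe_le_coe.2 (le_top : (2 : ℕ∞) ≤ ⊤))).eq e e₁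

/-- Mollification in the tangential variables. -/
def cv (f : Tan m × ℝ → Val n) (η : Tan m → ℝ) (y : Tan m) (s : ℝ) : Val n :=
  ∫ y', η (y - y') • f (y', s)

/-- Tangential moments. -/
def mom (f : Tan m × ℝ → Val n) (η : Tan m → ℝ) (s : ℝ) : Val n := ∫ y', η y' • f (y', s)

lemma cv_eq_mom (f : Tan m × ℝ → Val n) (η : Tan m → ℝ) (y : Tan m) (s : ℝ) :
    cv f η y s = mom f (fun y' => η (y - y')) s := rfl

lemma cv_smul (f : Tan m × ℝ → Val n) (η : Tan m → ℝ) (a : ℝ) (y : Tan m) (s : ℝ) :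
    cv f (fun y => a * η y) y s = a • cv f η y s := by
  simp only [cv, mul_smul]
  exact integral_smul _ _

lemma stronglyMeasurable_cv {f : Tan m × ℝ → Val n} (hf : StronglyMeasurable f) {η : Tan m → ℝ}
    (hη : Continuous η) : StronglyMeasurable fun z : Tan m × ℝ => cv f η z.1 z.2 := by
  unfold cv
  apply StronglyMeasurable.integral_prod_right
    (f := fun (z : Tan m × ℝ) (y' : Tan m) => η (z.1 - y') • f (y', z.2))
  have h1 : StronglyMeasurable fun z : (Tan m × ℝ) × Tan m => η (z.1.1 - z.2) :=
    (hη.comp (by fun_prop)).stronglyMeasurable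
  have h2 : StronglyMeasurable fun z : (Tan m × ℝ) × Tan m => f (z.2, z.1.2) :=
    hf.comp_measurable (by fun_prop)
  exact h1.smul h2

lemma cv_eq_convolution (f : Tan m × ℝ → Val n) (η : Tan m → ℝ) (s : ℝ) :
    (fun y => cv f η y s) = convolution (fun y => f (y, s)) η
      (ContinuousLinearMap.lsmul ℝ ℝ).flip volume := by
  ext1 y
  rfl

lemma contDiff_cv {f : Tan m × ℝ → Val n} {s : ℝ} (hf : Integrable fun y => f (y, s))
    {η : Tan m → ℝ} (hη : ContDiff ℝ ∞ η) (hc : HasCompactSupport η) :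
    ContDiff ℝ ∞ fun y => cv f η y s := by
  rw [cv_eq_convolution]
  exact hc.contDiff_convolution_right (n := ⊤) _ hf.locallyIntegrable hη

lemma fderiv_cv {f : Tan m × ℝ → Val n} {s : ℝ} (hf : Integrable fun y => f (y, s))
    {η : Tan m → ℝ} (hη : ContDiff ℝ ∞ η) (hc : HasCompactSupport η) (y e : Tan m) :
    fderiv ℝ (fun y => cv f η y s) y e = cv f (pd e η) y s := by
  have h1 : ContDiff ℝ 1 η := hη.of_le (by exact_mod_cast le_top)
  have h := hc.hasFDerivAt_convolution_right
    ((ContinuousLinearMap.lsmul ℝ ℝ).flip : Val n →L[ℝ] ℝ →L[ℝ] Val n) (μ := volume)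
    hf.locallyIntegrable h1 y
  rw [cv_eq_convolution, h.fderiv, convolution_precompR_apply _ hf.locallyIntegrable
    (hc.fderiv ℝ) (h1.continuous_fderiv (by simp))]
  rfl

lemma enorm_cv_le {f : Tan m × ℝ → Val n} {η : Tan m → ℝ} {C : ℝ} (hC : ∀ y, |η y| ≤ C)
    (y : Tan m) (s : ℝ) : ‖cv f η y s‖ₑ ≤ ENNReal.ofReal C * ∫⁻ y', ‖f (y', s)‖ₑ := by
  refine (enorm_integral_le_lintegral_enorm _).trans ?_
  rw [← lintegral_const_mul' _ _ ENNReal.ofReal_ne_top]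
  refine lintegral_mono fun y' => ?_
  rw [enorm_smul, ← ofReal_norm (η _)]
  gcongr
  exact hC _

lemma Ker.exists_bound {δ : ℝ} {η : Tan m → ℝ} (h : Ker δ η) : ∃ C, ∀ y, |η y| ≤ C :=
  h.smooth.continuous.bounded_above_of_compact_support h.hasCompactSupport

/-- Young's inequality for the mollification. -/
lemma lintegral_cv_le {f : Tan m × ℝ → Val n} (hf : StronglyMeasurable f) {η : Tan m → ℝ}
    (hη : Continuous η) (s : ℝ) :
    ∫⁻ y, ‖cv f η y s‖ₑ ≤ (∫⁻ y, ‖η y‖ₑ) * ∫⁻ y, ‖f (y, s)‖ₑ := by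
  have hm : Measurable fun z : Tan m × Tan m => ‖η (z.1 - z.2)‖ₑ * ‖f (z.2, s)‖ₑ := by
    refine Measurable.mul (f := fun z : Tan m × Tan m => ‖η (z.1 - z.2)‖ₑ) ?_ ?_
    · exact (hη.comp (by fun_prop)).measurable.enorm
    · exact (hf.comp_measurable (g := fun z : Tan m × Tan m => (z.2, s)) (by fun_prop)).enorm
  calc ∫⁻ y, ‖cv f η y s‖ₑ ≤ ∫⁻ y, ∫⁻ y', ‖η (y - y')‖ₑ * ‖f (y', s)‖ₑ := by
        refine lintegral_mono fun y => (enorm_integral_le_lintegral_enorm _).trans ?_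
        simp_rw [enorm_smul]; rfl
    _ = ∫⁻ y', ∫⁻ y, ‖η (y - y')‖ₑ * ‖f (y', s)‖ₑ := lintegral_lintegral_swap hm.aemeasurable
    _ = ∫⁻ y', (∫⁻ y, ‖η y‖ₑ) * ‖f (y', s)‖ₑ := by
        refine lintegral_congr fun y' => ?_
        rw [lintegral_mul_const' _ _ enorm_ne_top,
          lintegral_sub_right_eq_self (fun y => ‖η y‖ₑ) y']
    _ = _ := by
        rw [lintegral_const_mul]
        exact (hf.comp_measurable (g := fun z : Tan m => (z, s)) (by fun_prop)).enorm

end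

/-! ### Integrals against the weight `s ^ α` -/

section

variable {m n : ℕ}

lemma integrable_wt_iff {E : Type*} [NormedAddCommGroup E] [NormedSpace ℝ E] {α ρ : ℝ} {f : ℝ → E} :
    Integrable f (wt α ρ) ↔ IntegrableOn (fun s => s ^ α • f s) (Ioo 0 ρ) := by
  rw [wt, integrable_withDensity_iff_integrable_smul' (measurable_weight α)
    (ae_of_all _ fun _ => ENNReal.ofReal_lt_top)]
  apply integrable_congr
  filter_upwards [ae_restrict_mem measurableSet_Ioo] with s hs
  rw [ENNReal.toReal_ofReal (Real.rpow_nonneg hs.1.le _)]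

lemma integral_wt {E : Type*} [NormedAddCommGroup E] [NormedSpace ℝ E] {α ρ : ℝ} (f : ℝ → E) :
    ∫ s, f s ∂(wt α ρ) = ∫ s in Ioo 0 ρ, s ^ α • f s := by
  rw [wt, integral_withDensity_eq_integral_toReal_smul (measurable_weight α)
    (ae_of_all _ fun _ => ENNReal.ofReal_lt_top)]
  apply integral_congr_ae
  filter_upwards [ae_restrict_mem measurableSet_Ioo] with s hs
  rw [ENNReal.toReal_ofReal (Real.rpow_nonneg hs.1.le _)]

lemma locallyIntegrableOn_of_integrable_wt {E : Type*} [NormedAddCommGroup E] [NormedSpace ℝ E]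
    {α ρ : ℝ} {f : ℝ → E} (hf : Integrable f (wt α ρ)) : LocallyIntegrableOn f (Ioo 0 ρ) := by
  have h1 : LocallyIntegrableOn (fun s => s ^ α • f s) (Ioo 0 ρ) :=
    IntegrableOn.locallyIntegrableOn (integrable_wt_iff.1 hf)
  have h2 : ContinuousOn (fun s : ℝ => s ^ (-α)) (Ioo 0 ρ) := fun s hs =>
    (Real.continuousAt_rpow_const s _ (Or.inl hs.1.ne')).continuousWithinAt
  have h3 := h1.continuousOn_smul isOpen_Ioo.isLocallyClosed h2
  refine h3.congr ?_
  rw [EventuallyEq, ae_restrict_iff' measurableSet_Ioo]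
  refine ae_of_all _ fun s hs => ?_
  rw [smul_smul, ← Real.rpow_add hs.1]; simp

/-! ### Solutions on the unit cylinder -/

/-- The tangentially mollified flux `A^{ij} D_j u`. -/
def flux (c : Coeffs m n) (u g : Tan m × ℝ → Val n) (i : Fin (m + 1)) (η : Tan m → ℝ) (y : Tan m)
    (s : ℝ) : Val n :=
  act (c.A i (Fin.last m) s) (cv g η y s) +
    ∑ j : Fin m, act (c.A i j.castSucc s) (cv u (pd (xdir j) η) y s)

/-- The mollified weighted divergence of the normal flux, as given by the equation. -/
def source (c : Coeffs m n) (lam : ℝ) (u g : Tan m × ℝ → Val n) (η : Tan m → ℝ) (y : Tan m)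
    (s : ℝ) : Val n :=
  act (c.a0 s) (cv u (pd (tdir m) η) y s) + lam • act (c.C0 s) (cv u η y s) -
    ∑ i : Fin m, flux c u g i.castSucc (pd (xdir i) η) y s

/-- A solution `u` on the unit cylinder with normal derivative `g`, in terms of tangential
moments. -/
structure IsSol (α κ lam : ℝ) (c : Coeffs m n) (u g : Tan m × ℝ → Val n) : Prop where
  lam_nonneg : 0 ≤ lam
  adm : c.Admissible κ
  meas_u : StronglyMeasurable u
  meas_g : StronglyMeasurable g
  int_u : Integrable u (volume.prod (wt α 1))
  int_g : Integrable g (volume.prod (wt α 1))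
  primitive : ∀ η, TanTest η → ∃ C, ∀ᵐ s ∂(volume.restrict (Ioo (0 : ℝ) 1)),
    mom u η s = C + ∫ σ in (1 / 2 : ℝ)..s, mom g η σ
  flux_eq : ∀ η, TanTest η → ∀ᵐ s ∂(volume.restrict (Ioo (0 : ℝ) 1)),
    s ^ α • (act (c.A (Fin.last m) (Fin.last m) s) (mom g η s) -
        ∑ j : Fin m, act (c.A (Fin.last m) j.castSucc s) (mom u (pd (xdir j) η) s)) =
      ∫ σ in (0 : ℝ)..s, σ ^ α • (-act (c.a0 σ) (mom u (pd (tdir m) η) σ) +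
        lam • act (c.C0 σ) (mom u η σ) +
        ∑ i : Fin m, (act (c.A i.castSucc (Fin.last m) σ) (mom g (pd (xdir i) η) σ) -
          ∑ j : Fin m, act (c.A i.castSucc j.castSucc σ) (mom u (pd (xdir j) (pd (xdir i) η)) σ)))

/-- A kernel supported in positive times looks only into the past: `y - y'` in its support forces
`y'` to be earlier than `y`. So room of size `δ` is needed at the initial time and laterally, but
not at the final time `0`, which all cylinders share. -/
lemma Ker.tanTest {δ : ℝ} {η : Tan m → ℝ} (h : Ker δ η) {y : Tan m} (hy : y ∈ tanBox m (1 - δ)) :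
    TanTest fun y' => η (y - y') := by
  have hsub : tsupport (fun y' => η (y - y')) ⊆ (fun y' => y - y') ⁻¹' tsupport η :=
    tsupport_comp_subset_preimage η (by fun_prop)
  refine ⟨h.smooth.comp (contDiff_const.sub contDiff_id), ?_, ?_⟩
  · exact h.hasCompactSupport.comp_homeomorph (Homeomorph.subLeft y)
  · intro y' hy'
    have h1 := h.supp (hsub hy')
    obtain ⟨⟨h2, h3⟩, h4⟩ := h1
    obtain ⟨⟨h5, h6⟩, h7⟩ := hy
    simp only [Prod.fst_sub, Prod.snd_sub, mem_ball_zero_iff] at h2 h3 h4 h7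
    refine ⟨⟨by linarith, by linarith⟩, ?_⟩
    rw [mem_ball_zero_iff]
    have := norm_sub_norm_le y'.2 y.2
    rw [norm_sub_rev] at this
    linarith

lemma pd_reflect {η : Tan m → ℝ} (h : ContDiff ℝ ∞ η) (y e : Tan m) :
    pd e (fun y' => η (y - y')) = fun y' => -pd e η (y - y') := by
  ext y'
  have h1 : HasFDerivAt (fun y' => y - y') (-ContinuousLinearMap.id ℝ (Tan m)) y' :=
    (hasFDerivAt_id y').const_sub y
  have h2 := ((h.differentiable (by simp)) (y - y')).hasFDerivAt.comp y' h1
  unfold pd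
  rw [show (fun y' => η (y - y')) = η ∘ fun y' => y - y' from rfl, h2.fderiv]
  simp

lemma pd_neg (η : Tan m → ℝ) (e : Tan m) : pd e (fun y => -η y) = fun y => -pd e η y := by
  ext y; simp [pd]

lemma mom_neg (f : Tan m × ℝ → Val n) (η : Tan m → ℝ) (s : ℝ) :
    mom f (fun y => -η y) s = -mom f η s := by
  simp only [mom, neg_smul]; exact integral_neg _

section Facts
variable {α κ lam δ : ℝ} {c : Coeffs m n} {u g : Tan m × ℝ → Val n} {η : Tan m → ℝ} {y : Tan m}

lemma IsSol.primitive_cv (h : IsSol α κ lam c u g) (hη : Ker δ η) (hy : y ∈ tanBox m (1 - δ)) :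
    ∃ C, ∀ᵐ s ∂(volume.restrict (Ioo (0 : ℝ) 1)),
      cv u η y s = C + ∫ σ in (1 / 2 : ℝ)..s, cv g η y σ :=
  h.primitive _ (hη.tanTest hy)

/-- The reflection `y' ↦ η (y - y')` reverses the sign of first derivatives and preserves second
ones. This turns the signs of the weak formulation into those of the equation for the mollified
function. -/
lemma IsSol.flux_cv (h : IsSol α κ lam c u g) (hη : Ker δ η) (hy : y ∈ tanBox m (1 - δ)) :
    ∀ᵐ s ∂(volume.restrict (Ioo (0 : ℝ) 1)),
      s ^ α • flux c u g (Fin.last m) η y s = ∫ σ in (0 : ℝ)..s, σ ^ α • source c lam u g η y σ := by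
  have h1 := h.flux_eq _ (hη.tanTest hy)
  have e2 : ∀ i j : Fin m, pd (xdir j) (fun y' => -pd (xdir i) η (y - y')) =
      fun y' => pd (xdir j) (pd (xdir i) η) (y - y') := by
    intro i j
    rw [pd_neg, pd_reflect (contDiff_pd hη.smooth _)]
    simp
  simp only [pd_reflect hη.smooth, e2, mom_neg, ← cv_eq_mom, act_neg, sub_neg_eq_add,
    Finset.sum_neg_distrib, neg_neg] at h1
  filter_upwards [h1] with s hs
  rw [flux, hs]
  apply intervalIntegral.integral_congr
  intro σ _
  simp only [source, flux]
  congr 1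
  simp only [Finset.sum_sub_distrib, Finset.sum_neg_distrib, Finset.sum_add_distrib]
  abel

lemma lintegral_cv_wt_le {f : Tan m × ℝ → Val n} (hf : StronglyMeasurable f) {C : ℝ}
    (hC : ∀ y, |η y| ≤ C) (y : Tan m) :
    ∫⁻ s, ‖cv f η y s‖ₑ ∂(wt α 1) ≤ ENNReal.ofReal C * ∫⁻ z, ‖f z‖ₑ ∂(volume.prod (wt α 1)) := by
  rw [lintegral_prod_symm _ hf.enorm.aemeasurable, ← lintegral_const_mul' _ _ ENNReal.ofReal_ne_top]
  exact lintegral_mono fun s => enorm_cv_le hC y s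

/-- A bounded kernel in the tangential variables gives integrability along every normal line, not
only along almost every one. -/
lemma integrable_cv {f : Tan m × ℝ → Val n} (hf : StronglyMeasurable f)
    (hi : Integrable f (volume.prod (wt α 1))) (hη : Ker δ η) (y : Tan m) :
    Integrable (fun s => cv f η y s) (wt α 1) := by
  obtain ⟨C, hC⟩ := hη.exists_bound
  refine ⟨((stronglyMeasurable_cv hf hη.smooth.continuous).comp_measurable
    (g := fun s : ℝ => (y, s)) (by fun_prop)).aestronglyMeasurable, ?_⟩
  exact (lintegral_cv_wt_le hf hC y).trans_lt (ENNReal.mul_lt_top ENNReal.ofReal_lt_top hi.2)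

lemma Coeffs.Admissible.norm_flux_le (h : c.Admissible κ) {s : ℝ} (hs : 0 < s) (i : Fin (m + 1)) :
    ‖flux c u g i η y s‖ ≤ κ⁻¹ * (‖cv g η y s‖ + ∑ j : Fin m, ‖cv u (pd (xdir j) η) y s‖) := by
  rw [flux, mul_add, Finset.mul_sum]
  refine (norm_add_le _ _).trans (add_le_add ?_ ((norm_sum_le _ _).trans (Finset.sum_le_sum ?_)))
  · exact (norm_act_le _ _).trans (by gcongr; exact h.A_bounded s hs _ _)
  · intro j _
    exact (norm_act_le _ _).trans (by gcongr; exact h.A_bounded s hs _ _)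

/-- Ellipticity, tested with a gradient that has only a normal component. -/
lemma Coeffs.Admissible.coercive_last (h : c.Admissible κ) {s : ℝ} (hs : 0 < s) (v : Val n) :
    κ * ‖v‖ ≤ ‖act (c.A (Fin.last m) (Fin.last m) s) v‖ := by
  apply norm_le_of_coercive
  have := h.A_elliptic s hs (fun i => if i = Fin.last m then v else 0)
  simpa [Fin.sum_univ_castSucc, act_zero, (Fin.castSucc_lt_last _).ne] using this

/-- The normal derivative is the only part of the gradient that is not a mollification of `u`
itself. It is recovered from the flux by inverting `A^{dd}`. -/
lemma Coeffs.Admissible.norm_normal_le (h : c.Admissible κ) (hκ : 0 < κ) {s : ℝ} (hs : 0 < s) :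
    ‖cv g η y s‖ ≤ κ⁻¹ * (‖flux c u g (Fin.last m) η y s‖ +
      κ⁻¹ * ∑ j : Fin m, ‖cv u (pd (xdir j) η) y s‖) := by
  rw [← div_eq_inv_mul, le_div_iff₀ hκ, mul_comm]
  refine (h.coercive_last hs _).trans ?_
  have e : act (c.A (Fin.last m) (Fin.last m) s) (cv g η y s) = flux c u g (Fin.last m) η y s -
      ∑ j : Fin m, act (c.A (Fin.last m) j.castSucc s) (cv u (pd (xdir j) η) y s) := by
    simp [flux]
  rw [e]
  refine (norm_sub_le _ _).trans ?_
  gcongr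
  rw [Finset.mul_sum]
  refine (norm_sum_le _ _).trans (Finset.sum_le_sum fun j _ => ?_)
  exact (norm_act_le _ _).trans (by gcongr; exact h.A_bounded s hs _ _)

end Facts

end

section

variable {m n : ℕ}

/-! ### Families of functionals and their comparison -/

/-- A solution together with the size of the kernels. -/
structure Dat (m n : ℕ) (α κ : ℝ) where
  lam : ℝ
  c : Coeffs m n
  u : Tan m × ℝ → Val n
  g : Tan m × ℝ → Val n
  sol : IsSol α κ lam c u g
  δ : ℝ
  δ_pos : 0 < δ
  δ_le : δ ≤ 1 / 4

variable {α κ : ℝ}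

/-- `F` on a cylinder is controlled by `G` on a larger one, with a constant that is polynomial in
the inverse gap and uniform in the solution and the kernel. -/
def Dom (F G : Dat m n α κ → (Tan m → ℝ) → ℝ → ENNReal) : Prop :=
  ∃ C : ℝ, ∃ K : ℕ, 0 ≤ C ∧ ∀ D η ρ R, Ker D.δ η → 1 / 2 ≤ ρ → ρ < R → R ≤ 1 - D.δ →
    F D η ρ ≤ ENNReal.ofReal (C * ((R - ρ)⁻¹) ^ K) * G D η R

/-- Monotonicity in the radius. -/
def MonoR (F : Dat m n α κ → (Tan m → ℝ) → ℝ → ENNReal) : Prop :=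
  ∀ D η ρ R, ρ ≤ R → F D η ρ ≤ F D η R

variable {F F' G G' H : Dat m n α κ → (Tan m → ℝ) → ℝ → ENNReal}

/-- Gaps are at most one, so powers of the inverse gap with different exponents can be compared. -/
lemma one_le_inv_gap (D : Dat m n α κ) {ρ R : ℝ} (h : 1 / 2 ≤ ρ) (h' : ρ < R) (h'' : R ≤ 1 - D.δ) :
    1 ≤ (R - ρ)⁻¹ :=
  one_le_inv₀ (by linarith) |>.2 (by linarith [D.δ_pos])

lemma Dom.of_le {C : ℝ} (hG : MonoR G)
    (h : ∀ D η ρ, Ker D.δ η → 1 / 2 ≤ ρ → ρ ≤ 1 - D.δ → F D η ρ ≤ ENNReal.ofReal C * G D η ρ) :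
    Dom F G := by
  refine ⟨max C 0, 0, le_max_right _ _, fun D η ρ R hη hρ hR hR1 => ?_⟩
  refine (h D η ρ hη hρ (hR.le.trans hR1)).trans ?_
  rw [pow_zero, mul_one]
  gcongr
  · exact le_max_left _ _
  · exact hG _ _ _ _ hR.le

lemma Dom.refl (hG : MonoR G) : Dom G G :=
  Dom.of_le (C := 1) hG fun D η ρ _ _ _ => by simp

lemma Dom.trans (h1 : Dom F G) (h2 : Dom G H) : Dom F H := by
  obtain ⟨C, K, hC, h1⟩ := h1
  obtain ⟨C', K', hC', h2⟩ := h2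
  refine ⟨C * C' * 2 ^ (K + K'), K + K', by positivity, fun D η ρ R hη hρ hR hR1 => ?_⟩
  -- The midpoint serves as intermediate radius; halving the gap twice costs `2 ^ (K + K')`.
  have hm1 : ρ < (ρ + R) / 2 := by linarith
  have hm2 : (ρ + R) / 2 < R := by linarith
  refine (h1 D η ρ ((ρ + R) / 2) hη hρ hm1 (by linarith)).trans ?_
  calc _ ≤ ENNReal.ofReal (C * (((ρ + R) / 2 - ρ)⁻¹) ^ K) *
        (ENNReal.ofReal (C' * ((R - (ρ + R) / 2)⁻¹) ^ K') * H D η R) := by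
        gcongr
        exact h2 D η _ R hη (by linarith) hm2 hR1
    _ = _ := by
        have hp : 0 < R - ρ := by linarith
        rw [← mul_assoc, ← ENNReal.ofReal_mul
          (by rw [show (ρ + R) / 2 - ρ = (R - ρ) / 2 by ring]; positivity)]
        congr 2
        rw [show (ρ + R) / 2 - ρ = (R - ρ) / 2 by ring, show R - (ρ + R) / 2 = (R - ρ) / 2 by ring,
          inv_div, div_eq_mul_inv, mul_pow, mul_pow]
        ring

lemma Dom.add (h1 : Dom F H) (h2 : Dom G H) : Dom (fun D η ρ => F D η ρ + G D η ρ) H := by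
  obtain ⟨C, K, hC, h1⟩ := h1
  obtain ⟨C', K', hC', h2⟩ := h2
  refine ⟨C + C', K + K', by positivity, fun D η ρ R hη hρ hR hR1 => ?_⟩
  have hg := one_le_inv_gap D hρ hR hR1
  have hg0 : 0 ≤ (R - ρ)⁻¹ := by linarith
  rw [add_mul, ENNReal.ofReal_add (by positivity) (by positivity), add_mul]
  apply add_le_add
  · refine (h1 D η ρ R hη hρ hR hR1).trans ?_
    have := pow_le_pow_right₀ hg (show K ≤ K + K' by omega)
    have := pow_le_pow_right₀ hg (show K' ≤ K + K' by omega)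
    gcongr
  · refine (h2 D η ρ R hη hρ hR hR1).trans ?_
    have := pow_le_pow_right₀ hg (show K ≤ K + K' by omega)
    have := pow_le_pow_right₀ hg (show K' ≤ K + K' by omega)
    gcongr

lemma Dom.zero : Dom (fun _ _ _ => 0) G := ⟨0, 0, le_rfl, fun _ _ _ _ _ _ _ _ => zero_le⟩

lemma Dom.sum {ι : Type*} (s : Finset ι) {F : ι → Dat m n α κ → (Tan m → ℝ) → ℝ → ENNReal}
    (h : ∀ i ∈ s, Dom (F i) H) : Dom (fun D η ρ => ∑ i ∈ s, F i D η ρ) H := by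
  classical
  induction s using Finset.induction_on with
  | empty => simpa using Dom.zero
  | insert a s ha ih =>
    simp only [Finset.sum_insert ha]
    exact (h a (by simp)).add (ih fun i hi => h i (by simp [hi]))

lemma Dom.mono_left {C : ℝ} (h : Dom G H)
    (hF : ∀ D η ρ, Ker D.δ η → 1 / 2 ≤ ρ → ρ ≤ 1 - D.δ → F D η ρ ≤ ENNReal.ofReal C * G D η ρ) :
    Dom F H := by
  obtain ⟨C', K', hC', h2⟩ := h
  refine ⟨max C 0 * C', K', by positivity, fun D η ρ R hη hρ hR hR1 => ?_⟩
  refine (hF D η ρ hη hρ (hR.le.trans hR1)).trans ?_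
  rw [mul_assoc, ENNReal.ofReal_mul (by positivity), mul_assoc]
  gcongr
  · exact le_max_left _ _
  · exact h2 D η ρ R hη hρ hR hR1

/-- This is what uniformity in the kernel is for: with `T` a derivative or a multiplication, the
estimate passes to derivatives and multiples of the mollified solution. -/
lemma Dom.comp {T : Dat m n α κ → (Tan m → ℝ) → (Tan m → ℝ)}
    (hT : ∀ D η, Ker D.δ η → Ker D.δ (T D η)) (h : Dom F G) :
    Dom (fun D η => F D (T D η)) (fun D η => G D (T D η)) := by
  obtain ⟨C, K, hC, h⟩ := h
  exact ⟨C, K, hC, fun D η ρ R hη => h D _ ρ R (hT D η hη)⟩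

/-- The self-improvement of a bound of geometric mean type. -/
lemma Dom.absorb {C : ℝ} {K : ℕ} (hC : 0 ≤ C) (hF : MonoR F)
    (hfin : ∀ D η ρ, Ker D.δ η → 1 / 2 ≤ ρ → ρ ≤ 1 - D.δ → F D η ρ < ⊤) (hG : MonoR G)
    (h : ∀ D η ρ R, Ker D.δ η → 1 / 2 ≤ ρ → ρ < R → R ≤ 1 - D.δ →
      F D η ρ ^ 2 ≤ ENNReal.ofReal (C * ((R - ρ)⁻¹) ^ K) * (F D η R * G D η R)) : Dom F G := by
  refine ⟨C * 4 ^ K, K, by positivity, fun D η ρ R hη hρ hR hR1 => ?_⟩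
  -- The supremum of `F`, weighted by a power of the gap to `R`, is finite by `hfin`. The hypothesis
  -- between `x` and the midpoint of `x` and `R` leaves one such weight for `F` at the midpoint.
  -- This gives `A² ≤ C 4 ^ K A G`, and the finite factor `A` cancels.
  set A : ENNReal := ⨆ x ∈ Ico (1 / 2 : ℝ) R, ENNReal.ofReal ((R - x) ^ K) * F D η x with hA
  have hRf : F D η R < ⊤ := hfin D η R hη (by linarith) hR1
  have hAfin : A ≠ ⊤ := by
    refine ne_top_of_le_ne_top hRf.ne (iSup₂_le fun x hx => ?_)
    calc _ ≤ ENNReal.ofReal 1 * F D η R := by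
          gcongr
          · exact pow_le_one₀ (by linarith [hx.2]) (by linarith [hx.1, D.δ_pos])
          · exact hF _ _ _ _ hx.2.le
      _ = _ := by simp
  have hle : ∀ x ∈ Ico (1 / 2 : ℝ) R, (ENNReal.ofReal ((R - x) ^ K) * F D η x) ^ 2 ≤
      ENNReal.ofReal (C * 4 ^ K) * (A * G D η R) := by
    intro x hx
    have hp : 0 < R - x := by linarith [hx.2]
    have h1 := h D η x ((x + R) / 2) hη hx.1 (by linarith) (by linarith)
    have h2 : ENNReal.ofReal ((R - (x + R) / 2) ^ K) * F D η ((x + R) / 2) ≤ A :=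
      le_iSup₂_of_le (f := fun x (_ : x ∈ Ico (1 / 2 : ℝ) R) =>
        ENNReal.ofReal ((R - x) ^ K) * F D η x) ((x + R) / 2)
        ⟨by linarith [hx.1], by linarith⟩ le_rfl
    calc (ENNReal.ofReal ((R - x) ^ K) * F D η x) ^ 2
        = ENNReal.ofReal ((R - x) ^ K) ^ 2 * F D η x ^ 2 := mul_pow _ _ _
      _ ≤ ENNReal.ofReal ((R - x) ^ K) ^ 2 * (ENNReal.ofReal (C * (((x + R) / 2 - x)⁻¹) ^ K) *
          (F D η ((x + R) / 2) * G D η ((x + R) / 2))) := by gcongr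
      _ = ENNReal.ofReal (C * 4 ^ K) *
          ((ENNReal.ofReal ((R - (x + R) / 2) ^ K) * F D η ((x + R) / 2)) * G D η ((x + R) / 2)) := by
          have e : ENNReal.ofReal ((R - x) ^ K) ^ 2 *
              ENNReal.ofReal (C * (((x + R) / 2 - x)⁻¹) ^ K) =
              ENNReal.ofReal (C * 4 ^ K) * ENNReal.ofReal ((R - (x + R) / 2) ^ K) := by
            rw [← ENNReal.ofReal_pow (by positivity), ← ENNReal.ofReal_mul (by positivity),
              ← ENNReal.ofReal_mul (by positivity)]
            congr 1
            rw [show (x + R) / 2 - x = (R - x) / 2 by ring,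
              show R - (x + R) / 2 = (R - x) / 2 by ring, div_pow, inv_div, div_pow,
              show (4 : ℝ) = 2 * 2 by norm_num, mul_pow]
            field_simp
          rw [← mul_assoc, e]
          ring
      _ ≤ _ := by
          gcongr
          exact hG _ _ _ _ (by linarith)
  -- Squaring is continuous, so a strict violation by `A` would already occur at some `b < A`, hence
  -- at some admissible radius.
  have hA2 : A ^ 2 ≤ ENNReal.ofReal (C * 4 ^ K) * (A * G D η R) := by
    by_contra hcon
    push Not at hcon
    obtain ⟨b, hb1, hb2⟩ : ∃ b < A, ENNReal.ofReal (C * 4 ^ K) * (A * G D η R) < b ^ 2 := by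
      have hct : Tendsto (fun b : ENNReal => b ^ 2) (𝓝[<] A) (𝓝 (A ^ 2)) :=
        ((ENNReal.continuous_pow 2).tendsto A).mono_left nhdsWithin_le_nhds
      have hA0 : A ≠ 0 := by
        rintro h0
        rw [h0] at hcon
        simp at hcon
      have : (𝓝[<] A).NeBot := nhdsLT_neBot_of_exists_lt ⟨0, pos_iff_ne_zero.2 hA0⟩
      obtain ⟨b, h1, h2⟩ := ((hct.eventually (lt_mem_nhds hcon)).and self_mem_nhdsWithin).exists
      exact ⟨b, h2, h1⟩
    obtain ⟨x, hx⟩ := lt_iSup_iff.1 hb1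
    obtain ⟨hx1, hx2⟩ := lt_iSup_iff.1 hx
    have := hle x hx1
    exact absurd (this.trans_lt hb2) (not_lt.2 (by gcongr))
  have hA3 : A ≤ ENNReal.ofReal (C * 4 ^ K) * G D η R := by
    by_cases hA0 : A = 0
    · rw [hA0]; exact zero_le
    · rw [sq, mul_left_comm] at hA2
      exact (ENNReal.mul_le_mul_iff_right hA0 hAfin).1 hA2
  have hp : 0 < R - ρ := by linarith
  have h5 : ENNReal.ofReal ((R - ρ) ^ K) * F D η ρ ≤ A :=
    le_iSup₂_of_le (f := fun x (_ : x ∈ Ico (1 / 2 : ℝ) R) =>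
        ENNReal.ofReal ((R - x) ^ K) * F D η x) ρ ⟨hρ, hR⟩ le_rfl
  calc F D η ρ = ENNReal.ofReal (((R - ρ)⁻¹) ^ K) * (ENNReal.ofReal ((R - ρ) ^ K) * F D η ρ) := by
        rw [← mul_assoc, ← ENNReal.ofReal_mul (by positivity), ← mul_pow, inv_mul_cancel₀ hp.ne']
        simp
    _ ≤ ENNReal.ofReal (((R - ρ)⁻¹) ^ K) * (ENNReal.ofReal (C * 4 ^ K) * G D η R) := by
        exact mul_le_mul_right (h5.trans hA3) _
    _ = _ := by
        rw [← mul_assoc, ← ENNReal.ofReal_mul (by positivity)]; ring_nf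

end

section

variable {m n : ℕ} {α κ : ℝ}

/-! ### Regularity in the normal variable -/

/-- The size of the mollified solution and its spatial gradient. -/
def tot (D : Dat m n α κ) (η : Tan m → ℝ) (y : Tan m) (s : ℝ) : ENNReal :=
  ‖cv D.u η y s‖ₑ + ‖cv D.g η y s‖ₑ + ∑ i : Fin m, ‖cv D.u (pd (xdir i) η) y s‖ₑ

/-- Multiplication of a kernel by `λ`. -/
def lamMul (D : Dat m n α κ) (η : Tan m → ℝ) : Tan m → ℝ := fun y => D.lam * η y

/-- Sum of a functional over a kernel and its images under `λ`, `∂_t` and `∂_i`. -/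
def sumT (F : Dat m n α κ → (Tan m → ℝ) → ℝ → ENNReal) (D : Dat m n α κ) (η : Tan m → ℝ) (ρ : ℝ) :
    ENNReal :=
  F D η ρ + F D (lamMul D η) ρ + F D (pd (tdir m) η) ρ + ∑ i : Fin m, F D (pd (xdir i) η) ρ

lemma Ker.lamMul {D : Dat m n α κ} {η : Tan m → ℝ} (h : Ker D.δ η) : Ker D.δ (lamMul D η) :=
  h.smul _

/-- The closure property that lets one step of the normal iteration be repeated: the kernels
produced by the equation must not leave the control of `G`. -/
lemma Dom.sumT {F G : Dat m n α κ → (Tan m → ℝ) → ℝ → ENNReal} (h : Dom F G)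
    (hl : Dom (fun D η => G D (lamMul D η)) G) (ht : Dom (fun D η => G D (pd (tdir m) η)) G)
    (hx : ∀ i, Dom (fun D η => G D (pd (xdir i) η)) G) : Dom (sumT F) G :=
  ((h.add ((h.comp fun _ _ hη => hη.lamMul).trans hl)).add
    ((h.comp fun _ _ hη => hη.pd _).trans ht)).add
    (Dom.sum _ fun i _ => (h.comp fun _ _ hη => hη.pd _).trans (hx i))

lemma measurable_tot (D : Dat m n α κ) {η : Tan m → ℝ} (hη : Ker D.δ η) :
    Measurable fun z : Tan m × ℝ => tot D η z.1 z.2 := by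
  have h1 := (stronglyMeasurable_cv D.sol.meas_u hη.smooth.continuous).enorm
  have h2 := (stronglyMeasurable_cv D.sol.meas_g hη.smooth.continuous).enorm
  have h3 : ∀ i : Fin m, Measurable fun z : Tan m × ℝ => ‖cv D.u (pd (xdir i) η) z.1 z.2‖ₑ :=
    fun i => (stronglyMeasurable_cv D.sol.meas_u (hη.pd _).smooth.continuous).enorm
  exact (h1.add h2).add (Finset.measurable_fun_sum _ fun i _ => h3 i)

section Pointwise
variable (D : Dat m n α κ) {η : Tan m → ℝ} {y : Tan m} {s : ℝ}

lemma enorm_flux_le (hκ : 0 < κ) (hs : 0 < s) (i : Fin (m + 1)) :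
    ‖flux D.c D.u D.g i η y s‖ₑ ≤ ENNReal.ofReal κ⁻¹ * tot D η y s := by
  have h := ENNReal.ofReal_le_ofReal (D.sol.adm.norm_flux_le (u := D.u) (g := D.g) (η := η) (y := y) hs i)
  rw [ENNReal.ofReal_mul (by positivity), ENNReal.ofReal_add (by positivity) (by positivity),
    ENNReal.ofReal_sum_of_nonneg (fun _ _ => norm_nonneg _)] at h
  simp only [ofReal_norm] at h
  refine h.trans ?_
  rw [tot]
  gcongr
  exact le_add_self

/-- Each term of the source is a first-order quantity for one of the kernels `λ η`, `∂_t η`, `∂_i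
η`. Putting `λ` into the kernel keeps the constant independent of `λ`. -/
lemma enorm_source_le (hκ : 0 < κ) (hs : 0 < s) :
    ‖source D.c D.lam D.u D.g η y s‖ₑ ≤ ENNReal.ofReal κ⁻¹ * (tot D (lamMul D η) y s +
      tot D (pd (tdir m) η) y s + ∑ i : Fin m, tot D (pd (xdir i) η) y s) := by
  have h1 : ‖act (D.c.a0 s) (cv D.u (pd (tdir m) η) y s)‖ₑ ≤
      ENNReal.ofReal κ⁻¹ * tot D (pd (tdir m) η) y s := by
    rw [← ofReal_norm]
    refine (ENNReal.ofReal_le_ofReal ((norm_act_le _ _).trans (mul_le_mul_of_nonneg_right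
      (D.sol.adm.a0_bounded s hs) (norm_nonneg _)))).trans ?_
    rw [ENNReal.ofReal_mul (by positivity), ofReal_norm, tot, add_assoc]
    gcongr
    exact le_self_add
  have h2 : ‖D.lam • act (D.c.C0 s) (cv D.u η y s)‖ₑ ≤
      ENNReal.ofReal κ⁻¹ * tot D (lamMul D η) y s := by
    rw [← act_smul, ← cv_smul, ← ofReal_norm]
    refine (ENNReal.ofReal_le_ofReal ((norm_act_le _ _).trans (mul_le_mul_of_nonneg_right
      (D.sol.adm.C0_bounded s hs) (norm_nonneg _)))).trans ?_
    rw [ENNReal.ofReal_mul (by positivity), ofReal_norm, tot, add_assoc]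
    gcongr
    exact le_self_add
  have h3 : ‖∑ i : Fin m, flux D.c D.u D.g i.castSucc (pd (xdir i) η) y s‖ₑ ≤
      ENNReal.ofReal κ⁻¹ * ∑ i : Fin m, tot D (pd (xdir i) η) y s := by
    rw [Finset.mul_sum]
    exact (enorm_sum_le _ _).trans (Finset.sum_le_sum fun i _ => enorm_flux_le D hκ hs _)
  rw [source, mul_add, mul_add]
  refine (enorm_sub_le).trans (add_le_add ((enorm_add_le _ _).trans ?_) h3)
  rw [add_comm]
  exact add_le_add h2 h1

lemma enorm_normal_le (hκ : 0 < κ) (hs : 0 < s) :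
    ‖cv D.g η y s‖ₑ ≤ ENNReal.ofReal κ⁻¹ * (‖flux D.c D.u D.g (Fin.last m) η y s‖ₑ +
      ENNReal.ofReal κ⁻¹ * ∑ j : Fin m, ‖cv D.u (pd (xdir j) η) y s‖ₑ) := by
  have h := ENNReal.ofReal_le_ofReal
    (D.sol.adm.norm_normal_le (u := D.u) (g := D.g) (η := η) (y := y) hκ hs)
  rw [ENNReal.ofReal_mul (by positivity), ENNReal.ofReal_add (by positivity) (by positivity),
    ENNReal.ofReal_mul (by positivity), ENNReal.ofReal_sum_of_nonneg (fun _ _ => norm_nonneg _)] at h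
  simpa only [ofReal_norm] using h

end Pointwise

/-- Integral bounds of the solution and its tangential derivatives, and a bound of the flux, give
pointwise bounds. -/
lemma ae_tot_le (hκ : 0 < κ) {γ : ℝ} (hγ : 0 ≤ γ) :
    ∃ C : ℝ, 0 ≤ C ∧ ∀ (D : Dat m n α κ) (η : Tan m → ℝ) (ρ : ℝ) (y : Tan m) (M : ENNReal),
      Ker D.δ η → 1 / 2 ≤ ρ → ρ ≤ 1 - D.δ → y ∈ tanBox m ρ →
      (∫⁻ s in Ioo 0 ρ, ENNReal.ofReal (s ^ γ) * tot D η y s ≤ M) →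
      (∀ i, ∫⁻ s in Ioo 0 ρ, ENNReal.ofReal (s ^ γ) * tot D (pd (xdir i) η) y s ≤ M) →
      (∀ᵐ s ∂(volume.restrict (Ioo 0 ρ)),
        ENNReal.ofReal (s ^ γ) * ‖flux D.c D.u D.g (Fin.last m) η y s‖ₑ ≤ M) →
      ∀ᵐ s ∂(volume.restrict (Ioo 0 ρ)),
        ENNReal.ofReal (s ^ γ) * tot D η y s ≤ ENNReal.ofReal C * M := by
  obtain ⟨b, hb⟩ : ∃ b : ℝ, b = 8 * 4 ^ γ := ⟨_, rfl⟩
  have hb0 : 0 ≤ b := by rw [hb]; positivity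
  -- The three summands belong to `w`, to `D_d w` (through `enorm_normal_le`) and to the `m`
  -- tangential derivatives.
  refine ⟨b + κ⁻¹ * (1 + κ⁻¹ * (m * b)) + m * b, by positivity, ?_⟩
  intro D η ρ y M hη hρ hρ1 hy hM0 hMi hU
  have hρ1' : ρ ≤ 1 := by linarith [D.δ_pos]
  have hy1 : y ∈ tanBox m (1 - D.δ) := tanBox_mono hρ1 hy
  have key : ∀ η' : Tan m → ℝ, Ker D.δ η' →
      (∫⁻ s in Ioo 0 ρ, ENNReal.ofReal (s ^ γ) * tot D η' y s ≤ M) →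
      ∀ᵐ s ∂(volume.restrict (Ioo 0 ρ)),
        ENNReal.ofReal (s ^ γ) * ‖cv D.u η' y s‖ₑ ≤ ENNReal.ofReal b * M := by
    intro η' hη' hM
    obtain ⟨C, hC⟩ := D.sol.primitive_cv hη' hy1
    rw [hb]
    refine ae_rpow_mul_enorm_le_of_primitive hγ hρ1' hρ
      (locallyIntegrableOn_of_integrable_wt (integrable_cv D.sol.meas_g D.sol.int_g hη' y)) hC
      (le_trans (lintegral_mono fun s => ?_) hM) (le_trans (lintegral_mono fun s => ?_) hM)
    · dsimp only; gcongr; rw [tot, add_assoc]; exact le_self_add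
    · dsimp only; gcongr; rw [tot, add_assoc]; exact le_add_of_le_right le_self_add
  have k0 := key η hη hM0
  have ki : ∀ᵐ s ∂(volume.restrict (Ioo 0 ρ)), ∀ i : Fin m,
      ENNReal.ofReal (s ^ γ) * ‖cv D.u (pd (xdir i) η) y s‖ₑ ≤ ENNReal.ofReal b * M :=
    ae_all_iff.2 fun i => key _ (hη.pd _) (hMi i)
  filter_upwards [k0, ki, hU, ae_restrict_mem measurableSet_Ioo] with s h0 hi hu hs
  have hsum : ENNReal.ofReal (s ^ γ) * ∑ i : Fin m, ‖cv D.u (pd (xdir i) η) y s‖ₑ ≤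
      ENNReal.ofReal (m * b) * M := by
    rw [Finset.mul_sum]
    refine (Finset.sum_le_sum fun i _ => hi i).trans ?_
    rw [Finset.sum_const, Finset.card_univ, Fintype.card_fin, nsmul_eq_mul,
      ENNReal.ofReal_mul (p := (m : ℝ)) (by positivity), ENNReal.ofReal_natCast, mul_assoc]
  have hg : ENNReal.ofReal (s ^ γ) * ‖cv D.g η y s‖ₑ ≤
      ENNReal.ofReal (κ⁻¹ * (1 + κ⁻¹ * (m * b))) * M := by
    calc _ ≤ ENNReal.ofReal (s ^ γ) * (ENNReal.ofReal κ⁻¹ *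
            (‖flux D.c D.u D.g (Fin.last m) η y s‖ₑ +
              ENNReal.ofReal κ⁻¹ * ∑ j : Fin m, ‖cv D.u (pd (xdir j) η) y s‖ₑ)) := by
          gcongr; exact enorm_normal_le D hκ hs.1
      _ = ENNReal.ofReal κ⁻¹ * (ENNReal.ofReal (s ^ γ) * ‖flux D.c D.u D.g (Fin.last m) η y s‖ₑ +
            ENNReal.ofReal κ⁻¹ * (ENNReal.ofReal (s ^ γ) *
              ∑ j : Fin m, ‖cv D.u (pd (xdir j) η) y s‖ₑ)) := by ring
      _ ≤ ENNReal.ofReal κ⁻¹ * (M + ENNReal.ofReal κ⁻¹ * (ENNReal.ofReal (m * b) * M)) := by gcongr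
      _ = _ := by
          rw [ENNReal.ofReal_mul (p := κ⁻¹) (q := 1 + κ⁻¹ * (m * b)) (by positivity),
            ENNReal.ofReal_add (by positivity) (by positivity),
            ENNReal.ofReal_mul (p := κ⁻¹) (q := m * b) (by positivity), ENNReal.ofReal_one]
          ring
  rw [tot, mul_add, mul_add, ENNReal.ofReal_add (by positivity) (by positivity),
    ENNReal.ofReal_add (by positivity) (by positivity), add_mul, add_mul]
  exact add_le_add (add_le_add h0 hg) hsum

/-- Weighted supremum of the mollified solution and its gradient. -/
def supT (γ : ℝ) (D : Dat m n α κ) (η : Tan m → ℝ) (ρ : ℝ) : ENNReal :=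
  ⨆ y ∈ tanBox m ρ, essSup (fun s => ENNReal.ofReal (s ^ γ) * tot D η y s)
    (volume.restrict (Ioo 0 ρ))

/-- Supremum in the tangential variables of the integral in the normal one. -/
def supInt (D : Dat m n α κ) (η : Tan m → ℝ) (ρ : ℝ) : ENNReal :=
  ⨆ y ∈ tanBox m ρ, ∫⁻ s, tot D η y s ∂(wt α ρ)

lemma supT_le_iff {γ : ℝ} {D : Dat m n α κ} {η : Tan m → ℝ} {ρ : ℝ} {M : ENNReal} :
    supT γ D η ρ ≤ M ↔ ∀ y ∈ tanBox m ρ, ∀ᵐ s ∂(volume.restrict (Ioo 0 ρ)),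
      ENNReal.ofReal (s ^ γ) * tot D η y s ≤ M := by
  simp only [supT, iSup_le_iff]
  refine forall₂_congr fun y _ => ⟨fun h => ?_, fun h => essSup_le_of_ae_le _ h⟩
  filter_upwards [ENNReal.ae_le_essSup (μ := volume.restrict (Ioo 0 ρ))
    (fun s => ENNReal.ofReal (s ^ γ) * tot D η y s)] with s hs
  exact hs.trans h

lemma supInt_le_iff {D : Dat m n α κ} {η : Tan m → ℝ} {ρ : ℝ} {M : ENNReal} :
    supInt D η ρ ≤ M ↔ ∀ y ∈ tanBox m ρ, ∫⁻ s, tot D η y s ∂(wt α ρ) ≤ M := by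
  simp only [supInt, iSup_le_iff]

lemma supT_mono (γ : ℝ) : MonoR (supT (m := m) (n := n) (α := α) (κ := κ) γ) := by
  intro D η ρ R h
  rw [supT_le_iff]
  intro y hy
  exact ae_restrict_of_ae_restrict_of_subset (Ioo_subset_Ioo_right h)
    (supT_le_iff.1 le_rfl y (tanBox_mono h hy))

lemma le_sumT_self {F : Dat m n α κ → (Tan m → ℝ) → ℝ → ENNReal} {D : Dat m n α κ}
    {η : Tan m → ℝ} {ρ : ℝ} : F D η ρ ≤ sumT F D η ρ := by
  rw [sumT, add_assoc, add_assoc]; exact le_self_add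

lemma le_sumT_pd {F : Dat m n α κ → (Tan m → ℝ) → ℝ → ENNReal} {D : Dat m n α κ}
    {η : Tan m → ℝ} {ρ : ℝ} (i : Fin m) : F D (pd (xdir i) η) ρ ≤ sumT F D η ρ := by
  rw [sumT]
  exact (Finset.single_le_sum (f := fun i => F D (pd (xdir i) η) ρ) (fun _ _ => zero_le)
    (Finset.mem_univ i)).trans le_add_self

lemma sum_le_sumT {F : Dat m n α κ → (Tan m → ℝ) → ℝ → ENNReal} {D : Dat m n α κ}
    {η : Tan m → ℝ} {ρ : ℝ} : F D (lamMul D η) ρ + F D (pd (tdir m) η) ρ +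
      ∑ i : Fin m, F D (pd (xdir i) η) ρ ≤ sumT F D η ρ := by
  rw [sumT]
  gcongr
  exact le_add_self

/-- The flux is small near the boundary. -/
lemma ae_flux_le (hκ : 0 < κ) {γ : ℝ} (hγα : γ < α + 1) (D : Dat m n α κ) {η : Tan m → ℝ} {ρ : ℝ}
    (hη : Ker D.δ η) (hρ1 : ρ ≤ 1 - D.δ) {y : Tan m} (hy : y ∈ tanBox m ρ) :
    ∀ᵐ s ∂(volume.restrict (Ioo 0 ρ)),
      ENNReal.ofReal (s ^ (γ - 1)) * ‖flux D.c D.u D.g (Fin.last m) η y s‖ₑ ≤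
        ENNReal.ofReal (1 / (α + 1 - γ)) * (ENNReal.ofReal κ⁻¹ * (supT γ D (lamMul D η) ρ +
          supT γ D (pd (tdir m) η) ρ + ∑ i : Fin m, supT γ D (pd (xdir i) η) ρ)) := by
  apply ae_rpow_mul_enorm_flux_le hγα (by linarith [D.δ_pos])
    (D.sol.flux_cv hη (tanBox_mono hρ1 hy))
  have hi : ∀ᵐ s ∂(volume.restrict (Ioo 0 ρ)), ∀ i : Fin m,
      ENNReal.ofReal (s ^ γ) * tot D (pd (xdir i) η) y s ≤ supT γ D (pd (xdir i) η) ρ :=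
    ae_all_iff.2 fun i => supT_le_iff.1 le_rfl y hy
  filter_upwards [hi, supT_le_iff.1 (le_refl (supT γ D (lamMul D η) ρ)) y hy,
    supT_le_iff.1 (le_refl (supT γ D (pd (tdir m) η) ρ)) y hy,
    ae_restrict_mem measurableSet_Ioo] with s h1 h2 h3 hs
  calc _ ≤ ENNReal.ofReal (s ^ γ) * (ENNReal.ofReal κ⁻¹ * (tot D (lamMul D η) y s +
      tot D (pd (tdir m) η) y s + ∑ i : Fin m, tot D (pd (xdir i) η) y s)) := by
        gcongr; exact enorm_source_le D hκ hs.1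
    _ = ENNReal.ofReal κ⁻¹ * (ENNReal.ofReal (s ^ γ) * tot D (lamMul D η) y s +
      ENNReal.ofReal (s ^ γ) * tot D (pd (tdir m) η) y s +
      ∑ i : Fin m, ENNReal.ofReal (s ^ γ) * tot D (pd (xdir i) η) y s) := by
        rw [← Finset.mul_sum]; ring
    _ ≤ _ := by gcongr; exact h1 _

/-- One step of the regularity iteration. -/
lemma supT_step (hκ : 0 < κ) {γ γ' : ℝ} (hγα : γ < α + 1) (hγ' : 0 ≤ γ') (h : γ - 1 < γ') :
    ∃ C : ℝ, ∀ (D : Dat m n α κ) η ρ, Ker D.δ η → 1 / 2 ≤ ρ → ρ ≤ 1 - D.δ →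
      supT γ' D η ρ ≤ ENNReal.ofReal C * sumT (supT γ) D η ρ := by
  obtain ⟨C, hC, hmain⟩ := ae_tot_le (m := m) (n := n) (α := α) hκ hγ'
  have hp : 0 < γ' - γ + 1 := by linarith
  have hp' : 0 < α + 1 - γ := by linarith
  -- The first summand bounds `∫ s ^ (γ' - γ)`, which is finite because the exponent drops by less
  -- than one. The second is the constant of the flux estimate.
  refine ⟨C * (1 / (γ' - γ + 1) + 1 / (α + 1 - γ) * κ⁻¹), fun D η ρ hη hρ hρ1 => ?_⟩
  rw [supT_le_iff]
  intro y hy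
  rw [ENNReal.ofReal_mul hC, mul_assoc]
  have hρ1' : ρ ≤ 1 := by linarith [D.δ_pos]
  have e1 : ∀ η' : Tan m → ℝ, supT γ D η' ρ ≤ sumT (supT γ) D η ρ →
      ∫⁻ s in Ioo 0 ρ, ENNReal.ofReal (s ^ γ') * tot D η' y s ≤
        ENNReal.ofReal (1 / (γ' - γ + 1) + 1 / (α + 1 - γ) * κ⁻¹) * sumT (supT γ) D η ρ := by
    intro η' hle
    have h1 := supT_le_iff.1 hle y hy
    have h2 : ∫⁻ s in Ioo 0 ρ, ENNReal.ofReal (s ^ γ') * tot D η' y s ≤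
        ∫⁻ s in Ioo 0 ρ, ENNReal.ofReal (s ^ (γ' - γ)) * sumT (supT γ) D η ρ := by
      apply lintegral_mono_ae
      filter_upwards [h1, ae_restrict_mem measurableSet_Ioo] with s hs hsm
      calc _ = ENNReal.ofReal (s ^ (γ' - γ)) * (ENNReal.ofReal (s ^ γ) * tot D η' y s) := by
            rw [← mul_assoc, ← ENNReal.ofReal_mul (Real.rpow_nonneg hsm.1.le _),
              ← Real.rpow_add hsm.1]; simp
        _ ≤ _ := by gcongr
    refine h2.trans ?_
    rw [lintegral_mul_const _ (by fun_prop), lintegral_Ioo_rpow (by linarith) (by linarith)]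
    gcongr
    refine le_add_of_le_of_nonneg ?_ (by positivity)
    gcongr
    exact Real.rpow_le_one (by linarith) hρ1' (by linarith)
  refine hmain D η ρ y _ hη hρ hρ1 hy (e1 η le_sumT_self) (fun i => e1 _ (le_sumT_pd i)) ?_
  filter_upwards [ae_flux_le hκ hγα D hη hρ1 hy, ae_restrict_mem measurableSet_Ioo] with s hs hsm
  calc _ ≤ ENNReal.ofReal (s ^ (γ - 1)) * ‖flux D.c D.u D.g (Fin.last m) η y s‖ₑ := by
        refine mul_le_mul_left (ENNReal.ofReal_le_ofReal ?_) _
        exact Real.rpow_le_rpow_of_exponent_ge hsm.1 (hsm.2.le.trans hρ1') h.le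
    _ ≤ ENNReal.ofReal (1 / (α + 1 - γ)) * (ENNReal.ofReal κ⁻¹ * sumT (supT γ) D η ρ) := by
        refine hs.trans ?_
        gcongr
        exact sum_le_sumT
    _ ≤ _ := by
        rw [← mul_assoc, ← ENNReal.ofReal_mul (by positivity)]
        gcongr
        exact le_add_of_nonneg_left (by positivity)

lemma measurable_tot_right (D : Dat m n α κ) {η : Tan m → ℝ} (hη : Ker D.δ η) (y : Tan m) :
    Measurable fun s => tot D η y s :=
  Measurable.of_uncurry_left (f := tot D η) (measurable_tot D hη)

/-- The initial flux estimate needs only the integral of the source over a normal line, so it starts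
from integrability instead of a pointwise bound. -/
lemma lintegral_source_le (hκ : 0 < κ) (D : Dat m n α κ) {η : Tan m → ℝ} (hη : Ker D.δ η) {ρ : ℝ}
    {y : Tan m} (hy : y ∈ tanBox m ρ) :
    ∫⁻ s, ‖source D.c D.lam D.u D.g η y s‖ₑ ∂(wt α ρ) ≤
      ENNReal.ofReal κ⁻¹ * sumT supInt D η ρ := by
  have h0 : ∀ᵐ s ∂(wt α ρ), 0 < s := by
    rw [ae_wt_iff]
    filter_upwards [ae_restrict_mem measurableSet_Ioo] with s hs using hs.1
  have h1 := measurable_tot_right D hη.lamMul y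
  have h2 := measurable_tot_right D (hη.pd (tdir m)) y
  have h3 := fun i : Fin m => measurable_tot_right D (hη.pd (xdir i)) y
  calc ∫⁻ s, ‖source D.c D.lam D.u D.g η y s‖ₑ ∂(wt α ρ)
      ≤ ∫⁻ s, ENNReal.ofReal κ⁻¹ * (tot D (lamMul D η) y s +
      tot D (pd (tdir m) η) y s + ∑ i : Fin m, tot D (pd (xdir i) η) y s) ∂(wt α ρ) := by
        apply lintegral_mono_ae
        filter_upwards [h0] with s hs using enorm_source_le D hκ hs
    _ = ENNReal.ofReal κ⁻¹ * (∫⁻ s, tot D (lamMul D η) y s ∂(wt α ρ) +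
        ∫⁻ s, tot D (pd (tdir m) η) y s ∂(wt α ρ) +
        ∑ i : Fin m, ∫⁻ s, tot D (pd (xdir i) η) y s ∂(wt α ρ)) := by
        rw [lintegral_const_mul' _ _ ENNReal.ofReal_ne_top, lintegral_add_left (f := fun s => _ + _) (h1.add h2),
          lintegral_add_left h1, lintegral_finsetSum _ fun i _ => h3 i]
    _ ≤ ENNReal.ofReal κ⁻¹ * sumT supInt D η ρ := by
        refine mul_le_mul_right (le_trans ?_ sum_le_sumT) _
        exact add_le_add (add_le_add (supInt_le_iff.1 le_rfl y hy) (supInt_le_iff.1 le_rfl y hy))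
          (Finset.sum_le_sum fun i _ => supInt_le_iff.1 le_rfl y hy)

/-- The start of the regularity iteration. -/
lemma supT_init (hκ : 0 < κ) {γ : ℝ} (hγ : 0 ≤ γ) (hαγ : α ≤ γ) :
    ∃ C : ℝ, ∀ (D : Dat m n α κ) η ρ, Ker D.δ η → 1 / 2 ≤ ρ → ρ ≤ 1 - D.δ →
      supT γ D η ρ ≤ ENNReal.ofReal C * sumT supInt D η ρ := by
  obtain ⟨C, hC, hmain⟩ := ae_tot_le (m := m) (n := n) (α := α) hκ hγ
  refine ⟨C * (1 + κ⁻¹), fun D η ρ hη hρ hρ1 => ?_⟩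
  rw [supT_le_iff]
  intro y hy
  rw [ENNReal.ofReal_mul hC, mul_assoc]
  have hρ1' : ρ ≤ 1 := by linarith [D.δ_pos]
  have hκ1 : sumT supInt D η ρ ≤ ENNReal.ofReal (1 + κ⁻¹) * sumT supInt D η ρ := by
    rw [ENNReal.ofReal_add (by positivity) (by positivity), ENNReal.ofReal_one, add_mul, one_mul]
    exact le_self_add
  have e1 : ∀ η' : Tan m → ℝ, supInt D η' ρ ≤ sumT supInt D η ρ →
      ∫⁻ s in Ioo 0 ρ, ENNReal.ofReal (s ^ γ) * tot D η' y s ≤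
        ENNReal.ofReal (1 + κ⁻¹) * sumT supInt D η ρ := by
    intro η' hle
    refine le_trans ?_ ((supInt_le_iff.1 hle y hy).trans hκ1)
    rw [lintegral_wt]
    refine setLIntegral_mono_ae' measurableSet_Ioo (ae_of_all _ fun s hs => ?_)
    refine mul_le_mul_left (ENNReal.ofReal_le_ofReal ?_) _
    exact Real.rpow_le_rpow_of_exponent_ge hs.1 (hs.2.le.trans hρ1') hαγ
  refine hmain D η ρ y _ hη hρ hρ1 hy (e1 η le_sumT_self) (fun i => e1 _ (le_sumT_pd i)) ?_
  filter_upwards [ae_rpow_mul_enorm_flux_le_lintegral hαγ hρ1'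
    (D.sol.flux_cv hη (tanBox_mono hρ1 hy))] with s hs
  refine hs.trans ?_
  rw [← lintegral_wt]
  refine (lintegral_source_le hκ D hη hy).trans ?_
  exact mul_le_mul_left (ENNReal.ofReal_le_ofReal (by linarith)) _

/-- The regularity iteration as an induction principle. -/
lemma supT_zero_induction (hα : -1 < α) (hκ : 0 < κ)
    {Q : (Dat m n α κ → (Tan m → ℝ) → ℝ → ENNReal) → Prop} (h0 : Q supInt)
    (hstep : ∀ (F F' : Dat m n α κ → (Tan m → ℝ) → ℝ → ENNReal) (C : ℝ),
      (∀ D η ρ, Ker D.δ η → 1 / 2 ≤ ρ → ρ ≤ 1 - D.δ →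
        F D η ρ ≤ ENNReal.ofReal C * sumT F' D η ρ) → Q F' → Q F) : Q (supT 0) := by
  -- The weight exponent starts at `max α 0`, which lies in `[0, α + 1)`, and decreases by `1 / 2`
  -- per step until it reaches `0`. Keeping `Q` abstract lets the same iteration prove finiteness
  -- and quantitative domination.
  obtain ⟨a, ha⟩ : ∃ a : ℝ, a = max α 0 := ⟨_, rfl⟩
  have ha0 : 0 ≤ a := ha ▸ le_max_right _ _
  have haα : α ≤ a := ha ▸ le_max_left _ _
  have ha1 : a < α + 1 := by rw [ha]; exact max_lt (by linarith) (by linarith)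
  have key : ∀ k : ℕ, Q (supT (max (a - k / 2) 0)) := by
    intro k
    induction k with
    | zero =>
      obtain ⟨C, hC⟩ := supT_init (m := m) (n := n) (κ := κ) hκ ha0 haα
      have e : max (a - (0 : ℕ) / 2) 0 = a := by simp [ha0]
      rw [e]
      exact hstep _ _ C hC h0
    | succ k ih =>
      have h1 : max (a - k / 2) 0 < α + 1 :=
        max_lt (lt_of_le_of_lt (sub_le_self _ (by positivity)) ha1) (by linarith)
      have h2 : max (a - k / 2) 0 - 1 < max (a - (k + 1 : ℕ) / 2) 0 := by
        rcases le_total (a - k / 2) 0 with h | h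
        · rw [max_eq_right h]
          exact lt_of_lt_of_le (by norm_num) (le_max_right _ _)
        · rw [max_eq_left h]
          refine lt_of_lt_of_le ?_ (le_max_left _ _)
          push_cast
          linarith
      obtain ⟨C, hC⟩ := supT_step (m := m) (n := n) hκ h1 (le_max_right _ 0) h2
      exact hstep _ _ C hC ih
  obtain ⟨k, hk⟩ := exists_nat_ge (2 * a)
  have e : max (a - k / 2) 0 = 0 := max_eq_right (by linarith)
  have := key k
  rwa [e] at this

/-- The bound uses the supremum of the kernel and is purely qualitative; it only makes the
absorption arguments and energy integrals legitimate. -/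
lemma supInt_lt_top (D : Dat m n α κ) {η : Tan m → ℝ} {ρ : ℝ} (hη : Ker D.δ η) (hρ : ρ ≤ 1) :
    supInt D η ρ < ⊤ := by
  have hb : ∀ (f : Tan m × ℝ → Val n), StronglyMeasurable f →
      Integrable f (volume.prod (wt α 1)) → ∀ η' : Tan m → ℝ, Ker D.δ η' →
      ∃ B : ENNReal, B < ⊤ ∧ ∀ y, ∫⁻ s, ‖cv f η' y s‖ₑ ∂(wt α ρ) ≤ B := by
    intro f hf hi η' hη'
    obtain ⟨C, hC⟩ := hη'.exists_bound
    exact ⟨_, ENNReal.mul_lt_top ENNReal.ofReal_lt_top hi.2, fun y =>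
      (lintegral_mono' (wt_mono α hρ) le_rfl).trans (lintegral_cv_wt_le hf hC y)⟩
  obtain ⟨B1, hB1, h1⟩ := hb D.u D.sol.meas_u D.sol.int_u η hη
  obtain ⟨B2, hB2, h2⟩ := hb D.g D.sol.meas_g D.sol.int_g η hη
  choose B3 hB3 h3 using fun i : Fin m => hb D.u D.sol.meas_u D.sol.int_u _ (hη.pd (xdir i))
  have hm : ∀ {f : Tan m × ℝ → Val n}, StronglyMeasurable f → ∀ {η' : Tan m → ℝ}, Ker D.δ η' →
      ∀ y, Measurable fun s => ‖cv f η' y s‖ₑ := fun hf _ hη' y =>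
    Measurable.of_uncurry_left (f := fun y s => ‖cv _ _ y s‖ₑ)
      (stronglyMeasurable_cv hf hη'.smooth.continuous).enorm
  refine lt_of_le_of_lt (b := B1 + B2 + ∑ i, B3 i) ?_ (ENNReal.add_lt_top.2
    ⟨ENNReal.add_lt_top.2 ⟨hB1, hB2⟩, ENNReal.sum_lt_top.2 fun i _ => hB3 i⟩)
  rw [supInt_le_iff]
  intro y _
  simp only [tot]
  have m1 := hm D.sol.meas_u hη y
  have m2 := hm D.sol.meas_g hη y
  rw [lintegral_add_left (f := fun s => _ + _) (m1.add m2), lintegral_add_left m1,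
    lintegral_finsetSum _ fun i _ => hm D.sol.meas_u (hη.pd (xdir i)) y]
  exact add_le_add (add_le_add (h1 y) (h2 y)) (Finset.sum_le_sum fun i _ => h3 i y)

/-- Mollified solutions and their gradients are bounded. -/
lemma supT_zero_lt_top (hα : -1 < α) (hκ : 0 < κ) (D : Dat m n α κ) {η : Tan m → ℝ} {ρ : ℝ}
    (hη : Ker D.δ η) (hρ : 1 / 2 ≤ ρ) (hρ1 : ρ ≤ 1 - D.δ) : supT 0 D η ρ < ⊤ := by
  refine supT_zero_induction (Q := fun F => ∀ (D : Dat m n α κ) (η : Tan m → ℝ) (ρ : ℝ), Ker D.δ η →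
    1 / 2 ≤ ρ → ρ ≤ 1 - D.δ → F D η ρ < ⊤) hα hκ ?_ ?_ D η ρ hη hρ hρ1
  · intro D η ρ hη _ hρ1
    exact supInt_lt_top D hη (by linarith [D.δ_pos])
  · intro F F' C h hF' D η ρ hη hρ hρ1
    refine (h D η ρ hη hρ hρ1).trans_lt (ENNReal.mul_lt_top ENNReal.ofReal_lt_top ?_)
    simp only [sumT, ENNReal.add_lt_top, ENNReal.sum_lt_top]
    exact ⟨⟨⟨hF' _ _ _ hη hρ hρ1, hF' _ _ _ hη.lamMul hρ hρ1⟩, hF' _ _ _ (hη.pd _) hρ hρ1⟩,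
      fun i _ => hF' _ _ _ (hη.pd _) hρ hρ1⟩

/-- The quantitative run of the iteration: its constants stay uniform as long as `G` controls its
own images under `λ`, `∂_t` and `∂_i`. -/
lemma Dom.supT_zero (hα : -1 < α) (hκ : 0 < κ) {G : Dat m n α κ → (Tan m → ℝ) → ℝ → ENNReal}
    (h : Dom supInt G)
    (hl : Dom (fun D η => G D (WeightedParabolic.lamMul D η)) G)
    (ht : Dom (fun D η => G D (pd (tdir m) η)) G)
    (hx : ∀ i, Dom (fun D η => G D (pd (xdir i) η)) G) : Dom (supT 0) G :=
  supT_zero_induction (Q := fun F => Dom F G) hα hκ h fun _ _ _ hF hF' =>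
    (hF'.sumT hl ht hx).mono_left hF

end

section

/-! ### Essentially bounded functions -/

/-- Measurable and essentially bounded functions. -/
structure Bd {X E : Type*} [MeasurableSpace X] [NormedAddCommGroup E] (ν : Measure X) (f : X → E) :
    Prop where
  aesm : AEStronglyMeasurable f ν
  bound : ∃ C, ∀ᵐ z ∂ν, ‖f z‖ ≤ C

section Bd
variable {X E : Type*} [MeasurableSpace X] [NormedAddCommGroup E] {ν : Measure X} {f g : X → E}

lemma Bd.integrable [IsFiniteMeasure ν] (h : Bd ν f) : Integrable f ν := by
  obtain ⟨C, hC⟩ := h.bound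
  exact Integrable.of_bound h.aesm C hC

lemma Bd.add (hf : Bd ν f) (hg : Bd ν g) : Bd ν fun z => f z + g z := by
  obtain ⟨C, hC⟩ := hf.bound
  obtain ⟨C', hC'⟩ := hg.bound
  refine ⟨hf.aesm.add hg.aesm, C + C', ?_⟩
  filter_upwards [hC, hC'] with z h h'
  exact (norm_add_le _ _).trans (add_le_add h h')

lemma Bd.neg (hf : Bd ν f) : Bd ν fun z => -f z := by
  obtain ⟨C, hC⟩ := hf.bound
  exact ⟨hf.aesm.neg, C, by simpa using hC⟩

lemma Bd.sub (hf : Bd ν f) (hg : Bd ν g) : Bd ν fun z => f z - g z := by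
  simpa only [sub_eq_add_neg] using hf.add hg.neg

lemma Bd.zero : Bd ν fun _ => (0 : E) := ⟨aestronglyMeasurable_const, 0, by simp⟩

lemma Bd.sum {ι : Type*} (s : Finset ι) {f : ι → X → E} (h : ∀ i ∈ s, Bd ν (f i)) :
    Bd ν fun z => ∑ i ∈ s, f i z := by
  classical
  induction s using Finset.induction_on with
  | empty => simpa using Bd.zero
  | insert a s ha ih =>
    simp only [Finset.sum_insert ha]
    exact (h a (by simp)).add (ih fun i hi => h i (by simp [hi]))

lemma Bd.smul [NormedSpace ℝ E] {a : X → ℝ} (ha : Bd ν a) (hf : Bd ν f) :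
    Bd ν fun z => a z • f z := by
  obtain ⟨C, hC⟩ := ha.bound
  obtain ⟨C', hC'⟩ := hf.bound
  refine ⟨ha.aesm.smul hf.aesm, C * C', ?_⟩
  filter_upwards [hC, hC'] with z h h'
  rw [norm_smul]
  exact mul_le_mul h h' (norm_nonneg _) ((norm_nonneg _).trans h)

lemma Bd.mul {a b : X → ℝ} (ha : Bd ν a) (hb : Bd ν b) : Bd ν fun z => a z * b z :=
  ha.smul hb

lemma Bd.const (a : E) : Bd ν fun _ => a := ⟨aestronglyMeasurable_const, ‖a‖, by simp⟩

lemma Bd.norm (hf : Bd ν f) : Bd ν fun z => ‖f z‖ := by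
  obtain ⟨C, hC⟩ := hf.bound
  exact ⟨hf.aesm.norm, C, by simpa using hC⟩

lemma Bd.pow {a : X → ℝ} (ha : Bd ν a) (k : ℕ) : Bd ν fun z => a z ^ k := by
  induction k with
  | zero => simpa using Bd.const (1 : ℝ)
  | succ k ih => simpa only [pow_succ] using ih.mul ha

lemma Bd.inner [InnerProductSpace ℝ E] (hf : Bd ν f) (hg : Bd ν g) :
    Bd ν fun z => inner ℝ (f z) (g z) := by
  obtain ⟨C, hC⟩ := hf.bound
  obtain ⟨C', hC'⟩ := hg.bound
  refine ⟨hf.aesm.inner hg.aesm, C * C', ?_⟩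
  filter_upwards [hC, hC'] with z h h'
  exact (norm_inner_le_norm _ _).trans (mul_le_mul h h' (norm_nonneg _) ((norm_nonneg _).trans h))

lemma Bd.act {n : ℕ} {M : X → Matrix (Fin n) (Fin n) ℝ} {f : X → Val n} {C : ℝ}
    (hM : ∀ k l, AEMeasurable (fun z => M z k l) ν) (hC : ∀ᵐ z ∂ν, entryNorm (M z) ≤ C)
    (hf : Bd ν f) : Bd ν fun z => act (M z) (f z) := by
  obtain ⟨C', hC'⟩ := hf.bound
  refine ⟨aestronglyMeasurable_act hM hf.aesm, C * C', ?_⟩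
  filter_upwards [hC, hC'] with z h h'
  refine (norm_act_le _ _).trans (mul_le_mul h h' (norm_nonneg _) ?_)
  exact (Real.sqrt_nonneg _).trans h

lemma Bd.of_continuousOn {X : Type*} [TopologicalSpace X] [MeasurableSpace X] [OpensMeasurableSpace X]
    {ν : Measure X} {a : X → ℝ} (ha : Continuous a) {C : ℝ} (hC : ∀ᵐ z ∂ν, |a z| ≤ C) : Bd ν a :=
  ⟨ha.aestronglyMeasurable, C, hC⟩

end Bd

variable {m n : ℕ} {α κ : ℝ}

/-! ### The energy identity -/

lemma aemeasurable_coeff_wt {M : ℝ → Matrix (Fin n) (Fin n) ℝ} (hM : MeasurableCoeff M) (α R : ℝ)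
    (k l : Fin n) : AEMeasurable (fun s => M s k l) (wt α R) := by
  refine (hM k l).mono_ac ?_
  refine (withDensity_absolutelyContinuous _ _).trans ?_
  exact Measure.absolutelyContinuous_of_le (Measure.restrict_mono_set _ Ioo_subset_Ioi_self)

lemma ae_nuQ_mem (α R : ℝ) : ∀ᵐ z ∂(nuQ m α R), z.1 ∈ tanBox m R ∧ z.2 ∈ Ioo 0 R := by
  have h1 : ∀ᵐ y ∂((volume : Measure (Tan m)).restrict (tanBox m R)), y ∈ tanBox m R :=
    ae_restrict_mem (measurableSet_tanBox R)
  have h2 : ∀ᵐ s ∂(wt α R), s ∈ Ioo 0 R := by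
    rw [ae_wt_iff]; exact ae_restrict_mem measurableSet_Ioo
  exact (Measure.quasiMeasurePreserving_fst.ae h1).and (Measure.quasiMeasurePreserving_snd.ae h2)

lemma Bd.act_coeff {M : ℝ → Matrix (Fin n) (Fin n) ℝ} (hM : MeasurableCoeff M)
    (hb : ∀ s > 0, entryNorm (M s) ≤ κ⁻¹) {R : ℝ} {f : Tan m × ℝ → Val n} (hf : Bd (nuQ m α R) f) :
    Bd (nuQ m α R) fun z => WeightedParabolic.act (M z.2) (f z) := by
  refine Bd.act (C := κ⁻¹) (fun k l => ?_) ?_ hf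
  · exact (aemeasurable_coeff_wt hM α R k l).comp_quasiMeasurePreserving
      Measure.quasiMeasurePreserving_snd
  · filter_upwards [ae_nuQ_mem α R] with z hz using hb _ hz.2.1

lemma ae_tot_le_supT (D : Dat m n α κ) {η : Tan m → ℝ} (hη : Ker D.δ η) (R : ℝ) :
    ∀ᵐ z ∂(nuQ m α R), tot D η z.1 z.2 ≤ supT 0 D η R := by
  have hms : MeasurableSet {z : Tan m × ℝ | tot D η z.1 z.2 ≤ supT 0 D η R} :=
    measurableSet_le (measurable_tot D hη) measurable_const
  rw [nuQ, Measure.ae_prod_iff_ae_ae hms]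
  filter_upwards [ae_restrict_mem (measurableSet_tanBox R)] with y hy
  rw [ae_wt_iff]
  filter_upwards [supT_le_iff.1 (le_refl (supT 0 D η R)) y hy] with s hs
  simpa using hs

section Energy
variable (D : Dat m n α κ) {η η' : Tan m → ℝ} {R : ℝ}

/-- Boundedness of mollified solutions on a finite measure space makes every integral in the energy
identity absolutely convergent, although nothing beyond integrability of `u` and its gradient is
known. -/
lemma bd_cv_u (hα : -1 < α) (hκ : 0 < κ) (hη : Ker D.δ η) (hR : 1 / 2 ≤ R) (hR1 : R ≤ 1 - D.δ) :
    Bd (nuQ m α R) fun z => cv D.u η z.1 z.2 := by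
  have hfin := supT_zero_lt_top hα hκ D hη hR hR1
  refine ⟨(stronglyMeasurable_cv D.sol.meas_u hη.smooth.continuous).aestronglyMeasurable,
    (supT 0 D η R).toReal, ?_⟩
  filter_upwards [ae_tot_le_supT D hη R] with z hz
  rw [← toReal_enorm]
  exact ENNReal.toReal_mono hfin.ne (le_trans (by rw [tot, add_assoc]; exact le_self_add) hz)

lemma bd_cv_g (hα : -1 < α) (hκ : 0 < κ) (hη : Ker D.δ η) (hR : 1 / 2 ≤ R) (hR1 : R ≤ 1 - D.δ) :
    Bd (nuQ m α R) fun z => cv D.g η z.1 z.2 := by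
  have hfin := supT_zero_lt_top hα hκ D hη hR hR1
  refine ⟨(stronglyMeasurable_cv D.sol.meas_g hη.smooth.continuous).aestronglyMeasurable,
    (supT 0 D η R).toReal, ?_⟩
  filter_upwards [ae_tot_le_supT D hη R] with z hz
  rw [← toReal_enorm]
  exact ENNReal.toReal_mono hfin.ne
    (le_trans (by rw [tot, add_assoc]; exact le_add_of_le_right le_self_add) hz)

lemma bd_flux (hα : -1 < α) (hκ : 0 < κ) (hη : Ker D.δ η) (hR : 1 / 2 ≤ R) (hR1 : R ≤ 1 - D.δ)
    (i : Fin (m + 1)) : Bd (nuQ m α R) fun z => flux D.c D.u D.g i η z.1 z.2 := by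
  unfold flux
  refine Bd.add ?_ (Bd.sum _ fun j _ => ?_)
  · exact Bd.act_coeff (D.sol.adm.measurable_A _ _) (fun s hs => D.sol.adm.A_bounded s hs _ _)
      (bd_cv_g D hα hκ hη hR hR1)
  · exact Bd.act_coeff (D.sol.adm.measurable_A _ _) (fun s hs => D.sol.adm.A_bounded s hs _ _)
      (bd_cv_u D hα hκ (hη.pd _) hR hR1)

lemma bd_a0 {f : Tan m × ℝ → Val n} (hf : Bd (nuQ m α R) f) :
    Bd (nuQ m α R) fun z => act (D.c.a0 z.2) (f z) :=
  Bd.act_coeff D.sol.adm.measurable_a0 D.sol.adm.a0_bounded hf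

lemma bd_C0 {f : Tan m × ℝ → Val n} (hf : Bd (nuQ m α R) f) :
    Bd (nuQ m α R) fun z => act (D.c.C0 z.2) (f z) :=
  Bd.act_coeff D.sol.adm.measurable_C0 D.sol.adm.C0_bounded hf

lemma bd_source (hα : -1 < α) (hκ : 0 < κ) (hη : Ker D.δ η) (hR : 1 / 2 ≤ R) (hR1 : R ≤ 1 - D.δ) :
    Bd (nuQ m α R) fun z => source D.c D.lam D.u D.g η z.1 z.2 := by
  unfold source
  refine ((bd_a0 D (bd_cv_u D hα hκ (hη.pd _) hR hR1)).add
    ((Bd.const D.lam).smul (bd_C0 D (bd_cv_u D hα hκ hη hR hR1)))).sub (Bd.sum _ fun i _ => ?_)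
  exact bd_flux D hα hκ (hη.pd _) hR hR1 _

end Energy

/-- Sections of bounded functions. -/
lemma Bd.section_left {E : Type*} [NormedAddCommGroup E] {R : ℝ} {f : Tan m × ℝ → E}
    (hf : Bd (nuQ m α R) f) :
    ∀ᵐ y ∂((volume : Measure (Tan m)).restrict (tanBox m R)), Bd (wt α R) fun s => f (y, s) := by
  obtain ⟨C, hC⟩ := hf.bound
  have h1 := hf.aesm.prodMk_left
  have h2 := Measure.ae_ae_of_ae_prod hC
  filter_upwards [h1, h2] with y h1 h2 using ⟨h1, C, h2⟩

end

/-! ### Cutoffs and integration by parts in the normal variable -/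

section

variable {m n : ℕ} {α κ : ℝ}

lemma volume_restrict_ac_wt (α R : ℝ) : volume.restrict (Ioo 0 R) ≪ wt α R := by
  rw [← Measure.ae_le_iff_absolutelyContinuous]
  intro s hs
  have : ∀ᵐ x ∂(wt α R), x ∈ s := hs
  rw [ae_wt_iff] at this
  exact this

lemma Bd.of_wt {E : Type*} [NormedAddCommGroup E] {R : ℝ} {f : ℝ → E} (h : Bd (wt α R) f) :
    Bd (volume.restrict (Ioo 0 R)) f := by
  obtain ⟨C, hC⟩ := h.bound
  exact ⟨h.aesm.mono_ac (volume_restrict_ac_wt α R), C, ae_wt_iff.1 hC⟩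

/-- Integration by parts in the normal variable. -/
lemma integral_normal_eq_zero (hα : -1 < α) {R : ℝ} (hR : 1 / 2 ≤ R) (hR1 : R ≤ 1)
    {v g U h : ℝ → Val n} {c : Val n} (bv : Bd (wt α R) v) (bg : Bd (wt α R) g)
    (bU : Bd (wt α R) U) (bh : Bd (wt α R) h)
    (hv : ∀ᵐ s ∂(volume.restrict (Ioo (0 : ℝ) 1)), v s = c + ∫ σ in (1 / 2 : ℝ)..s, g σ)
    (hU : ∀ᵐ s ∂(volume.restrict (Ioo (0 : ℝ) 1)), s ^ α • U s = ∫ σ in (0 : ℝ)..s, σ ^ α • h σ) :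
    ∫ s, ((R - s) ^ 2 * (inner ℝ (h s) (v s) + inner ℝ (U s) (g s)) +
      (R - s) * (-2) * inner ℝ (U s) (v s)) ∂(wt α R) = 0 := by
  have hfw := isFiniteMeasure_wt hα (show 0 ≤ R by linarith)
  have hsub : Ioo 0 R ⊆ Ioo (0 : ℝ) 1 := Ioo_subset_Ioo_right hR1
  have hvR := ae_restrict_of_ae_restrict_of_subset hsub hv
  have hUR := ae_restrict_of_ae_restrict_of_subset hsub hU
  have bk : ∀ {f : ℝ → Val n}, Bd (wt α R) f → ∀ k, Bd (wt α R) fun s => f s k := by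
    intro f hf k
    obtain ⟨C, hC⟩ := hf.bound
    refine ⟨(EuclideanSpace.proj k : Val n →L[ℝ] ℝ).continuous.comp_aestronglyMeasurable hf.aesm,
      C, ?_⟩
    filter_upwards [hC] with s hs using (PiLp.norm_apply_le (f s) k).trans hs
  have bRs : Bd (wt α R) fun s => R - s := by
    refine Bd.of_continuousOn (by fun_prop) (C := 1) ?_
    rw [ae_wt_iff]
    filter_upwards [ae_restrict_mem measurableSet_Ioo] with s hs
    rw [abs_le]; constructor <;> linarith [hs.1, hs.2]
  have hg1 : IntegrableOn g (Ioo 0 R) := bg.of_wt.integrable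
  have hh1 : IntegrableOn (fun s => s ^ α • h s) (Ioo 0 R) := integrable_wt_iff.1 bh.integrable
  have hgint : ∀ s ∈ Ioo 0 R, IntervalIntegrable g volume (1 / 2) s := by
    intro s hs
    refine ((intervalIntegrable_iff_integrableOn_Ioo_of_le (show (0 : ℝ) ≤ R by linarith)).2
      hg1).mono_set ?_
    rw [uIcc_of_le (show (0 : ℝ) ≤ R by linarith)]
    exact ordConnected_Icc.uIcc_subset ⟨by norm_num, hR⟩ ⟨hs.1.le, hs.2.le⟩
  have hIntv : ∀ s ∈ Ioo 0 R, IntervalIntegrable (fun s => s ^ α • h s) volume 0 s := by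
    intro s hs
    refine ((intervalIntegrable_iff_integrableOn_Ioo_of_le (show (0 : ℝ) ≤ R by linarith)).2
      hh1).mono_set ?_
    rw [uIcc_of_le (show (0 : ℝ) ≤ R by linarith), uIcc_of_le hs.1.le]
    exact Icc_subset_Icc_right hs.2.le
  -- The scalar identity is applied to each component and summed. The weight `s ^ α` is part of the
  -- primitive, which is the weighted flux.
  have key : ∀ k : Fin n, ∫ s, ((R - s) ^ 2 * (h s k * v s k + U s k * g s k) +
      (R - s) * (-2) * (U s k * v s k)) ∂(wt α R) = 0 := by
    intro k
    have h1 := integral_primitive_mul_cutoff (v := fun s => v s k) (g := fun s => g s k)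
      (F := fun s => s ^ α * U s k) (f := fun s => s ^ α * h s k) (R := R) (c := c k) hR
      (bk bg k).of_wt.integrable
      (integrable_wt_iff.1 (bk bh k).integrable) ?_ ?_
    · rw [integral_wt (E := ℝ)]
      refine Eq.trans ?_ h1
      refine integral_congr_ae (ae_of_all _ fun s => ?_)
      simp only [smul_eq_mul]
      ring
    · filter_upwards [hvR, ae_restrict_mem measurableSet_Ioo] with s hs hsm
      rw [hs]
      simp only [PiLp.add_apply]
      congr 1
      have h3 := ((EuclideanSpace.proj k : Val n →L[ℝ] ℝ).intervalIntegral_comp_comm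
        (hgint s hsm)).symm
      exact h3
    · filter_upwards [hUR, ae_restrict_mem measurableSet_Ioo] with s hs hsm
      have h2 := congrArg (fun w : Val n => w k) hs
      simp only [PiLp.smul_apply, smul_eq_mul] at h2
      rw [h2]
      have h3 := ((EuclideanSpace.proj k : Val n →L[ℝ] ℝ).intervalIntegral_comp_comm
        (hIntv s hsm)).symm
      simpa using h3
  have hin : ∀ a b : Val n, inner ℝ a b = ∑ k, a k * b k := by
    intro a b
    simp [PiLp.inner_apply, mul_comm]
  rw [← Finset.sum_eq_zero (s := Finset.univ) fun k _ => key k, ← integral_finsetSum]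
  · refine integral_congr_ae (ae_of_all _ fun s => ?_)
    simp only [hin, Finset.sum_add_distrib, Finset.mul_sum, mul_add]
  · intro k _
    exact (((bRs.pow 2).mul (((bk bh k).mul (bk bv k)).add ((bk bU k).mul (bk bg k)))).add
      ((bRs.mul (Bd.const (-2))).mul ((bk bU k).mul (bk bv k)))).integrable

/-- The cutoff function. -/
def zet (R : ℝ) (z : Tan m × ℝ) : ℝ := (z.1.1 + R) * (R ^ 2 - ‖z.1.2‖ ^ 2) * (R - z.2)

/-- Twice the tangential derivatives of the cutoff. -/
def qx (R : ℝ) (i : Fin m) (z : Tan m × ℝ) : ℝ := (z.1.1 + R) * (-4 * z.1.2 i) * (R - z.2)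

/-- Twice the normal derivative of the cutoff. -/
def qd (R : ℝ) (z : Tan m × ℝ) : ℝ := -2 * ((z.1.1 + R) * (R ^ 2 - ‖z.1.2‖ ^ 2))

/-- Twice the time derivative of the cutoff. -/
def qt (R : ℝ) (z : Tan m × ℝ) : ℝ := 2 * ((R ^ 2 - ‖z.1.2‖ ^ 2) * (R - z.2))

section Cutoff
variable {R : ℝ}

/-- The cutoff `zet` vanishes for `t = -R`, `|x'| = R` and `s = R`, but neither for `t = 0` nor for
`s = 0`. At these two faces a sign and the natural boundary condition take its place. The factors
`q` are chosen so that the derivatives of `zet ^ 2` are `zet * q`. -/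
lemma cutoff_bounds (hR0 : 0 ≤ R) (hR1 : R ≤ 1) {z : Tan m × ℝ} (h1 : z.1 ∈ tanBox m R)
    (h2 : z.2 ∈ Ioo 0 R) :
    0 ≤ zet R z ∧ zet R z ≤ 1 ∧ (∀ i, |qx R i z| ≤ 4) ∧ |qd R z| ≤ 2 ∧ |qt R z| ≤ 2 := by
  obtain ⟨⟨h3, h4⟩, h5⟩ := h1
  rw [mem_ball_zero_iff] at h5
  have a1 : 0 ≤ z.1.1 + R := by linarith
  have a2 : z.1.1 + R ≤ 1 := by linarith
  have b1 : 0 ≤ R ^ 2 - ‖z.1.2‖ ^ 2 := by nlinarith [norm_nonneg z.1.2]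
  have b2 : R ^ 2 - ‖z.1.2‖ ^ 2 ≤ 1 := by nlinarith [norm_nonneg z.1.2]
  have c1 : 0 ≤ R - z.2 := by linarith [h2.2]
  have c2 : R - z.2 ≤ 1 := by linarith [h2.1]
  refine ⟨by unfold zet; positivity, ?_, fun i => ?_, ?_, ?_⟩
  · unfold zet
    exact mul_le_one₀ (mul_le_one₀ a2 b1 b2) c1 c2
  · have hx : |z.1.2 i| ≤ 1 := (PiLp.norm_apply_le z.1.2 i).trans (by linarith)
    unfold qx
    rw [abs_mul, abs_mul, abs_of_nonneg a1, abs_of_nonneg c1, abs_mul]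
    have : |(-4 : ℝ)| * |z.1.2 i| ≤ 4 := by norm_num; linarith
    have h0 : 0 ≤ |(-4 : ℝ)| * |z.1.2 i| := by positivity
    calc (z.1.1 + R) * (|(-4 : ℝ)| * |z.1.2 i|) * (R - z.2) ≤ 1 * 4 * 1 := by gcongr
      _ = 4 := by norm_num
  · unfold qd
    rw [abs_mul, abs_of_nonneg (by positivity : 0 ≤ (z.1.1 + R) * (R ^ 2 - ‖z.1.2‖ ^ 2))]
    have := mul_le_one₀ a2 b1 b2
    norm_num; linarith
  · unfold qt
    rw [abs_of_nonneg (by positivity)]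
    have := mul_le_one₀ b2 c1 c2
    linarith

lemma bd_zet (hR0 : 0 ≤ R) (hR1 : R ≤ 1) : Bd (nuQ m α R) (zet R) := by
  refine Bd.of_continuousOn (by unfold zet; fun_prop) (C := 1) ?_
  filter_upwards [ae_nuQ_mem α R] with z hz
  obtain ⟨h1, h2, -⟩ := cutoff_bounds hR0 hR1 hz.1 hz.2
  rw [abs_of_nonneg h1]; exact h2

lemma bd_qx (hR0 : 0 ≤ R) (hR1 : R ≤ 1) (i : Fin m) : Bd (nuQ m α R) (qx R i) := by
  refine Bd.of_continuousOn (by unfold qx; fun_prop) (C := 4) ?_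
  filter_upwards [ae_nuQ_mem α R] with z hz using (cutoff_bounds hR0 hR1 hz.1 hz.2).2.2.1 i

lemma bd_qd (hR0 : 0 ≤ R) (hR1 : R ≤ 1) : Bd (nuQ m α R) (qd R) := by
  refine Bd.of_continuousOn (by unfold qd; fun_prop) (C := 2) ?_
  filter_upwards [ae_nuQ_mem α R] with z hz using (cutoff_bounds hR0 hR1 hz.1 hz.2).2.2.2.1

lemma bd_qt (hR0 : 0 ≤ R) (hR1 : R ≤ 1) : Bd (nuQ m α R) (qt R) := by
  refine Bd.of_continuousOn (by unfold qt; fun_prop) (C := 2) ?_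
  filter_upwards [ae_nuQ_mem α R] with z hz using (cutoff_bounds hR0 hR1 hz.1 hz.2).2.2.2.2

end Cutoff

/-- The equation tested in the normal variable, integrated over the cylinder. -/
lemma integral_normal_identity (hα : -1 < α) (hκ : 0 < κ) (D : Dat m n α κ) {η η' : Tan m → ℝ}
    (hη : Ker D.δ η) (hη' : Ker D.δ η') {R : ℝ} (hR : 1 / 2 ≤ R) (hR1 : R ≤ 1 - D.δ) :
    ∫ z, (zet R z ^ 2 * (inner ℝ (source D.c D.lam D.u D.g η z.1 z.2) (cv D.u η' z.1 z.2) +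
        inner ℝ (flux D.c D.u D.g (Fin.last m) η z.1 z.2) (cv D.g η' z.1 z.2)) +
      zet R z * qd R z * inner ℝ (flux D.c D.u D.g (Fin.last m) η z.1 z.2) (cv D.u η' z.1 z.2))
      ∂(nuQ m α R) = 0 := by
  have hR0 : 0 ≤ R := by linarith
  have hR1' : R ≤ 1 := by linarith [D.δ_pos]
  have hfin := isFiniteMeasure_nuQ (m := m) hα hR0
  have b1 := bd_source D hα hκ hη hR hR1
  have b2 := bd_flux D hα hκ hη hR hR1 (Fin.last m)
  have b3 := bd_cv_u D hα hκ hη' hR hR1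
  have b4 := bd_cv_g D hα hκ hη' hR hR1
  have bz := bd_zet (m := m) (α := α) hR0 hR1'
  have bq := bd_qd (m := m) (α := α) hR0 hR1'
  have hprod := (((bz.pow 2).mul ((b1.inner b3).add (b2.inner b4))).add
    ((bz.mul bq).mul (b2.inner b3))).integrable
  rw [nuQ] at hprod ⊢
  rw [integral_prod _ hprod]
  apply integral_eq_zero_of_ae
  filter_upwards [b1.section_left, b2.section_left, b3.section_left, b4.section_left,
    ae_restrict_mem (measurableSet_tanBox R)] with y c1 c2 c3 c4 hy
  have hy1 := tanBox_mono hR1 hy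
  obtain ⟨C, hC⟩ := D.sol.primitive_cv hη' hy1
  -- For fixed tangential variables the cutoff is a constant times `R - s`, so the one-dimensional
  -- identity applies on each normal line.
  have h1 := integral_normal_eq_zero hα hR hR1' c3 c4 c2 c1 hC (D.sol.flux_cv hη hy1)
  have h2 := congrArg (fun x => ((y.1 + R) * (R ^ 2 - ‖y.2‖ ^ 2)) ^ 2 * x) h1
  simp only [mul_zero] at h2
  rw [← integral_const_mul] at h2
  rw [Pi.zero_apply, ← h2]
  refine integral_congr_ae (ae_of_all _ fun s => ?_)
  simp only [zet, qd]
  ring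

end

section

variable {m n : ℕ} {α κ : ℝ}

/-! ### Integration by parts in the tangential variables -/

/-- The square of the positive part is differentiable everywhere. Hence the squared cutoff, extended
by zero, is differentiable along lines that cross the lateral boundary. -/
lemma hasDerivAt_sq_max (a : ℝ) : HasDerivAt (fun x : ℝ => max 0 x ^ 2) (2 * max 0 a) a := by
  rcases lt_trichotomy a 0 with h | rfl | h
  · rw [max_eq_left h.le, mul_zero]
    refine (hasDerivAt_const a (0 : ℝ)).congr_of_eventuallyEq ?_
    filter_upwards [Iio_mem_nhds h] with x hx
    rw [max_eq_left (le_of_lt hx)]; simp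
  · simp only [max_self, mul_zero]
    rw [hasDerivAt_iff_isLittleO]
    simp only [max_self, sub_zero, ne_eq, OfNat.ofNat_ne_zero, not_false_eq_true, zero_pow,
      smul_zero]
    have h2 : (fun x : ℝ => x ^ 2) =o[𝓝 0] fun x => x := by
      simpa using (Asymptotics.isLittleO_pow_id (𝕜 := ℝ) one_lt_two)
    refine Asymptotics.IsBigO.trans_isLittleO (Asymptotics.IsBigO.of_bound 1 ?_) h2
    filter_upwards with x
    rw [one_mul, Real.norm_eq_abs, Real.norm_eq_abs, abs_pow, abs_pow]
    refine pow_le_pow_left₀ (abs_nonneg _) ?_ 2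
    rw [abs_of_nonneg (le_max_left (0 : ℝ) x)]
    exact max_le (abs_nonneg _) (le_abs_self _)
  · rw [max_eq_right h.le]
    refine HasDerivAt.congr_of_eventuallyEq (f := fun x => x ^ 2) ?_ ?_
    · simpa using hasDerivAt_pow 2 a
    · filter_upwards [Ioi_mem_nhds h] with x hx
      rw [max_eq_right (le_of_lt hx)]

lemma integrableOn_tanBox {E : Type*} [NormedAddCommGroup E] {f : Tan m → E} (hf : Continuous f)
    (R : ℝ) : IntegrableOn f (tanBox m R) := by
  have hc : IsCompact (Icc (-R) 0 ×ˢ Metric.closedBall (0 : EuclideanSpace ℝ (Fin m)) R) :=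
    isCompact_Icc.prod (isCompact_closedBall _ _)
  exact (hf.continuousOn.integrableOn_compact hc).mono_set
    (Set.prod_mono Ioo_subset_Icc_self Metric.ball_subset_closedBall)

/-- Integration by parts in a tangential space direction, with a cutoff vanishing on the lateral
boundary. -/
lemma integral_tangential_eq_zero {f : Tan m → ℝ} (hf : ContDiff ℝ 1 f) (i : Fin m) {R : ℝ}
    (hR : 0 < R) :
    ∫ y in tanBox m R, ((y.1 + R) ^ 2 * (R ^ 2 - ‖y.2‖ ^ 2) ^ 2 * fderiv ℝ f y (xdir i) +
      (y.1 + R) ^ 2 * (R ^ 2 - ‖y.2‖ ^ 2) * (-4 * y.2 i) * f y) = 0 := by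
  set G : Tan m → ℝ := (tanBox m R).indicator fun y => (y.1 + R) ^ 2 * (R ^ 2 - ‖y.2‖ ^ 2) ^ 2 with hG
  set G' : Tan m → ℝ := (tanBox m R).indicator fun y =>
    (y.1 + R) ^ 2 * (R ^ 2 - ‖y.2‖ ^ 2) * (-4 * y.2 i) with hG'
  have hf' : Continuous fun y => fderiv ℝ f y (xdir i) :=
    (hf.continuous_fderiv (by simp)).clm_apply continuous_const
  have hfc := hf.continuous
  have i1 : IntegrableOn (fun y : Tan m => (y.1 + R) ^ 2 * (R ^ 2 - ‖y.2‖ ^ 2) ^ 2 *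
      fderiv ℝ f y (xdir i)) (tanBox m R) := integrableOn_tanBox (by fun_prop) R
  have i2 : IntegrableOn (fun y : Tan m => (y.1 + R) ^ 2 * (R ^ 2 - ‖y.2‖ ^ 2) * (-4 * y.2 i) *
      f y) (tanBox m R) := integrableOn_tanBox (by fun_prop) R
  have i3 : IntegrableOn (fun y : Tan m => (y.1 + R) ^ 2 * (R ^ 2 - ‖y.2‖ ^ 2) ^ 2 *
      f y) (tanBox m R) := integrableOn_tanBox (by fun_prop) R
  have hms := measurableSet_tanBox (m := m) R
  have e : ∀ (p q : Tan m → ℝ), (fun y => ContinuousLinearMap.mul ℝ ℝ (q y)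
      ((tanBox m R).indicator p y)) = (tanBox m R).indicator fun y => p y * q y := by
    intro p q
    ext y
    by_cases hy : y ∈ tanBox m R <;> simp [hy, mul_comm]
  -- Integration by parts on the whole space, for the cutoff extended by zero. Only its derivative
  -- along spatial lines is needed, so the jump at `t = 0` does no harm.
  have key := integral_bilinear_hasLineDerivAt_right_eq_neg_left_of_integrable
    (μ := (volume : Measure (Tan m))) (f := f) (f' := fun y => fderiv ℝ f y (xdir i)) (g := G)
    (g' := G') (v := xdir i) (B := ContinuousLinearMap.mul ℝ ℝ)
    (by rw [hG, e]; exact i1.integrable_indicator hms)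
    (by rw [hG', e]; exact i2.integrable_indicator hms)
    (by rw [hG, e]; exact i3.integrable_indicator hms)
    (fun y _ => ((hf.differentiable (by simp)) y).hasFDerivAt.hasLineDerivAt _) ?_
  · rw [hG, hG', e, e, integral_indicator hms, integral_indicator hms] at key
    rw [integral_add i1 i2, key]; ring
  · intro y _
    unfold HasLineDerivAt
    have hy : ∀ τ : ℝ, y + τ • xdir i = (y.1, y.2 + τ • EuclideanSpace.single i 1) := by
      intro τ; ext <;> simp [xdir]
    have hn : ∀ τ : ℝ, ‖y.2 + τ • EuclideanSpace.single i (1 : ℝ)‖ ^ 2 =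
        ‖y.2‖ ^ 2 + 2 * τ * y.2 i + τ ^ 2 := by
      intro τ
      rw [norm_add_sq_real, inner_smul_right, EuclideanSpace.inner_single_right, norm_smul]
      simp; ring
    by_cases ht : y.1 ∈ Ioo (-R) 0
    · have e1 : ∀ x : EuclideanSpace ℝ (Fin m), ((y.1, x) : Tan m) ∈ tanBox m R ↔
          0 < R ^ 2 - ‖x‖ ^ 2 := by
        intro x
        simp only [tanBox, mem_prod, ht, true_and, mem_ball_zero_iff]
        rw [sub_pos, sq_lt_sq₀ (norm_nonneg _) hR.le]
      have e2 : ∀ x : EuclideanSpace ℝ (Fin m), G (y.1, x) =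
          (y.1 + R) ^ 2 * max 0 (R ^ 2 - ‖x‖ ^ 2) ^ 2 := by
        intro x
        by_cases h : ((y.1, x) : Tan m) ∈ tanBox m R
        · rw [hG, indicator_of_mem h, max_eq_right ((e1 x).1 h).le]
        · rw [hG, indicator_of_notMem h, max_eq_left (not_lt.1 (mt (e1 x).2 h))]; simp
      have e3 : G' y = (y.1 + R) ^ 2 * (2 * max 0 (R ^ 2 - ‖y.2‖ ^ 2) * (-(2 * y.2 i))) := by
        by_cases h : y ∈ tanBox m R
        · rw [hG', indicator_of_mem h, max_eq_right ((e1 y.2).1 h).le]; ring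
        · rw [hG', indicator_of_notMem h, max_eq_left (not_lt.1 (mt (e1 y.2).2 h))]; simp
      simp only [hy, e2, e3, hn]
      have d1 : HasDerivAt (fun τ : ℝ => R ^ 2 - (‖y.2‖ ^ 2 + 2 * τ * y.2 i + τ ^ 2))
          (-(2 * y.2 i)) 0 := by
        have a1 : HasDerivAt (fun τ : ℝ => 2 * τ * y.2 i) (2 * 1 * y.2 i) 0 :=
          ((hasDerivAt_id (0 : ℝ)).const_mul 2).mul_const _
        have a2 : HasDerivAt (fun τ : ℝ => τ ^ 2) 0 0 := by simpa using hasDerivAt_pow 2 (0 : ℝ)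
        have a3 := ((a1.const_add (‖y.2‖ ^ 2)).add a2).const_sub (R ^ 2)
        simpa using a3
      have d2 : HasDerivAt (fun x : ℝ => max 0 x ^ 2) (2 * max 0 (R ^ 2 - ‖y.2‖ ^ 2))
          (R ^ 2 - (‖y.2‖ ^ 2 + 2 * 0 * y.2 i + 0 ^ 2)) := by
        have := hasDerivAt_sq_max (R ^ 2 - ‖y.2‖ ^ 2)
        simpa using this
      exact (HasDerivAt.comp (0 : ℝ) d2 d1).const_mul _
    · have z1 : ∀ x : EuclideanSpace ℝ (Fin m), ((y.1, x) : Tan m) ∉ tanBox m R := fun x h => ht h.1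
      have z2 : G' y = 0 := indicator_of_notMem (z1 y.2) _
      have z3 : (fun τ : ℝ => G (y + τ • xdir i)) = fun _ => 0 := by
        ext τ; rw [hy]; exact indicator_of_notMem (z1 _) _
      rw [z2, z3]
      exact hasDerivAt_const _ _

/-- Integration by parts in time, with a cutoff vanishing at the initial time only. -/
lemma integral_time_nonneg {f : Tan m → ℝ} (hf : ContDiff ℝ 1 f) (hf0 : ∀ y, 0 ≤ f y) {R : ℝ}
    (hR : 0 < R) :
    0 ≤ ∫ y in tanBox m R, ((y.1 + R) ^ 2 * (R ^ 2 - ‖y.2‖ ^ 2) ^ 2 * fderiv ℝ f y (tdir m) +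
      2 * (y.1 + R) * (R ^ 2 - ‖y.2‖ ^ 2) ^ 2 * f y) := by
  have hf' : Continuous fun y => fderiv ℝ f y (tdir m) :=
    (hf.continuous_fderiv (by simp)).clm_apply continuous_const
  have hfc := hf.continuous
  have hi := integrableOn_tanBox (f := fun y : Tan m => (y.1 + R) ^ 2 * (R ^ 2 - ‖y.2‖ ^ 2) ^ 2 *
    fderiv ℝ f y (tdir m) + 2 * (y.1 + R) * (R ^ 2 - ‖y.2‖ ^ 2) ^ 2 * f y) (by fun_prop) R
  rw [IntegrableOn, tanBox, Measure.volume_eq_prod, ← Measure.prod_restrict] at hi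
  rw [tanBox, Measure.volume_eq_prod, ← Measure.prod_restrict, integral_prod_symm _ hi]
  refine integral_nonneg fun x => ?_
  simp only [Pi.zero_apply]
  have hd : ∀ t ∈ uIcc (-R) 0, HasDerivAt (fun t => (R ^ 2 - ‖x‖ ^ 2) ^ 2 * ((t + R) ^ 2 * f (t, x)))
      ((t + R) ^ 2 * (R ^ 2 - ‖x‖ ^ 2) ^ 2 * fderiv ℝ f (t, x) (tdir m) +
        2 * (t + R) * (R ^ 2 - ‖x‖ ^ 2) ^ 2 * f (t, x)) t := by
    intro t _
    have h1 : HasDerivAt (fun t => f (t, x)) (fderiv ℝ f (t, x) (tdir m)) t :=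
      ((hf.differentiable (by simp)) (t, x)).hasFDerivAt.comp_hasDerivAt t
        ((hasDerivAt_id t).prodMk (hasDerivAt_const t x))
    have h2 : HasDerivAt (fun t : ℝ => (t + R) ^ 2) (2 * (t + R)) t := by
      simpa using ((hasDerivAt_id' t).add_const R).fun_pow 2
    refine ((h2.fun_mul h1).const_mul ((R ^ 2 - ‖x‖ ^ 2) ^ 2)).congr_deriv ?_
    ring
  have hcont : Continuous fun t : ℝ => (t + R) ^ 2 * (R ^ 2 - ‖x‖ ^ 2) ^ 2 *
      fderiv ℝ f (t, x) (tdir m) + 2 * (t + R) * (R ^ 2 - ‖x‖ ^ 2) ^ 2 * f (t, x) := by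
    have c1 : Continuous fun t : ℝ => fderiv ℝ f (t, x) (tdir m) := hf'.comp (by fun_prop)
    have c2 : Continuous fun t : ℝ => f (t, x) := hfc.comp (by fun_prop)
    fun_prop
  -- On each time line the integrand is an exact derivative. The cutoff kills the value at `-R`, and
  -- the value at `0` is nonnegative.
  have := intervalIntegral.integral_eq_sub_of_hasDerivAt hd (hcont.intervalIntegrable _ _)
  rw [intervalIntegral.integral_of_le (by linarith), integral_Ioc_eq_integral_Ioo] at this
  rw [this]
  have := hf0 (0, x)
  simp only [zero_add, neg_add_cancel, ne_eq, OfNat.ofNat_ne_zero, not_false_eq_true, zero_pow,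
    zero_mul, mul_zero, sub_zero]
  positivity

section Slices
variable (D : Dat m n α κ) {η η' : Tan m → ℝ}

lemma ae_integrable_slice {f : Tan m × ℝ → Val n} (hf : Integrable f (volume.prod (wt α 1)))
    {R : ℝ} (hR : R ≤ 1) : ∀ᵐ s ∂(wt α R), Integrable fun y => f (y, s) :=
  ae_mono (wt_mono α hR) hf.prod_left_ae

lemma hasFDerivAt_cv {f : Tan m × ℝ → Val n} {s : ℝ} (hf : Integrable fun y => f (y, s))
    (hη : ContDiff ℝ ∞ η) (hc : HasCompactSupport η) (y : Tan m) :
    HasFDerivAt (fun y => cv f η y s) (fderiv ℝ (fun y => cv f η y s) y) y :=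
  ((contDiff_cv hf hη hc).differentiable (by simp) y).hasFDerivAt

lemma contDiff_act {f : Tan m → Val n} (hf : ContDiff ℝ ∞ f) (M : Matrix (Fin n) (Fin n) ℝ) :
    ContDiff ℝ ∞ fun y => act M (f y) :=
  (actL M).contDiff.comp hf

lemma fderiv_act {f : Tan m → Val n} (hf : ContDiff ℝ ∞ f) (M : Matrix (Fin n) (Fin n) ℝ)
    (y e : Tan m) : fderiv ℝ (fun y => act M (f y)) y e = act M (fderiv ℝ f y e) := by
  have h := (actL M).hasFDerivAt.comp y (hf.differentiable (by simp) y).hasFDerivAt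
  exact congrArg (fun L : Tan m →L[ℝ] Val n => L e) h.fderiv

lemma contDiff_flux {s : ℝ} (hu : Integrable fun y => D.u (y, s)) (hg : Integrable fun y => D.g (y, s))
    (hη : Ker D.δ η) (i : Fin (m + 1)) : ContDiff ℝ ∞ fun y => flux D.c D.u D.g i η y s := by
  unfold flux
  refine (contDiff_act (contDiff_cv hg hη.smooth hη.hasCompactSupport) _).add
    (ContDiff.sum fun j _ => contDiff_act (contDiff_cv hu (hη.pd _).smooth
      (hη.pd _).hasCompactSupport) _)

lemma fderiv_flux {s : ℝ} (hu : Integrable fun y => D.u (y, s)) (hg : Integrable fun y => D.g (y, s))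
    (hη : Ker D.δ η) (i : Fin (m + 1)) (y e : Tan m) :
    fderiv ℝ (fun y => flux D.c D.u D.g i η y s) y e = flux D.c D.u D.g i (pd e η) y s := by
  have c1 := contDiff_act (contDiff_cv hg hη.smooth hη.hasCompactSupport) (D.c.A i (Fin.last m) s)
  have c2 : ∀ j : Fin m, ContDiff ℝ ∞ fun y =>
      act (D.c.A i j.castSucc s) (cv D.u (pd (xdir j) η) y s) := fun j =>
    contDiff_act (contDiff_cv hu (hη.pd _).smooth (hη.pd _).hasCompactSupport) _
  unfold flux
  rw [fderiv_fun_add (c1.differentiable (by simp) y)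
    ((ContDiff.sum fun j _ => c2 j).differentiable (by simp) y),
    fderiv_fun_sum fun j _ => (c2 j).differentiable (by simp) y]
  rw [add_apply, sum_apply,
    fderiv_act (contDiff_cv hg hη.smooth hη.hasCompactSupport),
    fderiv_cv hg hη.smooth hη.hasCompactSupport]
  congr 1
  refine Finset.sum_congr rfl fun j _ => ?_
  rw [fderiv_act (contDiff_cv hu (hη.pd _).smooth (hη.pd _).hasCompactSupport),
    fderiv_cv hu (hη.pd _).smooth (hη.pd _).hasCompactSupport, pd_comm hη.smooth]

/-- The equation tested in a tangential variable. -/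
lemma integral_tangential_identity (hα : -1 < α) (hκ : 0 < κ) (hη : Ker D.δ η) (hη' : Ker D.δ η')
    {R : ℝ} (hR : 1 / 2 ≤ R) (hR1 : R ≤ 1 - D.δ) (i : Fin m) :
    ∫ z, (zet R z ^ 2 * (inner ℝ (flux D.c D.u D.g i.castSucc (pd (xdir i) η) z.1 z.2)
        (cv D.u η' z.1 z.2) + inner ℝ (flux D.c D.u D.g i.castSucc η z.1 z.2)
          (cv D.u (pd (xdir i) η') z.1 z.2)) +
      zet R z * qx R i z * inner ℝ (flux D.c D.u D.g i.castSucc η z.1 z.2) (cv D.u η' z.1 z.2))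
      ∂(nuQ m α R) = 0 := by
  have hR0 : 0 ≤ R := by linarith
  have hR1' : R ≤ 1 := by linarith [D.δ_pos]
  have hfin := isFiniteMeasure_nuQ (m := m) hα hR0
  have b1 := bd_flux D hα hκ (hη.pd (xdir i)) hR hR1 i.castSucc
  have b2 := bd_flux D hα hκ hη hR hR1 i.castSucc
  have b3 := bd_cv_u D hα hκ hη' hR hR1
  have b4 := bd_cv_u D hα hκ (hη'.pd (xdir i)) hR hR1
  have bz := bd_zet (m := m) (α := α) hR0 hR1'
  have bq := bd_qx (m := m) (α := α) hR0 hR1' i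
  have hprod := (((bz.pow 2).mul ((b1.inner b3).add (b2.inner b4))).add
    ((bz.mul bq).mul (b2.inner b3))).integrable
  rw [nuQ] at hprod ⊢
  rw [integral_prod_symm _ hprod]
  apply integral_eq_zero_of_ae
  filter_upwards [ae_integrable_slice D.sol.int_u hR1', ae_integrable_slice D.sol.int_g hR1']
    with s hu hg
  have c1 := contDiff_flux D hu hg hη i.castSucc
  have c2 := contDiff_cv hu hη'.smooth hη'.hasCompactSupport
  have h1 := integral_tangential_eq_zero (f := fun y => inner ℝ
    (flux D.c D.u D.g i.castSucc η y s) (cv D.u η' y s))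
    ((c1.inner ℝ c2).of_le (by exact_mod_cast le_top)) i (R := R) (by linarith)
  have h2 := congrArg (fun x => (R - s) ^ 2 * x) h1
  simp only [mul_zero] at h2
  rw [← integral_const_mul] at h2
  rw [Pi.zero_apply, ← h2]
  refine integral_congr_ae (ae_of_all _ fun y => ?_)
  simp only [zet, qx]
  rw [fderiv_inner_apply ℝ (c1.differentiable (by simp) y) (c2.differentiable (by simp) y),
    fderiv_flux D hu hg hη, fderiv_cv hu hη'.smooth hη'.hasCompactSupport]
  ring

/-- The sign of the time derivative term. -/
lemma integral_time_identity (hα : -1 < α) (hκ : 0 < κ) (hη : Ker D.δ η)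
    {R : ℝ} (hR : 1 / 2 ≤ R) (hR1 : R ≤ 1 - D.δ) :
    0 ≤ ∫ z, (zet R z ^ 2 * (2 * inner ℝ (act (D.c.a0 z.2) (cv D.u (pd (tdir m) η) z.1 z.2))
        (cv D.u η z.1 z.2)) +
      zet R z * qt R z * inner ℝ (act (D.c.a0 z.2) (cv D.u η z.1 z.2)) (cv D.u η z.1 z.2))
      ∂(nuQ m α R) := by
  have hR0 : 0 ≤ R := by linarith
  have hR1' : R ≤ 1 := by linarith [D.δ_pos]
  have hfin := isFiniteMeasure_nuQ (m := m) hα hR0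
  have b1 := bd_a0 D (bd_cv_u D hα hκ (hη.pd (tdir m)) hR hR1)
  have b2 := bd_a0 D (bd_cv_u D hα hκ hη hR hR1)
  have b3 := bd_cv_u D hα hκ hη hR hR1
  have bz := bd_zet (m := m) (α := α) hR0 hR1'
  have bq := bd_qt (m := m) (α := α) hR0 hR1'
  have hprod := (((bz.pow 2).mul ((Bd.const 2).mul (b1.inner b3))).add
    ((bz.mul bq).mul (b2.inner b3))).integrable
  rw [nuQ] at hprod ⊢
  rw [integral_prod_symm _ hprod]
  apply integral_nonneg_of_ae
  have hpos : ∀ᵐ s ∂(wt α R), 0 < s := by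
    rw [ae_wt_iff]
    filter_upwards [ae_restrict_mem measurableSet_Ioo] with s hs using hs.1
  filter_upwards [ae_integrable_slice D.sol.int_u hR1', hpos] with s hu hs
  have c2 := contDiff_cv hu hη.smooth hη.hasCompactSupport
  have c1 := contDiff_act c2 (D.c.a0 s)
  have h1 := integral_time_nonneg (f := fun y => inner ℝ (act (D.c.a0 s) (cv D.u η y s))
    (cv D.u η y s)) ((c1.inner ℝ c2).of_le (by exact_mod_cast le_top))
    (fun y => le_trans (by positivity) (D.sol.adm.a0_pos s hs _)) (R := R) (by linarith)
  have h2 := mul_nonneg (sq_nonneg (R - s)) h1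
  rw [← integral_const_mul] at h2
  refine h2.trans_eq ?_
  refine integral_congr_ae (ae_of_all _ fun y => ?_)
  simp only [zet, qt]
  -- Symmetry of `a₀` merges the two terms of the product rule into `2 ⟨a₀ w_t, w⟩`.
  rw [fderiv_inner_apply ℝ (c1.differentiable (by simp) y) (c2.differentiable (by simp) y),
    fderiv_act c2, fderiv_cv hu hη.smooth hη.hasCompactSupport,
    inner_act_comm (D.sol.adm.a0_symm s hs) (cv D.u η y s) (cv D.u (pd (tdir m) η) y s)]
  ring

/-- The energy identity. -/
lemma energy_identity (hα : -1 < α) (hκ : 0 < κ) (hη : Ker D.δ η) (hη' : Ker D.δ η')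
    {R : ℝ} (hR : 1 / 2 ≤ R) (hR1 : R ≤ 1 - D.δ) :
    ∫ z, (zet R z ^ 2 * (inner ℝ (act (D.c.a0 z.2) (cv D.u (pd (tdir m) η) z.1 z.2))
          (cv D.u η' z.1 z.2) +
        D.lam * inner ℝ (act (D.c.C0 z.2) (cv D.u η z.1 z.2)) (cv D.u η' z.1 z.2) +
        (inner ℝ (flux D.c D.u D.g (Fin.last m) η z.1 z.2) (cv D.g η' z.1 z.2) +
          ∑ i : Fin m, inner ℝ (flux D.c D.u D.g i.castSucc η z.1 z.2)
            (cv D.u (pd (xdir i) η') z.1 z.2))) +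
      zet R z * (qd R z * inner ℝ (flux D.c D.u D.g (Fin.last m) η z.1 z.2) (cv D.u η' z.1 z.2) +
        ∑ i : Fin m, qx R i z * inner ℝ (flux D.c D.u D.g i.castSucc η z.1 z.2)
          (cv D.u η' z.1 z.2))) ∂(nuQ m α R) = 0 := by
  have hR0 : 0 ≤ R := by linarith
  have hR1' : R ≤ 1 := by linarith [D.δ_pos]
  have hfin := isFiniteMeasure_nuQ (m := m) hα hR0
  have bs := bd_source D hα hκ hη hR hR1
  have bf := bd_flux D hα hκ hη hR hR1
  have bu := bd_cv_u D hα hκ hη' hR hR1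
  have bg := bd_cv_g D hα hκ hη' hR hR1
  have bz := bd_zet (m := m) (α := α) hR0 hR1'
  have bq := bd_qd (m := m) (α := α) hR0 hR1'
  have e1 := integral_normal_identity hα hκ D hη hη' hR hR1
  -- The source contains minus the tangential divergence of the fluxes. Adding these identities
  -- moves the derivatives to `η'` and to the cutoff. The time derivative stays on `η`, so that both
  -- `η' = η` and `η' = ∂_t η` can be used.
  have e2 := Finset.sum_eq_zero (s := Finset.univ) fun i _ =>
    integral_tangential_identity D hα hκ hη hη' hR hR1 i
  rw [← integral_finsetSum] at e2
  · have e3 := congrArg₂ (· + ·) e1 e2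
    simp only [add_zero] at e3
    rw [← integral_add] at e3
    · rw [← e3]
      refine integral_congr_ae (ae_of_all _ fun z => ?_)
      simp only [source, inner_sub_left, inner_add_left, sum_inner, inner_smul_left, conj_trivial,
        Finset.sum_add_distrib, mul_add, mul_sub, Finset.mul_sum]
      simp only [mul_assoc]
      ring
    · exact (((bz.pow 2).mul ((bs.inner bu).add ((bf _).inner bg))).add
        ((bz.mul bq).mul ((bf _).inner bu))).integrable
    · refine (Bd.sum _ fun i _ => ?_).integrable
      exact (((bz.pow 2).mul (((bd_flux D hα hκ (hη.pd (xdir i)) hR hR1 _).inner bu).add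
        ((bf _).inner (bd_cv_u D hα hκ (hη'.pd (xdir i)) hR hR1)))).add
        ((bz.mul (bd_qx hR0 hR1' i)).mul ((bf _).inner bu)))
  · intro i _
    exact (((bz.pow 2).mul (((bd_flux D hα hκ (hη.pd (xdir i)) hR hR1 _).inner bu).add
        ((bf _).inner (bd_cv_u D hα hκ (hη'.pd (xdir i)) hR hR1)))).add
        ((bz.mul (bd_qx hR0 hR1' i)).mul ((bf _).inner bu))).integrable

end Slices

end

section

variable {m n : ℕ} {α κ : ℝ}

/-! ### Energy estimates -/

/-- The mollified gradient. -/
def grd (D : Dat m n α κ) (η : Tan m → ℝ) (z : Tan m × ℝ) (i : Fin (m + 1)) : Val n :=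
  Fin.lastCases (motive := fun _ => Val n) (cv D.g η z.1 z.2) (fun j => cv D.u (pd (xdir j) η) z.1 z.2) i

/-- `|Dw|² + λ |w|²`. -/
def phiSq (D : Dat m n α κ) (η : Tan m → ℝ) (z : Tan m × ℝ) : ℝ :=
  ∑ i, ‖grd D η z i‖ ^ 2 + D.lam * ‖cv D.u η z.1 z.2‖ ^ 2

/-- `(|Dw|² + λ |w|²)^{1/2}`. -/
def phi (D : Dat m n α κ) (η : Tan m → ℝ) (z : Tan m × ℝ) : ℝ := √(phiSq D η z)

/-- The `L_2` norm of the mollified solution. -/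
def enU (D : Dat m n α κ) (η : Tan m → ℝ) (ρ : ℝ) : ENNReal :=
  eLpNorm (fun z : Tan m × ℝ => cv D.u η z.1 z.2) 2 (nuQ m α ρ)

/-- The `L_2` norm of the mollified gradient. -/
def enPhi (D : Dat m n α κ) (η : Tan m → ℝ) (ρ : ℝ) : ENNReal := eLpNorm (phi D η) 2 (nuQ m α ρ)

lemma enU_mono : MonoR (enU (m := m) (n := n) (α := α) (κ := κ)) :=
  fun _ _ _ _ h => eLpNorm_mono_measure _ (nuQ_mono α h)

lemma enPhi_mono : MonoR (enPhi (m := m) (n := n) (α := α) (κ := κ)) :=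
  fun _ _ _ _ h => eLpNorm_mono_measure _ (nuQ_mono α h)

section Pointwise
variable (D : Dat m n α κ) {η η' : Tan m → ℝ} {z : Tan m × ℝ}

lemma phiSq_nonneg (D : Dat m n α κ) (η : Tan m → ℝ) (z : Tan m × ℝ) : 0 ≤ phiSq D η z := by
  have := D.sol.lam_nonneg
  unfold phiSq; positivity

lemma phi_nonneg (D : Dat m n α κ) (η : Tan m → ℝ) (z : Tan m × ℝ) : 0 ≤ phi D η z :=
  Real.sqrt_nonneg _

lemma sq_phi (D : Dat m n α κ) (η : Tan m → ℝ) (z : Tan m × ℝ) : phi D η z ^ 2 = phiSq D η z :=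
  Real.sq_sqrt (phiSq_nonneg D η z)

lemma norm_grd_le (i : Fin (m + 1)) : ‖grd D η z i‖ ≤ phi D η z := by
  apply Real.le_sqrt_of_sq_le
  have h1 := Finset.single_le_sum (f := fun i => ‖grd D η z i‖ ^ 2) (fun _ _ => by positivity)
    (Finset.mem_univ i)
  have := D.sol.lam_nonneg
  have : 0 ≤ D.lam * ‖cv D.u η z.1 z.2‖ ^ 2 := by positivity
  unfold phiSq
  linarith

lemma sqrt_lam_mul_le : √D.lam * ‖cv D.u η z.1 z.2‖ ≤ phi D η z := by
  apply Real.le_sqrt_of_sq_le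
  rw [mul_pow, Real.sq_sqrt D.sol.lam_nonneg]
  have : 0 ≤ ∑ i, ‖grd D η z i‖ ^ 2 := by positivity
  unfold phiSq
  linarith

lemma sum_norm_grd_le : ∑ i, ‖grd D η z i‖ ≤ (m + 1) * phi D η z := by
  refine (Finset.sum_le_sum fun i _ => norm_grd_le D i).trans ?_
  simp

lemma sq_sum_norm_grd_le : (∑ i, ‖grd D η z i‖) ^ 2 ≤ (m + 1) * ∑ i, ‖grd D η z i‖ ^ 2 := by
  have := sq_sum_le_card_mul_sum_sq (s := Finset.univ) (f := fun i => ‖grd D η z i‖)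
  simpa using this

lemma flux_eq_sum (i : Fin (m + 1)) :
    flux D.c D.u D.g i η z.1 z.2 = ∑ j, act (D.c.A i j z.2) (grd D η z j) := by
  rw [Fin.sum_univ_castSucc, flux, add_comm]
  simp [grd]

lemma norm_flux_le (hz : 0 < z.2) (i : Fin (m + 1)) :
    ‖flux D.c D.u D.g i η z.1 z.2‖ ≤ κ⁻¹ * ∑ j, ‖grd D η z j‖ := by
  rw [flux_eq_sum, Finset.mul_sum]
  refine (norm_sum_le _ _).trans (Finset.sum_le_sum fun j _ => (norm_act_le _ _).trans ?_)
  gcongr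
  exact D.sol.adm.A_bounded _ hz _ _

lemma inner_act_le {M : Matrix (Fin n) (Fin n) ℝ} {b : ℝ} (hM : entryNorm M ≤ b) (v w : Val n) :
    |inner ℝ (act M v) w| ≤ b * (‖v‖ * ‖w‖) := by
  refine (abs_real_inner_le_norm _ _).trans ?_
  rw [← mul_assoc]
  gcongr
  exact (norm_act_le _ _).trans (by gcongr)

/-- The quadratic form of the energy identity. -/
def quad (D : Dat m n α κ) (η η' : Tan m → ℝ) (z : Tan m × ℝ) : ℝ :=
  inner ℝ (flux D.c D.u D.g (Fin.last m) η z.1 z.2) (cv D.g η' z.1 z.2) +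
    ∑ i : Fin m, inner ℝ (flux D.c D.u D.g i.castSucc η z.1 z.2) (cv D.u (pd (xdir i) η') z.1 z.2)

/-- The cutoff terms of the energy identity. -/
def cross (D : Dat m n α κ) (R : ℝ) (η η' : Tan m → ℝ) (z : Tan m × ℝ) : ℝ :=
  qd R z * inner ℝ (flux D.c D.u D.g (Fin.last m) η z.1 z.2) (cv D.u η' z.1 z.2) +
    ∑ i : Fin m, qx R i z * inner ℝ (flux D.c D.u D.g i.castSucc η z.1 z.2) (cv D.u η' z.1 z.2)

lemma quad_eq : quad D η η' z = ∑ i, inner ℝ (flux D.c D.u D.g i η z.1 z.2) (grd D η' z i) := by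
  rw [Fin.sum_univ_castSucc, quad, add_comm]
  simp [grd]

lemma le_quad (hz : 0 < z.2) : κ * ∑ i, ‖grd D η z i‖ ^ 2 ≤ quad D η η z := by
  refine (D.sol.adm.A_elliptic _ hz (grd D η z)).trans_eq ?_
  simp only [quad_eq, flux_eq_sum, sum_inner]

lemma abs_quad_le (hκ : 0 < κ) (hz : 0 < z.2) :
    |quad D η η' z| ≤ κ⁻¹ * ((m + 1) ^ 2 * (phi D η z * phi D η' z)) := by
  rw [quad_eq]
  refine (Finset.abs_sum_le_sum_abs _ _).trans ?_
  calc ∑ i, |inner ℝ (flux D.c D.u D.g i η z.1 z.2) (grd D η' z i)|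
      ≤ ∑ i, (κ⁻¹ * ∑ j, ‖grd D η z j‖) * ‖grd D η' z i‖ := by
        refine Finset.sum_le_sum fun i _ => (abs_real_inner_le_norm _ _).trans ?_
        gcongr
        exact norm_flux_le D hz i
    _ = κ⁻¹ * ((∑ j, ‖grd D η z j‖) * ∑ i, ‖grd D η' z i‖) := by rw [← Finset.mul_sum]; ring
    _ ≤ κ⁻¹ * (((m + 1) * phi D η z) * ((m + 1) * phi D η' z)) := by
        have := phi_nonneg D η z
        gcongr
        · exact sum_norm_grd_le D
        · exact sum_norm_grd_le D
    _ = _ := by ring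

lemma abs_cross_le {R : ℝ} (hR0 : 0 ≤ R) (hR1 : R ≤ 1) (h1 : z.1 ∈ tanBox m R)
    (h2 : z.2 ∈ Ioo 0 R) :
    |cross D R η η' z| ≤ 4 * (m + 1) * κ⁻¹ * ((∑ j, ‖grd D η z j‖) * ‖cv D.u η' z.1 z.2‖) := by
  obtain ⟨-, -, bx, bd, -⟩ := cutoff_bounds hR0 hR1 h1 h2
  have hin : ∀ i, |inner ℝ (flux D.c D.u D.g i η z.1 z.2) (cv D.u η' z.1 z.2)| ≤
      κ⁻¹ * (∑ j, ‖grd D η z j‖) * ‖cv D.u η' z.1 z.2‖ := fun i =>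
    (abs_real_inner_le_norm _ _).trans (by gcongr; exact norm_flux_le D h2.1 i)
  have h0 : 0 ≤ κ⁻¹ * (∑ j, ‖grd D η z j‖) * ‖cv D.u η' z.1 z.2‖ := (abs_nonneg _).trans (hin 0)
  have hterm : ∀ (q : ℝ) i, |q| ≤ 4 → |q * inner ℝ (flux D.c D.u D.g i η z.1 z.2)
      (cv D.u η' z.1 z.2)| ≤ 4 * (κ⁻¹ * (∑ j, ‖grd D η z j‖) * ‖cv D.u η' z.1 z.2‖) := by
    intro q i hq
    rw [abs_mul]
    exact mul_le_mul hq (hin i) (abs_nonneg _) (by norm_num)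
  unfold cross
  refine (abs_add_le _ _).trans ((add_le_add (hterm _ _ (by linarith))
    ((Finset.abs_sum_le_sum_abs _ _).trans (Finset.sum_le_sum fun i _ => hterm _ _ (bx i)))).trans_eq ?_)
  simp only [Finset.sum_const, Finset.card_univ, Fintype.card_fin, nsmul_eq_mul]
  ring

end Pointwise

section Bounded
variable (D : Dat m n α κ) {η η' : Tan m → ℝ} {R ρ : ℝ}

lemma bd_grd (hα : -1 < α) (hκ : 0 < κ) (hη : Ker D.δ η) (hR : 1 / 2 ≤ R) (hR1 : R ≤ 1 - D.δ)
    (i : Fin (m + 1)) : Bd (nuQ m α R) fun z => grd D η z i := by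
  refine Fin.lastCases ?_ (fun j => ?_) i
  · simpa [grd] using bd_cv_g D hα hκ hη hR hR1
  · simpa [grd] using bd_cv_u D hα hκ (hη.pd (xdir j)) hR hR1

lemma bd_phiSq (hα : -1 < α) (hκ : 0 < κ) (hη : Ker D.δ η) (hR : 1 / 2 ≤ R) (hR1 : R ≤ 1 - D.δ) :
    Bd (nuQ m α R) (phiSq D η) :=
  (Bd.sum _ fun i _ => (bd_grd D hα hκ hη hR hR1 i).norm.pow 2).add
    ((Bd.const D.lam).mul ((bd_cv_u D hα hκ hη hR hR1).norm.pow 2))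

lemma bd_phi (hα : -1 < α) (hκ : 0 < κ) (hη : Ker D.δ η) (hR : 1 / 2 ≤ R) (hR1 : R ≤ 1 - D.δ) :
    Bd (nuQ m α R) (phi D η) := by
  have h := bd_phiSq D hα hκ hη hR hR1
  obtain ⟨C, hC⟩ := h.bound
  refine ⟨Real.continuous_sqrt.comp_aestronglyMeasurable h.aesm, √C, ?_⟩
  filter_upwards [hC] with z hz
  rw [Real.norm_of_nonneg (phi_nonneg D η z)]
  exact Real.sqrt_le_sqrt ((le_abs_self _).trans hz)

lemma Bd.eLpNorm_two {X E : Type*} [MeasurableSpace X] [NormedAddCommGroup E] {ν : Measure X}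
    [IsFiniteMeasure ν] {f : X → E} (h : Bd ν f) :
    eLpNorm f 2 ν = ENNReal.ofReal (√(∫ z, ‖f z‖ ^ 2 ∂ν)) := by
  obtain ⟨C, hC⟩ := h.bound
  have hm : MemLp f 2 ν := MemLp.of_bound h.aesm C hC
  rw [hm.eLpNorm_eq_integral_rpow_norm (by simp) (by simp), Real.sqrt_eq_rpow]
  norm_num

lemma Bd.integral_mul_le {X : Type*} [MeasurableSpace X] {ν : Measure X} [IsFiniteMeasure ν]
    {f g : X → ℝ} (hf : Bd ν f) (hg : Bd ν g) :
    ∫ z, f z * g z ∂ν ≤ √(∫ z, ‖f z‖ ^ 2 ∂ν) * √(∫ z, ‖g z‖ ^ 2 ∂ν) := by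
  obtain ⟨C, hC⟩ := hf.bound
  obtain ⟨C', hC'⟩ := hg.bound
  have h := integral_mul_norm_le_Lp_mul_Lq (μ := ν) (f := f) (g := g) (p := 2) (q := 2)
    Real.HolderConjugate.two_two
    (by simpa using MemLp.of_bound (p := 2) hf.aesm C hC)
    (by simpa using MemLp.of_bound (p := 2) hg.aesm C' hC')
  simp only [Real.rpow_two, ← Real.sqrt_eq_rpow] at h
  refine le_trans (integral_mono_ae (hf.mul hg).integrable (hf.norm.mul hg.norm).integrable
    (ae_of_all _ fun z => ?_)) h
  simp only
  rw [← norm_mul]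
  exact le_abs_self _

/-- On the smaller cylinder each of the three factors of the cutoff is at least `R - ρ`. For the
lateral factor this uses `R + ρ ≥ 1`. -/
lemma pow_mul_integral_le (hα : -1 < α) (hρ : 1 / 2 ≤ ρ) (hρR : ρ < R) (hR1 : R ≤ 1)
    {f : Tan m × ℝ → ℝ} (hf : Bd (nuQ m α R) f) (hf0 : ∀ z, 0 ≤ f z) :
    (R - ρ) ^ 6 * ∫ z, f z ∂(nuQ m α ρ) ≤ ∫ z, zet R z ^ 2 * f z ∂(nuQ m α R) := by
  have hfin := isFiniteMeasure_nuQ (m := m) hα (show 0 ≤ R by linarith)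
  have bz := bd_zet (m := m) (α := α) (show 0 ≤ R by linarith) hR1
  have hi : Integrable (fun z => zet R z ^ 2 * f z) (nuQ m α R) := ((bz.pow 2).mul hf).integrable
  refine le_trans ?_ (integral_mono_measure (nuQ_mono α hρR.le)
    (ae_of_all _ fun z => mul_nonneg (sq_nonneg _) (hf0 z)) hi)
  rw [← integral_const_mul]
  refine integral_mono_ae ((hf.integrable.mono_measure (nuQ_mono α hρR.le)).const_mul _)
    (hi.mono_measure (nuQ_mono α hρR.le)) ?_
  filter_upwards [ae_nuQ_mem α ρ] with z hz
  obtain ⟨⟨⟨h3, h4⟩, h5⟩, h6, h7⟩ := hz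
  rw [mem_ball_zero_iff] at h5
  refine mul_le_mul_of_nonneg_right ?_ (hf0 z)
  rw [show (R - ρ) ^ 6 = ((R - ρ) * (R - ρ) * (R - ρ)) ^ 2 by ring]
  have hg : 0 < R - ρ := by linarith
  refine pow_le_pow_left₀ (by positivity) ?_ 2
  unfold zet
  have : R - ρ ≤ R ^ 2 - ‖z.1.2‖ ^ 2 := by nlinarith [norm_nonneg z.1.2]
  have t1 : R - ρ ≤ z.1.1 + R := by linarith
  have t2 : R - ρ ≤ R - z.2 := by linarith
  exact mul_le_mul (mul_le_mul t1 this hg.le (hg.le.trans t1)) t2 hg.le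
    (mul_nonneg (hg.le.trans t1) (hg.le.trans this))

/-- The difference of the two sides is a square. With `M = m + 1` the first coefficient is such
that, after Cauchy–Schwarz over the `M` gradient components, the term costs half of the ellipticity.
-/
lemma young_cross {k a b M : ℝ} (hk : 0 < k) (hM : 0 < M) :
    4 * M * k⁻¹ * (a * b) ≤ k / (2 * M) * a ^ 2 + 8 * M ^ 3 * k⁻¹ ^ 3 * b ^ 2 := by
  have h : k / (2 * M) * a ^ 2 + 8 * M ^ 3 * k⁻¹ ^ 3 * b ^ 2 - 4 * M * k⁻¹ * (a * b) =
      k / (2 * M) * (a - 4 * M ^ 2 * k⁻¹ ^ 2 * b) ^ 2 := by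
    field_simp
    ring
  have : 0 ≤ k / (2 * M) * (a - 4 * M ^ 2 * k⁻¹ ^ 2 * b) ^ 2 := by positivity
  linarith

/-- The energy identity with `η' = η`, whose time term has a good sign up to the derivative of the
cutoff. Ellipticity and positivity of `C₀` produce `κ ζ² phiSq`; half of it absorbs the cutoff
terms. The constant collects `κ⁻¹` from the time cutoff and `8 (m + 1)³ κ⁻³` from Young's
inequality. -/
lemma caccioppoli_real (hα : -1 < α) (hκ : 0 < κ) (hη : Ker D.δ η) (hρ : 1 / 2 ≤ ρ) (hρR : ρ < R)
    (hR1 : R ≤ 1 - D.δ) :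
    κ / 2 * ((R - ρ) ^ 6 * ∫ z, phiSq D η z ∂(nuQ m α ρ)) ≤
      (κ⁻¹ + 8 * (m + 1) ^ 3 * κ⁻¹ ^ 3) * ∫ z, ‖cv D.u η z.1 z.2‖ ^ 2 ∂(nuQ m α R) := by
  have hR : 1 / 2 ≤ R := by linarith
  have hR0 : 0 ≤ R := by linarith
  have hR1' : R ≤ 1 := by linarith [D.δ_pos]
  have hfin := isFiniteMeasure_nuQ (m := m) hα hR0
  have bp := bd_phiSq D hα hκ hη hR hR1
  have bf := bd_flux D hα hκ hη hR hR1
  have bu := bd_cv_u D hα hκ hη hR hR1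
  have bt := bd_cv_u D hα hκ (hη.pd (tdir m)) hR hR1
  have bg := bd_cv_g D hα hκ hη hR hR1
  have bz := bd_zet (m := m) (α := α) hR0 hR1'
  have bq := bd_qd (m := m) (α := α) hR0 hR1'
  have e1 := energy_identity D hα hκ hη hη hR hR1
  have e2 := integral_time_identity D hα hκ hη hR hR1
  have h1 := pow_mul_integral_le hα hρ hρR hR1' bp (phiSq_nonneg D η)
  have b1 := ((bz.pow 2).mul ((((bd_a0 D bt).inner bu).add ((Bd.const D.lam).mul
    ((bd_C0 D bu).inner bu))).add (((bf (Fin.last m)).inner bg).add (Bd.sum Finset.univ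
      fun (i : Fin m) _ => (bf i.castSucc).inner (bd_cv_u D hα hκ (hη.pd (xdir i)) hR hR1))))).add
    (bz.mul ((bq.mul ((bf (Fin.last m)).inner bu)).add (Bd.sum Finset.univ fun (i : Fin m) _ =>
      (bd_qx hR0 hR1' i).mul ((bf i.castSucc).inner bu))))
  have b2 := ((bz.pow 2).mul ((Bd.const 2).mul ((bd_a0 D bt).inner bu))).add
    ((bz.mul (bd_qt hR0 hR1')).mul ((bd_a0 D bu).inner bu))
  have b3 : Bd (nuQ m α R) fun z => (κ⁻¹ + 8 * (m + 1 : ℝ) ^ 3 * κ⁻¹ ^ 3) *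
    ‖cv D.u η z.1 z.2‖ ^ 2 := (Bd.const _).mul (bu.norm.pow 2)
  have b4 := ((bz.pow 2).mul bp)
  calc κ / 2 * ((R - ρ) ^ 6 * ∫ z, phiSq D η z ∂(nuQ m α ρ))
      ≤ κ / 2 * ∫ z, zet R z ^ 2 * phiSq D η z ∂(nuQ m α R) := by gcongr
    _ ≤ _ := by
      rw [← integral_const_mul, ← integral_const_mul]
      -- A pointwise inequality whose right-hand side contains the energy integrand, of integral
      -- zero, minus half of the time integrand, of nonnegative integral.
      have h2 := integral_mono_ae (b4.integrable.const_mul (κ / 2))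
        ((b1.integrable.add b3.integrable).sub (b2.integrable.const_mul (1 / 2))) ?_
      · rw [integral_sub' (b1.integrable.add b3.integrable) (b2.integrable.const_mul (1 / 2)),
          integral_add' b1.integrable b3.integrable, e1, integral_const_mul (1 / 2 : ℝ)] at h2
        linarith
      · filter_upwards [ae_nuQ_mem α R] with z hz
        obtain ⟨z0, z1, -, -, qt2⟩ := cutoff_bounds hR0 hR1' hz.1 hz.2
        have hs := hz.2.1
        have c1 := le_quad D (η := η) hs
        have c2 := D.sol.adm.C0_pos _ hs (cv D.u η z.1 z.2)
        have c3 := abs_cross_le D (η := η) (η' := η) hR0 hR1' hz.1 hz.2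
        have c4 := inner_act_le (D.sol.adm.a0_bounded _ hs) (cv D.u η z.1 z.2) (cv D.u η z.1 z.2)
        have c5 := sq_sum_norm_grd_le D (η := η) (z := z)
        have hl := D.sol.lam_nonneg
        simp only [Pi.sub_apply, Pi.add_apply]
        change κ / 2 * (zet R z ^ 2 * (∑ i, ‖grd D η z i‖ ^ 2 + D.lam * ‖cv D.u η z.1 z.2‖ ^ 2)) ≤
          zet R z ^ 2 * (inner ℝ (act (D.c.a0 z.2) (cv D.u (pd (tdir m) η) z.1 z.2))
            (cv D.u η z.1 z.2) + D.lam * inner ℝ (act (D.c.C0 z.2) (cv D.u η z.1 z.2))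
            (cv D.u η z.1 z.2) + quad D η η z) + zet R z * cross D R η η z +
          (κ⁻¹ + 8 * (m + 1 : ℝ) ^ 3 * κ⁻¹ ^ 3) * ‖cv D.u η z.1 z.2‖ ^ 2 - 1 / 2 *
          (zet R z ^ 2 * (2 * inner ℝ (act (D.c.a0 z.2) (cv D.u (pd (tdir m) η) z.1 z.2))
            (cv D.u η z.1 z.2)) + zet R z * qt R z * inner ℝ (act (D.c.a0 z.2) (cv D.u η z.1 z.2))
            (cv D.u η z.1 z.2))
        -- What remains is an inequality between real numbers; the term with `w_t` cancels.
        generalize inner ℝ (act (D.c.a0 z.2) (cv D.u (pd (tdir m) η) z.1 z.2))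
            (cv D.u η z.1 z.2) = a at *
        generalize inner ℝ (act (D.c.a0 z.2) (cv D.u η z.1 z.2)) (cv D.u η z.1 z.2) = b at *
        generalize inner ℝ (act (D.c.C0 z.2) (cv D.u η z.1 z.2)) (cv D.u η z.1 z.2) = cc at *
        generalize ∑ i, ‖grd D η z i‖ ^ 2 = P at *
        generalize hT : ∑ i, ‖grd D η z i‖ = T at *
        generalize ‖cv D.u η z.1 z.2‖ = w at *
        generalize quad D η η z = e at *
        generalize cross D R η η z = q at *
        generalize zet R z = ζ at *
        generalize qt R z = qq at *
        have hM : (0 : ℝ) < m + 1 := by positivity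
        have y1 := young_cross (a := ζ * T) (b := w) hκ hM
        have y2 : κ / (2 * (m + 1)) * (ζ * T) ^ 2 ≤ κ / 2 * (ζ ^ 2 * P) := by
          rw [mul_pow]
          calc κ / (2 * (m + 1)) * (ζ ^ 2 * T ^ 2) ≤ κ / (2 * (m + 1)) * (ζ ^ 2 * ((m + 1) * P)) := by
                gcongr
            _ = _ := by field_simp
        have y3 : -(4 * (m + 1) * κ⁻¹ * (ζ * T * w)) ≤ ζ * q := by
          have := mul_le_mul_of_nonneg_left (abs_le.1 c3).1 z0
          refine le_trans (le_of_eq ?_) this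
          ring
        have y4 : 1 / 2 * (ζ * qq * b) ≤ κ⁻¹ * w ^ 2 := by
          calc 1 / 2 * (ζ * qq * b) ≤ 1 / 2 * |ζ * qq * b| := by gcongr; exact le_abs_self _
            _ = 1 / 2 * (ζ * |qq| * |b|) := by rw [abs_mul, abs_mul, abs_of_nonneg z0]
            _ ≤ 1 / 2 * (1 * 2 * (κ⁻¹ * (w * w))) := by gcongr
            _ = κ⁻¹ * w ^ 2 := by ring
        have y5 : ζ ^ 2 * (κ * P) ≤ ζ ^ 2 * e := by gcongr
        have y6 : κ / 2 * (ζ ^ 2 * (D.lam * w ^ 2)) ≤ ζ ^ 2 * (D.lam * cc) := by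
          have t1 : ζ ^ 2 * (D.lam * (κ * w ^ 2)) ≤ ζ ^ 2 * (D.lam * cc) := by gcongr
          have t2 : 0 ≤ κ / 2 * (ζ ^ 2 * (D.lam * w ^ 2)) := by positivity
          nlinarith
        nlinarith

/-- Here the test function is `w_t` itself, that is `η' = ∂_t η`, and coercivity of `a₀` gives
`|w_t|²`. The other terms are products of first-order quantities of `w` with `w_t` or first-order
quantities of `w_t`, so no symmetry of `A^{ij}` or `C₀` is required. -/
lemma time_real (hα : -1 < α) (hκ : 0 < κ) (hη : Ker D.δ η) (hρ : 1 / 2 ≤ ρ) (hρR : ρ < R)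
    (hR1 : R ≤ 1 - D.δ) :
    κ * ((R - ρ) ^ 6 * ∫ z, ‖cv D.u (pd (tdir m) η) z.1 z.2‖ ^ 2 ∂(nuQ m α ρ)) ≤
      κ⁻¹ * (1 + 4 * (m + 1) ^ 2) * ∫ z, phi D η z * (phi D (pd (tdir m) η) z +
        ‖cv D.u (pd (tdir m) η) z.1 z.2‖) ∂(nuQ m α R) := by
  have hR : 1 / 2 ≤ R := by linarith
  have hR0 : 0 ≤ R := by linarith
  have hR1' : R ≤ 1 := by linarith [D.δ_pos]
  have hfin := isFiniteMeasure_nuQ (m := m) hα hR0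
  have bp := bd_phi D hα hκ hη hR hR1
  have bpt := bd_phi D hα hκ (hη.pd (tdir m)) hR hR1
  have bf := bd_flux D hα hκ hη hR hR1
  have bu := bd_cv_u D hα hκ hη hR hR1
  have bt := bd_cv_u D hα hκ (hη.pd (tdir m)) hR hR1
  have bg := bd_cv_g D hα hκ (hη.pd (tdir m)) hR hR1
  have bz := bd_zet (m := m) (α := α) hR0 hR1'
  have bq := bd_qd (m := m) (α := α) hR0 hR1'
  have e1 := energy_identity D hα hκ hη (hη.pd (tdir m)) hR hR1
  have h1 := pow_mul_integral_le hα hρ hρR hR1' (bt.norm.pow 2) (fun z => by positivity)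
  have b1 := ((bz.pow 2).mul ((((bd_a0 D bt).inner bt).add ((Bd.const D.lam).mul
    ((bd_C0 D bu).inner bt))).add (((bf (Fin.last m)).inner bg).add (Bd.sum Finset.univ
      fun (i : Fin m) _ => (bf i.castSucc).inner
        (bd_cv_u D hα hκ ((hη.pd (tdir m)).pd (xdir i)) hR hR1))))).add
    (bz.mul ((bq.mul ((bf (Fin.last m)).inner bt)).add (Bd.sum Finset.univ fun (i : Fin m) _ =>
      (bd_qx hR0 hR1' i).mul ((bf i.castSucc).inner bt))))
  have b3 : Bd (nuQ m α R) fun z => κ⁻¹ * (1 + 4 * (m + 1 : ℝ) ^ 2) * (phi D η z *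
    (phi D (pd (tdir m) η) z + ‖cv D.u (pd (tdir m) η) z.1 z.2‖)) :=
    (Bd.const _).mul (bp.mul (bpt.add bt.norm))
  calc κ * ((R - ρ) ^ 6 * ∫ z, ‖cv D.u (pd (tdir m) η) z.1 z.2‖ ^ 2 ∂(nuQ m α ρ))
      ≤ κ * ∫ z, zet R z ^ 2 * ‖cv D.u (pd (tdir m) η) z.1 z.2‖ ^ 2 ∂(nuQ m α R) := by gcongr
    _ ≤ _ := by
      rw [← integral_const_mul, ← integral_const_mul]
      have h2 := integral_mono_ae (((bz.pow 2).mul (bt.norm.pow 2)).integrable.const_mul κ)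
        (b1.integrable.add b3.integrable) ?_
      · rw [integral_add' b1.integrable b3.integrable, e1, zero_add] at h2
        exact h2
      · filter_upwards [ae_nuQ_mem α R] with z hz
        obtain ⟨z0, z1, -⟩ := cutoff_bounds hR0 hR1' hz.1 hz.2
        have hs := hz.2.1
        have c1 := abs_quad_le D (η := η) (η' := pd (tdir m) η) hκ hs
        have c2 := inner_act_le (D.sol.adm.C0_bounded _ hs) (cv D.u η z.1 z.2)
          (cv D.u (pd (tdir m) η) z.1 z.2)
        have c3 := abs_cross_le D (η := η) (η' := pd (tdir m) η) hR0 hR1' hz.1 hz.2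
        have c4 := D.sol.adm.a0_pos _ hs (cv D.u (pd (tdir m) η) z.1 z.2)
        have c5 := sum_norm_grd_le D (η := η) (z := z)
        have c6 : D.lam * (‖cv D.u η z.1 z.2‖ * ‖cv D.u (pd (tdir m) η) z.1 z.2‖) ≤
            phi D η z * phi D (pd (tdir m) η) z := by
          have := mul_le_mul (sqrt_lam_mul_le D (η := η) (z := z))
            (sqrt_lam_mul_le D (η := pd (tdir m) η) (z := z)) (by positivity) (phi_nonneg D η z)
          refine le_trans (le_of_eq ?_) this
          nth_rewrite 1 [← Real.mul_self_sqrt D.sol.lam_nonneg]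
          ring
        have hl := D.sol.lam_nonneg
        have p1 := phi_nonneg D η z
        have p2 := phi_nonneg D (pd (tdir m) η) z
        simp only [Pi.add_apply]
        change κ * (zet R z ^ 2 * ‖cv D.u (pd (tdir m) η) z.1 z.2‖ ^ 2) ≤
          zet R z ^ 2 * (inner ℝ (act (D.c.a0 z.2) (cv D.u (pd (tdir m) η) z.1 z.2))
            (cv D.u (pd (tdir m) η) z.1 z.2) + D.lam * inner ℝ (act (D.c.C0 z.2) (cv D.u η z.1 z.2))
            (cv D.u (pd (tdir m) η) z.1 z.2) + quad D η (pd (tdir m) η) z) +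
            zet R z * cross D R η (pd (tdir m) η) z +
          κ⁻¹ * (1 + 4 * (m + 1 : ℝ) ^ 2) * (phi D η z *
            (phi D (pd (tdir m) η) z + ‖cv D.u (pd (tdir m) η) z.1 z.2‖))
        have hw := norm_nonneg (cv D.u (pd (tdir m) η) z.1 z.2)
        generalize inner ℝ (act (D.c.a0 z.2) (cv D.u (pd (tdir m) η) z.1 z.2))
            (cv D.u (pd (tdir m) η) z.1 z.2) = a at *
        generalize inner ℝ (act (D.c.C0 z.2) (cv D.u η z.1 z.2)) (cv D.u (pd (tdir m) η) z.1 z.2) = cc at *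
        generalize ∑ i, ‖grd D η z i‖ = T at *
        generalize ‖cv D.u (pd (tdir m) η) z.1 z.2‖ = v at *
        generalize ‖cv D.u η z.1 z.2‖ = w at *
        generalize quad D η (pd (tdir m) η) z = e at *
        generalize cross D R η (pd (tdir m) η) z = q at *
        generalize zet R z = ζ at *
        generalize phi D η z = f at *
        generalize phi D (pd (tdir m) η) z = f' at *
        have hM : (0 : ℝ) < m + 1 := by positivity
        have hk : 0 < κ⁻¹ := by positivity
        have hζ : ζ ^ 2 ≤ 1 := pow_le_one₀ z0 z1
        have y1 : κ * (ζ ^ 2 * v ^ 2) ≤ ζ ^ 2 * a := by nlinarith [sq_nonneg ζ]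
        have y2 : -(κ⁻¹ * (f * f')) ≤ ζ ^ 2 * (D.lam * cc) := by
          have t1 : |ζ ^ 2 * (D.lam * cc)| ≤ 1 * (κ⁻¹ * (f * f')) := by
            rw [abs_mul, abs_of_nonneg (sq_nonneg ζ), abs_mul, abs_of_nonneg hl]
            refine mul_le_mul hζ ?_ (by positivity) zero_le_one
            calc D.lam * |cc| ≤ D.lam * (κ⁻¹ * (w * v)) := by gcongr
              _ = κ⁻¹ * (D.lam * (w * v)) := by ring
              _ ≤ _ := by gcongr
          rw [one_mul] at t1
          exact (abs_le.1 t1).1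
        have y3 : -(κ⁻¹ * ((m + 1) ^ 2 * (f * f'))) ≤ ζ ^ 2 * e := by
          have t1 : |ζ ^ 2 * e| ≤ 1 * (κ⁻¹ * ((m + 1) ^ 2 * (f * f'))) := by
            rw [abs_mul, abs_of_nonneg (sq_nonneg ζ)]
            gcongr
          rw [one_mul] at t1
          exact (abs_le.1 t1).1
        have y4 : -(4 * (m + 1) * κ⁻¹ * ((m + 1) * f * v)) ≤ ζ * q := by
          have t1 : |ζ * q| ≤ 1 * (4 * (m + 1) * κ⁻¹ * ((m + 1) * f * v)) := by
            rw [abs_mul, abs_of_nonneg z0]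
            refine mul_le_mul z1 (c3.trans ?_) (abs_nonneg _) zero_le_one
            gcongr
          rw [one_mul] at t1
          exact (abs_le.1 t1).1
        have y5 : 0 ≤ κ⁻¹ * ((m + 1) ^ 2 * (f * f')) := by positivity
        have y6 : 0 ≤ κ⁻¹ * (f * v) := by positivity
        nlinarith

end Bounded

end

/-! ### Energy bounds as comparisons between functionals -/

section

variable {m n : ℕ} {α κ : ℝ}

section Reals
variable (D : Dat m n α κ) {η : Tan m → ℝ} {R : ℝ}

lemma enU_eq (hα : -1 < α) (hκ : 0 < κ) (hη : Ker D.δ η) (hR : 1 / 2 ≤ R) (hR1 : R ≤ 1 - D.δ) :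
    enU D η R = ENNReal.ofReal (√(∫ z, ‖cv D.u η z.1 z.2‖ ^ 2 ∂(nuQ m α R))) := by
  have := isFiniteMeasure_nuQ (m := m) hα (show 0 ≤ R by linarith)
  exact (bd_cv_u D hα hκ hη hR hR1).eLpNorm_two

lemma enPhi_eq (hα : -1 < α) (hκ : 0 < κ) (hη : Ker D.δ η) (hR : 1 / 2 ≤ R) (hR1 : R ≤ 1 - D.δ) :
    enPhi D η R = ENNReal.ofReal (√(∫ z, phiSq D η z ∂(nuQ m α R))) := by
  have := isFiniteMeasure_nuQ (m := m) hα (show 0 ≤ R by linarith)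
  rw [enPhi, (bd_phi D hα hκ hη hR hR1).eLpNorm_two]
  simp only [Real.norm_eq_abs, sq_abs, sq_phi]

lemma enU_lt_top (hα : -1 < α) (hκ : 0 < κ) (hη : Ker D.δ η) (hR : 1 / 2 ≤ R) (hR1 : R ≤ 1 - D.δ) :
    enU D η R < ⊤ := by
  rw [enU_eq D hα hκ hη hR hR1]; exact ENNReal.ofReal_lt_top

end Reals

/-- Caccioppoli's inequality. -/
lemma dom_enPhi_enU (hα : -1 < α) (hκ : 0 < κ) :
    Dom (enPhi (m := m) (n := n) (α := α) (κ := κ)) enU := by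
  set C : ℝ := 2 * κ⁻¹ * (κ⁻¹ + 8 * (m + 1) ^ 3 * κ⁻¹ ^ 3) with hC
  have hC0 : 0 ≤ C := by positivity
  refine ⟨√C, 3, Real.sqrt_nonneg _, fun D η ρ R hη hρ hR hR1 => ?_⟩
  have hg : 0 < R - ρ := by linarith
  rw [enPhi_eq D hα hκ hη hρ (by linarith), enU_eq D hα hκ hη (by linarith) hR1,
    ← ENNReal.ofReal_mul (by positivity)]
  apply ENNReal.ofReal_le_ofReal
  have h := caccioppoli_real D hα hκ hη hρ hR hR1
  have hI : 0 ≤ ∫ z, ‖cv D.u η z.1 z.2‖ ^ 2 ∂(nuQ m α R) := integral_nonneg fun z => by positivity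
  have h2 : ∫ z, phiSq D η z ∂(nuQ m α ρ) ≤
      C * ((R - ρ)⁻¹ ^ 3) ^ 2 * ∫ z, ‖cv D.u η z.1 z.2‖ ^ 2 ∂(nuQ m α R) := by
    have h3 := mul_le_mul_of_nonneg_left h (show 0 ≤ 2 * κ⁻¹ * ((R - ρ)⁻¹ ^ 3) ^ 2 by positivity)
    refine le_trans (le_of_eq ?_) (h3.trans_eq ?_)
    · field_simp
    · rw [hC]; ring
  refine (Real.sqrt_le_sqrt h2).trans_eq ?_
  rw [Real.sqrt_mul (by positivity), Real.sqrt_mul hC0, Real.sqrt_sq (by positivity)]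

/-- Cauchy–Schwarz in `time_real`. The result is a geometric mean of the energy of `w` and of norms
of `w_t`, ready for absorption. -/
lemma sq_enU_time_le (hα : -1 < α) (hκ : 0 < κ) : ∃ C : ℝ, 0 ≤ C ∧ ∀ (D : Dat m n α κ) η ρ R,
    Ker D.δ η → 1 / 2 ≤ ρ → ρ < R → R ≤ 1 - D.δ →
      enU D (pd (tdir m) η) ρ ^ 2 ≤ ENNReal.ofReal (C * (R - ρ)⁻¹ ^ 6) *
        (enPhi D η R * (enPhi D (pd (tdir m) η) R + enU D (pd (tdir m) η) R)) := by
  refine ⟨κ⁻¹ * (κ⁻¹ * (1 + 4 * (m + 1) ^ 2)), by positivity, fun D η ρ R hη hρ hρR hR1 => ?_⟩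
  have hg : 0 < R - ρ := by linarith
  have hR : 1 / 2 ≤ R := by linarith
  have hfin := isFiniteMeasure_nuQ (m := m) hα (show 0 ≤ R by linarith)
  have hηt := hη.pd (tdir m)
  have h := time_real D hα hκ hη hρ hρR hR1
  have bp := bd_phi D hα hκ hη hR hR1
  have bpt := bd_phi D hα hκ hηt hR hR1
  have bt := bd_cv_u D hα hκ hηt hR hR1
  have h1 := bp.integral_mul_le bpt
  have h2 := bp.integral_mul_le bt.norm
  simp only [Real.norm_eq_abs, sq_abs, sq_phi, abs_norm] at h1 h2
  have h3 : ∫ z, phi D η z * (phi D (pd (tdir m) η) z +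
        ‖cv D.u (pd (tdir m) η) z.1 z.2‖) ∂(nuQ m α R) ≤
      √(∫ z, phiSq D η z ∂(nuQ m α R)) * (√(∫ z, phiSq D (pd (tdir m) η) z ∂(nuQ m α R)) +
        √(∫ z, ‖cv D.u (pd (tdir m) η) z.1 z.2‖ ^ 2 ∂(nuQ m α R))) := by
    simp only [mul_add]
    rw [integral_add (bp.mul bpt).integrable (bp.mul bt.norm).integrable]
    exact add_le_add h1 h2
  rw [enPhi_eq D hα hκ hη hR hR1, enPhi_eq D hα hκ hηt hR hR1, enU_eq D hα hκ hηt hR hR1,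
    enU_eq D hα hκ hηt hρ (by linarith), ← ENNReal.ofReal_add (by positivity) (by positivity),
    ← ENNReal.ofReal_mul (by positivity), ← ENNReal.ofReal_mul (by positivity),
    ← ENNReal.ofReal_pow (by positivity)]
  apply ENNReal.ofReal_le_ofReal
  rw [Real.sq_sqrt (integral_nonneg fun z => by positivity)]
  have h4 := mul_le_mul_of_nonneg_left (h.trans (mul_le_mul_of_nonneg_left h3 (by positivity)))
    (show 0 ≤ κ⁻¹ * (R - ρ)⁻¹ ^ 6 by positivity)
  refine le_trans (le_of_eq ?_) (h4.trans_eq ?_)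
  · field_simp
  · ring

/-- The time derivative is controlled by the gradient. -/
lemma dom_enU_time (hα : -1 < α) (hκ : 0 < κ) :
    Dom (fun D η => enU D (pd (tdir m) η)) (enPhi (m := m) (n := n) (α := α) (κ := κ)) := by
  obtain ⟨C, hC, h1⟩ := sq_enU_time_le (m := m) (n := n) hα hκ
  obtain ⟨C', K, hC', h2⟩ := dom_enPhi_enU (m := m) (n := n) hα hκ
  -- Caccioppoli's inequality for `w_t` bounds its energy by its own `L_2` norm on a larger
  -- cylinder, so `‖w_t‖²` is at most a constant times `‖w_t‖` times the energy of `w`. The powers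
  -- of two come from splitting the gap at the midpoint.
  refine Dom.absorb (C := C * 2 ^ 6 * (C' * 2 ^ K + 1)) (K := 6 + K) (by positivity)
    (fun D η ρ R h => enU_mono _ _ _ _ h)
    (fun D η ρ hη hρ hρ1 => enU_lt_top D hα hκ (hη.pd _) hρ hρ1) enPhi_mono
    (fun D η ρ R hη hρ hR hR1 => ?_)
  have hm1 : ρ < (ρ + R) / 2 := by linarith
  have hm2 : (ρ + R) / 2 < R := by linarith
  have hg1 : ((ρ + R) / 2 - ρ)⁻¹ = 2 * (R - ρ)⁻¹ := by
    rw [show (ρ + R) / 2 - ρ = (R - ρ) / 2 by ring, inv_div, div_eq_mul_inv]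
  have hg2 : (R - (ρ + R) / 2)⁻¹ = 2 * (R - ρ)⁻¹ := by
    rw [show R - (ρ + R) / 2 = (R - ρ) / 2 by ring, inv_div, div_eq_mul_inv]
  have hg : 1 ≤ (R - ρ)⁻¹ := one_le_inv_gap D hρ hR hR1
  have hg0 : 0 ≤ (R - ρ)⁻¹ := by linarith
  have a1 := h1 D η ρ _ hη hρ hm1 (hm2.le.trans hR1)
  have a2 := h2 D _ _ R (hη.pd (tdir m)) (by linarith) hm2 hR1
  rw [hg1] at a1
  rw [hg2] at a2
  have a3 : enPhi D (pd (tdir m) η) ((ρ + R) / 2) + enU D (pd (tdir m) η) ((ρ + R) / 2) ≤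
      ENNReal.ofReal ((C' * 2 ^ K + 1) * (R - ρ)⁻¹ ^ K) * enU D (pd (tdir m) η) R := by
    have a4 : enU D (pd (tdir m) η) ((ρ + R) / 2) ≤ ENNReal.ofReal ((R - ρ)⁻¹ ^ K) *
        enU D (pd (tdir m) η) R := by
      refine (enU_mono _ _ _ _ hm2.le).trans ?_
      refine le_mul_of_one_le_left' ?_
      rw [← ENNReal.ofReal_one]
      exact ENNReal.ofReal_le_ofReal (one_le_pow₀ hg)
    refine (add_le_add a2 a4).trans_eq ?_
    rw [← add_mul, ← ENNReal.ofReal_add (by positivity) (by positivity)]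
    congr 2
    rw [mul_pow]; ring
  refine a1.trans ?_
  calc _ ≤ ENNReal.ofReal (C * (2 * (R - ρ)⁻¹) ^ 6) * (enPhi D η R *
        (ENNReal.ofReal ((C' * 2 ^ K + 1) * (R - ρ)⁻¹ ^ K) * enU D (pd (tdir m) η) R)) := by
        gcongr
        exact enPhi_mono _ _ _ _ hm2.le
    _ = ENNReal.ofReal (C * (2 * (R - ρ)⁻¹) ^ 6) * ENNReal.ofReal ((C' * 2 ^ K + 1) *
        (R - ρ)⁻¹ ^ K) * (enU D (pd (tdir m) η) R * enPhi D η R) := by ring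
    _ = _ := by
        rw [← ENNReal.ofReal_mul (by positivity)]
        congr 2
        rw [mul_pow, pow_add]; ring

/-- Multiplication of a kernel by `√λ`. -/
def sqMul (D : Dat m n α κ) (η : Tan m → ℝ) : Tan m → ℝ := fun y => √D.lam * η y

lemma Ker.sqMul {D : Dat m n α κ} {η : Tan m → ℝ} (h : Ker D.δ η) : Ker D.δ (sqMul D η) :=
  h.smul _

lemma sqMul_sqMul (D : Dat m n α κ) (η : Tan m → ℝ) : sqMul D (sqMul D η) = lamMul D η := by
  ext y
  change √D.lam * (√D.lam * η y) = D.lam * η y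
  rw [← mul_assoc, Real.mul_self_sqrt D.sol.lam_nonneg]

lemma norm_cv_sqMul_le (D : Dat m n α κ) (η : Tan m → ℝ) (z : Tan m × ℝ) :
    ‖cv D.u (sqMul D η) z.1 z.2‖ ≤ ‖phi D η z‖ := by
  change ‖cv D.u (fun y => √D.lam * η y) z.1 z.2‖ ≤ _
  rw [cv_smul, norm_smul, Real.norm_of_nonneg (Real.sqrt_nonneg _),
    Real.norm_of_nonneg (phi_nonneg _ _ _)]
  exact sqrt_lam_mul_le D

lemma enU_sqMul_le (D : Dat m n α κ) (η : Tan m → ℝ) (ρ : ℝ) : enU D (sqMul D η) ρ ≤ enPhi D η ρ :=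
  eLpNorm_mono fun z => norm_cv_sqMul_le D η z

lemma enU_pd_le (D : Dat m n α κ) (η : Tan m → ℝ) (i : Fin m) (ρ : ℝ) :
    enU D (pd (xdir i) η) ρ ≤ enPhi D η ρ := by
  refine eLpNorm_mono fun z => ?_
  rw [Real.norm_of_nonneg (phi_nonneg _ _ _)]
  have := norm_grd_le D (η := η) (z := z) i.castSucc
  simpa [grd] using this

lemma dom_enU_pd_enPhi (i : Fin m) :
    Dom (fun D η => enU D (pd (xdir i) η)) (enPhi (m := m) (n := n) (α := α) (κ := κ)) :=
  Dom.of_le (C := 1) enPhi_mono fun D η ρ _ _ _ => by simpa using enU_pd_le D η i ρ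

lemma dom_enU_sqMul_enPhi :
    Dom (fun D η => enU D (sqMul D η)) (enPhi (m := m) (n := n) (α := α) (κ := κ)) :=
  Dom.of_le (C := 1) enPhi_mono fun D η ρ _ _ _ => by simpa using enU_sqMul_le D η ρ

/-- Write `λ w = √λ (√λ w)`. The outer `√λ` is absorbed into the energy of `√λ w`, which
Caccioppoli's inequality bounds by the `L_2` norm of `√λ w`, and this is part of the energy of `w`.
The constant does not depend on `λ`. -/
lemma dom_enU_lamMul_enPhi (hα : -1 < α) (hκ : 0 < κ) :
    Dom (fun D η => enU D (lamMul D η)) (enPhi (m := m) (n := n) (α := α) (κ := κ)) := by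
  have h1 := (dom_enU_sqMul_enPhi (m := m) (n := n) (α := α) (κ := κ)).comp (T := sqMul)
    fun D η hη => hη.sqMul
  have h2 := (dom_enPhi_enU (m := m) (n := n) hα hκ).comp (T := sqMul) fun D η hη => hη.sqMul
  have h3 := (h1.trans h2).trans dom_enU_sqMul_enPhi
  simpa only [sqMul_sqMul] using h3

lemma dom_enU_time_self (hα : -1 < α) (hκ : 0 < κ) :
    Dom (fun D η => enU D (pd (tdir m) η)) (enU (m := m) (n := n) (α := α) (κ := κ)) :=
  (dom_enU_time hα hκ).trans (dom_enPhi_enU hα hκ)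

lemma dom_enU_lamMul_self (hα : -1 < α) (hκ : 0 < κ) :
    Dom (fun D η => enU D (lamMul D η)) (enU (m := m) (n := n) (α := α) (κ := κ)) :=
  (dom_enU_lamMul_enPhi hα hκ).trans (dom_enPhi_enU hα hκ)

lemma dom_enU_pd_self (hα : -1 < α) (hκ : 0 < κ) (i : Fin m) :
    Dom (fun D η => enU D (pd (xdir i) η)) (enU (m := m) (n := n) (α := α) (κ := κ)) :=
  (dom_enU_pd_enPhi i).trans (dom_enPhi_enU hα hκ)

end

section

variable {m n : ℕ} {α κ : ℝ}

/-! ### A Sobolev inequality in the tangential variables -/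

/-- The fundamental theorem of calculus averaged over an interval. The interval lies to the left of
`a`, so that in the time variable only the past is used and the final time `0` is never crossed. -/
lemma enorm_le_lintegral_Ioo {h h' : ℝ → Val n} (hd : ∀ t, HasDerivAt h (h' t) t)
    (hc : Continuous h') (a : ℝ) {ℓ : ℝ} (hℓ : 0 < ℓ) (hℓ1 : ℓ ≤ 1) :
    ‖h a‖ₑ ≤ ENNReal.ofReal ℓ⁻¹ * ∫⁻ t in Ioo (a - ℓ) a, (‖h t‖ₑ + ‖h' t‖ₑ) := by
  have hch : Continuous h := continuous_iff_continuousAt.2 fun t => (hd t).continuousAt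
  have h1 : ∀ t ∈ Ioo (a - ℓ) a, ‖h a‖ₑ ≤ ‖h t‖ₑ + ∫⁻ τ in Ioo (a - ℓ) a, ‖h' τ‖ₑ := by
    intro t ht
    have e := intervalIntegral.integral_eq_sub_of_hasDerivAt (fun x _ => hd x)
      (hc.intervalIntegrable t a)
    have e2 : h a = h t + ∫ τ in t..a, h' τ := by rw [e]; abel
    rw [e2]
    refine (enorm_add_le _ _).trans (add_le_add le_rfl ?_)
    rw [intervalIntegral.integral_of_le ht.2.le, integral_Ioc_eq_integral_Ioo]
    exact (enorm_integral_le_lintegral_enorm _).trans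
      (lintegral_mono_set (Ioo_subset_Ioo_left ht.1.le))
  have h2 := setLIntegral_mono' (μ := volume) measurableSet_Ioo h1
  rw [setLIntegral_const, Real.volume_Ioo, lintegral_add_left hch.measurable.enorm,
    setLIntegral_const, Real.volume_Ioo, sub_sub_cancel] at h2
  have hl : ENNReal.ofReal ℓ⁻¹ * ENNReal.ofReal ℓ = 1 := by
    rw [← ENNReal.ofReal_mul (by positivity), inv_mul_cancel₀ hℓ.ne', ENNReal.ofReal_one]
  calc ‖h a‖ₑ = ENNReal.ofReal ℓ⁻¹ * (‖h a‖ₑ * ENNReal.ofReal ℓ) := by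
        rw [mul_left_comm, hl, mul_one]
    _ ≤ ENNReal.ofReal ℓ⁻¹ * ((∫⁻ t in Ioo (a - ℓ) a, ‖h t‖ₑ) +
        (∫⁻ τ in Ioo (a - ℓ) a, ‖h' τ‖ₑ) * 1) := by
        refine mul_le_mul_right (h2.trans ?_) _
        gcongr
        rw [← ENNReal.ofReal_one]
        exact ENNReal.ofReal_le_ofReal hℓ1
    _ = _ := by rw [mul_one, lintegral_add_left hch.measurable.enorm]

/-- Coordinates on the tangential variables. -/
def co (x : Fin (m + 1) → ℝ) : Tan m := (x 0, WithLp.toLp 2 fun j => x j.succ)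

/-- Coordinate directions. -/
def dirc (i : Fin (m + 1)) : Tan m := Fin.cases (motive := fun _ => Tan m) (tdir m) xdir i

lemma continuous_co : Continuous (co (m := m)) := by
  unfold co
  refine (continuous_apply 0).prodMk ((PiLp.continuous_toLp 2 _).comp ?_)
  exact continuous_pi fun j => continuous_apply _

lemma co_update (x : Fin (m + 1) → ℝ) (i : Fin (m + 1)) (τ : ℝ) :
    co (Function.update x i τ) = co x + (τ - x i) • dirc i := by
  refine Fin.cases ?_ (fun j => ?_) i
  · ext k
    · simp [co, dirc, tdir]
    · simp [co, dirc, tdir]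
  · ext k
    · simp [co, dirc, xdir, Function.update_of_ne (Fin.succ_ne_zero j).symm]
    · by_cases h : k = j
      · subst h; simp [co, dirc, xdir]
      · simp [co, dirc, xdir, h]

lemma measurePreserving_co : MeasurePreserving (co (m := m)) := by
  have h1 := volume_preserving_piFinSuccAbove (fun _ : Fin (m + 1) => ℝ) 0
  have h2 : MeasurePreserving (Prod.map id (WithLp.toLp 2 : (Fin m → ℝ) → EuclideanSpace ℝ (Fin m)))
      (volume : Measure (ℝ × (Fin m → ℝ))) (volume : Measure (Tan m)) :=
    (MeasurePreserving.id volume).prod (PiLp.volume_preserving_toLp (Fin m))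
  have h3 := h2.comp h1
  exact h3

lemma co_mem_tanBox {x : Fin (m + 1) → ℝ} {i : Fin (m + 1)} {τ ρ R : ℝ} (hρR : ρ < R)
    (hx : co x ∈ tanBox m ρ) (hτ : τ ∈ Ioo (x i - (R - ρ)) (x i)) :
    co (Function.update x i τ) ∈ tanBox m R := by
  obtain ⟨⟨h1, h2⟩, h3⟩ := hx
  rw [mem_ball_zero_iff] at h3
  rw [co_update]
  revert hτ
  refine Fin.cases ?_ (fun j => ?_) i
  · intro hτ
    refine ⟨⟨?_, ?_⟩, ?_⟩
    · simp [dirc, tdir]; simp [co] at h1 ⊢; linarith [hτ.1]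
    · simp [dirc, tdir]; simp [co] at h2 ⊢; linarith [hτ.2]
    · simp [dirc, tdir]; linarith
  · intro hτ
    refine ⟨⟨?_, ?_⟩, ?_⟩
    · simp [dirc, xdir]; linarith
    · simp [dirc, xdir]; linarith
    · rw [mem_ball_zero_iff]
      refine (norm_add_le _ _).trans_lt ?_
      have : ‖((τ - x j.succ) • dirc (m := m) j.succ).2‖ ≤ R - ρ := by
        simp only [dirc, xdir, Fin.cases_succ, Prod.smul_snd, norm_smul, Real.norm_eq_abs,
          PiLp.norm_single, norm_one, mul_one]
        rw [abs_le]; constructor <;> linarith [hτ.1, hτ.2]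
      linarith

section Tot
variable (D : Dat m n α κ) {η : Tan m → ℝ}

lemma cv_le_lintegral {f : Tan m × ℝ → Val n} {s : ℝ} (hf : Integrable fun y => f (y, s))
    {δ : ℝ} (hη : Ker δ η) (x : Fin (m + 1) → ℝ) (i : Fin (m + 1)) {ℓ : ℝ} (hℓ : 0 < ℓ)
    (hℓ1 : ℓ ≤ 1) :
    ‖cv f η (co x) s‖ₑ ≤ ENNReal.ofReal ℓ⁻¹ * ∫⁻ t in Ioo (x i - ℓ) (x i),
      (‖cv f η (co (Function.update x i t)) s‖ₑ +
        ‖cv f (pd (dirc i) η) (co (Function.update x i t)) s‖ₑ) := by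
  have hcd : ∀ t : ℝ, HasDerivAt (fun t => co (Function.update x i t)) (dirc i) t := by
    intro t
    simp only [co_update]
    simpa using (((hasDerivAt_id t).sub_const (x i)).smul_const (dirc (m := m) i)).const_add (co x)
  have h := enorm_le_lintegral_Ioo (h := fun t => cv f η (co (Function.update x i t)) s)
    (h' := fun t => cv f (pd (dirc i) η) (co (Function.update x i t)) s) (fun t => ?_) ?_ (x i) hℓ hℓ1
  · simpa only [Function.update_eq_self] using h
  · have h1 := (hasFDerivAt_cv hf hη.smooth hη.hasCompactSupport
      (co (Function.update x i t))).comp_hasDerivAt t (hcd t)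
    rw [fderiv_cv hf hη.smooth hη.hasCompactSupport] at h1
    exact h1
  · have h1 := (contDiff_cv hf (hη.pd (dirc i)).smooth (hη.pd (dirc i)).hasCompactSupport).continuous
    exact h1.comp (continuous_co.comp (continuous_const.update i continuous_id))

/-- Differentiating along a coordinate acts on the kernel, so each term of `tot` has its derivative
in the `tot` of the differentiated kernel. -/
lemma tot_le_lintegral {s : ℝ} (hu : Integrable fun y => D.u (y, s))
    (hg : Integrable fun y => D.g (y, s)) (hη : Ker D.δ η) (x : Fin (m + 1) → ℝ) (i : Fin (m + 1))
    {ℓ : ℝ} (hℓ : 0 < ℓ) (hℓ1 : ℓ ≤ 1) :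
    tot D η (co x) s ≤ ENNReal.ofReal ℓ⁻¹ * ∫⁻ t in Ioo (x i - ℓ) (x i),
      (tot D η (co (Function.update x i t)) s + tot D (pd (dirc i) η) (co (Function.update x i t)) s) := by
  have hmeas : ∀ (f : Tan m × ℝ → Val n) (η : Tan m → ℝ), StronglyMeasurable f → Ker D.δ η →
      Measurable fun t => ‖cv f η (co (Function.update x i t)) s‖ₑ := by
    intro f η hf hη
    refine ((stronglyMeasurable_cv hf hη.smooth.continuous).comp_measurable
      (g := fun t : ℝ => (co (Function.update x i t), s)) ?_).enorm
    exact ((continuous_co.comp (continuous_const.update i continuous_id)).prodMk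
      continuous_const).measurable
  have m1 := hmeas D.u η D.sol.meas_u hη
  have m2 := hmeas D.g η D.sol.meas_g hη
  have m3 := fun j : Fin m => hmeas D.u _ D.sol.meas_u (hη.pd (xdir j))
  have m4 := hmeas D.u _ D.sol.meas_u (hη.pd (dirc i))
  have m5 := hmeas D.g _ D.sol.meas_g (hη.pd (dirc i))
  have m6 := fun j : Fin m => hmeas D.u _ D.sol.meas_u ((hη.pd (xdir j)).pd (dirc i))
  have e : ∀ t, tot D η (co (Function.update x i t)) s +
      tot D (pd (dirc i) η) (co (Function.update x i t)) s =
      (‖cv D.u η (co (Function.update x i t)) s‖ₑ +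
        ‖cv D.u (pd (dirc i) η) (co (Function.update x i t)) s‖ₑ) +
      ((‖cv D.g η (co (Function.update x i t)) s‖ₑ +
        ‖cv D.g (pd (dirc i) η) (co (Function.update x i t)) s‖ₑ) +
      ∑ j : Fin m, (‖cv D.u (pd (xdir j) η) (co (Function.update x i t)) s‖ₑ +
        ‖cv D.u (pd (dirc i) (pd (xdir j) η)) (co (Function.update x i t)) s‖ₑ)) := by
    intro t
    simp only [tot, Finset.sum_add_distrib, pd_comm hη.smooth (dirc i) (xdir _)]
    ring
  simp only [e]
  have a1 : Measurable fun t => ‖cv D.u η (co (Function.update x i t)) s‖ₑ +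
      ‖cv D.u (pd (dirc i) η) (co (Function.update x i t)) s‖ₑ := m1.add m4
  have a2 : Measurable fun t => ‖cv D.g η (co (Function.update x i t)) s‖ₑ +
      ‖cv D.g (pd (dirc i) η) (co (Function.update x i t)) s‖ₑ := m2.add m5
  have a3 : ∀ j : Fin m, Measurable fun t =>
      ‖cv D.u (pd (xdir j) η) (co (Function.update x i t)) s‖ₑ +
      ‖cv D.u (pd (dirc i) (pd (xdir j) η)) (co (Function.update x i t)) s‖ₑ :=
    fun j => (m3 j).add (m6 j)
  rw [lintegral_add_left a1, lintegral_add_left a2, lintegral_finsetSum _ fun j _ => a3 j, mul_add, mul_add, Finset.mul_sum, tot,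
    add_assoc]
  refine add_le_add (cv_le_lintegral hu hη x i hℓ hℓ1) (add_le_add
    (cv_le_lintegral hg hη x i hℓ hℓ1) (Finset.sum_le_sum fun j _ =>
      cv_le_lintegral hu (hη.pd (xdir j)) x i hℓ hℓ1))

/-- The integral in the normal variable, restricted to a cylinder. -/
def normalInt (D : Dat m n α κ) (η : Tan m → ℝ) (ρ : ℝ) (x : Fin (m + 1) → ℝ) : ENNReal :=
  (co ⁻¹' tanBox m ρ).indicator (fun x => ∫⁻ s, tot D η (co x) s ∂(wt α ρ)) x

lemma measurable_tot_co (hη : Ker D.δ η) :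
    Measurable fun z : (Fin (m + 1) → ℝ) × ℝ => tot D η (co z.1) z.2 :=
  Measurable.comp (g := fun z : Tan m × ℝ => tot D η z.1 z.2)
    (f := fun z : (Fin (m + 1) → ℝ) × ℝ => ((co z.1, z.2) : Tan m × ℝ)) (measurable_tot D hη)
    ((continuous_co.comp continuous_fst).prodMk continuous_snd).measurable

lemma measurable_normalInt (hη : Ker D.δ η) (ρ : ℝ) : Measurable (normalInt D η ρ) := by
  refine Measurable.indicator ?_ (continuous_co.measurable (measurableSet_tanBox ρ))
  exact (measurable_tot_co D hη).lintegral_prod_right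

/-- The one-coordinate Sobolev step survives integration in the normal variable by Tonelli.
Extending by zero outside the cylinder allows the integral to run over the whole line. -/
lemma normalInt_le (hη : Ker D.δ η) {ρ R : ℝ} (hρ : 1 / 2 ≤ ρ) (hρR : ρ < R) (hR1 : R ≤ 1 - D.δ)
    (i : Fin (m + 1)) (x : Fin (m + 1) → ℝ) :
    normalInt D η ρ x ≤ ENNReal.ofReal (R - ρ)⁻¹ * ∫⁻ t, (normalInt D η R (Function.update x i t) +
      normalInt D (pd (dirc i) η) R (Function.update x i t)) := by
  by_cases hx : x ∈ co ⁻¹' tanBox m ρ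
  swap
  · rw [normalInt, indicator_of_notMem hx]; exact zero_le
  have hR1' : R ≤ 1 := by linarith [D.δ_pos]
  have hℓ : 0 < R - ρ := by linarith
  have hup : Measurable fun t : ℝ => Function.update x i t :=
    (continuous_const.update i continuous_id).measurable
  have hj : ∀ η, Ker D.δ η → Measurable fun z : ℝ × ℝ =>
      tot D η (co (Function.update x i z.2)) z.1 := fun η hη =>
    Measurable.comp (g := fun z : (Fin (m + 1) → ℝ) × ℝ => tot D η (co z.1) z.2)
      (f := fun z : ℝ × ℝ => (Function.update x i z.2, z.1)) (measurable_tot_co D hη)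
      ((hup.comp measurable_snd).prodMk measurable_fst)
  rw [normalInt, indicator_of_mem hx]
  calc ∫⁻ s, tot D η (co x) s ∂(wt α ρ) ≤ ∫⁻ s, tot D η (co x) s ∂(wt α R) :=
        lintegral_mono' (wt_mono α hρR.le) le_rfl
    _ ≤ ∫⁻ s, ENNReal.ofReal (R - ρ)⁻¹ * (∫⁻ t in Ioo (x i - (R - ρ)) (x i),
      (tot D η (co (Function.update x i t)) s +
        tot D (pd (dirc i) η) (co (Function.update x i t)) s)) ∂(wt α R) := by
        refine lintegral_mono_ae ?_
        filter_upwards [ae_integrable_slice D.sol.int_u hR1', ae_integrable_slice D.sol.int_g hR1']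
          with s hu hg
        exact tot_le_lintegral D hu hg hη x i hℓ (by linarith)
    _ = ENNReal.ofReal (R - ρ)⁻¹ * ∫⁻ t in Ioo (x i - (R - ρ)) (x i), ∫⁻ s,
      (tot D η (co (Function.update x i t)) s +
        tot D (pd (dirc i) η) (co (Function.update x i t)) s) ∂(wt α R) := by
        rw [lintegral_const_mul' _ _ ENNReal.ofReal_ne_top, lintegral_lintegral_swap]
        exact ((hj η hη).add (hj _ (hη.pd _))).aemeasurable
    _ = ENNReal.ofReal (R - ρ)⁻¹ * ∫⁻ t in Ioo (x i - (R - ρ)) (x i),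
      (normalInt D η R (Function.update x i t) +
        normalInt D (pd (dirc i) η) R (Function.update x i t)) := by
        congr 1
        refine setLIntegral_congr_fun measurableSet_Ioo fun t ht => ?_
        have hmem := co_mem_tanBox hρR hx ht
        simp only [normalInt]
        rw [indicator_of_mem (show Function.update x i t ∈ co ⁻¹' tanBox m R from hmem),
          indicator_of_mem (show Function.update x i t ∈ co ⁻¹' tanBox m R from hmem),
          lintegral_add_left (measurable_tot_right D hη _)]
    _ ≤ _ := by
        gcongr
        exact Measure.restrict_le_self

end Tot

/-- Partial integrals in the tangential variables. -/
def marg (J : Finset (Fin (m + 1))) (D : Dat m n α κ) (η : Tan m → ℝ) (ρ : ℝ) : ENNReal :=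
  ⨆ x, lmarginal (fun _ => volume) J (normalInt D η ρ) x

/-- Removing the coordinate `i` from the integration trades an integral for a supremum, at the cost
of one derivative in that coordinate, which `E` must control. -/
lemma Dom.marg_insert {E : Dat m n α κ → (Tan m → ℝ) → ℝ → ENNReal} {J : Finset (Fin (m + 1))}
    {i : Fin (m + 1)} (hi : i ∉ J) (h : Dom (marg (insert i J)) E)
    (hE : Dom (fun D η => E D (pd (dirc i) η)) E) : Dom (marg J) E := by
  have h1 := (h.comp (T := fun _ η => pd (dirc i) η) fun _ _ hη => hη.pd _).trans hE
  refine Dom.trans (G := fun D η ρ => marg (insert i J) D η ρ + marg (insert i J) D (pd (dirc i) η) ρ)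
    ⟨1, 1, zero_le_one, fun D η ρ R hη hρ hR hR1 => ?_⟩ (h.add h1)
  rw [one_mul, pow_one]
  refine iSup_le fun x => ?_
  have m1 := measurable_normalInt D hη R
  have m2 := measurable_normalInt D (hη.pd (dirc i)) R
  calc lmarginal (fun _ => volume) J (normalInt D η ρ) x
      ≤ lmarginal (fun _ => volume) J (fun x => ENNReal.ofReal (R - ρ)⁻¹ * ∫⁻ t,
          (normalInt D η R + normalInt D (pd (dirc i) η) R) (Function.update x i t)) x :=
        lmarginal_mono (fun x => normalInt_le D hη hρ hR hR1 i x) x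
    _ = ENNReal.ofReal (R - ρ)⁻¹ * lmarginal (fun _ => volume) (insert i J)
          (normalInt D η R + normalInt D (pd (dirc i) η) R) x := by
        rw [lmarginal_insert' _ (m1.add m2) hi]
        simp only [lmarginal]
        rw [lintegral_const_mul' _ _ ENNReal.ofReal_ne_top]
    _ ≤ _ := by
        gcongr
        simp only [lmarginal, Pi.add_apply]
        have m3 : Measurable fun y => normalInt D η R (Function.updateFinset x (insert i J) y) :=
          m1.comp measurable_updateFinset
        rw [lintegral_add_left m3]
        exact add_le_add (le_iSup (fun x => lmarginal (fun _ => volume) (insert i J)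
          (normalInt D η R) x) x) (le_iSup (fun x => lmarginal (fun _ => volume) (insert i J)
          (normalInt D (pd (dirc i) η) R) x) x)

lemma marg_univ_eq (D : Dat m n α κ) {η : Tan m → ℝ} (hη : Ker D.δ η) (ρ : ℝ) :
    marg Finset.univ D η ρ = ∫⁻ z, tot D η z.1 z.2 ∂(nuQ m α ρ) := by
  have h1 : Measurable fun y => ∫⁻ s, tot D η y s ∂(wt α ρ) :=
    (measurable_tot D hη).lintegral_prod_right
  have h2 : ∫⁻ x, normalInt D η ρ x = ∫⁻ z, tot D η z.1 z.2 ∂(nuQ m α ρ) := by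
    rw [nuQ, lintegral_prod _ (measurable_tot D hη).aemeasurable,
      ← lintegral_indicator (measurableSet_tanBox ρ),
      ← measurePreserving_co.lintegral_comp (h1.indicator (measurableSet_tanBox ρ))]
    rfl
  rw [marg, ← h2]
  simp only [lmarginal_univ]
  exact ciSup_const

lemma supInt_le_marg (D : Dat m n α κ) (η : Tan m → ℝ) (ρ : ℝ) :
    supInt D η ρ ≤ marg ∅ D η ρ := by
  rw [supInt_le_iff]
  intro y hy
  have hx : co (Fin.cons y.1 y.2.ofLp : Fin (m + 1) → ℝ) = y := by
    ext <;> simp [co]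
  refine le_trans (le_of_eq ?_) (le_iSup (fun x => lmarginal (fun _ => volume) ∅ (normalInt D η ρ) x)
    (Fin.cons y.1 y.2.ofLp : Fin (m + 1) → ℝ))
  rw [lmarginal_empty, normalInt, indicator_of_mem (by rw [mem_preimage, hx]; exact hy), hx]

lemma stronglyMeasurable_phi (D : Dat m n α κ) {η : Tan m → ℝ} (hη : Ker D.δ η) :
    StronglyMeasurable (phi D η) := by
  have hg : ∀ i, StronglyMeasurable fun z => grd D η z i := by
    intro i
    refine Fin.lastCases ?_ (fun j => ?_) i
    · simpa [grd] using stronglyMeasurable_cv D.sol.meas_g hη.smooth.continuous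
    · simpa [grd] using stronglyMeasurable_cv D.sol.meas_u (hη.pd (xdir j)).smooth.continuous
  refine Real.continuous_sqrt.comp_stronglyMeasurable (StronglyMeasurable.add ?_ ?_)
  · exact Finset.stronglyMeasurable_fun_sum _ fun i _ => (hg i).norm.pow 2
  · exact ((stronglyMeasurable_cv D.sol.meas_u hη.smooth.continuous).norm.pow 2).const_mul _

lemma lintegral_enorm_le_eLpNorm_two (hα : -1 < α) : ∃ C : ℝ, 0 ≤ C ∧ ∀ (E : Type)
    [NormedAddCommGroup E] (f : Tan m × ℝ → E) (ρ : ℝ), StronglyMeasurable f → ρ ≤ 1 →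
    ∫⁻ z, ‖f z‖ₑ ∂(nuQ m α ρ) ≤ ENNReal.ofReal C * eLpNorm f 2 (nuQ m α ρ) := by
  have hfin := isFiniteMeasure_nuQ (m := m) hα zero_le_one
  refine ⟨((nuQ m α 1 univ) ^ (1 / 2 : ℝ)).toReal, ENNReal.toReal_nonneg, fun E _ f ρ hf hρ => ?_⟩
  rw [ENNReal.ofReal_toReal (by simp), mul_comm, ← eLpNorm_one_eq_lintegral_enorm]
  refine (eLpNorm_le_eLpNorm_mul_rpow_measure_univ (p := 1) (q := 2) (by norm_num)
    hf.aestronglyMeasurable).trans ?_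
  gcongr
  have e : (1 / ENNReal.toReal 1 - 1 / ENNReal.toReal 2 : ℝ) = 1 / 2 := by norm_num
  rw [e]
  exact ENNReal.rpow_le_rpow (nuQ_mono α hρ univ) (by norm_num)

lemma tot_le_enorm (D : Dat m n α κ) (η : Tan m → ℝ) (z : Tan m × ℝ) :
    tot D η z.1 z.2 ≤ ‖cv D.u η z.1 z.2‖ₑ + (m + 1) * ‖phi D η z‖ₑ := by
  have h : ∀ i, ‖grd D η z i‖ₑ ≤ ‖phi D η z‖ₑ := by
    intro i
    rw [← ofReal_norm, ← ofReal_norm, Real.norm_of_nonneg (phi_nonneg _ _ _)]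
    exact ENNReal.ofReal_le_ofReal (norm_grd_le D i)
  have e : tot D η z.1 z.2 = ‖cv D.u η z.1 z.2‖ₑ + ∑ i, ‖grd D η z i‖ₑ := by
    rw [Fin.sum_univ_castSucc, tot, add_assoc]
    simp [grd, add_comm]
  rw [e]
  gcongr
  refine (Finset.sum_le_sum fun i _ => h i).trans_eq ?_
  simp

lemma dom_marg_univ (hα : -1 < α) (hκ : 0 < κ) :
    Dom (marg (m := m) (n := n) (α := α) (κ := κ) Finset.univ) enU := by
  obtain ⟨C, hC, h⟩ := lintegral_enorm_le_eLpNorm_two (m := m) hα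
  have h1 : Dom (fun D η ρ => enU (m := m) (n := n) (α := α) (κ := κ) D η ρ +
      ∑ _i : Fin (m + 1), enPhi D η ρ) enU :=
    (Dom.refl enU_mono).add (Dom.sum _ fun _ _ => dom_enPhi_enU hα hκ)
  refine h1.mono_left (C := C) fun D η ρ hη hρ hρ1 => ?_
  have hρ1' : ρ ≤ 1 := by linarith [D.δ_pos]
  have hm := stronglyMeasurable_cv D.sol.meas_u hη.smooth.continuous
  rw [marg_univ_eq D hη]
  refine (lintegral_mono fun z => tot_le_enorm D η z).trans ?_
  rw [lintegral_add_left hm.enorm, lintegral_const_mul _ (stronglyMeasurable_phi D hη).enorm,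
    mul_add]
  refine add_le_add (h _ _ ρ hm hρ1') ?_
  simp only [Finset.sum_const, Finset.card_univ, Fintype.card_fin, nsmul_eq_mul]
  push_cast
  rw [mul_left_comm]
  gcongr
  exact h _ _ ρ (stronglyMeasurable_phi D hη) hρ1'

/-- `S` is the set of coordinates in which integration has already been replaced by a supremum. No
derivative count is lost on the way, because the `L_2` norm controls that of every tangential
derivative. -/
lemma dom_marg (hα : -1 < α) (hκ : 0 < κ) (S : Finset (Fin (m + 1))) :
    Dom (marg (m := m) (n := n) (α := α) (κ := κ) Sᶜ) enU := by
  induction S using Finset.induction_on with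
  | empty => simpa using dom_marg_univ hα hκ
  | insert a S ha ih =>
    refine Dom.marg_insert (i := a) (by simp) ?_ ?_
    · have : insert a (insert a S)ᶜ = Sᶜ := by
        ext x
        by_cases hx : x = a <;> simp [hx, ha]
      rwa [this]
    · refine Fin.cases ?_ (fun j => ?_) a
      · exact dom_enU_time_self hα hκ
      · exact dom_enU_pd_self hα hκ j

/-- The supremum of the mollified solution and its gradient is controlled by the energy. -/
lemma dom_supT_enU (hα : -1 < α) (hκ : 0 < κ) :
    Dom (supT (m := m) (n := n) (α := α) (κ := κ) 0) enU := by
  refine Dom.supT_zero hα hκ ?_ (dom_enU_lamMul_self hα hκ) (dom_enU_time_self hα hκ)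
    (dom_enU_pd_self hα hκ)
  have h := dom_marg (m := m) (n := n) hα hκ Finset.univ
  rw [Finset.compl_univ] at h
  exact h.mono_left (C := 1) fun D η ρ _ _ _ => by simpa using supInt_le_marg D η ρ

end

section

variable {m n : ℕ} {α κ : ℝ}

/-! ### Interior bounds for mollified solutions -/

/-- If `E² ≤ F G`, as for the `L_2` norm between supremum and `L_1` norm, then `F ≤ C E` gives `F² ≤
C² F G`, and one factor `F` is absorbed. This lowers the exponent of the estimates from two to one.
-/
lemma Dom.of_interpolation {F E G : Dat m n α κ → (Tan m → ℝ) → ℝ → ENNReal} (h : Dom F E)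
    (hF : MonoR F) (hfin : ∀ D η ρ, Ker D.δ η → 1 / 2 ≤ ρ → ρ ≤ 1 - D.δ → F D η ρ < ⊤) (hG : MonoR G)
    (hE : ∀ D η ρ, Ker D.δ η → 1 / 2 ≤ ρ → ρ ≤ 1 - D.δ → E D η ρ ^ 2 ≤ F D η ρ * G D η ρ) :
    Dom F G := by
  obtain ⟨C, K, hC, h⟩ := h
  refine Dom.absorb (C := C ^ 2) (K := 2 * K) (by positivity) hF hfin hG
    fun D η ρ R hη hρ hR hR1 => ?_
  have hg := one_le_inv_gap D hρ hR hR1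
  calc F D η ρ ^ 2 ≤ (ENNReal.ofReal (C * (R - ρ)⁻¹ ^ K) * E D η R) ^ 2 := by
        gcongr; exact h D η ρ R hη hρ hR hR1
    _ = ENNReal.ofReal (C ^ 2 * (R - ρ)⁻¹ ^ (2 * K)) * E D η R ^ 2 := by
        rw [mul_pow, ← ENNReal.ofReal_pow (by positivity)]
        congr 2
        rw [mul_pow, ← pow_mul, mul_comm K 2]
    _ ≤ _ := by gcongr; exact hE D η R hη (by linarith) hR1

lemma sq_eLpNorm_two_le {X E : Type*} [MeasurableSpace X] [NormedAddCommGroup E] {ν : Measure X}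
    {f : X → E} {M : ENNReal} (hM : ∀ᵐ z ∂ν, ‖f z‖ₑ ≤ M) (hM' : M ≠ ⊤) :
    eLpNorm f 2 ν ^ 2 ≤ M * ∫⁻ z, ‖f z‖ₑ ∂ν := by
  rw [eLpNorm_eq_lintegral_rpow_enorm_toReal (by simp) (by simp), ← lintegral_const_mul' _ _ hM']
  rw [← ENNReal.rpow_natCast, ← ENNReal.rpow_mul]
  norm_num
  refine lintegral_mono_ae ?_
  filter_upwards [hM] with z hz
  rw [pow_two]
  gcongr

/-- The `L_1` norm of the mollified solution. -/
def intU (D : Dat m n α κ) (η : Tan m → ℝ) (ρ : ℝ) : ENNReal :=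
  ∫⁻ z, ‖cv D.u η z.1 z.2‖ₑ ∂(nuQ m α ρ)

/-- The `L_1` norm of the mollified gradient. -/
def intPhi (D : Dat m n α κ) (η : Tan m → ℝ) (ρ : ℝ) : ENNReal := ∫⁻ z, ‖phi D η z‖ₑ ∂(nuQ m α ρ)

/-- The essential supremum of the mollified gradient. -/
def supPhi (D : Dat m n α κ) (η : Tan m → ℝ) (ρ : ℝ) : ENNReal :=
  essSup (fun z => ‖phi D η z‖ₑ) (nuQ m α ρ)

/-- The essential supremum of the mollified flux, divided by the distance to the boundary. -/
def supFlux (D : Dat m n α κ) (η : Tan m → ℝ) (ρ : ℝ) : ENNReal :=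
  essSup (fun z => ENNReal.ofReal (z.2 ^ (-1 : ℝ)) * ‖flux D.c D.u D.g (Fin.last m) η z.1 z.2‖ₑ)
    (nuQ m α ρ)

lemma intU_mono : MonoR (intU (m := m) (n := n) (α := α) (κ := κ)) :=
  fun _ _ _ _ h => lintegral_mono' (nuQ_mono α h) le_rfl

lemma intPhi_mono : MonoR (intPhi (m := m) (n := n) (α := α) (κ := κ)) :=
  fun _ _ _ _ h => lintegral_mono' (nuQ_mono α h) le_rfl

lemma supPhi_mono : MonoR (supPhi (m := m) (n := n) (α := α) (κ := κ)) :=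
  fun _ _ _ _ h => essSup_mono_measure (Measure.absolutelyContinuous_of_le (nuQ_mono α h))

lemma enorm_cv_le_tot (D : Dat m n α κ) (η : Tan m → ℝ) (y : Tan m) (s : ℝ) :
    ‖cv D.u η y s‖ₑ ≤ tot D η y s := by
  rw [tot, add_assoc]; exact le_self_add

lemma dom_supT_intU (hα : -1 < α) (hκ : 0 < κ) :
    Dom (supT (m := m) (n := n) (α := α) (κ := κ) 0) intU := by
  refine (dom_supT_enU hα hκ).of_interpolation (supT_mono 0)
    (fun D η ρ hη hρ hρ1 => supT_zero_lt_top hα hκ D hη hρ hρ1) intU_mono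
    fun D η ρ hη hρ hρ1 => ?_
  refine sq_eLpNorm_two_le ?_ (supT_zero_lt_top hα hκ D hη hρ hρ1).ne
  filter_upwards [ae_tot_le_supT D hη ρ] with z hz
  exact (enorm_cv_le_tot D η _ _).trans hz

/-- The coefficients are measurable only up to null sets, so Fubini's theorem is applied to a
measurable representative. -/
lemma ae_nuQ_le_of_forall {ρ : ℝ} {f : Tan m × ℝ → ENNReal} (hf : AEMeasurable f (nuQ m α ρ))
    {M : ENNReal} (h : ∀ y ∈ tanBox m ρ, ∀ᵐ s ∂(volume.restrict (Ioo 0 ρ)), f (y, s) ≤ M) :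
    ∀ᵐ z ∂(nuQ m α ρ), f z ≤ M := by
  have h1 : ∀ᵐ z ∂(nuQ m α ρ), hf.mk f z ≤ M := by
    refine (Measure.ae_prod_iff_ae_ae (μ := (volume : Measure (Tan m)).restrict (tanBox m ρ))
      (ν := wt α ρ) (measurableSet_le hf.measurable_mk measurable_const)).2 ?_
    have h2 := Measure.ae_ae_of_ae_prod (μ := (volume : Measure (Tan m)).restrict (tanBox m ρ))
      (ν := wt α ρ) hf.ae_eq_mk
    filter_upwards [ae_restrict_mem (measurableSet_tanBox ρ), h2] with y hy hy2
    have h3 : ∀ᵐ s ∂(wt α ρ), f (y, s) ≤ M := ae_wt_iff.2 (h y hy)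
    filter_upwards [h3, hy2] with s hs hs2
    rw [← hs2]; exact hs
  filter_upwards [h1, hf.ae_eq_mk] with z hz hz2
  rw [hz2]; exact hz

lemma dom_supT_lamMul (hα : -1 < α) (hκ : 0 < κ) :
    Dom (fun D η => supT 0 D (lamMul D η)) (enPhi (m := m) (n := n) (α := α) (κ := κ)) :=
  ((dom_supT_enU hα hκ).comp fun _ _ hη => hη.lamMul).trans (dom_enU_lamMul_enPhi hα hκ)

lemma dom_supT_sqMul (hα : -1 < α) (hκ : 0 < κ) :
    Dom (fun D η => supT 0 D (sqMul D η)) (enPhi (m := m) (n := n) (α := α) (κ := κ)) :=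
  ((dom_supT_enU hα hκ).comp fun _ _ hη => hη.sqMul).trans dom_enU_sqMul_enPhi

lemma dom_supT_time (hα : -1 < α) (hκ : 0 < κ) :
    Dom (fun D η => supT 0 D (pd (tdir m) η)) (enPhi (m := m) (n := n) (α := α) (κ := κ)) :=
  ((dom_supT_enU hα hκ).comp fun _ _ hη => hη.pd _).trans (dom_enU_time hα hκ)

lemma dom_supT_pd (hα : -1 < α) (hκ : 0 < κ) (i : Fin m) :
    Dom (fun D η => supT 0 D (pd (xdir i) η)) (enPhi (m := m) (n := n) (α := α) (κ := κ)) :=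
  ((dom_supT_enU hα hκ).comp fun _ _ hη => hη.pd _).trans (dom_enU_pd_enPhi i)

/-- The source of the flux involves `w` only through `λ w`, `w_t` and `D_i w`. The first-order
quantities of all of these are bounded by the energy of `w`, without its `L_2` norm. The flux
estimate with `γ = 0` then carries the weight `s⁻¹`. -/
lemma dom_supFlux_enPhi (hα : -1 < α) (hκ : 0 < κ) :
    Dom (supFlux (m := m) (n := n) (α := α) (κ := κ)) enPhi := by
  have h1 : Dom (fun D η ρ => supT 0 D (lamMul D η) ρ + supT 0 D (pd (tdir m) η) ρ +
      ∑ i : Fin m, supT 0 D (pd (xdir i) η) ρ) (enPhi (m := m) (n := n) (α := α) (κ := κ)) :=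
    ((dom_supT_lamMul hα hκ).add (dom_supT_time hα hκ)).add
      (Dom.sum _ fun i _ => dom_supT_pd hα hκ i)
  refine h1.mono_left (C := 1 / (α + 1) * κ⁻¹) fun D η ρ hη hρ hρ1 => essSup_le_of_ae_le _ ?_
  refine ae_nuQ_le_of_forall ?_ fun y hy => ?_
  · have hb := (bd_flux D hα hκ hη hρ hρ1 (Fin.last m)).aesm.enorm
    refine AEMeasurable.mul (f := fun z : Tan m × ℝ => ENNReal.ofReal (z.2 ^ (-1 : ℝ))) ?_ hb
    exact Measurable.aemeasurable (by fun_prop)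
  · filter_upwards [ae_flux_le hκ (γ := 0) (by linarith) D hη hρ1 hy] with s hs
    rw [ENNReal.ofReal_mul (by have : 0 < α + 1 := by linarith
                               positivity), mul_assoc]
    simpa using hs

lemma phi_le (D : Dat m n α κ) (η : Tan m → ℝ) (z : Tan m × ℝ) :
    phi D η z ≤ ∑ i, ‖grd D η z i‖ + ‖cv D.u (sqMul D η) z.1 z.2‖ := by
  have e : ‖cv D.u (sqMul D η) z.1 z.2‖ = √D.lam * ‖cv D.u η z.1 z.2‖ := by
    change ‖cv D.u (fun y => √D.lam * η y) z.1 z.2‖ = _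
    rw [cv_smul, norm_smul, Real.norm_of_nonneg (Real.sqrt_nonneg _)]
  have hT : 0 ≤ ∑ i, ‖grd D η z i‖ := Finset.sum_nonneg fun i _ => norm_nonneg _
  have hP : ∑ i, ‖grd D η z i‖ ^ 2 ≤ (∑ i, ‖grd D η z i‖) ^ 2 :=
    Finset.sum_sq_le_sq_sum_of_nonneg fun i _ => norm_nonneg _
  rw [phi, Real.sqrt_le_iff]
  refine ⟨add_nonneg hT (norm_nonneg _), ?_⟩
  have h2 : D.lam * ‖cv D.u η z.1 z.2‖ ^ 2 = ‖cv D.u (sqMul D η) z.1 z.2‖ ^ 2 := by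
    rw [e, mul_pow, Real.sq_sqrt D.sol.lam_nonneg]
  have hL := norm_nonneg (cv D.u (sqMul D η) z.1 z.2)
  rw [phiSq, h2]
  generalize ∑ i, ‖grd D η z i‖ = T at *
  generalize ∑ i, ‖grd D η z i‖ ^ 2 = P at *
  generalize ‖cv D.u (sqMul D η) z.1 z.2‖ = L at *
  nlinarith

/-- The normal derivative is recovered from the flux, and `1 ≤ s⁻¹` on the unit cylinder. -/
lemma enorm_phi_le (hκ : 0 < κ) (D : Dat m n α κ) (η : Tan m → ℝ) {z : Tan m × ℝ}
    (hs : z.2 ∈ Ioo 0 1) :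
    ‖phi D η z‖ₑ ≤ ENNReal.ofReal (1 + κ⁻¹ + κ⁻¹ ^ 2) *
      (ENNReal.ofReal (z.2 ^ (-1 : ℝ)) * ‖flux D.c D.u D.g (Fin.last m) η z.1 z.2‖ₑ +
        ∑ i : Fin m, ‖cv D.u (pd (xdir i) η) z.1 z.2‖ₑ + ‖cv D.u (sqMul D η) z.1 z.2‖ₑ) := by
  have h1 : ‖phi D η z‖ₑ ≤ ∑ i : Fin m, ‖cv D.u (pd (xdir i) η) z.1 z.2‖ₑ + ‖cv D.g η z.1 z.2‖ₑ +
      ‖cv D.u (sqMul D η) z.1 z.2‖ₑ := by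
    have := ENNReal.ofReal_le_ofReal (phi_le D η z)
    rw [ENNReal.ofReal_add (by positivity) (by positivity),
      ENNReal.ofReal_sum_of_nonneg (fun _ _ => norm_nonneg _), Fin.sum_univ_castSucc] at this
    rw [← ofReal_norm, Real.norm_of_nonneg (phi_nonneg _ _ _)]
    refine this.trans_eq ?_
    simp [grd, ofReal_norm]
  have h2 := enorm_normal_le D (η := η) (y := z.1) hκ hs.1
  have h3 : ‖flux D.c D.u D.g (Fin.last m) η z.1 z.2‖ₑ ≤ ENNReal.ofReal (z.2 ^ (-1 : ℝ)) *
      ‖flux D.c D.u D.g (Fin.last m) η z.1 z.2‖ₑ := by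
    refine le_mul_of_one_le_left' ?_
    rw [← ENNReal.ofReal_one]
    apply ENNReal.ofReal_le_ofReal
    rw [Real.rpow_neg_one]
    exact (one_le_inv₀ hs.1).2 hs.2.le
  refine h1.trans ?_
  generalize ‖flux D.c D.u D.g (Fin.last m) η z.1 z.2‖ₑ = f at *
  generalize ENNReal.ofReal (z.2 ^ (-1 : ℝ)) * f = F at *
  generalize ∑ i : Fin m, ‖cv D.u (pd (xdir i) η) z.1 z.2‖ₑ = S at *
  generalize ‖cv D.u (sqMul D η) z.1 z.2‖ₑ = L at *
  rw [ENNReal.ofReal_add (by positivity) (by positivity),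
    ENNReal.ofReal_add (by positivity) (by positivity), ENNReal.ofReal_one,
    ENNReal.ofReal_pow (by positivity)]
  generalize ENNReal.ofReal κ⁻¹ = k at *
  calc S + ‖cv D.g η z.1 z.2‖ₑ + L ≤ S + k * (F + k * S) + L := by
        gcongr
        exact h2.trans (by gcongr)
    _ = (S + L) + k * F + k ^ 2 * S := by ring
    _ ≤ (F + S + L) + k * (F + S + L) + k ^ 2 * (F + S + L) := by
        gcongr
        · exact le_add_self
        · rw [add_assoc]; exact le_self_add
        · rw [add_right_comm]; exact le_add_self
    _ = _ := by ring

lemma ae_le_supFlux (D : Dat m n α κ) (η : Tan m → ℝ) (ρ : ℝ) : ∀ᵐ z ∂(nuQ m α ρ),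
    ENNReal.ofReal (z.2 ^ (-1 : ℝ)) * ‖flux D.c D.u D.g (Fin.last m) η z.1 z.2‖ₑ ≤ supFlux D η ρ :=
  ENNReal.ae_le_essSup _

/-- The bound of `supT` by the full `L_2` norm of `w` would be too weak here, since `tot` contains
`w` without a factor `√λ`. Instead each part of `Φ` is bounded separately by the energy. -/
lemma dom_supPhi_enPhi (hα : -1 < α) (hκ : 0 < κ) :
    Dom (supPhi (m := m) (n := n) (α := α) (κ := κ)) enPhi := by
  have h1 : Dom (fun D η ρ => supFlux D η ρ + ∑ i : Fin m, supT 0 D (pd (xdir i) η) ρ +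
      supT 0 D (sqMul D η) ρ) (enPhi (m := m) (n := n) (α := α) (κ := κ)) :=
    ((dom_supFlux_enPhi hα hκ).add (Dom.sum _ fun i _ => dom_supT_pd hα hκ i)).add
      (dom_supT_sqMul hα hκ)
  refine h1.mono_left (C := 1 + κ⁻¹ + κ⁻¹ ^ 2) fun D η ρ hη hρ hρ1 => essSup_le_of_ae_le _ ?_
  have h2 : ∀ᵐ z ∂(nuQ m α ρ), ∀ i : Fin m, tot D (pd (xdir i) η) z.1 z.2 ≤
      supT 0 D (pd (xdir i) η) ρ := ae_all_iff.2 fun i => ae_tot_le_supT D (hη.pd _) ρ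
  filter_upwards [ae_nuQ_mem α ρ, ae_le_supFlux D η ρ, h2, ae_tot_le_supT D hη.sqMul ρ]
    with z hz h3 h4 h5
  refine (enorm_phi_le hκ D η ⟨hz.2.1, hz.2.2.trans_le (by linarith [D.δ_pos])⟩).trans ?_
  gcongr with i
  · exact (enorm_cv_le_tot D _ _ _).trans (h4 i)
  · exact (enorm_cv_le_tot D _ _ _).trans h5

lemma Bd.essSup_lt_top {X E : Type*} [MeasurableSpace X] [NormedAddCommGroup E] {ν : Measure X}
    {f : X → E} (hf : Bd ν f) : essSup (fun z => ‖f z‖ₑ) ν < ⊤ := by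
  obtain ⟨C, hC⟩ := hf.bound
  refine (essSup_le_of_ae_le (ENNReal.ofReal C) ?_).trans_lt ENNReal.ofReal_lt_top
  filter_upwards [hC] with z hz
  rw [← ofReal_norm]
  exact ENNReal.ofReal_le_ofReal hz

lemma dom_supPhi_intPhi (hα : -1 < α) (hκ : 0 < κ) :
    Dom (supPhi (m := m) (n := n) (α := α) (κ := κ)) intPhi := by
  have hfin : ∀ (D : Dat m n α κ) η ρ, Ker D.δ η → 1 / 2 ≤ ρ → ρ ≤ 1 - D.δ → supPhi D η ρ < ⊤ :=
    fun D η ρ hη hρ hρ1 => (bd_phi D hα hκ hη hρ hρ1).essSup_lt_top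
  refine (dom_supPhi_enPhi hα hκ).of_interpolation supPhi_mono hfin intPhi_mono
    fun D η ρ hη hρ hρ1 => ?_
  exact sq_eLpNorm_two_le (ENNReal.ae_le_essSup _) (hfin D η ρ hη hρ hρ1).ne

lemma dom_enPhi_supPhi (hα : -1 < α) :
    Dom (enPhi (m := m) (n := n) (α := α) (κ := κ)) supPhi := by
  have hfin := isFiniteMeasure_nuQ (m := m) hα zero_le_one
  refine Dom.of_le (C := ((nuQ m α 1 univ) ^ (1 / 2 : ℝ)).toReal) supPhi_mono
    fun D η ρ hη hρ hρ1 => ?_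
  rw [ENNReal.ofReal_toReal (by simp), mul_comm, supPhi, ← eLpNormEssSup, ← eLpNorm_exponent_top]
  refine (eLpNorm_le_eLpNorm_mul_rpow_measure_univ (p := 2) (q := ⊤) le_top
    (stronglyMeasurable_phi D hη).aestronglyMeasurable).trans ?_
  gcongr
  have e : (1 / ENNReal.toReal 2 - 1 / ENNReal.toReal ⊤ : ℝ) = 1 / 2 := by norm_num
  rw [e]
  exact ENNReal.rpow_le_rpow (nuQ_mono α (by linarith [D.δ_pos]) univ) (by norm_num)

/-- The flux does not bound `Φ`, so absorption is not applied to it directly; the passage from `L_2`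
to `L_1` goes through the supremum of `Φ`. -/
lemma dom_supFlux_intPhi (hα : -1 < α) (hκ : 0 < κ) :
    Dom (supFlux (m := m) (n := n) (α := α) (κ := κ)) intPhi :=
  ((dom_supFlux_enPhi hα hκ).trans (dom_enPhi_supPhi hα)).trans (dom_supPhi_intPhi hα hκ)

lemma Dom.half {F G : Dat m n α κ → (Tan m → ℝ) → ℝ → ENNReal} (h : Dom F G) :
    ∃ C : ℝ, 0 ≤ C ∧ ∀ D η, Ker D.δ η → F D η (1 / 2) ≤ ENNReal.ofReal C * G D η (1 - D.δ) := by
  obtain ⟨C, K, hC, h⟩ := h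
  refine ⟨C * 4 ^ K, by positivity, fun D η hη => ?_⟩
  -- The gap between `1 / 2` and `1 - δ` is at least `1 / 4`, whatever the kernel.
  have hδ := D.δ_le
  refine (h D η (1 / 2) (1 - D.δ) hη le_rfl (by linarith) le_rfl).trans ?_
  gcongr
  · exact inv_nonneg.2 (by linarith)
  · rw [inv_le_comm₀ (by linarith) (by norm_num)]; linarith

/-- Interior bounds for mollified solutions. -/
lemma exists_mollified_bound (hα : -1 < α) (hκ : 0 < κ) : ∃ C : ℝ, 0 ≤ C ∧
    ∀ (D : Dat m n α κ) (η : Tan m → ℝ), Ker D.δ η →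
      (∀ᵐ z ∂(nuQ m α (1 / 2)), ‖cv D.u η z.1 z.2‖ₑ ≤ ENNReal.ofReal C * intU D η (1 - D.δ)) ∧
      (∀ᵐ z ∂(nuQ m α (1 / 2)), ‖phi D η z‖ₑ ≤ ENNReal.ofReal C * intPhi D η (1 - D.δ)) ∧
      (∀ᵐ z ∂(nuQ m α (1 / 2)), ENNReal.ofReal (z.2 ^ (-1 : ℝ)) *
        ‖flux D.c D.u D.g (Fin.last m) η z.1 z.2‖ₑ ≤ ENNReal.ofReal C * intPhi D η (1 - D.δ)) := by
  obtain ⟨C1, hC1, h1⟩ := (dom_supT_intU (m := m) (n := n) hα hκ).half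
  obtain ⟨C2, hC2, h2⟩ := (dom_supPhi_intPhi (m := m) (n := n) hα hκ).half
  obtain ⟨C3, hC3, h3⟩ := (dom_supFlux_intPhi (m := m) (n := n) hα hκ).half
  refine ⟨C1 + C2 + C3, by positivity, fun D η hη => ⟨?_, ?_, ?_⟩⟩
  · filter_upwards [ae_tot_le_supT D hη (1 / 2)] with z hz
    refine ((enorm_cv_le_tot D η _ _).trans hz).trans ((h1 D η hη).trans ?_)
    gcongr; linarith
  · have : ∀ᵐ z ∂(nuQ m α (1 / 2)), ‖phi D η z‖ₑ ≤ supPhi D η (1 / 2) := ENNReal.ae_le_essSup _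
    filter_upwards [this] with z hz
    refine hz.trans ((h2 D η hη).trans ?_)
    gcongr; linarith
  · filter_upwards [ae_le_supFlux D η (1 / 2)] with z hz
    refine hz.trans ((h3 D η hη).trans ?_)
    gcongr; linarith

end

section

variable {m n : ℕ} {α κ : ℝ}

/-! ### Removal of the mollification -/

/-- The scale of the approximate identity. -/
def scl (k : ℕ) : ℝ := 1 / (16 * (k + 1))

lemma scl_pos (k : ℕ) : 0 < scl k := by unfold scl; positivity

lemma scl_le (k : ℕ) : 4 * scl k ≤ 1 / 4 := by
  unfold scl
  have hk : (0 : ℝ) ≤ k := Nat.cast_nonneg k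
  rw [show 4 * (1 / (16 * ((k : ℝ) + 1))) = 1 / (4 * (k + 1)) by field_simp; norm_num]
  exact one_div_le_one_div_of_le (by norm_num) (by linarith)

lemma tendsto_scl : Tendsto scl atTop (𝓝[>] 0) := by
  refine tendsto_nhdsWithin_iff.2 ⟨?_, Eventually.of_forall scl_pos⟩
  have h := (tendsto_one_div_add_atTop_nhds_zero_nat (𝕜 := ℝ)).const_mul (1 / 16 : ℝ)
  rw [mul_zero] at h
  refine h.congr fun k => ?_
  unfold scl
  field_simp

/-- Bump functions whose supports lie in positive times. -/
def bump (m k : ℕ) : ContDiffBump ((2 * scl k, 0) : Tan m) where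
  rIn := scl k / 2
  rOut := scl k
  rIn_pos := half_pos (scl_pos k)
  rIn_lt_rOut := half_lt_self (scl_pos k)

/-- A one-sided approximate identity. -/
def mol (m k : ℕ) : Tan m → ℝ := (bump m k).normed volume

/-- The bump is centred at time `2 scl k` and has radius `scl k`, so its times stay in `[scl k, 3
scl k]`. -/
lemma ker_mol (m k : ℕ) : Ker (4 * scl k) (mol m k) := by
  refine ⟨(bump m k).contDiff_normed (n := ⊤), (bump m k).hasCompactSupport_normed, ?_⟩
  rw [mol, ContDiffBump.tsupport_normed_eq]
  intro y hy
  have hs := scl_pos k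
  rw [← closedBall_prod_same, mem_prod, Real.closedBall_eq_Icc, mem_closedBall_zero_iff] at hy
  change (y.1 ∈ Icc (2 * scl k - scl k) (2 * scl k + scl k)) ∧ ‖y.2‖ ≤ scl k at hy
  refine ⟨⟨by linarith [hy.1.1], by linarith [hy.1.2]⟩, ?_⟩
  rw [mem_ball_zero_iff]
  linarith [hy.2]

lemma lintegral_mol (m k : ℕ) : ∫⁻ y, ‖mol m k y‖ₑ = 1 := by
  have h : ∀ y, ‖mol m k y‖ₑ = ENNReal.ofReal (mol m k y) := fun y => by
    rw [← ofReal_norm, Real.norm_of_nonneg (show 0 ≤ mol m k y from (bump m k).nonneg_normed y)]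
  have hi : Integrable (mol m k) := (bump m k).integrable_normed
  have h1 : ∫ y, mol m k y = 1 := (bump m k).integral_normed
  simp only [h]
  rw [← ofReal_integral_eq_lintegral_ofReal hi
    (ae_of_all _ fun y => (bump m k).nonneg_normed y), h1, ENNReal.ofReal_one]

/-- The kernels are not centred at the origin. Lebesgue differentiation for a doubling measure still
applies to the balls around `y - (2 scl k, 0)`, since `y` lies within twice their radius. -/
lemma ae_tendsto_mol {f : Tan m → Val n} (hf : Integrable f) :
    ∀ᵐ y, Tendsto (fun k => ∫ y', mol m k (y - y') • f y') atTop (𝓝 (f y)) := by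
  filter_upwards [IsUnifLocDoublingMeasure.ae_tendsto_average_norm_sub volume
    hf.locallyIntegrable 2] with y hy
  have h1 := hy (fun k => y - ((2 * scl k, 0) : Tan m)) scl tendsto_scl (Eventually.of_forall
    fun k => by
      rw [Metric.mem_closedBall, dist_eq_norm, sub_sub_cancel, Prod.norm_mk, norm_zero,
        Real.norm_of_nonneg (by linarith [scl_pos k]), max_eq_left (by linarith [scl_pos k])])
  -- The inner radius of the bump is half of the outer one, which bounds its height by `2 ^ dim`
  -- over the volume of the ball.
  refine tendsto_integral_smul_of_tendsto_average_norm_sub (2 ^ Module.finrank ℝ (Tan m)) h1 ?_ ?_ ?_ ?_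
  · exact Eventually.of_forall fun k => hf.integrableOn
  · refine tendsto_const_nhds.congr fun k => ?_
    rw [integral_sub_left_eq_self (fun y => mol m k y) volume y]
    exact ((bump m k).integral_normed).symm
  · refine Eventually.of_forall fun k => ?_
    intro y' hy'
    have h2 : y - y' ∈ Function.support ((bump m k).normed volume) := hy'
    rw [ContDiffBump.support_normed_eq, Metric.mem_ball, dist_eq_norm] at h2
    rw [Metric.mem_closedBall, dist_eq_norm, norm_sub_rev]
    rw [sub_right_comm] at h2
    exact h2.le
  · refine Eventually.of_forall fun k y' => ?_
    rw [mol, abs_of_nonneg ((bump m k).nonneg_normed _)]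
    have h3 := (bump m k).normed_le_div_measure_closedBall_rOut volume 2
      (by change scl k ≤ 2 * (scl k / 2); linarith) (y - y')
    refine h3.trans_eq ?_
    congr 1
    rw [Measure.addHaar_real_closedBall_center,
      Measure.addHaar_real_closedBall_center volume (y - ((2 * scl k, 0) : Tan m))]
    rfl

lemma nuQ_le_prod (α : ℝ) {ρ : ℝ} (hρ : ρ ≤ 1) :
    nuQ m α ρ ≤ (volume : Measure (Tan m)).prod (wt α 1) :=
  Measure.prod_mono Measure.restrict_le_self (wt_mono α hρ)

lemma ae_tendsto_cv {f : Tan m × ℝ → Val n} (hf : StronglyMeasurable f)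
    (hi : Integrable f (volume.prod (wt α 1))) :
    ∀ᵐ z ∂((volume : Measure (Tan m)).prod (wt α 1)),
      Tendsto (fun k => cv f (mol m k) z.1 z.2) atTop (𝓝 (f z)) := by
  have hms : MeasurableSet {z : Tan m × ℝ |
      Tendsto (fun k => cv f (mol m k) z.1 z.2) atTop (𝓝 (f z))} := by
    have h1 : ∀ k, Measurable fun z : Tan m × ℝ => cv f (mol m k) z.1 z.2 - f z := fun k =>
      ((stronglyMeasurable_cv hf (ker_mol m k).smooth.continuous).sub hf).measurable
    have h2 := measurableSet_tendsto (𝓝 (0 : Val n)) (l := atTop) h1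
    simpa only [tendsto_sub_nhds_zero_iff] using h2
  rw [Measure.ae_prod_iff_ae_ae hms, Measure.ae_ae_comm hms]
  filter_upwards [hi.prod_left_ae] with s hs
  exact ae_tendsto_mol hs

/-- A solution on the unit cylinder together with its spatial gradient. -/
structure IsGradSol (α κ lam : ℝ) (c : Coeffs m n) (u : Tan m × ℝ → Val n)
    (G : Fin (m + 1) → Tan m × ℝ → Val n) : Prop where
  sol : IsSol α κ lam c u (G (Fin.last m))
  meas : ∀ i, StronglyMeasurable (G i)
  int : ∀ i, Integrable (G i) (volume.prod (wt α 1))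
  tangential : ∀ (i : Fin m) η, TanTest η → ∀ᵐ s ∂(volume.restrict (Ioo (0 : ℝ) 1)),
    mom u (pd (xdir i) η) s = -mom (G i.castSucc) η s

section Limit
variable {lam : ℝ} {c : Coeffs m n} {u : Tan m × ℝ → Val n} {G : Fin (m + 1) → Tan m × ℝ → Val n}

/-- The data for the mollification at a given scale. -/
def IsGradSol.dat (h : IsGradSol α κ lam c u G) (k : ℕ) : Dat m n α κ where
  lam := lam
  c := c
  u := u
  g := G (Fin.last m)
  sol := h.sol
  δ := 4 * scl k
  δ_pos := by linarith [scl_pos k]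
  δ_le := scl_le k

/-- In `grd` the tangential derivatives fall on the kernel, which would blow up as the scale
shrinks. The weak derivative of `u` moves them back to the solution. -/
lemma IsGradSol.ae_grd (h : IsGradSol α κ lam c u G) (k : ℕ) {ρ : ℝ} (hρ : ρ ≤ 1 - 4 * scl k) :
    ∀ᵐ z ∂(nuQ m α ρ), ∀ i, grd (h.dat k) (mol m k) z i = cv (G i) (mol m k) z.1 z.2 := by
  have hk := ker_mol m k
  refine ae_all_iff.2 fun i => ?_
  refine Fin.lastCases ?_ (fun j => ?_) i
  · refine ae_of_all _ fun z => ?_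
    simp [grd, IsGradSol.dat]
  · have hms : MeasurableSet {z : Tan m × ℝ | grd (h.dat k) (mol m k) z j.castSucc =
        cv (G j.castSucc) (mol m k) z.1 z.2} := by
      refine measurableSet_eq_fun ?_ (stronglyMeasurable_cv (h.meas _) hk.smooth.continuous).measurable
      simpa [grd, IsGradSol.dat] using
        (stronglyMeasurable_cv h.sol.meas_u (hk.pd (xdir j)).smooth.continuous).measurable
    refine (Measure.ae_prod_iff_ae_ae (μ := (volume : Measure (Tan m)).restrict (tanBox m ρ))
      (ν := wt α ρ) hms).2 ?_
    filter_upwards [ae_restrict_mem (measurableSet_tanBox ρ)] with y hy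
    have h1 := h.tangential j _ (hk.tanTest (tanBox_mono hρ hy))
    rw [ae_wt_iff]
    have hρ1 : ρ ≤ 1 := by linarith [scl_pos k]
    filter_upwards [ae_restrict_of_ae_restrict_of_subset (Ioo_subset_Ioo_right hρ1) h1] with s hs
    rw [pd_reflect hk.smooth, mom_neg, neg_inj] at hs
    simp only [grd, Fin.lastCases_castSucc]
    exact hs

lemma lintegral_cv_prod_le {f : Tan m × ℝ → Val n} (hf : StronglyMeasurable f) (k : ℕ) {ρ : ℝ}
    (hρ : ρ ≤ 1) : ∫⁻ z, ‖cv f (mol m k) z.1 z.2‖ₑ ∂(nuQ m α ρ) ≤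
      ∫⁻ z, ‖f z‖ₑ ∂((volume : Measure (Tan m)).prod (wt α 1)) := by
  have hm := stronglyMeasurable_cv hf (ker_mol m k).smooth.continuous
  refine (lintegral_mono' (nuQ_le_prod α hρ) le_rfl).trans ?_
  rw [lintegral_prod_symm _ hm.enorm.aemeasurable, lintegral_prod_symm _ hf.enorm.aemeasurable]
  refine lintegral_mono fun s => ?_
  have := lintegral_cv_le hf (ker_mol m k).smooth.continuous s
  rwa [lintegral_mol, one_mul] at this

/-- The weighted `L_1` norm of `|Du| + √λ |u|`. -/
def gradMass (α lam : ℝ) (u : Tan m × ℝ → Val n) (G : Fin (m + 1) → Tan m × ℝ → Val n) : ENNReal :=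
  ∑ i, ∫⁻ z, ‖G i z‖ₑ ∂((volume : Measure (Tan m)).prod (wt α 1)) +
    ENNReal.ofReal √lam * ∫⁻ z, ‖u z‖ₑ ∂((volume : Measure (Tan m)).prod (wt α 1))

/-- The bound is independent of `k`, because the kernels have integral one and do not increase `L_1`
norms. -/
lemma IsGradSol.intPhi_le (h : IsGradSol α κ lam c u G) (k : ℕ) :
    intPhi (h.dat k) (mol m k) (1 - 4 * scl k) ≤ gradMass α lam u G := by
  have hρ1 : 1 - 4 * scl k ≤ 1 := by linarith [scl_pos k]
  have hm := fun i => (stronglyMeasurable_cv (h.meas i) (ker_mol m k).smooth.continuous).enorm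
  have hmu := (stronglyMeasurable_cv h.sol.meas_u (ker_mol m k).smooth.continuous).enorm
  calc intPhi (h.dat k) (mol m k) (1 - 4 * scl k)
      ≤ ∫⁻ z, (∑ i, ‖cv (G i) (mol m k) z.1 z.2‖ₑ + ENNReal.ofReal √lam *
          ‖cv u (mol m k) z.1 z.2‖ₑ) ∂(nuQ m α (1 - 4 * scl k)) := by
        refine lintegral_mono_ae ?_
        filter_upwards [h.ae_grd k le_rfl] with z hz
        rw [← ofReal_norm, Real.norm_of_nonneg (phi_nonneg _ _ _)]
        refine (ENNReal.ofReal_le_ofReal (phi_le (h.dat k) (mol m k) z)).trans_eq ?_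
        have e : cv (h.dat k).u (sqMul (h.dat k) (mol m k)) z.1 z.2 =
          √lam • cv u (mol m k) z.1 z.2 := cv_smul _ _ _ _ _
        rw [ENNReal.ofReal_add (Finset.sum_nonneg fun _ _ => norm_nonneg _) (norm_nonneg _),
          ENNReal.ofReal_sum_of_nonneg (fun _ _ => norm_nonneg _), e, norm_smul,
          Real.norm_of_nonneg (Real.sqrt_nonneg _), ENNReal.ofReal_mul (Real.sqrt_nonneg _)]
        simp only [hz, ofReal_norm]
    _ ≤ _ := by
        rw [lintegral_add_right _ (hmu.const_mul _), lintegral_finsetSum _ fun i _ => hm i,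
          lintegral_const_mul _ hmu, gradMass]
        exact add_le_add (Finset.sum_le_sum fun i _ => lintegral_cv_prod_le (h.meas i) k hρ1)
          (mul_le_mul_right (lintegral_cv_prod_le h.sol.meas_u k hρ1) _)

lemma enorm_le_of_tendsto {E : Type*} [NormedAddCommGroup E] {f : ℕ → E} {a : E}
    (h : Tendsto f atTop (𝓝 a)) {M : ENNReal} (hM : ∀ k, ‖f k‖ₑ ≤ M) : ‖a‖ₑ ≤ M :=
  le_of_tendsto' h.enorm hM

/-- Interior bounds on the unit cylinder. -/
lemma exists_bound (m n : ℕ) (hα : -1 < α) (hκ : 0 < κ) : ∃ C : ℝ, 0 ≤ C ∧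
    ∀ (lam : ℝ) (c : Coeffs m n) (u : Tan m × ℝ → Val n) (G : Fin (m + 1) → Tan m × ℝ → Val n),
      IsGradSol α κ lam c u G → ∀ᵐ z ∂(nuQ m α (1 / 2)),
        ‖u z‖ₑ ≤ ENNReal.ofReal C *
          ∫⁻ z, ‖u z‖ₑ ∂((volume : Measure (Tan m)).prod (wt α 1)) ∧
        (∀ i, ‖G i z‖ₑ ≤ ENNReal.ofReal C * gradMass α lam u G) ∧
        ‖√lam • u z‖ₑ ≤ ENNReal.ofReal C * gradMass α lam u G ∧
        ‖z.2⁻¹ • ∑ j, act (c.A (Fin.last m) j z.2) (G j z)‖ₑ ≤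
          ENNReal.ofReal C * gradMass α lam u G := by
  obtain ⟨C, hC, h⟩ := exists_mollified_bound (m := m) (n := n) hα hκ
  refine ⟨C, hC, fun lam c u G hs => ?_⟩
  have hk : ∀ k, Ker (hs.dat k).δ (mol m k) := fun k => ker_mol m k
  have hle := nuQ_le_prod (m := m) α (show (1 / 2 : ℝ) ≤ 1 by norm_num)
  have h1 : ∀ᵐ z ∂(nuQ m α (1 / 2)), ∀ k, ‖cv u (mol m k) z.1 z.2‖ₑ ≤ ENNReal.ofReal C *
      ∫⁻ z, ‖u z‖ₑ ∂((volume : Measure (Tan m)).prod (wt α 1)) := by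
    refine ae_all_iff.2 fun k => ?_
    filter_upwards [(h (hs.dat k) _ (hk k)).1] with z hz
    refine hz.trans ?_
    gcongr
    exact lintegral_cv_prod_le hs.sol.meas_u k (by change 1 - 4 * scl k ≤ 1; linarith [scl_pos k])
  have h2 : ∀ᵐ z ∂(nuQ m α (1 / 2)), ∀ k, ‖phi (hs.dat k) (mol m k) z‖ₑ ≤
      ENNReal.ofReal C * gradMass α lam u G := by
    refine ae_all_iff.2 fun k => ?_
    filter_upwards [(h (hs.dat k) _ (hk k)).2.1] with z hz
    refine hz.trans ?_
    gcongr
    exact hs.intPhi_le k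
  have h3 : ∀ᵐ z ∂(nuQ m α (1 / 2)), ∀ k, ENNReal.ofReal (z.2 ^ (-1 : ℝ)) *
      ‖flux c u (G (Fin.last m)) (Fin.last m) (mol m k) z.1 z.2‖ₑ ≤
      ENNReal.ofReal C * gradMass α lam u G := by
    refine ae_all_iff.2 fun k => ?_
    filter_upwards [(h (hs.dat k) _ (hk k)).2.2] with z hz
    refine hz.trans ?_
    gcongr
    exact hs.intPhi_le k
  have h4 : ∀ᵐ z ∂(nuQ m α (1 / 2)), ∀ k i, grd (hs.dat k) (mol m k) z i =
      cv (G i) (mol m k) z.1 z.2 :=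
    ae_all_iff.2 fun k => hs.ae_grd k (by linarith [scl_le k])
  have t1 := ae_mono hle (ae_tendsto_cv hs.sol.meas_u hs.sol.int_u)
  have t2 : ∀ᵐ z ∂(nuQ m α (1 / 2)), ∀ i, Tendsto (fun k => cv (G i) (mol m k) z.1 z.2) atTop
      (𝓝 (G i z)) := ae_all_iff.2 fun i => ae_mono hle (ae_tendsto_cv (hs.meas i) (hs.int i))
  filter_upwards [h1, h2, h3, h4, t1, t2, ae_nuQ_mem α (1 / 2)] with z h1 h2 h3 h4 t1 t2 hz
  have hnp : ∀ k, ‖phi (hs.dat k) (mol m k) z‖ₑ = ENNReal.ofReal (phi (hs.dat k) (mol m k) z) :=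
    fun k => by rw [← ofReal_norm, Real.norm_of_nonneg (phi_nonneg _ _ _)]
  refine ⟨enorm_le_of_tendsto t1 h1, fun i => enorm_le_of_tendsto (t2 i) fun k => ?_,
    enorm_le_of_tendsto (t1.const_smul √lam) fun k => ?_,
    enorm_le_of_tendsto ((tendsto_finsetSum Finset.univ fun j _ =>
      ((actL (c.A (Fin.last m) j z.2)).continuous.tendsto _).comp (t2 j)).const_smul z.2⁻¹) fun k => ?_⟩
  · refine le_trans ?_ (h2 k)
    rw [hnp, ← h4 k i, ← ofReal_norm]
    exact ENNReal.ofReal_le_ofReal (norm_grd_le _ i)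
  · refine le_trans ?_ (h2 k)
    rw [hnp, ← ofReal_norm, norm_smul, Real.norm_of_nonneg (Real.sqrt_nonneg _)]
    exact ENNReal.ofReal_le_ofReal (sqrt_lam_mul_le (hs.dat k))
  · refine le_trans (le_of_eq ?_) (h3 k)
    have e := flux_eq_sum (hs.dat k) (η := mol m k) (z := z) (Fin.last m)
    simp only [h4 k] at e
    change flux c u (G (Fin.last m)) (Fin.last m) (mol m k) z.1 z.2 = _ at e
    rw [e, enorm_smul, Real.rpow_neg_one, ← ofReal_norm z.2⁻¹,
      Real.norm_of_nonneg (inv_nonneg.2 hz.2.1.le)]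
    rfl

end Limit

end

section

variable {m n : ℕ} {α r : ℝ}

/-! ### Parabolic dilations -/

/-- The parabolic dilation that maps the unit cylinder to `Q_r^+`. -/
def dil (m : ℕ) (hr : 0 < r) : Tan m × ℝ ≃ₜ Pt m where
  toFun w := (r ^ 2 * w.1.1, r • w.1.2, r * w.2)
  invFun z := ((r⁻¹ ^ 2 * z.1, r⁻¹ • z.2.1), r⁻¹ * z.2.2)
  left_inv w := by
    have h : r ≠ 0 := hr.ne'
    ext <;> simp [h, smul_smul]
  right_inv z := by
    have h : r ≠ 0 := hr.ne'
    ext <;> simp [h, smul_smul]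
  continuous_toFun := by fun_prop
  continuous_invFun := by fun_prop

lemma dil_apply (hr : 0 < r) (w : Tan m × ℝ) : dil m hr w = (r ^ 2 * w.1.1, r • w.1.2, r * w.2) := rfl

lemma xd_dil (hr : 0 < r) (w : Tan m × ℝ) : xd (dil m hr w) = r * w.2 := rfl

/-- The exponent is the parabolic dimension `2 + m + 1`. -/
lemma map_dil_volume (hr : 0 < r) :
    Measure.map (dil m hr) ((volume : Measure (Tan m)).prod volume) =
      ENNReal.ofReal (r ^ (m + 3))⁻¹ • (volume : Measure (Pt m)) := by
  have h0 : r ≠ 0 := hr.ne'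
  have e : ⇑(dil m hr) = MeasurableEquiv.prodAssoc ∘
      Prod.map (Prod.map (r ^ 2 * ·) (r • · : EuclideanSpace ℝ (Fin m) → _)) (r * ·) := rfl
  have m1 : Measurable fun x : ℝ => r ^ 2 * x := by fun_prop
  have m2 : Measurable fun x : EuclideanSpace ℝ (Fin m) => r • x := by fun_prop
  have m3 : Measurable fun x : ℝ => r * x := by fun_prop
  rw [e, ← Measure.map_map MeasurableEquiv.prodAssoc.measurable ((m1.prodMap m2).prodMap m3),
    ← Measure.map_prod_map _ _ (m1.prodMap m2) m3, Measure.volume_eq_prod ℝ,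
    ← Measure.map_prod_map _ _ m1 m2, Real.map_volume_mul_left h0,
    Real.map_volume_mul_left (pow_ne_zero 2 h0), Measure.map_addHaar_smul volume h0]
  simp only [Measure.prod_smul_left, Measure.prod_smul_right, Measure.map_smul, smul_smul]
  rw [(measurePreserving_prodAssoc volume volume volume).map_eq]
  congr 1
  rw [← ENNReal.ofReal_mul (by positivity), ← ENNReal.ofReal_mul (by positivity), ← abs_mul, ← abs_mul,
    finrank_euclideanSpace_fin, abs_of_pos (by positivity), ← mul_inv, ← mul_inv]
  congr 2
  ring

/-- The unit cylinder in the coordinates `((t, x'), x_d)`. -/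
def unitCyl (m : ℕ) (ρ : ℝ) : Set (Tan m × ℝ) := tanBox m ρ ×ˢ Ioo 0 ρ

lemma measurableSet_unitCyl (ρ : ℝ) : MeasurableSet (unitCyl m ρ) :=
  (measurableSet_tanBox ρ).prod measurableSet_Ioo

lemma measurableSet_Qplus (r : ℝ) : MeasurableSet (Qplus m r) :=
  measurableSet_Ioo.prod (measurableSet_ball.prod measurableSet_Ioo)

lemma dil_preimage_Qplus (hr : 0 < r) : dil m hr ⁻¹' Qplus m r = unitCyl m 1 := by
  ext w
  simp only [mem_preimage, dil_apply, Qplus, unitCyl, tanBox, mem_prod, mem_Ioo,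
    mem_ball_zero_iff, norm_smul, Real.norm_of_nonneg hr.le]
  have h2 : 0 < r ^ 2 := by positivity
  constructor
  · rintro ⟨⟨h3, h4⟩, h5, h6, h7⟩
    refine ⟨⟨⟨?_, ?_⟩, ?_⟩, ?_, ?_⟩ <;> nlinarith
  · rintro ⟨⟨⟨h3, h4⟩, h5⟩, h6, h7⟩
    refine ⟨⟨?_, ?_⟩, ?_, ?_, ?_⟩ <;> nlinarith

lemma nuQ_eq_withDensity (α ρ : ℝ) : nuQ m α ρ =
    (((volume : Measure (Tan m)).prod volume).restrict (unitCyl m ρ)).withDensity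
      fun w => ENNReal.ofReal (w.2 ^ α) := by
  rw [nuQ, wt, prod_withDensity_right (measurable_weight α), Measure.prod_restrict, unitCyl]

lemma nuQ_eq_restrict (α : ℝ) : nuQ m α 1 =
    ((volume : Measure (Tan m)).prod (wt α 1)).restrict (unitCyl m 1) := by
  have h : wt α 1 = (wt α 1).restrict (Ioo 0 1) := by
    rw [wt, restrict_withDensity measurableSet_Ioo, Measure.restrict_restrict measurableSet_Ioo,
      inter_self]
  rw [nuQ, unitCyl, ← Measure.prod_restrict, ← h]

lemma mu_restrict_Qplus (α r : ℝ) : (mu m α).restrict (Qplus m r) =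
    (volume.restrict (Qplus m r)).withDensity fun z => ENNReal.ofReal (xd z ^ α) := by
  rw [mu, restrict_withDensity (measurableSet_Qplus r),
    Measure.restrict_restrict (measurableSet_Qplus r), inter_eq_left.2]
  intro z hz
  exact hz.2.2.1

lemma measurable_xd : Measurable (xd (m := m)) := measurable_snd.comp measurable_snd

lemma measurable_xd_rpow (α : ℝ) : Measurable fun z : Pt m => ENNReal.ofReal (xd z ^ α) :=
  (measurable_weight α).comp measurable_xd

lemma volume_eq_map_dil (hr : 0 < r) : (volume : Measure (Pt m)) =
    ENNReal.ofReal (r ^ (m + 3)) • Measure.map (dil m hr) ((volume : Measure (Tan m)).prod volume) := by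
  rw [map_dil_volume hr, smul_smul, ← ENNReal.ofReal_mul (by positivity),
    mul_inv_cancel₀ (by positivity), ENNReal.ofReal_one, one_smul]

/-- The Jacobian of the dilation for the weighted measure. -/
def jac (m : ℕ) (α r : ℝ) : ℝ := r ^ (m + 3) * r ^ α

lemma jac_pos (hr : 0 < r) : 0 < jac m α r := by unfold jac; positivity

lemma mu_restrict_eq_map (hr : 0 < r) : (mu m α).restrict (Qplus m r) =
    ENNReal.ofReal (jac m α r) • Measure.map (dil m hr).toMeasurableEquiv (nuQ m α 1) := by
  refine Measure.ext_of_lintegral _ fun F hF => ?_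
  have hpre : (dil m hr).toMeasurableEquiv ⁻¹' Qplus m r = unitCyl m 1 := dil_preimage_Qplus hr
  have hw : Measurable fun w : Tan m × ℝ => ENNReal.ofReal (w.2 ^ α) :=
    (measurable_weight α).comp measurable_snd
  have hF' : Measurable fun w => F ((dil m hr).toMeasurableEquiv w) :=
    hF.comp (dil m hr).toMeasurableEquiv.measurable
  rw [mu_restrict_Qplus, lintegral_withDensity_eq_lintegral_mul _ (measurable_xd_rpow α) hF,
    lintegral_smul_measure, lintegral_map_equiv, nuQ_eq_withDensity,
    lintegral_withDensity_eq_lintegral_mul _ hw hF', volume_eq_map_dil hr,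
    Measure.restrict_smul, lintegral_smul_measure]
  change _ • ∫⁻ z in Qplus m r, _ ∂(Measure.map (dil m hr).toMeasurableEquiv _) = _
  rw [Measure.restrict_map (dil m hr).toMeasurableEquiv.measurable (measurableSet_Qplus r), hpre,
    lintegral_map_equiv, jac, ENNReal.ofReal_mul (by positivity), smul_eq_mul, smul_eq_mul, mul_assoc]
  congr 1
  rw [← lintegral_const_mul' _ _ ENNReal.ofReal_ne_top]
  refine setLIntegral_congr_fun (measurableSet_unitCyl 1) fun w hw => ?_
  change ENNReal.ofReal ((r * w.2) ^ α) * F (dil m hr w) =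
    ENNReal.ofReal (r ^ α) * (ENNReal.ofReal (w.2 ^ α) * F (dil m hr w))
  rw [Real.mul_rpow hr.le hw.2.1.le, ENNReal.ofReal_mul (by positivity), mul_assoc]

lemma integral_mu_eq (hr : 0 < r) {E : Type*} [NormedAddCommGroup E] [NormedSpace ℝ E]
    (F : Pt m → E) : ∫ z in Qplus m r, F z ∂(mu m α) =
      jac m α r • ∫ w, F (dil m hr w) ∂(nuQ m α 1) := by
  rw [mu_restrict_eq_map hr, integral_smul_measure, integral_map_equiv,
    ENNReal.toReal_ofReal (jac_pos hr).le]
  rfl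

lemma lintegral_mu_eq (hr : 0 < r) (F : Pt m → ENNReal) : ∫⁻ z in Qplus m r, F z ∂(mu m α) =
    ENNReal.ofReal (jac m α r) * ∫⁻ w, F (dil m hr w) ∂(nuQ m α 1) := by
  rw [mu_restrict_eq_map hr, lintegral_smul_measure, lintegral_map_equiv, smul_eq_mul]
  rfl

lemma ae_mu_iff (hr : 0 < r) {P : Pt m → Prop} : (∀ᵐ z ∂((mu m α).restrict (Qplus m r)), P z) ↔
    ∀ᵐ w ∂(nuQ m α 1), P (dil m hr w) := by
  rw [mu_restrict_eq_map hr, Measure.ae_ennreal_smul_measure_iff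
    (by simpa using jac_pos hr), (dil m hr).toMeasurableEquiv.measurableEmbedding.ae_map_iff]
  rfl

/-- Weak derivatives are defined by unweighted integrals. They are rewritten with the weighted
measure so that all terms live on `nuQ`. -/
lemma integral_volume_eq (hr : 0 < r) (α : ℝ) {E : Type*} [NormedAddCommGroup E] [NormedSpace ℝ E]
    (F : Pt m → E) : ∫ z in Qplus m r, F z =
      (jac m α r * r ^ (-α)) • ∫ w, w.2 ^ (-α) • F (dil m hr w) ∂(nuQ m α 1) := by
  have h1 : ∫ z in Qplus m r, F z = ∫ z in Qplus m r, xd z ^ (-α) • F z ∂(mu m α) := by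
    rw [mu_restrict_Qplus, integral_withDensity_eq_integral_toReal_smul (measurable_xd_rpow α)
      (ae_of_all _ fun _ => ENNReal.ofReal_lt_top)]
    refine setIntegral_congr_fun (measurableSet_Qplus r) fun z hz => ?_
    have hz' : 0 < xd z := hz.2.2.1
    rw [ENNReal.toReal_ofReal (Real.rpow_nonneg hz'.le _), smul_smul, ← Real.rpow_add hz']
    simp
  rw [h1, integral_mu_eq hr, mul_smul]
  congr 1
  rw [← integral_smul]
  refine integral_congr_ae ?_
  filter_upwards [ae_nuQ_mem α 1] with w hw
  rw [xd_dil, Real.mul_rpow hr.le hw.2.1.le, mul_smul]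

/-- After dilation `Q_{r/2}^+` occupies the times `(-1 / 4, 0)`, inside the interval `(-1 / 2, 0)`
of `nuQ m α (1 / 2)`. The weight is positive, so null sets agree. -/
lemma ae_volume_of_ae_nuQ (hr : 0 < r) {P : Pt m → Prop}
    (h : ∀ᵐ w ∂(nuQ m α (1 / 2)), P (dil m hr w)) :
    ∀ᵐ z ∂(volume.restrict (Qplus m (r / 2))), P z := by
  have h1 : ∀ᵐ w ∂(((volume : Measure (Tan m)).prod volume).restrict (unitCyl m (1 / 2))),
      P (dil m hr w) := by
    have hm : Measurable fun w : Tan m × ℝ => ENNReal.ofReal (w.2 ^ α) :=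
      (measurable_weight α).comp measurable_snd
    rw [nuQ_eq_withDensity, ae_withDensity_iff hm] at h
    filter_upwards [h, ae_restrict_mem (measurableSet_unitCyl (1 / 2))] with w hw hw2
    exact hw (by simpa using Real.rpow_pos_of_pos hw2.2.1 α)
  rw [ae_restrict_iff' (measurableSet_unitCyl _)] at h1
  rw [ae_restrict_iff' (measurableSet_Qplus _), volume_eq_map_dil hr,
    Measure.ae_ennreal_smul_measure_iff (by simpa using by positivity)]
  change ∀ᵐ z ∂(Measure.map (dil m hr).toMeasurableEquiv _), _
  rw [(dil m hr).toMeasurableEquiv.measurableEmbedding.ae_map_iff]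
  filter_upwards [h1] with w hw hq
  refine hw ?_
  have hq' : dil m hr w ∈ Qplus m (r / 2) := hq
  simp only [dil_apply, Qplus, mem_prod, mem_Ioo,
    mem_ball_zero_iff, norm_smul, Real.norm_of_nonneg hr.le] at hq'
  simp only [unitCyl, tanBox, mem_prod, mem_Ioo, mem_ball_zero_iff]
  obtain ⟨⟨h3, h4⟩, h5, h6, h7⟩ := hq'
  have h2 : 0 < r ^ 2 := by positivity
  refine ⟨⟨⟨?_, ?_⟩, ?_⟩, ?_, ?_⟩ <;> nlinarith

/-! ### Products of test functions -/

/-- The dilated product of a tangential and a normal test function. -/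
def tens (hr : 0 < r) (η : Tan m → ℝ) (ψ : ℝ → ℝ) (z : Pt m) : ℝ :=
  η ((dil m hr).symm z).1 * ψ ((dil m hr).symm z).2

/-- The inverse dilation as a linear map. -/
def undil (m : ℕ) (r : ℝ) : Pt m →L[ℝ] Tan m × ℝ :=
  ((r⁻¹ ^ 2 • ContinuousLinearMap.fst ℝ ℝ (EuclideanSpace ℝ (Fin m) × ℝ)).prod
    (r⁻¹ • (ContinuousLinearMap.fst ℝ (EuclideanSpace ℝ (Fin m)) ℝ).comp
      (ContinuousLinearMap.snd ℝ ℝ (EuclideanSpace ℝ (Fin m) × ℝ)))).prod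
    (r⁻¹ • (ContinuousLinearMap.snd ℝ (EuclideanSpace ℝ (Fin m)) ℝ).comp
      (ContinuousLinearMap.snd ℝ ℝ (EuclideanSpace ℝ (Fin m) × ℝ)))

lemma contDiff_tens (hr : 0 < r) {η : Tan m → ℝ} {ψ : ℝ → ℝ} (hη : ContDiff ℝ ∞ η)
    (hψ : ContDiff ℝ ∞ ψ) : ContDiff ℝ ∞ (tens hr η ψ) := by
  have h : ContDiff ℝ ∞ fun w : Tan m × ℝ => η w.1 * ψ w.2 :=
    (hη.comp contDiff_fst).mul (hψ.comp contDiff_snd)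
  exact h.comp (undil m r).contDiff

lemma fderiv_tens (hr : 0 < r) {η : Tan m → ℝ} {ψ : ℝ → ℝ} (hη : ContDiff ℝ ∞ η)
    (hψ : ContDiff ℝ ∞ ψ) (w : Tan m × ℝ) (v : Pt m) :
    fderiv ℝ (tens hr η ψ) (dil m hr w) v =
      fderiv ℝ η w.1 (undil m r v).1 * ψ w.2 + η w.1 * (deriv ψ w.2 * (undil m r v).2) := by
  have hw : undil m r (dil m hr w) = w := (dil m hr).symm_apply_apply w
  have h1 : HasFDerivAt (fun w : Tan m × ℝ => η w.1)
      ((fderiv ℝ η w.1).comp (ContinuousLinearMap.fst ℝ (Tan m) ℝ)) w :=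
    (hη.differentiable (by simp) w.1).hasFDerivAt.comp w hasFDerivAt_fst
  have h2 : HasFDerivAt (fun w : Tan m × ℝ => ψ w.2)
      ((fderiv ℝ ψ w.2).comp (ContinuousLinearMap.snd ℝ (Tan m) ℝ)) w :=
    (hψ.differentiable (by simp) w.2).hasFDerivAt.comp w hasFDerivAt_snd
  have h3 := h1.mul h2
  rw [← hw] at h3
  have h4 := h3.comp (dil m hr w) (undil m r).hasFDerivAt
  have h5 : fderiv ℝ (tens hr η ψ) (dil m hr w) = _ := h4.fderiv
  rw [h5, hw]
  simp only [add_apply, ContinuousLinearMap.comp_apply, smul_apply, smul_eq_mul,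
    ContinuousLinearMap.coe_fst', ContinuousLinearMap.coe_snd']
  have h6 : fderiv ℝ ψ w.2 ((undil m r) v).2 = deriv ψ w.2 * ((undil m r) v).2 := by
    rw [← fderiv_apply_one_eq_deriv, mul_comm, ← smul_eq_mul, ← map_smul, smul_eq_mul, mul_one]
  rw [h6]
  ring

lemma undil_timeDir (r : ℝ) : undil m r (timeDir m) = (r⁻¹ ^ 2 • tdir m, 0) := by
  ext <;> simp [undil, timeDir, tdir]

lemma undil_spaceDir (r : ℝ) (i : Fin m) :
    undil m r (spaceDir i.castSucc) = (r⁻¹ • xdir i, 0) := by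
  ext <;> simp [undil, spaceDir, xdir]

lemma undil_spaceDir_last (r : ℝ) : undil m r (spaceDir (Fin.last m)) = (0, r⁻¹) := by
  ext <;> simp [undil, spaceDir]

section TestDeriv
variable (hr : 0 < r) {η : Tan m → ℝ} {ψ : ℝ → ℝ}

lemma dt_tens (hη : ContDiff ℝ ∞ η) (hψ : ContDiff ℝ ∞ ψ) (w : Tan m × ℝ) :
    dt (tens hr η ψ) (dil m hr w) = r⁻¹ ^ 2 * (pd (tdir m) η w.1 * ψ w.2) := by
  rw [dt, fderiv_tens hr hη hψ, undil_timeDir, map_smul]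
  simp [pd, mul_assoc]

lemma dx_tens (hη : ContDiff ℝ ∞ η) (hψ : ContDiff ℝ ∞ ψ) (w : Tan m × ℝ) (i : Fin m) :
    dx i.castSucc (tens hr η ψ) (dil m hr w) = r⁻¹ * (pd (xdir i) η w.1 * ψ w.2) := by
  rw [dx, fderiv_tens hr hη hψ, undil_spaceDir, map_smul]
  simp [pd, mul_assoc]

lemma dx_last_tens (hη : ContDiff ℝ ∞ η) (hψ : ContDiff ℝ ∞ ψ) (w : Tan m × ℝ) :
    dx (Fin.last m) (tens hr η ψ) (dil m hr w) = r⁻¹ * (η w.1 * deriv ψ w.2) := by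
  rw [dx, fderiv_tens hr hη hψ, undil_spaceDir_last, map_zero]
  ring

lemma dt_smul_const {f : Pt m → ℝ} (hf : ContDiff ℝ ∞ f) (e : Val n) (z : Pt m) :
    dt (fun z => f z • e) z = dt f z • e := by
  rw [dt, fderiv_smul_const (hf.differentiable (by simp) z)]
  rfl

lemma dx_smul_const {f : Pt m → ℝ} (hf : ContDiff ℝ ∞ f) (e : Val n) (z : Pt m) (i : Fin (m + 1)) :
    dx i (fun z => f z • e) z = dx i f z • e := by
  rw [dx, fderiv_smul_const (hf.differentiable (by simp) z)]
  rfl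

lemma isTestFunction_tens (hη : TanTest η) (hψ : ContDiff ℝ ∞ ψ) (hc : HasCompactSupport ψ)
    {O : Set (Pt m)} (hO : ∀ w : Tan m × ℝ, w.1 ∈ tanBox m 1 → w.2 ∈ tsupport ψ → dil m hr w ∈ O) :
    IsTestFunction O (tens hr η ψ) := by
  have hK : IsCompact (dil m hr '' (tsupport η ×ˢ tsupport ψ)) :=
    (IsCompact.prod hη.hasCompactSupport hc).image (dil m hr).continuous
  have hsub : ∀ z, tens hr η ψ z ≠ 0 → z ∈ dil m hr '' (tsupport η ×ˢ tsupport ψ) := by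
    intro z hz
    refine ⟨(dil m hr).symm z, ⟨subset_tsupport _ (left_ne_zero_of_mul hz),
      subset_tsupport _ (right_ne_zero_of_mul hz)⟩, (dil m hr).apply_symm_apply z⟩
  refine ⟨contDiff_tens hr hη.smooth hψ, HasCompactSupport.intro hK fun z hz => ?_, ?_⟩
  · by_contra h
    exact hz (hsub z h)
  · refine (closure_minimal (fun z hz => hsub z hz) hK.isClosed).trans ?_
    rintro _ ⟨w, hw, rfl⟩
    exact hO w (hη.supp hw.1) hw.2

lemma isTestFunction_smul_const {O : Set (Pt m)} {f : Pt m → ℝ} (hf : IsTestFunction O f)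
    (e : Val n) : IsTestFunction O fun z => f z • e :=
  ⟨hf.smooth.smul contDiff_const, hf.hasCompactSupport.smul_right,
    (tsupport_smul_subset_left f fun _ => e).trans hf.tsupport_subset⟩

lemma dil_mem_Qtest {w : Tan m × ℝ} (h1 : w.1 ∈ tanBox m 1) (h2 : w.2 < 1) :
    dil m hr w ∈ Qtest m r := by
  obtain ⟨⟨h3, h4⟩, h5⟩ := h1
  rw [mem_ball_zero_iff] at h5
  have h6 : 0 < r ^ 2 := by positivity
  simp only [dil_apply, Qtest, mem_prod, mem_Ioo, mem_Iio, mem_ball_zero_iff, norm_smul,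
    Real.norm_of_nonneg hr.le]
  refine ⟨⟨?_, ?_⟩, ?_, ?_⟩ <;> nlinarith

lemma dil_mem_Qplus {w : Tan m × ℝ} (h1 : w.1 ∈ tanBox m 1) (h2 : w.2 ∈ Ioo 0 1) :
    dil m hr w ∈ Qplus m r := by
  have h : w ∈ dil m hr ⁻¹' Qplus m r := by rw [dil_preimage_Qplus]; exact ⟨h1, h2⟩
  exact h

end TestDeriv

end

section

variable {m n : ℕ} {α : ℝ}

/-! ### Vector-valued weak primitives -/

lemma integrable_smul_of_tsupport_subset {v : ℝ → Val n} {χ : ℝ → ℝ} {U : Set ℝ}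
    (hv : LocallyIntegrableOn v U) (hχ : Continuous χ) (hc : HasCompactSupport χ)
    (hs : tsupport χ ⊆ U) : Integrable fun s => χ s • v s := by
  obtain ⟨C, hC⟩ := hχ.bounded_above_of_compact_support hc
  have h1 : IntegrableOn v (tsupport χ) := hv.integrableOn_compact_subset hs hc
  have h2 : IntegrableOn (fun s => χ s • v s) (tsupport χ) :=
    Integrable.bdd_smul h1 C hχ.aestronglyMeasurable (ae_of_all _ hC)
  refine (integrableOn_iff_integrable_of_support_subset ?_).1 h2
  intro s hs
  exact subset_tsupport _ (left_ne_zero_of_smul hs)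

lemma ae_eq_integral_of_weak_natural {F f : ℝ → Val n} (hF : IntegrableOn F (Ioo 0 1))
    (hf : IntegrableOn f (Ioo 0 1))
    (h : ∀ ψ : ℝ → ℝ, ContDiff ℝ ∞ ψ → HasCompactSupport ψ → tsupport ψ ⊆ Iio 1 →
      ∫ s in Ioo 0 1, (deriv ψ s • F s + ψ s • f s) = 0) :
    ∀ᵐ s ∂(volume.restrict (Ioo (0 : ℝ) 1)), F s = ∫ σ in (0 : ℝ)..s, f σ := by
  have hk : ∀ k, ∀ᵐ s ∂(volume.restrict (Ioo (0 : ℝ) 1)), F s k = ∫ σ in (0 : ℝ)..s, f σ k := by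
    intro k
    refine ae_eq_primitive_of_weak_natural
      ((EuclideanSpace.proj k : Val n →L[ℝ] ℝ).integrable_comp hF)
      ((EuclideanSpace.proj k : Val n →L[ℝ] ℝ).integrable_comp hf) fun ψ hψ hc hs => ?_
    obtain ⟨C, hC⟩ := hψ.continuous.bounded_above_of_compact_support hc
    have hψ' : Continuous (deriv ψ) := hψ.continuous_deriv (by simp)
    obtain ⟨C', hC'⟩ := hψ'.bounded_above_of_compact_support hc.deriv
    have i1 : Integrable (fun s => deriv ψ s • F s) (volume.restrict (Ioo 0 1)) :=
      hF.bdd_smul C' hψ'.aestronglyMeasurable (ae_of_all _ hC')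
    have i2 : Integrable (fun s => ψ s • f s) (volume.restrict (Ioo 0 1)) :=
      hf.bdd_smul C hψ.continuous.aestronglyMeasurable (ae_of_all _ hC)
    have h1 := (EuclideanSpace.proj k : Val n →L[ℝ] ℝ).integral_comp_comm (i1.add i2)
    have h2 : ∫ s in Ioo 0 1, (deriv ψ s • F s + ψ s • f s) = 0 := h ψ hψ hc hs
    simp only [Pi.add_apply, h2, map_zero] at h1
    simpa using h1
  filter_upwards [ae_all_iff.2 hk, ae_restrict_mem measurableSet_Ioo] with s hs hs1
  have hi : IntervalIntegrable f volume 0 s := by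
    rw [intervalIntegrable_iff_integrableOn_Ioo_of_le hs1.1.le]
    exact hf.mono_set (Ioo_subset_Ioo_right hs1.2.le)
  ext k
  rw [hs k]
  exact (EuclideanSpace.proj k : Val n →L[ℝ] ℝ).intervalIntegral_comp_comm hi

lemma exists_ae_eq_const_add_integral_of_weak {v g : ℝ → Val n}
    (hv : LocallyIntegrableOn v (Ioo 0 1)) (hg : LocallyIntegrableOn g (Ioo 0 1))
    (h : ∀ ψ : ℝ → ℝ, ContDiff ℝ ∞ ψ → HasCompactSupport ψ → tsupport ψ ⊆ Ioo 0 1 →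
      ∫ s in Ioo 0 1, deriv ψ s • v s = -∫ s in Ioo 0 1, ψ s • g s) :
    ∃ c, ∀ᵐ s ∂(volume.restrict (Ioo (0 : ℝ) 1)), v s = c + ∫ σ in (1 / 2 : ℝ)..s, g σ := by
  have hcomp : ∀ {w : ℝ → Val n}, LocallyIntegrableOn w (Ioo 0 1) → ∀ k,
      LocallyIntegrableOn (fun s => w s k) (Ioo 0 1) := by
    intro w hw k x hx
    obtain ⟨t, ht, hi⟩ := hw x hx
    exact ⟨t, ht, (EuclideanSpace.proj k : Val n →L[ℝ] ℝ).integrable_comp hi⟩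
  have hk : ∀ k, ∃ c, ∀ᵐ s ∂(volume.restrict (Ioo (0 : ℝ) 1)),
      v s k = c + ∫ σ in (1 / 2 : ℝ)..s, g σ k := by
    intro k
    refine exists_ae_eq_const_add_primitive_of_weak (hcomp hv k) (hcomp hg k)
      fun ψ hψ hc hs => ?_
    have hψ' : Continuous (deriv ψ) := hψ.continuous_deriv (by simp)
    have i1 := (integrable_smul_of_tsupport_subset hv hψ' hc.deriv
      ((tsupport_deriv_subset (f := ψ)).trans hs)).integrableOn (s := Ioo 0 1)
    have i2 := (integrable_smul_of_tsupport_subset hg hψ.continuous hc hs).integrableOn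
      (s := Ioo 0 1)
    have h1 := (EuclideanSpace.proj k : Val n →L[ℝ] ℝ).integral_comp_comm i1
    have h2 := (EuclideanSpace.proj k : Val n →L[ℝ] ℝ).integral_comp_comm i2
    rw [h ψ hψ hc hs, map_neg, ← h2] at h1
    simpa using h1
  choose c hc using hk
  refine ⟨WithLp.toLp 2 c, ?_⟩
  filter_upwards [ae_all_iff.2 hc, ae_restrict_mem measurableSet_Ioo] with s hs hs1
  have hi : IntervalIntegrable g volume (1 / 2) s := by
    refine (hg.integrableOn_compact_subset ?_ isCompact_uIcc).intervalIntegrable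
    exact (convex_Ioo (0 : ℝ) 1).ordConnected.uIcc_subset ⟨by norm_num, by norm_num⟩ hs1
  ext k
  rw [hs k, PiLp.add_apply]
  congr 1
  exact (EuclideanSpace.proj k : Val n →L[ℝ] ℝ).intervalIntegral_comp_comm hi

lemma ae_eq_of_weak {v g : ℝ → Val n}
    (hv : LocallyIntegrableOn v (Ioo 0 1)) (hg : LocallyIntegrableOn g (Ioo 0 1))
    (h : ∀ ψ : ℝ → ℝ, ContDiff ℝ ∞ ψ → HasCompactSupport ψ → tsupport ψ ⊆ Ioo 0 1 →
      ∫ s in Ioo 0 1, ψ s • v s = -∫ s in Ioo 0 1, ψ s • g s) :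
    ∀ᵐ s ∂(volume.restrict (Ioo (0 : ℝ) 1)), v s = -g s := by
  rw [ae_restrict_iff' measurableSet_Ioo]
  have h1 := isOpen_Ioo.ae_eq_zero_of_integral_contDiff_smul_eq_zero (hv.add hg)
    fun ψ hψ hc hs => by
      have i1 := integrable_smul_of_tsupport_subset hv hψ.continuous hc hs
      have i2 := integrable_smul_of_tsupport_subset hg hψ.continuous hc hs
      have hz : ∀ w : ℝ → Val n, ∫ s in Ioo 0 1, ψ s • w s = ∫ s, ψ s • w s := fun w =>
        setIntegral_eq_integral_of_forall_compl_eq_zero fun s hs' => by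
          rw [image_eq_zero_of_notMem_tsupport fun h' => hs' (hs h'), zero_smul]
      have h2 := h ψ hψ hc hs
      rw [hz, hz] at h2
      simp only [Pi.add_apply, smul_add]
      rw [integral_add i1 i2, h2, neg_add_cancel]
  filter_upwards [h1] with s hs hs1
  exact eq_neg_of_add_eq_zero_left (hs hs1)

/-! ### Moments of functions on the unit cylinder -/

lemma TanTest.exists_bound {η : Tan m → ℝ} (h : TanTest η) : ∃ C, ∀ y, ‖η y‖ ≤ C :=
  h.smooth.continuous.bounded_above_of_compact_support h.hasCompactSupport

lemma TanTest.pd {η : Tan m → ℝ} (h : TanTest η) (e : Tan m) : TanTest (pd e η) :=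
  ⟨contDiff_pd h.smooth e, h.hasCompactSupport.fderiv_apply ℝ e,
    (tsupport_fderiv_apply_subset ℝ e).trans h.supp⟩

section Moments
variable {f : Tan m × ℝ → Val n} {η : Tan m → ℝ}

lemma integrable_tanTest_smul (hf : Integrable f (volume.prod (wt α 1))) (hη : TanTest η) :
    Integrable (fun z : Tan m × ℝ => η z.1 • f z) (volume.prod (wt α 1)) := by
  obtain ⟨C, hC⟩ := hη.exists_bound
  exact hf.bdd_smul C (φ := fun z : Tan m × ℝ => η z.1)
    (hη.smooth.continuous.comp continuous_fst).aestronglyMeasurable (ae_of_all _ fun z => hC z.1)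

lemma integrable_mom (hf : Integrable f (volume.prod (wt α 1))) (hη : TanTest η) :
    Integrable (mom f η) (wt α 1) :=
  (integrable_tanTest_smul hf hη).integral_prod_right

lemma integrable_prod_smul (hf : Integrable f (volume.prod (wt α 1))) (hη : TanTest η) {b : ℝ → ℝ}
    (hb : Measurable b) {C : ℝ} (hC : ∀ s ∈ Ioo (0 : ℝ) 1, ‖b s‖ ≤ C) :
    Integrable (fun z : Tan m × ℝ => (η z.1 * b z.2) • f z) (volume.prod (wt α 1)) := by
  have h2 : ∀ᵐ s ∂(wt α 1), s ∈ Ioo (0 : ℝ) 1 := ae_wt_iff.2 (ae_restrict_mem measurableSet_Ioo)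
  have h3 : ∀ᵐ z ∂((volume : Measure (Tan m)).prod (wt α 1)), ‖b z.2‖ ≤ C := by
    filter_upwards [Measure.quasiMeasurePreserving_snd.ae h2] with z hz using hC _ hz
  have h := (integrable_tanTest_smul hf hη).bdd_smul C (φ := fun z : Tan m × ℝ => b z.2)
    (hb.comp measurable_snd).aestronglyMeasurable h3
  refine h.congr (ae_of_all _ fun z => ?_)
  simp only [Pi.smul_apply', smul_smul, mul_comm]

lemma integral_prod_smul (hf : Integrable f (volume.prod (wt α 1)))
    (hz : ∀ z ∉ unitCyl m 1, f z = 0) (hη : TanTest η) {b : ℝ → ℝ}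
    (hb : Measurable b) {C : ℝ} (hC : ∀ s ∈ Ioo (0 : ℝ) 1, ‖b s‖ ≤ C) :
    ∫ z, (η z.1 * b z.2) • f z ∂(nuQ m α 1) = ∫ s, b s • mom f η s ∂(wt α 1) := by
  rw [nuQ_eq_restrict, setIntegral_eq_integral_of_forall_compl_eq_zero (fun z h => by
    rw [hz z h, smul_zero]), integral_prod_symm _ (integrable_prod_smul hf hη hb hC)]
  congr 1
  ext1 s
  rw [mom, ← integral_smul]
  congr 1
  ext1 y
  rw [smul_smul, mul_comm]

lemma nuQ_one_le_prod (m : ℕ) (α : ℝ) : nuQ m α 1 ≤ (volume : Measure (Tan m)).prod (wt α 1) :=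
  nuQ_le_prod α le_rfl

/-- Bounded measurable coefficients. -/
structure BddCoeff (M : ℝ → Matrix (Fin n) (Fin n) ℝ) (K : ℝ) : Prop where
  meas : MeasurableCoeff M
  bdd : ∀ s > 0, entryNorm (M s) ≤ K

variable {M : ℝ → Matrix (Fin n) (Fin n) ℝ} {K : ℝ}

lemma BddCoeff.integrable_act (hM : BddCoeff M K) {v : ℝ → Val n} (hv : Integrable v (wt α 1)) :
    Integrable (fun s => act (M s) (v s)) (wt α 1) := by
  refine Integrable.mono' (hv.norm.const_mul K)
    (aestronglyMeasurable_act (fun k l => aemeasurable_coeff_wt hM.meas α 1 k l)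
      hv.aestronglyMeasurable) ?_
  rw [ae_wt_iff]
  filter_upwards [ae_restrict_mem measurableSet_Ioo] with s hs
  exact (norm_act_le _ _).trans (mul_le_mul_of_nonneg_right (hM.bdd s hs.1) (norm_nonneg _))

lemma BddCoeff.integrable_act_prod (hM : BddCoeff M K) (hf : Integrable f (volume.prod (wt α 1))) :
    Integrable (fun z : Tan m × ℝ => act (M z.2) (f z)) (volume.prod (wt α 1)) := by
  refine Integrable.mono' (hf.norm.const_mul K)
    (aestronglyMeasurable_act (M := fun z : Tan m × ℝ => M z.2)
      (fun k l => (aemeasurable_coeff_wt hM.meas α 1 k l).comp_quasiMeasurePreserving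
        Measure.quasiMeasurePreserving_snd) hf.aestronglyMeasurable) ?_
  have h2 : ∀ᵐ s ∂(wt α 1), s ∈ Ioo (0 : ℝ) 1 := ae_wt_iff.2 (ae_restrict_mem measurableSet_Ioo)
  filter_upwards [Measure.quasiMeasurePreserving_snd.ae h2] with z hz
  exact (norm_act_le _ _).trans (mul_le_mul_of_nonneg_right (hM.bdd _ hz.1) (norm_nonneg _))

/-- A matrix that depends on `s` only commutes with integration in the tangential variables. This is
where the special form of the coefficients is used. -/
lemma mom_act (M : ℝ → Matrix (Fin n) (Fin n) ℝ) (hf : Integrable f (volume.prod (wt α 1)))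
    (hη : TanTest η) : ∀ᵐ s ∂(wt α 1),
      mom (fun z => act (M z.2) (f z)) η s = act (M s) (mom f η s) := by
  filter_upwards [(integrable_tanTest_smul hf hη).prod_left_ae] with s hs
  have h := (actL (M s)).integral_comp_comm hs
  have h' : ∀ y, actL (M s) (η y • f (y, s)) = η y • act (M s) (f (y, s)) := fun y =>
    (actL (M s)).map_smul _ _
  simp only [h'] at h
  exact h

lemma BddCoeff.integral_prod_smul_act (hM : BddCoeff M K) (hf : Integrable f (volume.prod (wt α 1)))
    (hz : ∀ z ∉ unitCyl m 1, f z = 0) (hη : TanTest η) {b : ℝ → ℝ}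
    (hb : Measurable b) {C : ℝ} (hC : ∀ s ∈ Ioo (0 : ℝ) 1, ‖b s‖ ≤ C) :
    Integrable (fun z : Tan m × ℝ => (η z.1 * b z.2) • act (M z.2) (f z)) (nuQ m α 1) ∧
    Integrable (fun s => b s • act (M s) (mom f η s)) (wt α 1) ∧
    ∫ z, (η z.1 * b z.2) • act (M z.2) (f z) ∂(nuQ m α 1) =
      ∫ s, b s • act (M s) (mom f η s) ∂(wt α 1) := by
  refine ⟨(integrable_prod_smul (hM.integrable_act_prod hf) hη hb hC).mono_measure
    (nuQ_one_le_prod m α), ?_, ?_⟩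
  · have hb' : ∀ᵐ s ∂(wt α 1), ‖b s‖ ≤ C := by
      rw [ae_wt_iff]
      filter_upwards [ae_restrict_mem measurableSet_Ioo] with s hs using hC s hs
    exact (hM.integrable_act (integrable_mom hf hη)).bdd_smul C (φ := b) hb.aestronglyMeasurable hb'
  · have e := integral_prod_smul (f := fun z : Tan m × ℝ => act (M z.2) (f z)) (hM.integrable_act_prod hf) (fun z h => by rw [hz z h, act_zero]) hη hb hC
    rw [e]
    refine integral_congr_ae ?_
    filter_upwards [mom_act M hf hη] with s hs
    rw [hs]

end Moments

/-- The support stays away from `0`, so the factor that removes the weight is harmless. -/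
lemma exists_bound_rpow_mul {ψ : ℝ → ℝ} (hψ : Continuous ψ) (hc : HasCompactSupport ψ)
    (hs : tsupport ψ ⊆ Ioo 0 1) (α : ℝ) : ∃ C, ∀ s, ‖s ^ (-α) * ψ s‖ ≤ C := by
  have hco : ContinuousOn (fun s : ℝ => s ^ (-α) * ψ s) (tsupport ψ) := fun s h =>
    ((Real.continuousAt_rpow_const s _ (Or.inl (hs h).1.ne')).mul
      hψ.continuousAt).continuousWithinAt
  obtain ⟨C, hC⟩ := IsCompact.exists_bound_of_continuousOn hc hco
  refine ⟨max C 0, fun s => ?_⟩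
  by_cases h : s ∈ tsupport ψ
  · exact (hC s h).trans (le_max_left _ _)
  · rw [image_eq_zero_of_notMem_tsupport h, mul_zero, norm_zero]
    exact le_max_right _ _

lemma integral_wt_rpow_neg (v : ℝ → Val n) (χ : ℝ → ℝ) :
    ∫ s, (s ^ (-α) * χ s) • v s ∂(wt α 1) = ∫ s in Ioo 0 1, χ s • v s := by
  rw [integral_wt]
  refine setIntegral_congr_fun measurableSet_Ioo fun s hs => ?_
  rw [smul_smul, ← mul_assoc, ← Real.rpow_add hs.1]
  simp

end

section

variable {m n : ℕ} {α κ lam : ℝ}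

/-! ### From the weak formulation on the unit cylinder to moments -/

lemma Coeffs.Admissible.bddCoeff_a0 {c : Coeffs m n} (h : c.Admissible κ) : BddCoeff c.a0 κ⁻¹ :=
  ⟨h.measurable_a0, h.a0_bounded⟩

lemma Coeffs.Admissible.bddCoeff_C0 {c : Coeffs m n} (h : c.Admissible κ) : BddCoeff c.C0 κ⁻¹ :=
  ⟨h.measurable_C0, h.C0_bounded⟩

lemma Coeffs.Admissible.bddCoeff_A {c : Coeffs m n} (h : c.Admissible κ) (i j : Fin (m + 1)) :
    BddCoeff (c.A i j) κ⁻¹ :=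
  ⟨h.measurable_A i j, fun s hs => h.A_bounded s hs i j⟩

/-- The integrand of the weak formulation for the test function `η ⊗ ψ`. -/
def weakInt (lam : ℝ) (c : Coeffs m n) (u : Tan m × ℝ → Val n)
    (G : Fin (m + 1) → Tan m × ℝ → Val n) (η : Tan m → ℝ) (ψ : ℝ → ℝ) (z : Tan m × ℝ) : Val n :=
  -((pd (tdir m) η z.1 * ψ z.2) • act (c.a0 z.2) (u z)) +
    (∑ i : Fin m, ∑ j, (pd (xdir i) η z.1 * ψ z.2) • act (c.A i.castSucc j z.2) (G j z)) +
    (∑ j, (η z.1 * deriv ψ z.2) • act (c.A (Fin.last m) j z.2) (G j z)) +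
    lam • ((η z.1 * ψ z.2) • act (c.C0 z.2) (u z))

/-- The tangential moment of the normal flux. -/
def momFlux (c : Coeffs m n) (G : Fin (m + 1) → Tan m × ℝ → Val n) (η : Tan m → ℝ) (s : ℝ) :
    Val n :=
  ∑ j, act (c.A (Fin.last m) j s) (mom (G j) η s)

/-- The tangential moment of the remaining terms of the equation. -/
def momSource (lam : ℝ) (c : Coeffs m n) (u : Tan m × ℝ → Val n)
    (G : Fin (m + 1) → Tan m × ℝ → Val n) (η : Tan m → ℝ) (s : ℝ) : Val n :=
  -act (c.a0 s) (mom u (pd (tdir m) η) s) + lam • act (c.C0 s) (mom u η s) +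
    ∑ i : Fin m, ∑ j, act (c.A i.castSucc j s) (mom (G j) (pd (xdir i) η) s)

/-- A weak solution on the unit cylinder, extended by zero, with its gradient. -/
structure IsCylSol (α κ lam : ℝ) (c : Coeffs m n) (u : Tan m × ℝ → Val n)
    (G : Fin (m + 1) → Tan m × ℝ → Val n) : Prop where
  lam_nonneg : 0 ≤ lam
  adm : c.Admissible κ
  meas_u : StronglyMeasurable u
  meas : ∀ i, StronglyMeasurable (G i)
  int_u : Integrable u (volume.prod (wt α 1))
  int : ∀ i, Integrable (G i) (volume.prod (wt α 1))
  zero_u : ∀ z ∉ unitCyl m 1, u z = 0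
  zero : ∀ i, ∀ z ∉ unitCyl m 1, G i z = 0
  weak : ∀ η, TanTest η → ∀ ψ : ℝ → ℝ, ContDiff ℝ ∞ ψ → HasCompactSupport ψ → tsupport ψ ⊆ Iio 1 →
    ∀ e : Val n, ∫ z, inner ℝ e (weakInt lam c u G η ψ z) ∂(nuQ m α 1) = 0
  weak_dx : ∀ (i : Fin m) η, TanTest η → ∀ ψ : ℝ → ℝ, ContDiff ℝ ∞ ψ → HasCompactSupport ψ →
    tsupport ψ ⊆ Ioo 0 1 →
    ∫ z, (pd (xdir i) η z.1 * (z.2 ^ (-α) * ψ z.2)) • u z ∂(nuQ m α 1) =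
      -∫ z, (η z.1 * (z.2 ^ (-α) * ψ z.2)) • G i.castSucc z ∂(nuQ m α 1)
  weak_dx_last : ∀ η, TanTest η → ∀ ψ : ℝ → ℝ, ContDiff ℝ ∞ ψ → HasCompactSupport ψ →
    tsupport ψ ⊆ Ioo 0 1 →
    ∫ z, (η z.1 * (z.2 ^ (-α) * deriv ψ z.2)) • u z ∂(nuQ m α 1) =
      -∫ z, (η z.1 * (z.2 ^ (-α) * ψ z.2)) • G (Fin.last m) z ∂(nuQ m α 1)

section CylSol
variable {c : Coeffs m n} {u : Tan m × ℝ → Val n} {G : Fin (m + 1) → Tan m × ℝ → Val n}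
  {η : Tan m → ℝ}

lemma IsCylSol.tangential (h : IsCylSol α κ lam c u G) (hη : TanTest η) (i : Fin m) :
    ∀ᵐ s ∂(volume.restrict (Ioo (0 : ℝ) 1)),
      mom u (WeightedParabolic.pd (xdir i) η) s = -mom (G i.castSucc) η s := by
  refine ae_eq_of_weak
    (locallyIntegrableOn_of_integrable_wt (integrable_mom h.int_u (hη.pd (xdir i))))
    (locallyIntegrableOn_of_integrable_wt (integrable_mom (h.int i.castSucc) hη))
    fun ψ hψ hc hs => ?_
  obtain ⟨C, hC⟩ := exists_bound_rpow_mul hψ.continuous hc hs α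
  have hm : Measurable fun s : ℝ => s ^ (-α) * ψ s :=
    (measurable_id.pow_const _).mul hψ.continuous.measurable
  have h1 := h.weak_dx i η hη ψ hψ hc hs
  rw [integral_prod_smul h.int_u h.zero_u (hη.pd (xdir i)) hm (fun s _ => hC s),
    integral_prod_smul (h.int _) (h.zero _) hη hm (fun s _ => hC s),
    integral_wt_rpow_neg, integral_wt_rpow_neg] at h1
  exact h1

lemma IsCylSol.primitive (h : IsCylSol α κ lam c u G) (hη : TanTest η) :
    ∃ C, ∀ᵐ s ∂(volume.restrict (Ioo (0 : ℝ) 1)),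
      mom u η s = C + ∫ σ in (1 / 2 : ℝ)..s, mom (G (Fin.last m)) η σ := by
  refine exists_ae_eq_const_add_integral_of_weak
    (locallyIntegrableOn_of_integrable_wt (integrable_mom h.int_u hη))
    (locallyIntegrableOn_of_integrable_wt (integrable_mom (h.int _) hη))
    fun ψ hψ hc hs => ?_
  have hψ' : Continuous (deriv ψ) := hψ.continuous_deriv (by simp)
  obtain ⟨C, hC⟩ := exists_bound_rpow_mul hψ.continuous hc hs α
  obtain ⟨C', hC'⟩ := exists_bound_rpow_mul hψ' hc.deriv
    ((tsupport_deriv_subset (f := ψ)).trans hs) α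
  have hm : Measurable fun s : ℝ => s ^ (-α) * ψ s :=
    (measurable_id.pow_const _).mul hψ.continuous.measurable
  have hm' : Measurable fun s : ℝ => s ^ (-α) * deriv ψ s :=
    (measurable_id.pow_const _).mul hψ'.measurable
  have h1 := h.weak_dx_last η hη ψ hψ hc hs
  rw [integral_prod_smul h.int_u h.zero_u hη hm' (fun s _ => hC' s),
    integral_prod_smul (h.int _) (h.zero _) hη hm (fun s _ => hC s),
    integral_wt_rpow_neg, integral_wt_rpow_neg] at h1
  exact h1

lemma IsCylSol.integrable_momFlux (h : IsCylSol α κ lam c u G) (hη : TanTest η) :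
    Integrable (momFlux c G η) (wt α 1) :=
  integrable_finsetSum _ fun j _ => (h.adm.bddCoeff_A _ j).integrable_act (integrable_mom (h.int j) hη)

lemma IsCylSol.integrable_momSource (h : IsCylSol α κ lam c u G) (hη : TanTest η) :
    Integrable (momSource lam c u G η) (wt α 1) :=
  ((h.adm.bddCoeff_a0.integrable_act (integrable_mom h.int_u (hη.pd _))).neg.add
    ((h.adm.bddCoeff_C0.integrable_act (integrable_mom h.int_u hη)).smul lam)).add
    (integrable_finsetSum _ fun _ _ => integrable_finsetSum _ fun j _ =>
      (h.adm.bddCoeff_A _ j).integrable_act (integrable_mom (h.int j) (hη.pd _)))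

lemma IsCylSol.integral_momFlux (h : IsCylSol α κ lam c u G) (hη : TanTest η) {ψ : ℝ → ℝ}
    (hψ : ContDiff ℝ ∞ ψ) (hc : HasCompactSupport ψ) (hs : tsupport ψ ⊆ Iio 1) :
    ∫ s, (deriv ψ s • momFlux c G η s + ψ s • momSource lam c u G η s) ∂(wt α 1) = 0 := by
  have hψ' : Continuous (deriv ψ) := hψ.continuous_deriv (by simp)
  obtain ⟨C, hC⟩ := hψ.continuous.bounded_above_of_compact_support hc
  obtain ⟨C', hC'⟩ := hψ'.bounded_above_of_compact_support hc.deriv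
  have hm := hψ.continuous.measurable
  have hm' := hψ'.measurable
  have ha := h.adm.bddCoeff_a0.integral_prod_smul_act h.int_u h.zero_u (hη.pd (tdir m)) hm
    (fun s _ => hC s)
  have h0 := h.adm.bddCoeff_C0.integral_prod_smul_act h.int_u h.zero_u hη hm (fun s _ => hC s)
  have hA := fun (i : Fin m) j => (h.adm.bddCoeff_A i.castSucc j).integral_prod_smul_act (h.int j)
    (h.zero j) (hη.pd (xdir i)) hm (fun s _ => hC s)
  have hd := fun j => (h.adm.bddCoeff_A (Fin.last m) j).integral_prod_smul_act (h.int j)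
    (h.zero j) hη hm' (fun s _ => hC' s)
  have iA := integrable_finsetSum (Finset.univ (α := Fin m)) fun i _ =>
    integrable_finsetSum Finset.univ fun j _ => (hA i j).1
  have id := integrable_finsetSum Finset.univ fun j _ => (hd j).1
  have jA := integrable_finsetSum (Finset.univ (α := Fin m)) fun i _ =>
    integrable_finsetSum Finset.univ fun j _ => (hA i j).2.1
  have jd := integrable_finsetSum Finset.univ fun j _ => (hd j).2.1
  have hW : Integrable (weakInt lam c u G η ψ) (nuQ m α 1) :=
    ((ha.1.neg.add iA).add id).add (h0.1.smul lam)
  have e1 : ∫ z, weakInt lam c u G η ψ z ∂(nuQ m α 1) = 0 := by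
    -- The weak formulation with constant vectors `e` recovers the vector identity.
    refine ext_inner_left ℝ fun e => ?_
    rw [← integral_inner hW, h.weak η hη ψ hψ hc hs e, inner_zero_right]
  have e2 : ∫ z, weakInt lam c u G η ψ z ∂(nuQ m α 1) =
      -(∫ s, ψ s • act (c.a0 s) (mom u (WeightedParabolic.pd (tdir m) η) s) ∂(wt α 1)) +
      (∑ i : Fin m, ∑ j, ∫ s, ψ s • act (c.A i.castSucc j s)
        (mom (G j) (WeightedParabolic.pd (xdir i) η) s) ∂(wt α 1)) +
      (∑ j, ∫ s, deriv ψ s • act (c.A (Fin.last m) j s) (mom (G j) η s) ∂(wt α 1)) +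
      lam • ∫ s, ψ s • act (c.C0 s) (mom u η s) ∂(wt α 1) := by
    have := integral_add ((ha.1.neg.add iA).add id) (h0.1.smul lam)
    refine this.trans ?_
    rw [integral_add' (ha.1.neg.add iA) id, integral_add' ha.1.neg iA, integral_neg',
      integral_finsetSum _ (fun i _ => integrable_finsetSum _ fun j _ => (hA i j).1),
      integral_finsetSum _ (fun j _ => (hd j).1), ha.2.2]
    congr 1
    · congr 1
      · congr 1
        refine Finset.sum_congr rfl fun i _ => ?_
        rw [integral_finsetSum _ (fun j _ => (hA i j).1)]
        exact Finset.sum_congr rfl fun j _ => (hA i j).2.2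
      · exact Finset.sum_congr rfl fun j _ => (hd j).2.2
    · refine (integral_smul lam _).trans ?_
      rw [h0.2.2]
  have e3 : ∫ s, (deriv ψ s • momFlux c G η s + ψ s • momSource lam c u G η s) ∂(wt α 1) =
      ∫ z, weakInt lam c u G η ψ z ∂(nuQ m α 1) := by
    rw [e2]
    have := integral_add ((ha.2.1.neg.add jA).add jd) (h0.2.1.smul lam)
    rw [integral_add' (ha.2.1.neg.add jA) jd, integral_add' ha.2.1.neg jA, integral_neg',
      integral_finsetSum _ (fun i _ => integrable_finsetSum _ fun j _ => (hA i j).2.1),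
      integral_finsetSum _ (fun j _ => (hd j).2.1)] at this
    have e4 : ∀ i : Fin m, ∫ s, ∑ j, ψ s • act (c.A i.castSucc j s)
        (mom (G j) (WeightedParabolic.pd (xdir i) η) s) ∂(wt α 1) = ∑ j, ∫ s, ψ s • act (c.A i.castSucc j s)
        (mom (G j) (WeightedParabolic.pd (xdir i) η) s) ∂(wt α 1) := fun i =>
      integral_finsetSum _ (fun j _ => (hA i j).2.1)
    have e5 := integral_smul (μ := wt α 1) lam fun s => ψ s • act (c.C0 s) (mom u η s)
    simp only [e4] at this
    refine Eq.trans ?_ (this.trans (congrArg _ e5))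
    refine integral_congr_ae (ae_of_all _ fun s => ?_)
    simp only [momFlux, momSource, Pi.add_apply, Pi.neg_apply, Pi.smul_apply, smul_add, smul_neg,
      Finset.smul_sum, smul_comm (ψ s) lam]
    abel
  rw [e3, e1]

/-- Test functions in `s` that need not vanish at `0` force the weighted flux to be the primitive
that starts from `0`. This is the conormal boundary condition. -/
lemma IsCylSol.flux_eq (h : IsCylSol α κ lam c u G) (hη : TanTest η) :
    ∀ᵐ s ∂(volume.restrict (Ioo (0 : ℝ) 1)),
      s ^ α • momFlux c G η s = ∫ σ in (0 : ℝ)..s, σ ^ α • momSource lam c u G η σ := by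
  refine ae_eq_integral_of_weak_natural (integrable_wt_iff.1 (h.integrable_momFlux hη))
    (integrable_wt_iff.1 (h.integrable_momSource hη)) fun ψ hψ hc hs => ?_
  have h1 := h.integral_momFlux hη hψ hc hs
  rw [integral_wt] at h1
  rw [← h1]
  refine integral_congr_ae (ae_of_all _ fun s => ?_)
  simp only [smul_add, smul_comm (s ^ α)]

/-- In `IsSol` tangential derivatives are carried by the test function. Moments of the tangential
gradient are converted accordingly, with a change of sign. -/
lemma IsCylSol.isGradSol (h : IsCylSol α κ lam c u G) : IsGradSol α κ lam c u G := by
  refine ⟨⟨h.lam_nonneg, h.adm, h.meas_u, h.meas _, h.int_u, h.int _, fun η hη => h.primitive hη,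
    fun η hη => ?_⟩, h.meas, h.int, fun i η hη => h.tangential hη i⟩
  have t1 : ∀ᵐ s ∂(volume.restrict (Ioo (0 : ℝ) 1)), ∀ j : Fin m,
      mom u (WeightedParabolic.pd (xdir j) η) s = -mom (G j.castSucc) η s :=
    ae_all_iff.2 fun j => h.tangential hη j
  have t2 : ∀ᵐ s ∂(volume.restrict (Ioo (0 : ℝ) 1)), ∀ i j : Fin m,
      mom u (WeightedParabolic.pd (xdir j) (WeightedParabolic.pd (xdir i) η)) s =
        -mom (G j.castSucc) (WeightedParabolic.pd (xdir i) η) s :=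
    ae_all_iff.2 fun i => ae_all_iff.2 fun j => h.tangential (hη.pd (xdir i)) j
  filter_upwards [h.flux_eq hη, t1, ae_restrict_mem measurableSet_Ioo] with s hs ht hs1
  have e1 : act (c.A (Fin.last m) (Fin.last m) s) (mom (G (Fin.last m)) η s) -
      ∑ j : Fin m, act (c.A (Fin.last m) j.castSucc s) (mom u (WeightedParabolic.pd (xdir j) η) s) =
      momFlux c G η s := by
    simp only [momFlux, Fin.sum_univ_castSucc, ht, act_neg, Finset.sum_neg_distrib, sub_neg_eq_add]
    abel
  rw [e1, hs]
  refine intervalIntegral.integral_congr_ae ?_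
  rw [ae_restrict_iff' measurableSet_Ioo] at t2
  filter_upwards [t2] with σ hσ hσ'
  rw [uIoc_of_le hs1.1.le] at hσ'
  have h2 := hσ ⟨hσ'.1, hσ'.2.trans_lt hs1.2⟩
  simp only [momSource, Fin.sum_univ_castSucc, h2, act_neg, Finset.sum_neg_distrib, sub_neg_eq_add,
    Finset.sum_add_distrib]
  congr 2
  abel

end CylSol

end

section

variable {m n : ℕ} {α κ lam p r : ℝ}

/-! ### Reduction to the unit cylinder -/

/-- The coefficients after a dilation. -/
def Coeffs.dilate (c : Coeffs m n) (r : ℝ) : Coeffs m n :=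
  ⟨fun s => c.a0 (r * s), fun i j s => c.A i j (r * s), fun s => c.C0 (r * s)⟩

lemma MeasurableCoeff.dilate {M : ℝ → Matrix (Fin n) (Fin n) ℝ} (hM : MeasurableCoeff M)
    (hr : 0 < r) : MeasurableCoeff fun s => M (r * s) := by
  intro k l
  have h1 : Measure.QuasiMeasurePreserving (r * ·) (volume : Measure ℝ) volume := by
    refine ⟨by fun_prop, ?_⟩
    rw [Real.map_volume_mul_left hr.ne']
    exact Measure.smul_absolutelyContinuous
  have h2 : Measure.QuasiMeasurePreserving (r * ·) ((volume : Measure ℝ).restrict (Ioi 0))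
      (volume.restrict (Ioi 0)) := h1.restrict fun s hs => mul_pos hr hs
  exact (hM k l).comp_quasiMeasurePreserving h2

lemma Coeffs.Admissible.dilate {c : Coeffs m n} (h : c.Admissible κ) (hr : 0 < r) :
    (c.dilate r).Admissible κ where
  measurable_a0 := h.measurable_a0.dilate hr
  measurable_A i j := (h.measurable_A i j).dilate hr
  measurable_C0 := h.measurable_C0.dilate hr
  A_elliptic _ hs := h.A_elliptic _ (mul_pos hr hs)
  A_bounded _ hs := h.A_bounded _ (mul_pos hr hs)
  a0_pos _ hs := h.a0_pos _ (mul_pos hr hs)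
  a0_bounded _ hs := h.a0_bounded _ (mul_pos hr hs)
  a0_symm _ hs := h.a0_symm _ (mul_pos hr hs)
  C0_pos _ hs := h.C0_pos _ (mul_pos hr hs)
  C0_bounded _ hs := h.C0_bounded _ (mul_pos hr hs)

/-- The pullback to the unit cylinder, extended by zero. -/
def pull {E : Type*} [Zero E] (hr : 0 < r) (F : Pt m → E) : Tan m × ℝ → E :=
  (unitCyl m 1).indicator fun w => F (dil m hr w)

lemma pull_of_notMem {E : Type*} [Zero E] (hr : 0 < r) (F : Pt m → E) {w : Tan m × ℝ}
    (hw : w ∉ unitCyl m 1) : pull hr F w = 0 :=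
  indicator_of_notMem hw _

section Pull
variable {E : Type*} [NormedAddCommGroup E]

lemma stronglyMeasurable_pull (hr : 0 < r) {F : Pt m → E} (hF : StronglyMeasurable F) :
    StronglyMeasurable (pull hr F) :=
  (hF.comp_measurable (dil m hr).continuous.measurable).indicator (measurableSet_unitCyl 1)

lemma ae_pull_eq (hr : 0 < r) {F F' : Pt m → E} (h : F =ᵐ[(mu m α).restrict (Qplus m r)] F') :
    ∀ᵐ w ∂(nuQ m α 1), pull hr F' w = F (dil m hr w) := by
  filter_upwards [(ae_mu_iff hr).1 h, ae_nuQ_mem α 1] with w h1 h2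
  rw [pull, indicator_of_mem (show w ∈ unitCyl m 1 from h2), h1]

lemma integrable_pull (hr : 0 < r) {F : Pt m → E}
    (hF : Integrable F ((mu m α).restrict (Qplus m r))) :
    Integrable (pull hr F) (volume.prod (wt α 1)) := by
  rw [pull, integrable_indicator_iff (measurableSet_unitCyl 1), IntegrableOn, ← nuQ_eq_restrict]
  rw [mu_restrict_eq_map hr, integrable_smul_measure (by simpa using jac_pos hr)
    ENNReal.ofReal_ne_top, integrable_map_equiv] at hF
  exact hF

lemma lintegral_pull (hr : 0 < r) (F : Pt m → E) :
    ∫⁻ w, ‖pull hr F w‖ₑ ∂((volume : Measure (Tan m)).prod (wt α 1)) =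
      ∫⁻ w, ‖pull hr F w‖ₑ ∂(nuQ m α 1) := by
  rw [nuQ_eq_restrict, setLIntegral_eq_of_support_subset]
  intro w hw
  by_contra h
  exact hw (by simp only [pull_of_notMem hr F h, enorm_zero])

end Pull

lemma isFiniteMeasure_mu (hα : -1 < α) (hr : 0 < r) :
    IsFiniteMeasure ((mu m α).restrict (Qplus m r)) := by
  have := isFiniteMeasure_nuQ (m := m) hα zero_le_one
  rw [mu_restrict_eq_map hr]
  have : IsFiniteMeasure (Measure.map (dil m hr).toMeasurableEquiv (nuQ m α 1)) :=
    Measure.isFiniteMeasure_map _ _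
  exact Measure.smul_finite _ ENNReal.ofReal_ne_top

section Reduction
variable {a0 : ℝ → Matrix (Fin n) (Fin n) ℝ} {u U : Pt m → Val n} {Du DU : Pt m → Grad m n}

lemma tens_dil (hr : 0 < r) (η : Tan m → ℝ) (ψ : ℝ → ℝ) (w : Tan m × ℝ) :
    tens hr η ψ (dil m hr w) = η w.1 * ψ w.2 := by
  simp [tens]

lemma HasWeakDx.integral_dil {v : Pt m → Val n} {i : Fin (m + 1)} (h : HasWeakDx (Qplus m r) i u v)
    (hr : 0 < r) (α : ℝ) {η : Tan m → ℝ} (hη : TanTest η) {ψ : ℝ → ℝ} (hψ : ContDiff ℝ ∞ ψ)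
    (hc : HasCompactSupport ψ) (hs : tsupport ψ ⊆ Ioo 0 1) :
    ∫ w, w.2 ^ (-α) • dx i (tens hr η ψ) (dil m hr w) • u (dil m hr w) ∂(nuQ m α 1) =
      -∫ w, w.2 ^ (-α) • (η w.1 * ψ w.2) • v (dil m hr w) ∂(nuQ m α 1) := by
  have h1 := h.integral_eq (tens hr η ψ) (isTestFunction_tens hr hη hψ hc fun w h1 h2 =>
    dil_mem_Qplus hr h1 (hs h2))
  rw [integral_volume_eq hr α, integral_volume_eq hr α, ← smul_neg] at h1
  have h2 : jac m α r * r ^ (-α) ≠ 0 := (mul_pos (jac_pos hr) (Real.rpow_pos_of_pos hr _)).ne'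
  simpa only [tens_dil] using smul_right_injective _ h2 h1

/-- Under the dilation the gradient acquires a factor `r` and `λ` becomes `λ r²`. Strongly
measurable representatives are used because mollification is defined at every point. -/
lemma isCylSol_pull {c : Coeffs m n} (hα : -1 < α) (hp : 1 ≤ p) (hr : 0 < r) (hlam : 0 ≤ lam)
    (hc : c.Admissible κ) (h : MemH1 α p r c.a0 u Du) (hw : IsWeakSolution α lam r c u Du)
    (hU : StronglyMeasurable U) (hDU : StronglyMeasurable DU)
    (hUe : u =ᵐ[(mu m α).restrict (Qplus m r)] U)
    (hDUe : Du =ᵐ[(mu m α).restrict (Qplus m r)] DU) :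
    IsCylSol α κ (lam * r ^ 2) (c.dilate r) (pull hr U)
      (fun i => pull hr fun z => r • DU z i) := by
  have hr0 : r ≠ 0 := hr.ne'
  have hfin := isFiniteMeasure_mu (m := m) hα hr
  have hp' : (1 : ENNReal) ≤ ENNReal.ofReal p := by simpa using hp
  have iU : Integrable U ((mu m α).restrict (Qplus m r)) := (h.memLp.integrable hp').congr hUe
  have iDU : Integrable DU ((mu m α).restrict (Qplus m r)) :=
    (h.memLp_grad.integrable hp').congr hDUe
  have hpr : ∀ i, Continuous fun g : Grad m n => g i := fun i => PiLp.continuous_apply 2 _ i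
  have eU := ae_pull_eq hr hUe
  have eG : ∀ i, ∀ᵐ w ∂(nuQ m α 1), pull hr (fun z => r • DU z i) w = r • Du (dil m hr w) i := by
    intro i
    refine ae_pull_eq hr (F := fun z => r • Du z i) ?_
    filter_upwards [hDUe] with z hz
    rw [hz]
  refine ⟨by positivity, hc.dilate hr, stronglyMeasurable_pull hr hU, fun i =>
    stronglyMeasurable_pull hr (((hpr i).comp_stronglyMeasurable hDU).const_smul r),
    integrable_pull hr iU, fun i => integrable_pull hr ?_, fun w => pull_of_notMem hr _,
    fun i w => pull_of_notMem hr _, ?_, ?_, ?_⟩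
  · exact (((PiLp.proj 2 (fun _ : Fin (m + 1) => Val n) i :
      Grad m n →L[ℝ] Val n)).integrable_comp iDU).smul r
  · intro η hη ψ hψ hc' hs e
    have h1 := hw (fun z => tens hr η ψ z • e) (isTestFunction_smul_const
      (isTestFunction_tens hr hη hψ hc' fun w h1 h2 => dil_mem_Qtest hr h1 (hs h2)) e)
    rw [integral_mu_eq hr, smul_eq_zero_iff_right (jac_pos hr).ne'] at h1
    -- The factor `r²` cancels the `r⁻²` of the time derivative. In the divergence term it meets
    -- `r⁻¹`, and the remaining `r` is the one in the rescaled gradient.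
    rw [← mul_zero (r ^ 2), ← h1, ← integral_const_mul]
    refine integral_congr_ae ?_
    have hsm := contDiff_tens hr hη.smooth hψ
    filter_upwards [eU, ae_all_iff.2 eG] with w e1 e2
    simp only [weakInt, e1, e2, xd_dil, dt_smul_const hsm, dx_smul_const hsm,
      dt_tens hr hη.smooth hψ, tens_dil, Coeffs.dilate, Fin.sum_univ_castSucc (n := m),
      dx_tens hr hη.smooth hψ, dx_last_tens hr hη.smooth hψ, inner_add_right, inner_neg_right,
      inner_sum, inner_smul_right, act_smul, real_inner_comm e]
    have k1 : ∀ x y : ℝ, r ^ 2 * (r⁻¹ ^ 2 * x * y) = x * y := fun x y => by field_simp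
    have k2 : ∀ x y : ℝ, r ^ 2 * (r⁻¹ * x * y) = x * (r * y) := fun x y => by field_simp
    simp only [mul_add, mul_neg, Finset.mul_sum, k1, k2, Finset.sum_add_distrib]
    ring
  · intro i η hη ψ hψ hc' hs
    have h1 := (h.hasWeakDx i.castSucc).integral_dil hr α hη hψ hc' hs
    have h2 := congrArg (r • ·) h1
    simp only [smul_neg, ← integral_smul] at h2
    refine Eq.trans (integral_congr_ae ?_) (h2.trans (congrArg _ (integral_congr_ae ?_)))
    · filter_upwards [eU] with w e1
      rw [e1, dx_tens hr hη.smooth hψ, smul_smul, smul_smul]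
      congr 1
      field_simp
    · filter_upwards [eG i.castSucc] with w e1
      rw [e1, smul_smul, smul_smul, smul_smul]
      congr 1
      ring
  · intro η hη ψ hψ hc' hs
    have h1 := (h.hasWeakDx (Fin.last m)).integral_dil hr α hη hψ hc' hs
    have h2 := congrArg (r • ·) h1
    simp only [smul_neg, ← integral_smul] at h2
    refine Eq.trans (integral_congr_ae ?_) (h2.trans (congrArg _ (integral_congr_ae ?_)))
    · filter_upwards [eU] with w e1
      rw [e1, dx_last_tens hr hη.smooth hψ, smul_smul, smul_smul]
      congr 1
      field_simp
    · filter_upwards [eG (Fin.last m)] with w e1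
      rw [e1, smul_smul, smul_smul, smul_smul]
      congr 1
      ring

end Reduction

/-! ### Averages -/

/-- Hölder's inequality for the normalised measure; it converts the `L_1` bounds into averages with
exponent `p`. -/
lemma lintegral_enorm_le_laverage {X E : Type*} [MeasurableSpace X] [NormedAddCommGroup E]
    {ν : Measure X} [IsFiniteMeasure ν] {f : X → E} (hf : AEStronglyMeasurable f ν) (hp : 1 ≤ p) :
    ∫⁻ x, ‖f x‖ₑ ∂ν ≤ ν univ * (⨍⁻ x, ‖f x‖ₑ ^ p ∂ν) ^ (1 / p) := by
  rcases eq_or_ne ν 0 with rfl | h0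
  · simp
  have : NeZero ν := ⟨h0⟩
  rw [← measure_mul_laverage ν]
  refine mul_le_mul_right ?_ _
  have hf' : AEStronglyMeasurable f ((ν univ)⁻¹ • ν) := hf.smul_measure _
  have h := eLpNorm_le_eLpNorm_of_exponent_le (p := 1) (q := ENNReal.ofReal p) (by simpa using hp) hf'
  rw [eLpNorm_one_eq_lintegral_enorm, eLpNorm_eq_lintegral_rpow_enorm_toReal
    (by simpa using by linarith) ENNReal.ofReal_ne_top, ENNReal.toReal_ofReal (by linarith)] at h
  exact h

/-- Averages are invariant under dilation: the Jacobian cancels. -/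
lemma setLAverage_mu_eq (hr : 0 < r) (F : Pt m → ENNReal) :
    ⨍⁻ z in Qplus m r, F z ∂(mu m α) = ⨍⁻ w, F (dil m hr w) ∂(nuQ m α 1) := by
  have h0 : ENNReal.ofReal (jac m α r) ≠ 0 := by simpa using jac_pos hr
  have h1 : ((mu m α).restrict (Qplus m r)) univ = ENNReal.ofReal (jac m α r) * nuQ m α 1 univ := by
    rw [← lintegral_one, lintegral_mu_eq hr, lintegral_one]
  rw [laverage_eq, laverage_eq, lintegral_mu_eq hr, h1]
  exact ENNReal.mul_div_mul_left _ _ h0 ENNReal.ofReal_ne_top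

end

section

variable {m n : ℕ} {α κ lam p r : ℝ}

/-! ### The estimates in `Q_r^+` -/

lemma enorm_grad_le (g : Grad m n) : ‖g‖ₑ ≤ ∑ i, ‖g i‖ₑ := by
  have h1 : ‖g‖ ≤ ∑ i, ‖g i‖ := by
    rw [PiLp.norm_eq_of_L2]
    refine Real.sqrt_le_iff.2 ⟨Finset.sum_nonneg fun _ _ => norm_nonneg _, ?_⟩
    exact Finset.sum_sq_le_sq_sum_of_nonneg fun _ _ => norm_nonneg _
  rw [← ofReal_norm]
  refine (ENNReal.ofReal_le_ofReal h1).trans ?_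
  rw [ENNReal.ofReal_sum_of_nonneg fun _ _ => norm_nonneg _]
  exact (Finset.sum_congr rfl fun i _ => ofReal_norm (g i)).le

lemma enorm_grad_apply_le (g : Grad m n) (i : Fin (m + 1)) : ‖g i‖ₑ ≤ ‖g‖ₑ := by
  rw [← ofReal_norm, ← ofReal_norm]
  exact ENNReal.ofReal_le_ofReal (PiLp.norm_apply_le g i)

section Mass
variable {u U : Pt m → Val n} {Du DU : Pt m → Grad m n}

lemma lintegral_pull_le (hα : -1 < α) (hp : 1 ≤ p) (hr : 0 < r) (hU : StronglyMeasurable U)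
    (hUe : u =ᵐ[(mu m α).restrict (Qplus m r)] U) :
    ∫⁻ w, ‖pull hr U w‖ₑ ∂((volume : Measure (Tan m)).prod (wt α 1)) ≤
      nuQ m α 1 univ * avgU α p r u := by
  have := isFiniteMeasure_nuQ (m := m) hα zero_le_one
  rw [lintegral_pull, avgU, setLAverage_mu_eq hr]
  refine (lintegral_enorm_le_laverage
    (stronglyMeasurable_pull hr hU).aestronglyMeasurable hp).trans (le_of_eq ?_)
  congr 2
  refine laverage_congr ?_
  filter_upwards [ae_pull_eq hr hUe] with w hw
  rw [hw]

lemma laverage_le_avgDU (hr : 0 < r) (hp : 1 ≤ p) {g : Tan m × ℝ → ENNReal}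
    (hg : ∀ᵐ w ∂(nuQ m α 1), g w ≤ ‖Du (dil m hr w)‖ₑ ^ p +
      ENNReal.ofReal (lam ^ (p / 2)) * ‖u (dil m hr w)‖ₑ ^ p) :
    (⨍⁻ w, g w ∂(nuQ m α 1)) ^ (1 / p) ≤ avgDU α p lam r u Du := by
  rw [avgDU, setLAverage_mu_eq hr]
  refine ENNReal.rpow_le_rpow ?_ (by positivity)
  rw [laverage_eq, laverage_eq]
  exact ENNReal.div_le_div_right (lintegral_mono_ae hg) _

/-- The number `m + 2` counts the `m + 1` gradient components and `√λ u`, each of which is dominated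
by the integrand of `avgDU`; for the last one `(√λ)^p = λ^{p/2}`. -/
lemma gradMass_pull_le (hα : -1 < α) (hp : 1 ≤ p) (hr : 0 < r) (hlam : 0 ≤ lam)
    (hU : StronglyMeasurable U) (hDU : StronglyMeasurable DU)
    (hUe : u =ᵐ[(mu m α).restrict (Qplus m r)] U)
    (hDUe : Du =ᵐ[(mu m α).restrict (Qplus m r)] DU) :
    gradMass α (lam * r ^ 2) (pull hr U) (fun i => pull hr fun z => r • DU z i) ≤
      ENNReal.ofReal r * ((m + 2) * (nuQ m α 1 univ * avgDU α p lam r u Du)) := by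
  have := isFiniteMeasure_nuQ (m := m) hα zero_le_one
  have hpr : ∀ i, Continuous fun g : Grad m n => g i := fun i => PiLp.continuous_apply 2 _ i
  have hp0 : 0 ≤ p := by linarith
  have h1 : ∀ i, ∫⁻ w, ‖pull hr (fun z => r • DU z i) w‖ₑ
      ∂((volume : Measure (Tan m)).prod (wt α 1)) ≤
      ENNReal.ofReal r * (nuQ m α 1 univ * avgDU α p lam r u Du) := by
    intro i
    have e : ∀ w, ‖pull hr (fun z => r • DU z i) w‖ₑ =
        ENNReal.ofReal r * ‖pull hr (fun z => DU z i) w‖ₑ := by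
      intro w
      rw [← Real.enorm_of_nonneg hr.le, ← enorm_smul]
      by_cases hw : w ∈ unitCyl m 1 <;> simp [pull, hw]
    simp only [e]
    rw [lintegral_const_mul' _ _ ENNReal.ofReal_ne_top, lintegral_pull]
    refine mul_le_mul_right ((lintegral_enorm_le_laverage (stronglyMeasurable_pull hr
      ((hpr i).comp_stronglyMeasurable hDU)).aestronglyMeasurable hp).trans
      (mul_le_mul_right (laverage_le_avgDU hr hp ?_) _)) _
    have hDUi : (fun z => Du z i) =ᵐ[(mu m α).restrict (Qplus m r)] fun z => DU z i := by
      filter_upwards [hDUe] with z hz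
      rw [hz]
    filter_upwards [ae_pull_eq hr hDUi] with w hw
    rw [hw]
    exact (ENNReal.rpow_le_rpow (enorm_grad_apply_le _ i) hp0).trans le_self_add
  have h2 : ENNReal.ofReal √(lam * r ^ 2) *
      ∫⁻ w, ‖pull hr U w‖ₑ ∂((volume : Measure (Tan m)).prod (wt α 1)) ≤
      ENNReal.ofReal r * (nuQ m α 1 univ * avgDU α p lam r u Du) := by
    rw [Real.sqrt_mul hlam, Real.sqrt_sq hr.le, mul_comm √lam, ENNReal.ofReal_mul hr.le, mul_assoc]
    refine mul_le_mul_right ?_ _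
    rw [lintegral_pull, ← lintegral_const_mul' _ _ ENNReal.ofReal_ne_top]
    simp only [← Real.enorm_of_nonneg (Real.sqrt_nonneg lam), ← enorm_smul]
    refine (lintegral_enorm_le_laverage ((stronglyMeasurable_pull hr hU).const_smul
      √lam).aestronglyMeasurable hp).trans (mul_le_mul_right (laverage_le_avgDU hr hp ?_) _)
    filter_upwards [ae_pull_eq hr hUe] with w hw
    rw [Pi.smul_apply, hw, enorm_smul, ENNReal.mul_rpow_of_nonneg _ _ hp0,
      Real.enorm_of_nonneg (Real.sqrt_nonneg lam), ENNReal.ofReal_rpow_of_nonneg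
        (Real.sqrt_nonneg lam) hp0, Real.sqrt_eq_rpow, ← Real.rpow_mul hlam,
      show 1 / 2 * p = p / 2 by ring]
    exact le_add_self
  refine (add_le_add (Finset.sum_le_sum fun i _ => h1 i) h2).trans (le_of_eq ?_)
  rw [Finset.sum_const, Finset.card_univ, Fintype.card_fin, nsmul_eq_mul]
  push_cast
  ring

end Mass

lemma supNorm_le_of_ae {E : Type*} [NormedAddCommGroup E] (hr : 0 < r) (α : ℝ) {F : Pt m → E}
    {B : ENNReal} (h : ∀ᵐ w ∂(nuQ m α (1 / 2)), ‖F (dil m hr w)‖ₑ ≤ B) :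
    supNorm (r / 2) F ≤ B := by
  rw [supNorm, eLpNorm_exponent_top]
  exact essSup_le_of_ae_le _ (ae_volume_of_ae_nuQ hr (P := fun z => ‖F z‖ₑ ≤ B) h)

lemma ofReal_inv_mul_cancel_left (hr : 0 < r) (a : ENNReal) :
    ENNReal.ofReal r⁻¹ * (ENNReal.ofReal r * a) = a := by
  rw [← mul_assoc, ← ENNReal.ofReal_mul (by positivity), inv_mul_cancel₀ hr.ne', ENNReal.ofReal_one,
    one_mul]

section Estimates
variable {u : Pt m → Val n} {Du : Pt m → Grad m n} {c : Coeffs m n}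

/-- The estimates of a weak solution in terms of the constant for the unit cylinder. -/
lemma estimates_of_bound (hα : -1 < α) (hp : 1 ≤ p) (hr : 0 < r) (hlam : 0 ≤ lam)
    (hc : c.Admissible κ) (h : MemH1 α p r c.a0 u Du) (hw : IsWeakSolution α lam r c u Du)
    {C : ENNReal}
    (hC : ∀ (lam : ℝ) (c : Coeffs m n) (u : Tan m × ℝ → Val n) (G : Fin (m + 1) → Tan m × ℝ → Val n),
      IsGradSol α κ lam c u G → ∀ᵐ z ∂(nuQ m α (1 / 2)),
        ‖u z‖ₑ ≤ C * ∫⁻ z, ‖u z‖ₑ ∂((volume : Measure (Tan m)).prod (wt α 1)) ∧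
        (∀ i, ‖G i z‖ₑ ≤ C * gradMass α lam u G) ∧
        ‖√lam • u z‖ₑ ≤ C * gradMass α lam u G ∧
        ‖z.2⁻¹ • ∑ j, act (c.A (Fin.last m) j z.2) (G j z)‖ₑ ≤ C * gradMass α lam u G) :
    supNorm (r / 2) u ≤ C * nuQ m α 1 univ * avgU α p r u ∧
    supNorm (r / 2) Du + ENNReal.ofReal √lam * supNorm (r / 2) u ≤
      (m + 2) * ((m + 2) * (C * nuQ m α 1 univ)) * avgDU α p lam r u Du ∧
    supNorm (r / 2) (fun z => (xd z)⁻¹ • conormalFlux c Du z) ≤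
      ENNReal.ofReal r⁻¹ * ((m + 2) * (C * nuQ m α 1 univ) * avgDU α p lam r u Du) := by
  have hr0 : r ≠ 0 := hr.ne'
  have hri : 0 ≤ r⁻¹ := by positivity
  set U := h.memLp.aestronglyMeasurable.mk u with hUdef
  set DU := h.memLp_grad.aestronglyMeasurable.mk Du with hDUdef
  have hU : StronglyMeasurable U := h.memLp.aestronglyMeasurable.stronglyMeasurable_mk
  have hDU : StronglyMeasurable DU := h.memLp_grad.aestronglyMeasurable.stronglyMeasurable_mk
  have hUe : u =ᵐ[(mu m α).restrict (Qplus m r)] U := h.memLp.aestronglyMeasurable.ae_eq_mk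
  have hDUe : Du =ᵐ[(mu m α).restrict (Qplus m r)] DU := h.memLp_grad.aestronglyMeasurable.ae_eq_mk
  have hsol := (isCylSol_pull hα hp hr hlam hc h hw hU hDU hUe hDUe).isGradSol
  have hle : nuQ m α (1 / 2) ≤ nuQ m α 1 := nuQ_mono α (by norm_num)
  have eU := ae_mono hle (ae_pull_eq hr hUe)
  have eG : ∀ᵐ w ∂(nuQ m α (1 / 2)), ∀ i,
      pull hr (fun z => r • DU z i) w = r • Du (dil m hr w) i := by
    refine ae_all_iff.2 fun i => ae_mono hle (ae_pull_eq hr (F := fun z => r • Du z i) ?_)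
    filter_upwards [hDUe] with z hz
    rw [hz]
  have hb := hC _ _ _ _ hsol
  have hm1 := mul_le_mul_right (lintegral_pull_le hα hp hr hU hUe) C
  have hm2 := mul_le_mul_right (gradMass_pull_le hα hp hr hlam hU hDU hUe hDUe) C
  set V := nuQ m α 1 univ
  set X := avgDU α p lam r u Du
  have hK : C * (ENNReal.ofReal r * ((m + 2) * (V * X))) =
      ENNReal.ofReal r * ((m + 2) * (C * V) * X) := by ring
  rw [hK] at hm2
  -- The rescaled gradient and the right-hand side both carry one factor `r`, which cancels.
  have key : ∀ {E : Type} [NormedAddCommGroup E] [NormedSpace ℝ E] (v : E),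
      ‖r • v‖ₑ ≤ ENNReal.ofReal r * ((m + 2) * (C * V) * X) → ‖v‖ₑ ≤ (m + 2) * (C * V) * X := by
    intro E _ _ v hv
    rw [enorm_smul, Real.enorm_of_nonneg hr.le] at hv
    have := mul_le_mul_right hv (ENNReal.ofReal r⁻¹)
    rwa [ofReal_inv_mul_cancel_left hr, ofReal_inv_mul_cancel_left hr] at this
  refine ⟨?_, ?_, ?_⟩
  · refine supNorm_le_of_ae hr α ?_
    filter_upwards [hb, eU] with w h1 h2
    rw [h2] at h1
    exact (h1.1.trans hm1).trans (mul_assoc _ _ _).ge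
  · have s1 : supNorm (r / 2) Du ≤ (m + 1) * ((m + 2) * (C * V) * X) := by
      refine supNorm_le_of_ae hr α ?_
      filter_upwards [hb, eG] with w h1 h2
      refine (enorm_grad_le _).trans ((Finset.sum_le_sum (g := fun _ => (m + 2) * (C * V) * X)
        fun i _ => key _ ?_).trans (le_of_eq ?_))
      · rw [← h2 i]
        exact (h1.2.1 i).trans hm2
      · rw [Finset.sum_const, Finset.card_univ, Fintype.card_fin, nsmul_eq_mul]
        push_cast
        ring
    have s2 : ENNReal.ofReal √lam * supNorm (r / 2) u ≤ (m + 2) * (C * V) * X := by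
      have e : ENNReal.ofReal √lam * supNorm (r / 2) u = supNorm (r / 2) (√lam • u) := by
        rw [supNorm, supNorm, eLpNorm_const_smul, Real.enorm_of_nonneg (Real.sqrt_nonneg _)]
      rw [e]
      refine supNorm_le_of_ae hr α ?_
      filter_upwards [hb, eU] with w h1 h2
      refine key _ ?_
      have h3 := h1.2.2.1.trans hm2
      rw [h2, Real.sqrt_mul hlam, Real.sqrt_sq hr.le, mul_comm, mul_smul] at h3
      exact h3
    refine (add_le_add s1 s2).trans (le_of_eq ?_)
    ring
  · refine supNorm_le_of_ae hr α ?_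
    filter_upwards [hb, eG] with w h1 h2
    have h3 := h1.2.2.2.trans hm2
    -- One factor `r` comes from the rescaled gradient and one from `x_d = r s`. Only the first is
    -- matched on the right, whence the `r⁻¹` in the third estimate.
    have e : w.2⁻¹ • ∑ j, act ((c.dilate r).A (Fin.last m) j w.2) (pull hr (fun z => r • DU z j) w) =
        r • r • ((xd (dil m hr w))⁻¹ • conormalFlux c Du (dil m hr w)) := by
      simp only [h2, act_smul, conormalFlux, xd_dil, Coeffs.dilate, ← Finset.smul_sum, smul_smul]
      congr 1
      field_simp
    rw [e] at h3
    have h4 := key _ h3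
    rw [enorm_smul, Real.enorm_of_nonneg hr.le] at h4
    have h5 := mul_le_mul_right h4 (ENNReal.ofReal r⁻¹)
    rwa [ofReal_inv_mul_cancel_left hr] at h5

end Estimates

end

end WeightedParabolic

end

open WeightedParabolic in
/-- The spatial dimension is `d = m + 1`. -/
theorem lemma4p4 (m n : ℕ) (α p κ : ℝ) (hα : -1 < α) (hp1 : 1 < p) (hp2 : p ≤ 2)
    (hκ0 : 0 < κ) (hκ1 : κ ≤ 1) :
    ∃ N : ℝ, 0 < N ∧
      ∀ (lam r : ℝ) (c : Coeffs m n), 0 ≤ lam → 0 < r → c.Admissible κ →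
        ∀ (u : Pt m → Val n) (Du : Pt m → Grad m n),
          MemH1 α p r c.a0 u Du → IsWeakSolution α lam r c u Du →
            supNorm (r / 2) u ≤ ENNReal.ofReal N * avgU α p r u ∧
            supNorm (r / 2) Du + ENNReal.ofReal (√lam) * supNorm (r / 2) u
              ≤ ENNReal.ofReal N * avgDU α p lam r u Du ∧
            supNorm (r / 2) (fun z => (xd z)⁻¹ • conormalFlux c Du z)
              ≤ ENNReal.ofReal (N * r⁻¹) * avgDU α p lam r u Du := by
  obtain ⟨C, hC0, hC⟩ := exists_bound m n hα hκ0
  have hfin := isFiniteMeasure_nuQ (m := m) hα zero_le_one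
  have hm : (0 : ℝ) ≤ m := Nat.cast_nonneg m
  generalize hV : (nuQ m α 1).real univ = V
  have hV0 : 0 ≤ V := hV ▸ ENNReal.toReal_nonneg
  have eV : nuQ m α 1 univ = ENNReal.ofReal V := by rw [← hV, ofReal_measureReal]
  have em : (m + 2 : ENNReal) = ENNReal.ofReal (m + 2) := by
    rw [ENNReal.ofReal_add hm (by norm_num), ENNReal.ofReal_natCast, ENNReal.ofReal_ofNat]
  have hCV : 0 ≤ C * V := mul_nonneg hC0 hV0
  have hmCV : C * V ≤ (m + 2) * (C * V) := le_mul_of_one_le_left hCV (by linarith)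
  have hmmCV : (m + 2) * (C * V) ≤ (m + 2) * ((m + 2) * (C * V)) :=
    le_mul_of_one_le_left (hCV.trans hmCV) (by linarith)
  -- The largest of the three constants serves for all; adding `1` makes it positive.
  refine ⟨(m + 2) * ((m + 2) * (C * V)) + 1, by linarith, fun lam r c hlam hr hc u Du h hw => ?_⟩
  obtain ⟨h1, h2, h3⟩ := estimates_of_bound hα hp1.le hr hlam hc h hw hC
  rw [eV, em, ← ENNReal.ofReal_mul hC0] at *
  rw [← ENNReal.ofReal_mul (by linarith)] at h2 h3
  rw [← ENNReal.ofReal_mul (by linarith)] at h2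
  refine ⟨h1.trans (mul_le_mul_left (ENNReal.ofReal_le_ofReal (by linarith)) _),
    h2.trans (mul_le_mul_left (ENNReal.ofReal_le_ofReal (by linarith)) _), h3.trans ?_⟩
  rw [← mul_assoc, ← ENNReal.ofReal_mul (by positivity), mul_comm r⁻¹]
  exact mul_le_mul_left (ENNReal.ofReal_le_ofReal
    (mul_le_mul_of_nonneg_right (by linarith) (by positivity))) _
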